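/- Theorem 2.1. Let $d\ge 3$, let $\langle v\rangle=\sqrt{1+|v|^2}$, and use the convention $\widehat g(\xi)=\int_{\mathbb R^d}e^{-ix\cdot\xi}g(x)\,dx$. Let $\mu\in L^1(\mathbb R^d)$ be a real-valued function satisfying the following two hypotheses. (H1) $\mu$ is smooth and tends to $0$ at infinity, $\langle v\rangle^{k}\nabla\mu\in W^{2,\infty}(\mathbb R^d)$ for some real $k>d$, and $\langle v\rangle^{4d+6}\nabla\mu\in W^{2d+5,1}(\mathbb R^d)$. (H2) (Penrose stability) There is $\kappa>0$ such that $$\Big|1-\int_0^{+\infty}e^{-(\gamma+i\tau)s}\,\frac{1}{1+|\xi|^2}\,i\xi\cdot\widehat{\nabla\mu}(s\xi)\,ds\Big|\ge\kappa\qquad\text{for all }\gamma\ge0,\ \tau\in\mathbb R,\ \xi\in\mathbb R^d.$$ Functions of time are extended by zero to $t<0$. Given a source $S$, consider the linearized density equation $$\rho(t,x)=\int_0^t\!\int_{\mathbb R^d}\big[\nabla_x(1-\Delta_x)^{-1}\rho\big](s,x-(t-s)v)\cdot\nabla_v\mu(v)\,dv\,ds+S(t,x),\qquad t\ge0.\tag{1}$$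 Then there is a kernel $G:\mathbb R\times\mathbb R^d\to\mathbb R$, depending only on $d$ and $\mu$, with $G(t)=0$ for $t<0$, such that: (i) for every $S\in L^1(\mathbb R;L^1(\mathbb R^d)\cap L^\infty(\mathbb R^d))$ vanishing for $t<0$, equation (1) has a unique solution $\rho$ in the class of functions in $L^1_{loc}(\mathbb R;L^2(\mathbb R^d))$ vanishing for $t<0$ (uniqueness being up to equality almost everywhere), and it is given by $$\rho=S+G*_{t,x}S;$$ (ii) for every $\delta\in(0,1)$ there is $C>0$ such that $$\|G(t)\|_{L^1}\le\frac{C}{1+t},\qquad \|G(t)\|_{L^\infty}\le\frac{C}{t^{d-1+\delta}+t^{d+1}}\qquad\text{for all }t>0,$$ $$\|\nabla_xG(t)\|_{L^1}\le\frac{C}{t^{2}},\qquad \|\nabla_xG(t)\|_{L^\infty}\le\frac{C}{t^{d+2}}\qquad\text{for all }t\ge1,$$ where $\nabla_x G(t)$ is the weak gradient. -/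

import Mathlib

open MeasureTheory Set Filter Topology
open scoped ContDiff Gradient Convolution

noncomputable section

namespace ScreenedVlasov

/-- The Japanese bracket `⟨v⟩ = √(1 + |v|²)`. -/
def bracket {d : ℕ} (v : EuclideanSpace ℝ (Fin d)) : ℝ := Real.sqrt (1 + ‖v‖ ^ 2)

/-- The smooth functions of the Sobolev space `W^{m,p}(ℝ^d)`: all derivatives of order at most `m`
(classical ones, which for a smooth function are the weak ones) lie in `L^p`. -/
def IsSmoothSobolev {d : ℕ} {F : Type*} [NormedAddCommGroup F] [NormedSpace ℝ F]
    (m : ℕ) (p : ENNReal) (f : EuclideanSpace ℝ (Fin d) → F) : Prop :=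
  ContDiff ℝ ∞ f ∧ ∀ j : ℕ, j ≤ m → MemLp (fun v => iteratedFDeriv ℝ j f v) p volume

/-- Regularity of the equilibrium: `μ ∈ L¹` is smooth and decaying, `⟨v⟩^k ∇μ ∈ W^{2,∞}` for some `k > d`, and
`⟨v⟩^{4d+6} ∇μ ∈ W^{2d+5,1}`. -/
structure RegularEquilibrium {d : ℕ} (μ : EuclideanSpace ℝ (Fin d) → ℝ) : Prop where
  integrable : Integrable μ volume
  smooth : ContDiff ℝ ∞ μ
  decay : Tendsto μ (cocompact (EuclideanSpace ℝ (Fin d))) (𝓝 0)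
  weighted_bounded : ∃ k : ℝ, (d : ℝ) < k ∧ IsSmoothSobolev 2 ⊤ (fun v => bracket v ^ k • ∇ μ v)
  weighted_integrable : IsSmoothSobolev (2 * d + 5) 1 (fun v => bracket v ^ (4 * d + 6) • ∇ μ v)

/-- The Fourier transform `ĝ(ξ) = ∫ e^{-i x·ξ} g(x) dx`. -/
def fourierHat {d : ℕ} (g : EuclideanSpace ℝ (Fin d) → ℂ) (ξ : EuclideanSpace ℝ (Fin d)) : ℂ :=
  ∫ x, Complex.exp (-(Complex.I * ((inner ℝ x ξ : ℝ) : ℂ))) * g x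

/-- The Laplace transform
`∫_0^∞ e^{-(γ+iτ)s} (1+|ξ|²)⁻¹ iξ · (∇μ)^(sξ) ds`. -/
def penroseIntegral {d : ℕ} (μ : EuclideanSpace ℝ (Fin d) → ℝ) (γ τ : ℝ)
    (ξ : EuclideanSpace ℝ (Fin d)) : ℂ :=
  ∫ s in Ioi (0 : ℝ), Complex.exp (-(((γ : ℂ) + Complex.I * (τ : ℂ)) * (s : ℂ))) *
    (1 / (1 + ((‖ξ‖ : ℝ) : ℂ) ^ 2)) *
      ∑ j : Fin d, Complex.I * ((ξ j : ℝ) : ℂ) * fourierHat (fun v => ((∇ μ v j : ℝ) : ℂ)) (s • ξ)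

/-- The Penrose stability criterion: the infimum over `γ ≥ 0`, `τ ∈ ℝ`, `ξ ∈ ℝ^d`
of `|1 - penroseIntegral μ γ τ ξ|` is bounded below by a positive constant. -/
def PenroseStable {d : ℕ} (μ : EuclideanSpace ℝ (Fin d) → ℝ) : Prop :=
  ∃ κ : ℝ, 0 < κ ∧ ∀ γ : ℝ, 0 ≤ γ → ∀ (τ : ℝ) (ξ : EuclideanSpace ℝ (Fin d)),
    κ ≤ ‖1 - penroseIntegral μ γ τ ξ‖

/-- The Green function `B` of `1 - Δ` on `ℝ^d` (the Bessel kernel)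
`B(x) = ∫_0^∞ (4πs)^{-d/2} e^{-s-|x|²/(4s)} ds`, so that `(1 - Δ)⁻¹ r = B * r`. -/
def greenKernel {d : ℕ} (x : EuclideanSpace ℝ (Fin d)) : ℝ :=
  ∫ s in Ioi (0 : ℝ), (4 * Real.pi * s) ^ (-(d : ℝ) / 2) * Real.exp (-s - ‖x‖ ^ 2 / (4 * s))

/-- The Fourier transform of the integrand of `greenKernel`. -/
lemma fourier_heat {d : ℕ} {s : ℝ} (hs : 0 < s) (ξ : EuclideanSpace ℝ (Fin d)) :
    ∫ x : EuclideanSpace ℝ (Fin d), Complex.exp (-(Complex.I * ((inner ℝ x ξ : ℝ) : ℂ))) *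
      (((4 * Real.pi * s) ^ (-(d : ℝ) / 2) * Real.exp (-s - ‖x‖ ^ 2 / (4 * s)) : ℝ) : ℂ)
      = Complex.exp (-((1 + ‖ξ‖ ^ 2 : ℝ) : ℂ) * (s : ℂ)) := by
  have hb : 0 < ((1 / (4 * s) : ℝ) : ℂ).re := by
    rw [Complex.ofReal_re]; positivity
  have h := GaussianFourier.integral_cexp_neg_mul_sq_norm_add hb (-Complex.I) ξ
  have e : ∀ x : EuclideanSpace ℝ (Fin d), Complex.exp (-(Complex.I * ((inner ℝ x ξ : ℝ) : ℂ))) *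
      (((4 * Real.pi * s) ^ (-(d : ℝ) / 2) * Real.exp (-s - ‖x‖ ^ 2 / (4 * s)) : ℝ) : ℂ)
      = ((((4 * Real.pi * s) ^ (-(d : ℝ) / 2) : ℝ) : ℂ) * Complex.exp (-(s:ℂ))) *
        Complex.exp (-((1 / (4 * s) : ℝ) : ℂ) * ‖x‖ ^ 2 + -Complex.I * inner ℝ ξ x) := by
    intro x
    rw [real_inner_comm]
    push_cast
    rw [sub_eq_add_neg, Complex.exp_add, Complex.exp_add]
    have : -(1 / (4 * (s:ℂ))) * (‖x‖:ℂ) ^ 2 = -((‖x‖:ℂ) ^ 2 / (4 * s)) := by ring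
    rw [this]; ring_nf
  simp_rw [e]
  rw [integral_const_mul, h]
  have hs' : (s:ℂ) ≠ 0 := by exact_mod_cast hs.ne'
  have h1 : ((Real.pi : ℂ) / ((1 / (4 * s) : ℝ) : ℂ)) ^ ((Module.finrank ℝ (EuclideanSpace ℝ (Fin d)) : ℂ) / 2)
      = (((4 * Real.pi * s) ^ ((d : ℝ) / 2) : ℝ) : ℂ) := by
    rw [Complex.ofReal_cpow (by positivity)]
    simp only [finrank_euclideanSpace, Fintype.card_fin]; push_cast; congr 1; rw [one_div, div_inv_eq_mul]; ring
  rw [h1]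
  have h2 : (((4 * Real.pi * s) ^ (-(d : ℝ) / 2) : ℝ) : ℂ) * (((4 * Real.pi * s) ^ ((d : ℝ) / 2) : ℝ) : ℂ) = 1 := by
    rw [← Complex.ofReal_mul, ← Real.rpow_add (by positivity)]
    simp [neg_div]
  have h3 : Complex.exp (-(s:ℂ)) * Complex.exp ((-Complex.I) ^ 2 * ‖ξ‖ ^ 2 / (4 * ((1 / (4 * s) : ℝ) : ℂ))) = Complex.exp (-((1 + ‖ξ‖ ^ 2 : ℝ) : ℂ) * (s : ℂ)) := by
    rw [← Complex.exp_add]; congr 1; push_cast; simp [Complex.I_sq]; field_simp; ring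
  rw [← h3]
  linear_combination (Complex.exp (-(s:ℂ)) * Complex.exp ((-Complex.I) ^ 2 * ‖ξ‖ ^ 2 / (4 * ((1 / (4 * s) : ℝ) : ℂ)))) * h2

lemma integral_exp_resolvent {d : ℕ} (ξ : EuclideanSpace ℝ (Fin d)) :
    ∫ s in Ioi (0:ℝ), Complex.exp (-((1 + ‖ξ‖ ^ 2 : ℝ) : ℂ) * (s : ℂ)) = 1 / (1 + (‖ξ‖:ℂ)^2) := by
  have := integral_exp_mul_complex_Ioi (a := -((1 + ‖ξ‖ ^ 2 : ℝ) : ℂ)) (by rw [Complex.neg_re, Complex.ofReal_re]; have := sq_nonneg ‖ξ‖; linarith) 0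
  rw [this]; push_cast; rw [mul_zero, Complex.exp_zero, neg_div_neg_eq]

lemma heat_integrable {d : ℕ} :
    Integrable (fun q : EuclideanSpace ℝ (Fin d) × ℝ =>
      (4 * Real.pi * q.2) ^ (-(d : ℝ) / 2) * Real.exp (-q.2 - ‖q.1‖ ^ 2 / (4 * q.2)))
      (volume.prod (volume.restrict (Ioi (0:ℝ)))) := by
  have hm : AEStronglyMeasurable (fun q : EuclideanSpace ℝ (Fin d) × ℝ =>
      (4 * Real.pi * q.2) ^ (-(d : ℝ) / 2) * Real.exp (-q.2 - ‖q.1‖ ^ 2 / (4 * q.2)))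
      (volume.prod (volume.restrict (Ioi (0:ℝ)))) := by
    apply Measurable.aestronglyMeasurable; fun_prop
  have hs1 : ∀ s : ℝ, 0 < s → Integrable (fun x : EuclideanSpace ℝ (Fin d) =>
      (4 * Real.pi * s) ^ (-(d : ℝ) / 2) * Real.exp (-s - ‖x‖ ^ 2 / (4 * s))) := by
    intro s hs
    have hb : 0 < ((1 / (4 * s) : ℝ) : ℂ).re := by
      rw [Complex.ofReal_re]; positivity
    have h := (GaussianFourier.integrable_cexp_neg_mul_sq_norm_add hb 0 (0 : EuclideanSpace ℝ (Fin d))).norm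
    have : (fun x : EuclideanSpace ℝ (Fin d) =>
      (4 * Real.pi * s) ^ (-(d : ℝ) / 2) * Real.exp (-s - ‖x‖ ^ 2 / (4 * s))) = fun x =>
       ((4 * Real.pi * s) ^ (-(d : ℝ) / 2) * Real.exp (-s)) * ‖Complex.exp (-((1 / (4 * s) : ℝ) : ℂ) * ‖x‖ ^ 2 + 0 * inner ℝ (0 : EuclideanSpace ℝ (Fin d)) x)‖ := by
      funext x
      have e : -((1 / (4 * s) : ℝ) : ℂ) * ‖x‖ ^ 2 + 0 * inner ℝ (0 : EuclideanSpace ℝ (Fin d)) x = ((-(‖x‖^2 / (4*s)) : ℝ) : ℂ) := by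
        push_cast; ring
      rw [e, Complex.norm_exp, Complex.ofReal_re, sub_eq_add_neg, Real.exp_add]; ring
    rw [this]; exact h.const_mul _
  have hval : ∀ s : ℝ, 0 < s → ∫ x : EuclideanSpace ℝ (Fin d), ‖
      (4 * Real.pi * s) ^ (-(d : ℝ) / 2) * Real.exp (-s - ‖x‖ ^ 2 / (4 * s))‖ = Real.exp (-s) := by
    intro s hs
    have h := fourier_heat hs (0 : EuclideanSpace ℝ (Fin d))
    simp only [inner_zero_right, Complex.ofReal_zero, mul_zero, neg_zero, Complex.exp_zero, one_mul] at h
    rw [integral_complex_ofReal] at h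
    have : ∀ x : EuclideanSpace ℝ (Fin d), ‖
      (4 * Real.pi * s) ^ (-(d : ℝ) / 2) * Real.exp (-s - ‖x‖ ^ 2 / (4 * s))‖ = (4 * Real.pi * s) ^ (-(d : ℝ) / 2) * Real.exp (-s - ‖x‖ ^ 2 / (4 * s)) := fun x => by
      rw [Real.norm_of_nonneg]; positivity
    simp_rw [this]
    apply Complex.ofReal_injective
    rw [h]; simp
  rw [integrable_prod_iff' hm]
  constructor
  · filter_upwards [ae_restrict_mem measurableSet_Ioi] with s hs using hs1 s hs
  · have : IntegrableOn (fun s : ℝ => Real.exp (-s)) (Ioi 0) := integrableOn_exp_neg_Ioi 0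
    refine this.congr ?_
    filter_upwards [ae_restrict_mem measurableSet_Ioi] with s hs using (hval s hs).symm

/-- `greenKernel` is integrable with Fourier transform `1 / (1 + |ξ|²)`: it is the convolution kernel
of `(1 - Δ)⁻¹`. -/
theorem fourierHat_greenKernel {d : ℕ} (ξ : EuclideanSpace ℝ (Fin d)) :
    Integrable (greenKernel (d := d)) volume ∧
    fourierHat (fun x => (greenKernel x : ℂ)) ξ = 1 / (1 + (‖ξ‖ : ℂ) ^ 2) := by
  refine ⟨heat_integrable.integral_prod_left, ?_⟩
  unfold fourierHat greenKernel
  simp_rw [← integral_complex_ofReal, ← integral_const_mul]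
  rw [integral_integral_swap]
  · rw [← integral_exp_resolvent]
    exact setIntegral_congr_fun measurableSet_Ioi fun s hs => fourier_heat hs ξ
  · have h := (heat_integrable (d := d)).ofReal (𝕜 := ℂ)
    refine h.bdd_mul (c := 1) (f := fun q : EuclideanSpace ℝ (Fin d) × ℝ => Complex.exp (-(Complex.I * ((inner ℝ q.1 ξ : ℝ) : ℂ)))) ?_ ?_
    · apply Continuous.aestronglyMeasurable; fun_prop
    · refine Eventually.of_forall fun q => ?_
      rw [Complex.norm_exp]; simp

/-- `∇ (1 - Δ)⁻¹ r = r * ∇B`, where `B` is the Green function of `1 - Δ`. -/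
def gradPotential {d : ℕ} (r : EuclideanSpace ℝ (Fin d) → ℝ) :
    EuclideanSpace ℝ (Fin d) → EuclideanSpace ℝ (Fin d) :=
  r ⋆[ContinuousLinearMap.lsmul ℝ ℝ, volume] (fun x => ∇ greenKernel x)

/-- The source class: `S ∈ L¹(ℝ; L¹(ℝ^d) ∩ L^∞(ℝ^d))`, extended by zero to negative times. -/
structure IsSource {d : ℕ} (S : ℝ → EuclideanSpace ℝ (Fin d) → ℝ) : Prop where
  measurable : AEStronglyMeasurable (Function.uncurry S) volume
  integrable : ∫⁻ t, (eLpNorm (S t) 1 volume + eLpNorm (S t) ⊤ volume) < ⊤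
  causal : ∀ᵐ p : ℝ × EuclideanSpace ℝ (Fin d), p.1 < 0 → S p.1 p.2 = 0

/-- The integrand `[∇(1-Δ)⁻¹ρ](s, x - (t-s)v) · ∇μ(v)`. -/
def reaction {d : ℕ} (μ : EuclideanSpace ℝ (Fin d) → ℝ) (ρ : ℝ → EuclideanSpace ℝ (Fin d) → ℝ)
    (t : ℝ) (x : EuclideanSpace ℝ (Fin d)) (s : ℝ) (v : EuclideanSpace ℝ (Fin d)) : ℝ :=
  inner ℝ (gradPotential (ρ s) (x - (t - s) • v)) (∇ μ v)

/-- `ρ ∈ L¹_loc(ℝ; L²(ℝ^d))`, extended by zero to negative times, solves the linearized density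
equation
`ρ(t,x) = ∫_0^t ∫ [∇(1-Δ)⁻¹ρ](s, x - (t-s)v) · ∇μ(v) dv ds + S(t,x)` for `t ≥ 0`,
almost everywhere and with an absolutely convergent integral. -/
structure IsDensitySolution {d : ℕ} (μ : EuclideanSpace ℝ (Fin d) → ℝ)
    (S ρ : ℝ → EuclideanSpace ℝ (Fin d) → ℝ) : Prop where
  measurable : AEStronglyMeasurable (Function.uncurry ρ) volume
  locallyIntegrable : ∀ T : ℝ, ∫⁻ t in Icc (-T) T, eLpNorm (ρ t) 2 volume < ⊤
  causal : ∀ᵐ p : ℝ × EuclideanSpace ℝ (Fin d), p.1 < 0 → ρ p.1 p.2 = 0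
  equation : ∀ᵐ p : ℝ × EuclideanSpace ℝ (Fin d), 0 ≤ p.1 →
    IntegrableOn (fun q : ℝ × EuclideanSpace ℝ (Fin d) => reaction μ ρ p.1 p.2 q.1 q.2)
      (Ioc 0 p.1 ×ˢ univ) volume ∧
    ρ p.1 p.2 = (∫ s in (0 : ℝ)..p.1, ∫ v, reaction μ ρ p.1 p.2 s v) + S p.1 p.2

/-- `g` is the weak (distributional) gradient of `u` on `ℝ^d`. -/
def HasWeakGradient {d : ℕ} (u : EuclideanSpace ℝ (Fin d) → ℝ)
    (g : EuclideanSpace ℝ (Fin d) → EuclideanSpace ℝ (Fin d)) : Prop :=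
  LocallyIntegrable u volume ∧ LocallyIntegrable g volume ∧
    ∀ φ : EuclideanSpace ℝ (Fin d) → ℝ, ContDiff ℝ ∞ φ → HasCompactSupport φ →
      ∫ x, u x • ∇ φ x = -∫ x, φ x • g x

/-- The space-time convolution `(G *_{t,x} S)(t,x)`. -/
def spaceTimeConv {d : ℕ} (G S : ℝ → EuclideanSpace ℝ (Fin d) → ℝ) (t : ℝ)
    (x : EuclideanSpace ℝ (Fin d)) : ℝ :=
  (Function.uncurry G ⋆[ContinuousLinearMap.mul ℝ ℝ, volume] Function.uncurry S) (t, x)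

/-- The kernel estimates with exponent `δ` and constant `C`. -/
structure KernelBounds {d : ℕ} (G : ℝ → EuclideanSpace ℝ (Fin d) → ℝ) (δ C : ℝ) : Prop where
  one : ∀ t : ℝ, 0 < t → eLpNorm (G t) 1 volume ≤ ENNReal.ofReal (C / (1 + t))
  top : ∀ t : ℝ, 0 < t →
    eLpNorm (G t) ⊤ volume ≤ ENNReal.ofReal (C / (t ^ ((d : ℝ) - 1 + δ) + t ^ ((d : ℝ) + 1)))
  grad : ∀ t : ℝ, 1 ≤ t → ∃ g : EuclideanSpace ℝ (Fin d) → EuclideanSpace ℝ (Fin d),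
    HasWeakGradient (G t) g ∧
    eLpNorm g 1 volume ≤ ENNReal.ofReal (C / t ^ 2) ∧
    eLpNorm g ⊤ volume ≤ ENNReal.ofReal (C / t ^ (d + 2))

end ScreenedVlasov

end

/-! Equation (1) is a convolution equation `ρ = S + K * ρ` in space-time, with `K(t,x) = ∫ ∇B(x -
tv)·∇μ(v) dv` for `t > 0` and `B` the Green function (`kernel`, `reaction_integral`). For large `β`
the kernel has norm at most `1/2` in `L¹` with weight `e^{-βt}(1+|x|)^{d+1}`, so a contraction
produces a resolvent `G = K + K * G` (`exists_spaceTimeResolvent`). Associativity of convolution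
turns `ρ = S + K * ρ` into `ρ = S + G * S`. Uniqueness in `L¹_loc(L²)` uses the same smallness of
`K`, acting on `L¹` with a weight that decays in `x` (`IsDensitySolution.ae_eq`).

So far `G` might grow like `e^{βt}`; its decay is proved on the Fourier side. For fixed `ξ ≠ 0` put
`r = |ξ|` and `b = 1/(1+r²)`. The spatial transform of `G` is the scalar Volterra resolvent of `k(t)
= K̂(t,ξ)`, and `|k(t)| ≤ A b r/(1+rt)^{d+5}`, because free transport evaluates the transform of
`∇μ` at `tξ`: the only time scale is `1/r`. The Penrose condition bounds `1 -` (Laplace transform of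
`k`) from below on the closed half-plane. A quantitative half-line Wiener lemma
(`integrable_resolvent`) then bounds the resolvent in `L¹` by a constant depending on `A` and `κ`
only. It combines an a priori bound, from Plancherel for `h` and `t h` and Cauchy-Schwarz, with a
continuation argument in the exponential damping down to zero damping.

Multiplication by `t` or by `x_j` is a derivation of the convolution algebra, so every moment of the
resolvent solves the same Volterra equation with a forcing built from lower moments. This yields
`|Ĝ| ≲ b r/(1+rt)^{d+3}` and `|∂_{ξ_j}^{i+1} Ĝ| ≲ (1+t)^i/(1+rt)^{d+3}` (`resolvent_decay`,
`derived_resolvent_decay`).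

It remains to integrate over frequencies, where `∫ |ξ|^k (1+|ξ|t)^{-d-3} dξ` is a multiple of
`t^{-d-k}`. The case `k = -1` (from `b r ≤ 1/r`) gives the sup bound at short times, `k = 1, 2` give
those of `G` and `∇G` at long times. The moments up to order `d+1` (with `k = 0, 1`) add decay in
`x`: for `t ≥ 1`, `|G| ≲ t^{-d-1}(1+|x|/t)^{-d-1}`, with one more factor `1/t` for the gradient
(`FreqBound.profile_bound`). That profile has mass of order `t^d`, which gives the `L¹` bounds `1/t`
and `1/t²`. For `t ≤ 1` the `L¹` bound is read off from `G = K + K * G`. -/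

noncomputable section
namespace ScreenedVlasov
open scoped ENNReal NNReal FourierTransform
open ContinuousLinearMap (mul)

set_option linter.unusedSectionVars false

/-! ### Weighted Young inequalities and absorption -/

section Convolution

variable {V : Type*} [NormedAddCommGroup V] [MeasureSpace V] [BorelSpace V]
  [SecondCountableTopology V] [SFinite (volume : Measure V)]
  [(volume : Measure V).IsAddLeftInvariant] [(volume : Measure V).IsNegInvariant]
variable {𝕜 : Type*} [RCLike 𝕜]

/-- Convolution of functions with values in `[0, ∞]`. -/
def lconv (a b : V → ℝ≥0∞) (x : V) : ℝ≥0∞ := ∫⁻ y, a y * b (x - y)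

lemma aemeasurable_lconv_integrand {a b : V → ℝ≥0∞} (ha : AEMeasurable a) (hb : AEMeasurable b) :
    AEMeasurable (fun p : V × V => a p.2 * b (p.1 - p.2)) (volume.prod volume) :=
  ha.comp_snd.mul (hb.comp_quasiMeasurePreserving
    (quasiMeasurePreserving_sub_of_right_invariant volume volume))

lemma aemeasurable_lconv {a b : V → ℝ≥0∞} (ha : AEMeasurable a) (hb : AEMeasurable b) :
    AEMeasurable (lconv a b) :=
  (aemeasurable_lconv_integrand ha hb).lintegral_prod_right'

/-- The weight passes inside the convolution through `W x ≤ w y * W (x - y)`, and Tonelli concludes.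
Keeping the two weights distinct makes one lemma serve exponential, growing, truncated and spatially
decaying weights. -/
lemma lintegral_mul_lconv_le {a b w W : V → ℝ≥0∞} (ha : AEMeasurable a) (hb : AEMeasurable b)
    (hw : Measurable w) (hW : Measurable W) (h : ∀ x y, W (x + y) ≤ w x * W y) :
    ∫⁻ x, W x * lconv a b x ≤ (∫⁻ x, w x * a x) * ∫⁻ x, W x * b x := by
  have h1 : ∀ x, W x * lconv a b x ≤ lconv (fun x => w x * a x) (fun x => W x * b x) x := by
    intro x
    calc W x * lconv a b x ≤ ∫⁻ y, W x * (a y * b (x - y)) := lintegral_const_mul_le _ _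
      _ ≤ _ := by
        refine lintegral_mono fun y => ?_
        have := h y (x - y)
        rw [add_sub_cancel] at this
        calc W x * (a y * b (x - y)) ≤ (w y * W (x - y)) * (a y * b (x - y)) := by gcongr
          _ = w y * a y * (W (x - y) * b (x - y)) := by ring
  refine (lintegral_mono h1).trans ?_
  unfold lconv
  rw [lintegral_lintegral_swap (f := fun x y => w y * a y * (W (x - y) * b (x - y)))
    (aemeasurable_lconv_integrand (hw.aemeasurable.mul ha) (hW.aemeasurable.mul hb))]
  refine le_of_eq ?_
  rw [← lintegral_mul_const'' (f := fun x => w x * a x) _ (hw.aemeasurable.mul ha)]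
  refine lintegral_congr fun y => ?_
  rw [lintegral_const_mul'']
  · rw [lintegral_sub_right_eq_self (fun x => W x * b x) y]
  · exact (hW.aemeasurable.mul hb).comp_quasiMeasurePreserving
      (measurePreserving_sub_right volume y).quasiMeasurePreserving

lemma lintegral_lconv_le {a b : V → ℝ≥0∞} (ha : AEMeasurable a) (hb : AEMeasurable b) :
    ∫⁻ x, lconv a b x ≤ (∫⁻ x, a x) * ∫⁻ x, b x := by
  simpa using lintegral_mul_lconv_le (w := 1) (W := 1) ha hb measurable_one measurable_one
    (fun x y => by simp)

lemma enorm_convolution_le (f g : V → 𝕜) (x : V) :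
    ‖(f ⋆[mul 𝕜 𝕜, volume] g) x‖ₑ ≤ lconv (fun y => ‖f y‖ₑ) (fun y => ‖g y‖ₑ) x := by
  rw [convolution_def]
  refine (enorm_integral_le_lintegral_enorm _).trans (le_of_eq ?_)
  simp [lconv, enorm_mul]

lemma convolutionExistsAt_of_lconv {f g : V → 𝕜} (hf : AEStronglyMeasurable f)
    (hg : AEStronglyMeasurable g) {x : V}
    (h : lconv (fun y => ‖f y‖ₑ) (fun y => ‖g y‖ₑ) x < ⊤) :
    ConvolutionExistsAt f g x (mul 𝕜 𝕜) volume := by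
  refine ⟨hf.convolution_integrand_snd (mul 𝕜 𝕜) hg x, ?_⟩
  rw [hasFiniteIntegral_iff_enorm]
  simpa [lconv, enorm_mul] using h

/-- A finite weighted integral of the absolute convolution makes it finite almost everywhere, since
the weight never vanishes. -/
lemma ae_convolutionExistsAt_of_weight {f g : V → 𝕜} (hf : AEStronglyMeasurable f)
    (hg : AEStronglyMeasurable g) {w W : V → ℝ≥0∞} (hw : Measurable w) (hW : Measurable W)
    (h : ∀ x y, W (x + y) ≤ w x * W y) (hpos : ∀ x, W x ≠ 0)
    (h1 : ∫⁻ x, w x * ‖f x‖ₑ < ⊤) (h2 : ∫⁻ x, W x * ‖g x‖ₑ < ⊤) :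
    ∀ᵐ x, ConvolutionExistsAt f g x (mul 𝕜 𝕜) volume := by
  have h3 := (lintegral_mul_lconv_le hf.enorm hg.enorm hw hW h).trans_lt (ENNReal.mul_lt_top h1 h2)
  filter_upwards [ae_lt_top' (hW.aemeasurable.mul (aemeasurable_lconv hf.enorm hg.enorm)) h3.ne]
    with x hx
  refine convolutionExistsAt_of_lconv hf hg ?_
  by_contra hc
  rw [not_lt, top_le_iff] at hc
  rw [Pi.mul_apply, hc, ENNReal.mul_top (hpos x)] at hx
  exact lt_irrefl _ hx

lemma aestronglyMeasurable_convolution {f g : V → 𝕜} (hf : AEStronglyMeasurable f)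
    (hg : AEStronglyMeasurable g) :
    AEStronglyMeasurable (f ⋆[mul 𝕜 𝕜, volume] g) :=
  (hf.convolution_integrand (mul 𝕜 𝕜) hg).integral_prod_right'

/-- Multiplication by a multiplicative character commutes with convolution. -/
lemma char_mul_convolution {χ : V → 𝕜} (hχ : ∀ x y, χ (x + y) = χ x * χ y) (f g : V → 𝕜) (x : V) :
    χ x * (f ⋆[mul 𝕜 𝕜, volume] g) x
      = ((fun y => χ y * f y) ⋆[mul 𝕜 𝕜, volume] (fun y => χ y * g y)) x := by
  simp only [convolution_def, ContinuousLinearMap.mul_apply']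
  rw [← integral_const_mul]
  congr 1; ext y
  have : χ x = χ y * χ (x - y) := by rw [← hχ, add_sub_cancel]
  rw [this]; ring

lemma convolution_mul_comm (f g : V → 𝕜) :
    f ⋆[mul 𝕜 𝕜, volume] g = g ⋆[mul 𝕜 𝕜, volume] f := by
  rw [← convolution_flip]
  congr 1
  ext; simp

lemma ae_convolution_mul_assoc {f g k : V → 𝕜} (hf : Integrable f) (hg : Integrable g)
    (hk : Integrable k) :
    (f ⋆[mul 𝕜 𝕜, volume] g) ⋆[mul 𝕜 𝕜, volume] k
      =ᵐ[volume] f ⋆[mul 𝕜 𝕜, volume] (g ⋆[mul 𝕜 𝕜, volume] k) := by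
  filter_upwards [hf.norm.ae_convolution_exists (mul ℝ ℝ)
    (hg.norm.integrable_convolution (mul ℝ ℝ) hk.norm)] with x hx
  exact convolution_assoc _ _ _ _ (fun x y z => by simp [mul_assoc]) hf.1 hg.1 hk.1
    (hf.ae_convolution_exists _ hg) (hg.norm.ae_convolution_exists _ hk.norm) hx

lemma integral_norm_convolution_le {f g : V → 𝕜} (hf : Integrable f) (hg : Integrable g) :
    ∫ x, ‖(f ⋆[mul 𝕜 𝕜, volume] g) x‖ ≤ (∫ x, ‖f x‖) * ∫ x, ‖g x‖ := by
  have h0 := hf.integrable_convolution (mul 𝕜 𝕜) hg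
  rw [integral_norm_eq_lintegral_enorm h0.1, integral_norm_eq_lintegral_enorm hf.1,
    integral_norm_eq_lintegral_enorm hg.1, ← ENNReal.toReal_mul]
  refine ENNReal.toReal_mono (ENNReal.mul_ne_top hf.2.ne hg.2.ne) ?_
  exact (lintegral_mono (enorm_convolution_le f g)).trans (lintegral_lconv_le hf.1.enorm hg.1.enorm)

lemma norm_convolution_le_of_bound {f g : V → 𝕜} (hf : Integrable f) {B : ℝ}
    (hg : ∀ᵐ x, ‖g x‖ ≤ B) (x : V) :
    ‖(f ⋆[mul 𝕜 𝕜, volume] g) x‖ ≤ (∫ x, ‖f x‖) * B := by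
  rw [convolution_def, ← integral_mul_const]
  refine norm_integral_le_of_norm_le (hf.norm.mul_const B) ?_
  have : ∀ᵐ y, ‖g (x - y)‖ ≤ B := by
    have := (quasiMeasurePreserving_sub_left_of_right_invariant (volume : Measure V) x).ae hg
    exact this
  filter_upwards [this] with y hy
  simp only [ContinuousLinearMap.mul_apply', norm_mul]
  gcongr

lemma convolution_congr_left {f f' : V → 𝕜} (g : V → 𝕜) (h : f =ᵐ[volume] f') :
    f ⋆[mul 𝕜 𝕜, volume] g = f' ⋆[mul 𝕜 𝕜, volume] g :=
  convolution_congr _ h (EventuallyEq.refl _ _)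

lemma convolution_congr_right (f : V → 𝕜) {g g' : V → 𝕜} (h : g =ᵐ[volume] g') :
    f ⋆[mul 𝕜 𝕜, volume] g = f ⋆[mul 𝕜 𝕜, volume] g' :=
  convolution_congr _ (EventuallyEq.refl _ _) h

/-- A Gronwall type absorption principle. -/
lemma lintegral_le_of_absorption {a b c w W : V → ℝ≥0∞} (hc : AEMeasurable c)
    (ha : AEMeasurable a) (hb : AEMeasurable b) (hw : Measurable w) (hW : Measurable W)
    (h : ∀ x y, W (x + y) ≤ w x * W y) (hle : ∀ᵐ x, a x ≤ b x + lconv c a x)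
    (hsmall : ∫⁻ x, w x * c x ≤ 1 / 2) (hfin : ∫⁻ x, W x * a x < ⊤) :
    ∫⁻ x, W x * a x ≤ 2 * ∫⁻ x, W x * b x := by
  have h1 : ∫⁻ x, W x * a x ≤ (∫⁻ x, W x * b x) + 1 / 2 * ∫⁻ x, W x * a x := by
    calc ∫⁻ x, W x * a x ≤ ∫⁻ x, (W x * b x + W x * lconv c a x) := by
          refine lintegral_mono_ae ?_
          filter_upwards [hle] with x hx
          rw [← mul_add]; gcongr
      _ = (∫⁻ x, W x * b x) + ∫⁻ x, W x * lconv c a x :=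
          lintegral_add_left' (hW.aemeasurable.mul hb) _
      _ ≤ _ := by
          gcongr
          exact (lintegral_mul_lconv_le hc ha hw hW h).trans (by gcongr)
  by_cases hbt : ∫⁻ x, W x * b x = ⊤
  · rw [hbt]; simp
  -- From `X ≤ Y + X / 2` one may conclude `X ≤ 2 Y` only for finite `X`. The truncated weights
  -- introduced later exist to guarantee this finiteness.
  have hf' := hfin.ne
  generalize ∫⁻ x, W x * a x = X at *
  generalize ∫⁻ x, W x * b x = Y at *
  lift X to ℝ≥0 using hf'
  lift Y to ℝ≥0 using hbt
  have e : (1 / 2 : ℝ≥0∞) = ((1 / 2 : ℝ≥0) : ℝ≥0∞) := by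
    rw [ENNReal.coe_div (by norm_num)]; simp
  rw [e] at h1
  norm_cast at h1 ⊢
  rw [← NNReal.coe_le_coe] at h1 ⊢
  push_cast at h1 ⊢
  linarith

end Convolution
end ScreenedVlasov
end

noncomputable section
namespace ScreenedVlasov
open scoped ENNReal NNReal FourierTransform SchwartzMap
open ContinuousLinearMap (mul)
set_option linter.unusedSectionVars false

/-! ### Resolvents of convolution equations -/

section Resolvent

variable {V : Type*} [NormedAddCommGroup V] [MeasureSpace V] [BorelSpace V]
  [SecondCountableTopology V] [SFinite (volume : Measure V)]
  [(volume : Measure V).IsAddLeftInvariant] [(volume : Measure V).IsNegInvariant]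
variable {𝕜 : Type*} [RCLike 𝕜]

/-- Compute `h * u` twice: as `h * q + h * k * u` from the equation for `u`, and as `k * u + k * h *
u` from the equation for `h`. The triple products cancel and leave `k * u = h * q`. -/
lemma eq_add_resolvent_convolution {k h q u : V → 𝕜} (hk : Integrable k) (hh : Integrable h)
    (hq : Integrable q) (hu : Integrable u) (hkh : h =ᵐ[volume] k + k ⋆[mul 𝕜 𝕜, volume] h)
    (hqu : u =ᵐ[volume] q + k ⋆[mul 𝕜 𝕜, volume] u) :
    u =ᵐ[volume] q + h ⋆[mul 𝕜 𝕜, volume] q := by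
  have hku := hk.integrable_convolution (mul 𝕜 𝕜) hu
  have e1 : h ⋆[mul 𝕜 𝕜, volume] u = h ⋆[mul 𝕜 𝕜, volume] (q + k ⋆[mul 𝕜 𝕜, volume] u) :=
    convolution_congr_right _ hqu
  have e2 : h ⋆[mul 𝕜 𝕜, volume] u = (k + k ⋆[mul 𝕜 𝕜, volume] h) ⋆[mul 𝕜 𝕜, volume] u :=
    convolution_congr_left _ hkh
  have e3 := ae_convolution_mul_assoc hh hk hu
  rw [convolution_mul_comm h k] at e3
  filter_upwards [hqu, e3, hh.ae_convolution_exists (mul 𝕜 𝕜) hq,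
    hh.ae_convolution_exists (mul 𝕜 𝕜) hku, hk.ae_convolution_exists (mul 𝕜 𝕜) hu,
    (hk.integrable_convolution (mul 𝕜 𝕜) hh).ae_convolution_exists (mul 𝕜 𝕜) hu]
    with x h0 h3 h4 h5 h6 h7
  have e1' := congrFun e1 x
  have e2' := congrFun e2 x
  rw [h4.distrib_add h5] at e1'
  rw [h6.add_distrib h7] at e2'
  rw [h0, Pi.add_apply, Pi.add_apply]
  rw [e1', h3] at e2'
  linear_combination -e2'

/-- The converse direction: `k * u = k * q + k * h * q = (k + k * h) * q = h * q`. -/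
lemma eq_add_kernel_convolution {k h q u : V → 𝕜} (hk : Integrable k) (hh : Integrable h)
    (hq : Integrable q) (hkh : h =ᵐ[volume] k + k ⋆[mul 𝕜 𝕜, volume] h)
    (hqu : u =ᵐ[volume] q + h ⋆[mul 𝕜 𝕜, volume] q) :
    u =ᵐ[volume] q + k ⋆[mul 𝕜 𝕜, volume] u := by
  have hhq := hh.integrable_convolution (mul 𝕜 𝕜) hq
  have e1 : k ⋆[mul 𝕜 𝕜, volume] u = k ⋆[mul 𝕜 𝕜, volume] (q + h ⋆[mul 𝕜 𝕜, volume] q) :=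
    convolution_congr_right _ hqu
  have e2 : h ⋆[mul 𝕜 𝕜, volume] q = (k + k ⋆[mul 𝕜 𝕜, volume] h) ⋆[mul 𝕜 𝕜, volume] q :=
    convolution_congr_left _ hkh
  filter_upwards [hqu, ae_convolution_mul_assoc hk hh hq, hk.ae_convolution_exists (mul 𝕜 𝕜) hq,
    hk.ae_convolution_exists (mul 𝕜 𝕜) hhq,
    (hk.integrable_convolution (mul 𝕜 𝕜) hh).ae_convolution_exists (mul 𝕜 𝕜) hq]
    with x h0 h3 h4 h5 h6
  have e1' := congrFun e1 x
  have e2' := congrFun e2 x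
  rw [h4.distrib_add h5] at e1'
  rw [h4.add_distrib h6] at e2'
  rw [h0, Pi.add_apply, Pi.add_apply, e1', e2', h3]

lemma char_mul_ae_eq {χ : V → 𝕜} (hχ : ∀ x y, χ (x + y) = χ x * χ y) {u q k v : V → 𝕜}
    (h : u =ᵐ[volume] q + k ⋆[mul 𝕜 𝕜, volume] v) :
    (fun x => χ x * u x) =ᵐ[volume]
      (fun x => χ x * q x) + (fun x => χ x * k x) ⋆[mul 𝕜 𝕜, volume] (fun x => χ x * v x) := by
  filter_upwards [h] with x hx
  rw [hx, Pi.add_apply, Pi.add_apply, mul_add, char_mul_convolution hχ]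

lemma ae_eq_of_char_mul {χ : V → 𝕜} (hχ : ∀ x y, χ (x + y) = χ x * χ y) (h0 : ∀ x, χ x ≠ 0)
    {u q k v : V → 𝕜} (h : (fun x => χ x * u x) =ᵐ[volume]
      (fun x => χ x * q x) + (fun x => χ x * k x) ⋆[mul 𝕜 𝕜, volume] (fun x => χ x * v x)) :
    u =ᵐ[volume] q + k ⋆[mul 𝕜 𝕜, volume] v := by
  filter_upwards [h] with x hx
  rw [Pi.add_apply, ← char_mul_convolution hχ, ← mul_add] at hx
  exact mul_left_cancel₀ (h0 x) hx

/-- The resolvent formula for kernels that are integrable against a multiplicative character. -/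
lemma eq_add_resolvent_convolution_char {χ : V → 𝕜} (hχ : ∀ x y, χ (x + y) = χ x * χ y)
    (h0 : ∀ x, χ x ≠ 0) {k h q u : V → 𝕜} (hk : Integrable fun x => χ x * k x)
    (hh : Integrable fun x => χ x * h x) (hq : Integrable fun x => χ x * q x)
    (hu : Integrable fun x => χ x * u x) (hkh : h =ᵐ[volume] k + k ⋆[mul 𝕜 𝕜, volume] h)
    (hqu : u =ᵐ[volume] q + k ⋆[mul 𝕜 𝕜, volume] u) :
    u =ᵐ[volume] q + h ⋆[mul 𝕜 𝕜, volume] q :=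
  ae_eq_of_char_mul hχ h0 (eq_add_resolvent_convolution hk hh hq hu (char_mul_ae_eq hχ hkh)
    (char_mul_ae_eq hχ hqu))

lemma eq_add_kernel_convolution_char {χ : V → 𝕜} (hχ : ∀ x y, χ (x + y) = χ x * χ y)
    (h0 : ∀ x, χ x ≠ 0) {k h q u : V → 𝕜} (hk : Integrable fun x => χ x * k x)
    (hh : Integrable fun x => χ x * h x) (hq : Integrable fun x => χ x * q x)
    (hkh : h =ᵐ[volume] k + k ⋆[mul 𝕜 𝕜, volume] h)
    (hqu : u =ᵐ[volume] q + h ⋆[mul 𝕜 𝕜, volume] q) :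
    u =ᵐ[volume] q + k ⋆[mul 𝕜 𝕜, volume] u :=
  ae_eq_of_char_mul hχ h0 (eq_add_kernel_convolution hk hh hq (char_mul_ae_eq hχ hkh)
    (char_mul_ae_eq hχ hqu))

end Resolvent

/-! ### Fourier inversion and Plancherel for integrable functions -/

section Fourier

variable {E : Type*} [NormedAddCommGroup E] [InnerProductSpace ℝ E] [FiniteDimensional ℝ E]
  [MeasurableSpace E] [BorelSpace E]

lemma ae_eq_of_integral_schwartz {u v : E → ℂ} (hu : LocallyIntegrable u)
    (hv : LocallyIntegrable v) (h : ∀ φ : 𝓢(E, ℂ), ∫ x, φ x * u x = ∫ x, φ x * v x) :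
    u =ᵐ[volume] v := by
  refine ae_eq_of_integral_contDiff_smul_eq hu hv fun g hg hgs => ?_
  have hs : HasCompactSupport (fun x => (g x : ℂ)) := hgs.comp_left (g := fun r : ℝ => (r : ℂ)) rfl
  have hc : ContDiff ℝ ∞ (fun x => (g x : ℂ)) := Complex.ofRealCLM.contDiff.comp hg
  simpa using h (hs.toSchwartzMap hc)

lemma integral_fourier_mul_eq_of_integrable {f g : E → ℂ} (hf : Integrable f) (hg : Integrable g) :
    ∫ x, 𝓕 f x * g x = ∫ x, f x * 𝓕 g x := by
  have := VectorFourier.integral_fourierIntegral_smul_eq_flip (L := innerₗ E) (f := f) (g := g)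
    (μ := volume) (ν := volume) Real.continuous_fourierChar continuous_inner hf hg
  simp only [flip_innerₗ, smul_eq_mul] at this
  exact this

lemma continuous_fourier {f : E → ℂ} (hf : Integrable f) : Continuous (𝓕 f) :=
  VectorFourier.fourierIntegral_continuous Real.continuous_fourierChar
    (innerSL ℝ).continuous₂ hf

lemma continuous_fourierInv {f : E → ℂ} (hf : Integrable f) : Continuous (𝓕⁻ f) := by
  rw [Real.fourierInv_eq_fourier_comp_neg]
  exact continuous_fourier hf.comp_neg

/-- Fourier inversion almost everywhere. -/
lemma ae_eq_fourierInv_fourier {f : E → ℂ} (hf : Integrable f) (hf' : Integrable (𝓕 f)) :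
    f =ᵐ[volume] 𝓕⁻ (𝓕 f) := by
  refine ae_eq_of_integral_schwartz hf.locallyIntegrable
    (continuous_fourierInv hf').locallyIntegrable fun φ => ?_
  -- Inversion by duality: a test function `φ` is written as `𝓕 (𝓕⁻ φ)`, and the transform is moved
  -- across the pairing once for `f` and once for `𝓕 f`.
  have h1 := integral_fourier_mul_eq_of_integrable hf (𝓕⁻ φ).integrable
  have h2 := integral_fourier_mul_eq_of_integrable hf'.comp_neg φ.integrable
  have e1 : 𝓕 ((𝓕⁻ φ : 𝓢(E, ℂ)) : E → ℂ) = φ := by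
    rw [← SchwartzMap.fourier_coe, FourierTransform.fourier_fourierInv_eq]
  rw [e1] at h1
  rw [← SchwartzMap.fourier_coe] at h2
  calc ∫ x, φ x * f x = ∫ x, f x * φ x := by simp_rw [mul_comm]
    _ = ∫ x, 𝓕 f x * (𝓕⁻ φ) x := h1.symm
    _ = ∫ x, 𝓕 f (-x) * 𝓕 φ x := by
      rw [← integral_neg_eq_self]
      congr 1; ext x
      rw [SchwartzMap.fourierInv_coe, Real.fourierInv_eq_fourier_neg, neg_neg,
        SchwartzMap.fourier_coe]
    _ = ∫ x, 𝓕⁻ (𝓕 f) x * φ x := by rw [← h2, Real.fourierInv_eq_fourier_comp_neg]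
    _ = _ := by simp_rw [mul_comm]

/-- The `L²` extension of the Fourier transform and the Fourier integral of `f` pair identically
with every Schwartz function, hence agree almost everywhere; the isometry of the extension then
transfers to the integral. -/
lemma plancherel_of_integrable {f : E → ℂ} (hf : Integrable f) (hf2 : MemLp f 2) :
    MemLp (𝓕 f) 2 ∧ ∫ x, ‖𝓕 f x‖ ^ 2 = ∫ x, ‖f x‖ ^ 2 := by
  have hae : ((𝓕 hf2.toLp : Lp ℂ 2 (volume : Measure E)) : E → ℂ) =ᵐ[volume] 𝓕 f := by
    refine ae_eq_of_integral_schwartz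
      ((Lp.memLp _).locallyIntegrable (by norm_num))
      (continuous_fourier hf).locallyIntegrable fun φ => ?_
    have h1 := Lp.fourier_toTemperedDistribution_eq hf2.toLp
    have h2 := DFunLike.congr_fun h1 φ
    rw [TemperedDistribution.fourier_apply, Lp.toTemperedDistribution_apply,
      Lp.toTemperedDistribution_apply] at h2
    simp only [smul_eq_mul] at h2
    rw [← h2]
    calc _ = ∫ x, f x * 𝓕 φ x := by
          refine integral_congr_ae ?_
          filter_upwards [hf2.coeFn_toLp] with x hx
          rw [hx, mul_comm]
      _ = _ := by
          rw [SchwartzMap.fourier_coe, ← integral_fourier_mul_eq_of_integrable hf φ.integrable]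
          simp_rw [mul_comm]
  have hm : MemLp (𝓕 f) 2 := (memLp_congr_ae hae).1 (Lp.memLp _)
  refine ⟨hm, ?_⟩
  have hn := Lp.norm_fourier_eq hf2.toLp
  have e : hm.toLp = 𝓕 hf2.toLp := by
    rw [MemLp.toLp_congr hm (Lp.memLp _) hae.symm, Lp.toLp_coeFn]
  have key : ∀ {g : E → ℂ} (hg : MemLp g 2), ‖hg.toLp g‖ ^ 2 = ∫ x, ‖g x‖ ^ 2 := by
    intro g hg
    rw [← @inner_self_eq_norm_sq ℂ, L2.inner_def]
    have e2 : ∫ a, inner ℂ ((hg.toLp g) a) ((hg.toLp g) a) = ∫ a, ((‖g a‖ ^ 2 : ℝ) : ℂ) := by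
      refine integral_congr_ae ?_
      filter_upwards [hg.coeFn_toLp] with x hx
      rw [hx, inner_self_eq_norm_sq_to_K]; norm_cast
    rw [e2, integral_complex_ofReal]; exact Complex.ofReal_re _
  rw [← key hm, ← key hf2, e, hn]

end Fourier

/-! ### Integrating out the space variable -/

section Partial

variable {E : Type*} [NormedAddCommGroup E] [MeasureSpace E] [BorelSpace E]
  [SecondCountableTopology E] [SFinite (volume : Measure E)]
  [(volume : Measure E).IsAddLeftInvariant] [(volume : Measure E).IsNegInvariant]

/-- Integrating out one variable turns convolution into convolution. -/
lemma ae_integral_convolution_eq [(volume : Measure (ℝ × E)).IsAddLeftInvariant]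
     {f g : ℝ × E → ℂ} (hf : Integrable f) (hg : Integrable g) :
    (fun t => ∫ x, (f ⋆[mul ℂ ℂ, volume] g) (t, x)) =ᵐ[volume]
      (fun t => ∫ x, f (t, x)) ⋆[mul ℂ ℂ, volume] (fun t => ∫ x, g (t, x)) := by
  have h0 := hf.convolution_integrand (mul ℂ ℂ) hg
  have h1 := ((measurePreserving_prodAssoc (volume : Measure ℝ) (volume : Measure E)
    (volume : Measure (ℝ × E))).symm.integrable_comp_emb
      (MeasurableEquiv.measurableEmbedding _)).2 h0
  have h2 : Integrable (fun q : ℝ × (E × (ℝ × E)) =>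
      f q.2.2 * g ((q.1, q.2.1) - q.2.2)) (volume.prod (volume.prod volume)) := h1
  filter_upwards [h2.prod_right_ae] with t ht
  have ht' : Integrable (Function.uncurry fun (x : E) (q : ℝ × E) => f q * g ((t, x) - q))
    (volume.prod volume) := ht
  have e1 : ∀ q : ℝ × E, ∫ x, f q * g ((t, x) - q) = f q * ∫ x, g (t - q.1, x) := by
    intro q
    rw [integral_const_mul]
    congr 1
    exact integral_sub_right_eq_self (fun x => g (t - q.1, x)) q.2
  calc ∫ x, (f ⋆[mul ℂ ℂ, volume] g) (t, x)
      = ∫ x, ∫ q, f q * g ((t, x) - q) := rfl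
    _ = ∫ q, ∫ x, f q * g ((t, x) - q) := integral_integral_swap ht'
    _ = ∫ q, f q * ∫ x, g (t - q.1, x) := by simp_rw [e1]
    _ = ∫ s, ∫ y, f (s, y) * ∫ x, g (t - s, x) := by
      have h3 := ht'.integral_prod_right
      simp only [Function.uncurry_apply_pair, e1] at h3
      exact integral_prod _ h3
    _ = _ := by
      rw [convolution_def]
      congr 1; ext s
      rw [integral_mul_const]; rfl

end Partial
end ScreenedVlasov
end

/-! ### Leibniz rule, the scale-invariant decay profile and exponential damping -/

noncomputable section
namespace ScreenedVlasov
open scoped ENNReal NNReal FourierTransform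
open ContinuousLinearMap (mul)
set_option linter.unusedSectionVars false

/-- Multiplication by powers of an additive function satisfies the Leibniz rule with respect to
convolution. -/
lemma pow_mul_convolution {V 𝕜 : Type*} [NormedAddCommGroup V] [MeasureSpace V] [RCLike 𝕜]
    {l : V → 𝕜} (hl : ∀ x y, l (x + y) = l x + l y) (f g : V → 𝕜) (m : ℕ) (x : V)
    (h : ∀ i ≤ m, ConvolutionExistsAt (fun y => l y ^ i * f y) (fun y => l y ^ (m - i) * g y) x
      (mul 𝕜 𝕜) volume) :
    l x ^ m * (f ⋆[mul 𝕜 𝕜, volume] g) x = ∑ i ∈ Finset.range (m + 1), (m.choose i : 𝕜) *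
      ((fun y => l y ^ i * f y) ⋆[mul 𝕜 𝕜, volume] (fun y => l y ^ (m - i) * g y)) x := by
  simp only [convolution_def, ContinuousLinearMap.mul_apply']
  simp_rw [← integral_const_mul]
  rw [← integral_finsetSum]
  · congr 1; ext y
    have : l x = l y + l (x - y) := by rw [← hl, add_sub_cancel]
    rw [this, add_pow, Finset.sum_mul]
    refine Finset.sum_congr rfl fun i _ => by ring
  · intro i hi
    exact (h i (by simpa [Nat.lt_succ_iff] using hi)).integrable.const_mul _

lemma lintegral_le_of_tendsto_of_le {α : Type*} [MeasurableSpace α] {μ : Measure α}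
    {f : ℕ → α → ℝ≥0∞} {g : α → ℝ≥0∞} {C : ℝ≥0∞} (hf : ∀ n, AEMeasurable (f n) μ)
    (h : ∀ᵐ x ∂μ, Tendsto (fun n => f n x) atTop (𝓝 (g x))) (hC : ∀ n, ∫⁻ x, f n x ∂μ ≤ C) :
    ∫⁻ x, g x ∂μ ≤ C := by
  calc ∫⁻ x, g x ∂μ = ∫⁻ x, liminf (fun n => f n x) atTop ∂μ :=
        lintegral_congr_ae (h.mono fun x hx => hx.liminf_eq.symm)
    _ ≤ liminf (fun n => ∫⁻ x, f n x ∂μ) atTop := lintegral_liminf_le' hf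
    _ ≤ liminf (fun _ : ℕ => C) atTop := liminf_le_liminf (Eventually.of_forall hC)
    _ = C := liminf_const C

section Decay

variable {r : ℝ}

/-- The profile is the derivative of `-(1 + r t)⁻¹`. Its mass is `1` for every `r`; this
normalization makes the later `L¹` bounds uniform in the frequency. -/
lemma integrableOn_decay (hr : 0 < r) :
    IntegrableOn (fun t : ℝ => r / (1 + r * t) ^ 2) (Ioi 0) ∧
      ∫ t in Ioi (0:ℝ), r / (1 + r * t) ^ 2 = 1 := by
  have hd : ∀ t ∈ Ioi (0:ℝ), HasDerivAt (fun t : ℝ => -(1 + r * t)⁻¹) (r / (1 + r * t) ^ 2) t := by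
    intro t ht
    have h1 : HasDerivAt (fun t : ℝ => 1 + r * t) r t := by
      simpa using ((hasDerivAt_id t).const_mul r).const_add 1
    have h2 : 1 + r * t ≠ 0 := by have := mul_pos hr ht; linarith
    have h3 := (h1.inv h2).neg
    rw [neg_div, neg_neg] at h3
    exact h3
  have hc : ContinuousWithinAt (fun t : ℝ => -(1 + r * t)⁻¹) (Ici 0) 0 := by
    apply ContinuousAt.continuousWithinAt
    apply ContinuousAt.neg
    apply ContinuousAt.inv₀ (by fun_prop) (by simp)
  have hl : Tendsto (fun t : ℝ => -(1 + r * t)⁻¹) atTop (𝓝 0) := by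
    rw [← neg_zero]
    refine (tendsto_inv_atTop_zero.comp ?_).neg
    exact tendsto_atTop_add_const_left _ _ (tendsto_id.const_mul_atTop hr)
  have hn : ∀ t ∈ Ioi (0:ℝ), 0 ≤ r / (1 + r * t) ^ 2 := fun t _ => by positivity
  refine ⟨integrableOn_Ioi_deriv_of_nonneg hc hd hn hl, ?_⟩
  rw [integral_Ioi_of_hasDerivAt_of_nonneg hc hd hn hl]; simp

lemma integrable_of_decay (hr : 0 < r) {A : ℝ} {f : ℝ → ℂ} (hf : AEStronglyMeasurable f)
    (h0 : ∀ t ≤ 0, f t = 0) (hb : ∀ᵐ t, 0 < t → ‖f t‖ ≤ A * (r / (1 + r * t) ^ 2)) :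
    Integrable f ∧ ∫ t, ‖f t‖ ≤ A := by
  have hi : IntegrableOn f (Ioi 0) := by
    refine Integrable.mono' ((integrableOn_decay hr).1.const_mul A) hf.restrict ?_
    rw [ae_restrict_iff' measurableSet_Ioi]
    exact hb
  have hs : Function.support f ⊆ Ioi 0 := by
    intro t ht
    by_contra hc
    exact ht (h0 t (not_lt.1 hc))
  refine ⟨(integrableOn_iff_integrable_of_support_subset hs).1 hi, ?_⟩
  rw [← setIntegral_eq_integral_of_forall_compl_eq_zero (s := Ioi 0)
    (fun t ht => by rw [h0 t (not_lt.1 ht), norm_zero])]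
  calc ∫ t in Ioi 0, ‖f t‖ ≤ ∫ t in Ioi 0, A * (r / (1 + r * t) ^ 2) := by
        refine integral_mono_ae hi.norm ((integrableOn_decay hr).1.const_mul A) ?_
        change ∀ᵐ t ∂(volume.restrict (Ioi 0)), ‖f t‖ ≤ A * (r / (1 + r * t) ^ 2)
        rw [ae_restrict_iff' measurableSet_Ioi]
        exact hb
    _ = A := by rw [integral_const_mul, (integrableOn_decay hr).2, mul_one]

lemma memLp_two_of_bound {f : ℝ → ℂ} (hf : Integrable f) {B : ℝ} (hB : ∀ᵐ t, ‖f t‖ ≤ B) :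
    MemLp f 2 := by
  rw [memLp_two_iff_integrable_sq_norm hf.1]
  refine (hf.norm.const_mul B).mono' (by have := hf.1; fun_prop) ?_
  filter_upwards [hB] with t ht
  rw [norm_pow, norm_norm, sq]
  gcongr

/-- `‖f‖₂² ≤ ‖f‖_∞ ‖f‖₁ ≤ (A r) A`. The factor `r` is undone by the factor `r⁻¹` of the
Cauchy-Schwarz step in `integral_norm_damp_resolvent_le`. -/
lemma integral_sq_le_of_decay (hr : 0 < r) {A : ℝ} (hA : 0 ≤ A) {f : ℝ → ℂ}
    (hf : AEStronglyMeasurable f)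
    (h0 : ∀ t ≤ 0, f t = 0) (hb : ∀ t, 0 < t → ‖f t‖ ≤ A * (r / (1 + r * t) ^ 2)) :
    MemLp f 2 ∧ ∫ t, ‖f t‖ ^ 2 ≤ A ^ 2 * r := by
  have hb' : ∀ t, ‖f t‖ ≤ A * r := by
    intro t
    rcases le_or_gt t 0 with ht | ht
    · rw [h0 t ht, norm_zero]; positivity
    · refine (hb t ht).trans ?_
      gcongr
      refine div_le_self hr.le (one_le_pow₀ ?_)
      have := mul_pos hr ht; linarith
  obtain ⟨h1, h2⟩ := integrable_of_decay hr hf h0 (Eventually.of_forall hb)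
  have h3 := memLp_two_of_bound h1 (Eventually.of_forall hb')
  refine ⟨h3, ?_⟩
  calc ∫ t, ‖f t‖ ^ 2 ≤ ∫ t, (A * r) * ‖f t‖ := by
        refine integral_mono ((memLp_two_iff_integrable_sq_norm hf).1 h3) (h1.norm.const_mul _) ?_
        intro t
        simp only [sq]
        gcongr
        exact hb' t
    _ ≤ (A * r) * A := by rw [integral_const_mul]; gcongr
    _ = _ := by ring

end Decay

/-- Multiplication by the exponential `e^{-γ t}`. -/
def damp (γ : ℝ) (f : ℝ → ℂ) (t : ℝ) : ℂ := ((Real.exp (-(γ * t)) : ℝ) : ℂ) * f t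

lemma norm_damp (γ : ℝ) (f : ℝ → ℂ) (t : ℝ) : ‖damp γ f t‖ = Real.exp (-(γ * t)) * ‖f t‖ := by
  rw [damp, norm_mul, Complex.norm_real, Real.norm_of_nonneg (Real.exp_pos _).le]

lemma exp_char (γ : ℝ) (x y : ℝ) : ((Real.exp (-(γ * (x + y))) : ℝ) : ℂ)
    = ((Real.exp (-(γ * x)) : ℝ) : ℂ) * ((Real.exp (-(γ * y)) : ℝ) : ℂ) := by
  rw [← Complex.ofReal_mul, ← Real.exp_add]; congr 2; ring

lemma exp_char_ne_zero (γ x : ℝ) : ((Real.exp (-(γ * x)) : ℝ) : ℂ) ≠ 0 := by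
  exact_mod_cast (Real.exp_pos _).ne'

lemma damp_damp (γ γ' : ℝ) (f : ℝ → ℂ) : damp γ (damp γ' f) = damp (γ + γ') f := by
  ext t
  simp only [damp]
  rw [← mul_assoc, ← Complex.ofReal_mul, ← Real.exp_add]
  congr 3; ring

lemma damp_zero (f : ℝ → ℂ) : damp 0 f = f := by
  ext t; simp [damp]

lemma measurable_damp {γ : ℝ} {f : ℝ → ℂ} (hf : AEStronglyMeasurable f) :
    AEStronglyMeasurable (damp γ f) := by
  refine AEStronglyMeasurable.mul ?_ hf
  apply Continuous.aestronglyMeasurable; fun_prop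

lemma norm_damp_le {γ γ' : ℝ} (h : γ' ≤ γ) {f : ℝ → ℂ} (h0 : ∀ t ≤ 0, f t = 0) (t : ℝ) :
    ‖damp γ f t‖ ≤ ‖damp γ' f t‖ := by
  rw [norm_damp, norm_damp]
  rcases le_or_gt t 0 with ht | ht
  · simp [h0 t ht]
  · gcongr

lemma integrable_damp_mono {γ γ' : ℝ} (h : γ' ≤ γ) {f : ℝ → ℂ} (hf : AEStronglyMeasurable f)
    (h0 : ∀ t ≤ 0, f t = 0) (hi : Integrable (damp γ' f)) : Integrable (damp γ f) :=
  hi.mono (measurable_damp hf) (Eventually.of_forall (norm_damp_le h h0))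

lemma damp_ae_eq (γ : ℝ) {u q k v : ℝ → ℂ} (h : u =ᵐ[volume] q + k ⋆[mul ℂ ℂ, volume] v) :
    damp γ u =ᵐ[volume] damp γ q + damp γ k ⋆[mul ℂ ℂ, volume] damp γ v :=
  char_mul_ae_eq (exp_char γ) h

lemma damp_of_nonpos {γ : ℝ} {f : ℝ → ℂ} (h0 : ∀ t ≤ 0, f t = 0) : ∀ t ≤ 0, damp γ f t = 0 :=
  fun t ht => by simp [damp, h0 t ht]

end ScreenedVlasov
end

/-! ### A priori bound for scalar Volterra resolvents under the Penrose condition -/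

noncomputable section
namespace ScreenedVlasov
open scoped ENNReal NNReal FourierTransform
open ContinuousLinearMap (mul)
set_option linter.unusedSectionVars false

/-- A causal kernel `k` on the half line with decay on the time scale `1 / r`. -/
structure IsDecayKernel (r A : ℝ) (N : ℕ) (k : ℝ → ℂ) : Prop where
  meas : AEStronglyMeasurable k
  causal : ∀ t ≤ 0, k t = 0
  bound : ∀ t, 0 < t → ‖k t‖ ≤ A * (r / (1 + r * t) ^ N)

/-- `h` is the (causal, exponentially bounded) Volterra resolvent of `k`. -/
structure IsResolvent (k h : ℝ → ℂ) : Prop where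
  meas : AEStronglyMeasurable h
  causal : ∀ t ≤ 0, h t = 0
  exp_integrable : ∃ β : ℝ, Integrable (damp β h)
  eq : h =ᵐ[volume] k + k ⋆[mul ℂ ℂ, volume] h

lemma one_le_one_add_mul {r t : ℝ} (hr : 0 < r) (ht : 0 < t) : 1 ≤ 1 + r * t := by
  have := mul_pos hr ht; linarith

section

variable {r A : ℝ} {k h : ℝ → ℂ}

lemma IsDecayKernel.mono {M N : ℕ} (hr : 0 < r) (hA : 0 ≤ A) (hk : IsDecayKernel r A N k)
    (hMN : M ≤ N) : IsDecayKernel r A M k := by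
  refine ⟨hk.meas, hk.causal, fun t ht => (hk.bound t ht).trans ?_⟩
  have := one_le_one_add_mul hr ht
  gcongr

lemma IsDecayKernel.norm_le {N : ℕ} (hr : 0 < r) (hA : 0 ≤ A) (hk : IsDecayKernel r A N k) (t : ℝ) :
    ‖k t‖ ≤ A * r := by
  rcases le_or_gt t 0 with ht | ht
  · rw [hk.causal t ht, norm_zero]; positivity
  · simpa using (hk.mono hr hA (Nat.zero_le N)).bound t ht

lemma IsDecayKernel.damp {N : ℕ} {γ : ℝ} (hγ : 0 ≤ γ) (hk : IsDecayKernel r A N k) :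
    IsDecayKernel r A N (damp γ k) := by
  refine ⟨measurable_damp hk.meas, damp_of_nonpos hk.causal, fun t ht => ?_⟩
  refine (norm_damp_le hγ hk.causal t).trans ?_
  rw [damp_zero]
  exact hk.bound t ht

lemma IsDecayKernel.integrable {N : ℕ} (hr : 0 < r) (hA : 0 ≤ A) (hN : 2 ≤ N)
    (hk : IsDecayKernel r A N k) : Integrable k ∧ ∫ t, ‖k t‖ ≤ A :=
  integrable_of_decay hr hk.meas hk.causal (Eventually.of_forall (hk.mono hr hA hN).bound)

/-- The factor `r t` is dimensionless: each one costs a power of decay and leaves `A` and `r`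
unchanged. -/
lemma IsDecayKernel.pow_mul {N i : ℕ} (hr : 0 < r) 
    (hk : IsDecayKernel r A (N + i) k) : IsDecayKernel r A N (fun t => ((r * t : ℝ) : ℂ) ^ i * k t) := by
  refine ⟨?_, fun t ht => by simp [hk.causal t ht], fun t ht => ?_⟩
  · refine AEStronglyMeasurable.mul ?_ hk.meas
    apply Continuous.aestronglyMeasurable; fun_prop
  · have h1 := one_le_one_add_mul hr ht
    have h2 : 0 < r * t := mul_pos hr ht
    rw [norm_mul, norm_pow, Complex.norm_real, Real.norm_of_nonneg h2.le]
    calc (r * t) ^ i * ‖k t‖ ≤ (1 + r * t) ^ i * (A * (r / (1 + r * t) ^ (N + i))) := by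
          gcongr
          · linarith
          · exact hk.bound t ht
      _ = _ := by rw [pow_add]; field_simp

lemma fourier_add_apply {E : Type*} [NormedAddCommGroup E] [InnerProductSpace ℝ E]
    [MeasurableSpace E] [BorelSpace E] [FiniteDimensional ℝ E] {f g : E → ℂ} (hf : Integrable f)
    (hg : Integrable g) (w : E) : 𝓕 (f + g) w = 𝓕 f w + 𝓕 g w :=
  congrFun (VectorFourier.fourierIntegral_add (L := innerₗ E) Real.continuous_fourierChar
    continuous_inner hf hg) w

lemma mul_char_add (r x y : ℝ) : ((r * (x + y) : ℝ) : ℂ) = ((r * x : ℝ) : ℂ) + ((r * y : ℝ) : ℂ) := by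
  rw [← Complex.ofReal_add]; congr 1; ring

/-- A priori bound in `L¹` for the damped resolvent, from Plancherel and the Penrose condition. -/
lemma integral_norm_damp_resolvent_le {κ γ γ' : ℝ} (hr : 0 < r) (hA : 0 ≤ A) (hκ : 0 < κ)
    (hk : IsDecayKernel r A 3 k) (hh : IsResolvent k h) (hγ' : 0 ≤ γ') (hγ : γ' < γ)
    (hint : Integrable (damp γ' h)) (hpen : ∀ τ, κ ≤ ‖1 - 𝓕 (damp γ k) τ‖) :
    ∫ t, ‖damp γ h t‖ ≤ 1 + A ^ 2 * ((κ⁻¹) ^ 2 + (κ⁻¹ ^ 2) ^ 2) := by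
  have hγ0 : 0 ≤ γ := hγ'.trans hγ.le
  have hkγ := hk.damp hγ0
  have hkγ' := hk.damp hγ'
  have hkγi := (hkγ.integrable hr hA (by norm_num)).1
  -- boundedness of the damped resolvents
  obtain ⟨B, hB⟩ : ∃ B : ℝ, ∀ᵐ t, ‖damp γ' h t‖ ≤ B := by
    refine ⟨A * r + (∫ t, ‖damp γ' h t‖) * (A * r), ?_⟩
    filter_upwards [damp_ae_eq γ' hh.eq] with t ht
    rw [ht, Pi.add_apply, convolution_mul_comm]
    exact (norm_add_le _ _).trans (add_le_add (hkγ'.norm_le hr hA t)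
      (norm_convolution_le_of_bound hint (Eventually.of_forall (hkγ'.norm_le hr hA)) t))
  set f := damp γ h with hf
  have hfi : Integrable f := integrable_damp_mono hγ.le hh.meas hh.causal hint
  have hfB : ∀ᵐ t, ‖f t‖ ≤ B := by
    filter_upwards [hB] with t ht using (norm_damp_le hγ.le hh.causal t).trans ht
  have hf2 := memLp_two_of_bound hfi hfB
  have hfeq : f =ᵐ[volume] damp γ k + damp γ k ⋆[mul ℂ ℂ, volume] f := damp_ae_eq γ hh.eq
  set l : ℝ → ℂ := fun t => ((r * t : ℝ) : ℂ) with hl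
  set Tf : ℝ → ℂ := fun t => l t * f t with hTf
  set Tk : ℝ → ℂ := fun t => l t * damp γ k t with hTk
  have hTkd : IsDecayKernel r A 2 Tk := by
    have := IsDecayKernel.pow_mul (N := 2) (i := 1) hr hkγ
    simp only [pow_one] at this
    exact this
  have hTki := (hTkd.integrable hr hA le_rfl).1
  -- The damping gap pays for the factor `r t`, by `y e^{-y} ≤ 1` with `y = (γ - γ') t`. The
  -- constant blows up as the gap closes, but it only serves to show that `Tf` lies in `L¹` and
  -- `L²`; it does not enter the final bound.
  have hTle : ∀ t, ‖Tf t‖ ≤ (r / (γ - γ')) * ‖damp γ' h t‖ := by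
    intro t
    rcases le_or_gt t 0 with ht | ht
    · simp [hTf, hf, damp, hh.causal t ht]
    · have hg : 0 < γ - γ' := sub_pos.2 hγ
      have e : f t = damp (γ - γ') (damp γ' h) t := by rw [damp_damp, sub_add_cancel]
      rw [hTf, norm_mul, e, norm_damp, hl, Complex.norm_real,
        Real.norm_of_nonneg (mul_pos hr ht).le, ← mul_assoc]
      gcongr
      have h1 : (γ - γ') * t * Real.exp (-((γ - γ') * t)) ≤ 1 := by
        rw [Real.exp_neg, ← div_eq_mul_inv, div_le_one (Real.exp_pos _)]
        linarith [Real.add_one_le_exp ((γ - γ') * t)]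
      rw [le_div_iff₀ hg]
      calc r * t * Real.exp (-((γ - γ') * t)) * (γ - γ')
          = r * ((γ - γ') * t * Real.exp (-((γ - γ') * t))) := by ring
        _ ≤ r * 1 := by gcongr
        _ = r := mul_one r
  have hlm : Continuous l := by rw [hl]; fun_prop
  have hTfi : Integrable Tf :=
    (hint.norm.const_mul _).mono' (hlm.aestronglyMeasurable.mul hfi.1) (Eventually.of_forall hTle)
  have hTf2 : MemLp Tf 2 := by
    refine memLp_two_of_bound hTfi (B := (r / (γ - γ')) * B) ?_
    filter_upwards [hB] with t ht
    have hg : 0 < γ - γ' := sub_pos.2 hγ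
    exact (hTle t).trans (by gcongr)
  -- Multiplication by `r t` is a derivation for convolution; it is applied to `f = k_γ + k_γ * f`,
  -- with `k_γ` the damped kernel.
  have hTeq : Tf =ᵐ[volume] Tk + (damp γ k ⋆[mul ℂ ℂ, volume] Tf + Tk ⋆[mul ℂ ℂ, volume] f) := by
    filter_upwards [hfeq, hkγi.ae_convolution_exists (mul ℂ ℂ) hTfi,
      hTki.ae_convolution_exists (mul ℂ ℂ) hfi] with t h0 h1 h2
    have h3 := pow_mul_convolution (l := l) (mul_char_add r) (damp γ k) f 1 t (by
      intro i hi
      interval_cases i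
      · simpa using h1
      · simpa using h2)
    simp only [pow_one, Finset.sum_range_succ, Finset.range_zero, Finset.sum_empty, Nat.choose_zero_right,
      Nat.choose_self, Nat.cast_one, one_mul, zero_add, pow_zero, Nat.sub_zero, Nat.sub_self] at h3
    simp only [hTf, Pi.add_apply]
    rw [h0, Pi.add_apply, mul_add, h3]
  -- Fourier transforms
  have hF : ∀ τ, 𝓕 f τ = 𝓕 (damp γ k) τ + 𝓕 (damp γ k) τ * 𝓕 f τ := by
    intro τ
    refine (Real.fourier_congr_ae hfeq τ).trans ?_
    rw [← Real.fourier_mul_convolution_eq hkγi hfi]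
    exact fourier_add_apply hkγi (hkγi.integrable_convolution (mul ℂ ℂ) hfi) τ
  have hFT : ∀ τ, 𝓕 Tf τ = 𝓕 Tk τ + (𝓕 (damp γ k) τ * 𝓕 Tf τ + 𝓕 Tk τ * 𝓕 f τ) := by
    intro τ
    refine (Real.fourier_congr_ae hTeq τ).trans ?_
    rw [← Real.fourier_mul_convolution_eq hkγi hTfi, ← Real.fourier_mul_convolution_eq hTki hfi]
    have i1 := hkγi.integrable_convolution (mul ℂ ℂ) hTfi
    have i2 := hTki.integrable_convolution (mul ℂ ℂ) hfi
    rw [fourier_add_apply hTki (i1.add i2), fourier_add_apply i1 i2]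
  have hne : ∀ τ, 1 - 𝓕 (damp γ k) τ ≠ 0 := fun τ h0 => by
    have := hpen τ
    rw [h0, norm_zero] at this
    linarith
  have hinv : ∀ τ, ‖(1 - 𝓕 (damp γ k) τ)⁻¹‖ ≤ κ⁻¹ := fun τ => by
    rw [norm_inv]
    exact inv_anti₀ hκ (hpen τ)
  have b1 : ∀ τ, ‖𝓕 f τ‖ ≤ κ⁻¹ * ‖𝓕 (damp γ k) τ‖ := by
    intro τ
    have : 𝓕 f τ = (1 - 𝓕 (damp γ k) τ)⁻¹ * 𝓕 (damp γ k) τ := by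
      rw [eq_inv_mul_iff_mul_eq₀ (hne τ)]
      linear_combination hF τ
    rw [this, norm_mul]
    gcongr
    exact hinv τ
  -- The transformed equation reads `(1 - k̂) T̂f = T̂k (1 + f̂)`, and `1 + f̂ = (1 - k̂)⁻¹`; hence
  -- the square of the inverse symbol.
  have b2 : ∀ τ, ‖𝓕 Tf τ‖ ≤ κ⁻¹ ^ 2 * ‖𝓕 Tk τ‖ := by
    intro τ
    have : 𝓕 Tf τ = (1 - 𝓕 (damp γ k) τ)⁻¹ ^ 2 * 𝓕 Tk τ := by
      rw [inv_pow, eq_inv_mul_iff_mul_eq₀ (pow_ne_zero _ (hne τ))]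
      linear_combination (1 - 𝓕 (damp γ k) τ) * hFT τ + 𝓕 Tk τ * hF τ
    rw [this, norm_mul, norm_pow]
    gcongr
    exact hinv τ
  have sqle : ∀ {u v : ℝ → ℂ} {c : ℝ}, 0 ≤ c → Integrable u → MemLp u 2 → Integrable v →
      (MemLp v 2 ∧ ∫ t, ‖v t‖ ^ 2 ≤ A ^ 2 * r) → (∀ τ, ‖𝓕 u τ‖ ≤ c * ‖𝓕 v τ‖) →
      ∫ t, ‖u t‖ ^ 2 ≤ c ^ 2 * (A ^ 2 * r) := by
    intro u v c hc hu hu2 hv hv2 huv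
    obtain ⟨p1, p2⟩ := plancherel_of_integrable hu hu2
    obtain ⟨q1, q2⟩ := plancherel_of_integrable hv hv2.1
    rw [← p2]
    calc ∫ τ, ‖𝓕 u τ‖ ^ 2 ≤ ∫ τ, c ^ 2 * ‖𝓕 v τ‖ ^ 2 := by
          refine integral_mono ((memLp_two_iff_integrable_sq_norm p1.1).1 p1)
            (((memLp_two_iff_integrable_sq_norm q1.1).1 q1).const_mul _) fun τ => ?_
          simp only
          rw [← mul_pow]
          exact pow_le_pow_left₀ (norm_nonneg _) (huv τ) 2
      _ ≤ _ := by
          rw [integral_const_mul, q2]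
          gcongr
          exact hv2.2
  have n1 := sqle (by positivity) hfi hf2 hkγi
    (integral_sq_le_of_decay hr hA hkγ.meas hkγ.causal (hkγ.mono hr hA (by norm_num)).bound) b1
  have n2 := sqle (by positivity) hTfi hTf2 hTki
    (integral_sq_le_of_decay hr hA hTkd.meas hTkd.causal hTkd.bound) b2
  have hsq1 := (memLp_two_iff_integrable_sq_norm hfi.1).1 hf2
  have hsq2 := (memLp_two_iff_integrable_sq_norm hTfi.1).1 hTf2
  -- Cauchy-Schwarz
  have hpt : ∀ t, 0 < t → ‖f t‖ ≤ r / (1 + r * t) ^ 2 + r⁻¹ * (‖f t‖ ^ 2 + ‖Tf t‖ ^ 2) := by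
    intro t ht
    have h1 := one_le_one_add_mul hr ht
    have h2 : ‖Tf t‖ = r * t * ‖f t‖ := by
      rw [hTf, norm_mul, hl, Complex.norm_real, Real.norm_of_nonneg (mul_pos hr ht).le]
    rw [h2]
    set y := ‖f t‖
    set p := r * t with hp
    have hp0 : 0 < p := mul_pos hr ht
    have h3 : y ≤ 2⁻¹ * (r / (1 + p) ^ 2 + r⁻¹ * (1 + p) ^ 2 * y ^ 2) := by
      have : 0 ≤ (r / (1 + p) - (1 + p) * y) ^ 2 := sq_nonneg _
      have e : r * (2⁻¹ * (r / (1 + p) ^ 2 + r⁻¹ * (1 + p) ^ 2 * y ^ 2) - y)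
        = 2⁻¹ * (r / (1 + p) - (1 + p) * y) ^ 2 := by field_simp; ring
      have h5 : 0 ≤ r * (2⁻¹ * (r / (1 + p) ^ 2 + r⁻¹ * (1 + p) ^ 2 * y ^ 2) - y) := by
        rw [e]; positivity
      have := nonneg_of_mul_nonneg_right h5 hr
      linarith
    refine h3.trans ?_
    have h4 : (1 + p) ^ 2 ≤ 2 * (1 + p ^ 2) := by nlinarith [sq_nonneg (1 - p)]
    have h5 : 0 ≤ r / (1 + p) ^ 2 := by positivity
    have h6 : r⁻¹ * (1 + p) ^ 2 * y ^ 2 ≤ r⁻¹ * (2 * (1 + p ^ 2)) * y ^ 2 := by gcongr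
    calc _ ≤ 2⁻¹ * (2 * (r / (1 + p) ^ 2) + r⁻¹ * (2 * (1 + p ^ 2)) * y ^ 2) := by gcongr; linarith
      _ = _ := by ring
  rw [← setIntegral_eq_integral_of_forall_compl_eq_zero (s := Ioi 0)
    (fun t ht => by rw [hf, damp_of_nonpos hh.causal t (not_lt.1 ht), norm_zero])]
  have hsum : Integrable fun t => r⁻¹ * (‖f t‖ ^ 2 + ‖Tf t‖ ^ 2) := (hsq1.add hsq2).const_mul _
  calc ∫ t in Ioi 0, ‖f t‖
      ≤ ∫ t in Ioi 0, (r / (1 + r * t) ^ 2 + r⁻¹ * (‖f t‖ ^ 2 + ‖Tf t‖ ^ 2)) :=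
        setIntegral_mono_on hfi.norm.integrableOn ((integrableOn_decay hr).1.add hsum.integrableOn)
          measurableSet_Ioi hpt
    _ = 1 + ∫ t in Ioi 0, r⁻¹ * (‖f t‖ ^ 2 + ‖Tf t‖ ^ 2) := by
        rw [integral_add (integrableOn_decay hr).1 hsum.integrableOn, (integrableOn_decay hr).2]
    _ ≤ 1 + ∫ t, r⁻¹ * (‖f t‖ ^ 2 + ‖Tf t‖ ^ 2) := by
        gcongr
        · exact Eventually.of_forall fun t => by positivity
        · exact Measure.restrict_le_self
    _ = 1 + r⁻¹ * ((∫ t, ‖f t‖ ^ 2) + ∫ t, ‖Tf t‖ ^ 2) := by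
        rw [integral_const_mul, integral_add hsq1 hsq2]
    -- The factors `r⁻¹` and `r` cancel, so the bound depends neither on `r` nor on the damping.
    _ ≤ 1 + r⁻¹ * ((κ⁻¹) ^ 2 * (A ^ 2 * r) + (κ⁻¹ ^ 2) ^ 2 * (A ^ 2 * r)) := by gcongr
    _ = _ := by field_simp

end
end ScreenedVlasov
end

/-! ### Continuation in the damping: the half-line Wiener lemma -/

noncomputable section
namespace ScreenedVlasov
open scoped ENNReal NNReal FourierTransform
open ContinuousLinearMap (mul)
set_option linter.unusedSectionVars false

section

variable {r A : ℝ} {k h : ℝ → ℂ}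

lemma lintegral_enorm_eq {f : ℝ → ℂ} (hf : Integrable f) :
    ∫⁻ t, ‖f t‖ₑ = ENNReal.ofReal (∫ t, ‖f t‖) :=
  (ofReal_integral_norm_eq_lintegral_enorm hf).symm

lemma damp_convolution (γ : ℝ) (f g : ℝ → ℂ) (t : ℝ) :
    damp γ (f ⋆[mul ℂ ℂ, volume] g) t = (damp γ f ⋆[mul ℂ ℂ, volume] damp γ g) t :=
  char_mul_convolution (χ := fun t => ((Real.exp (-(γ * t)) : ℝ) : ℂ)) (exp_char γ) f g t

/-- Weights interpolating between `1` and an exponential. -/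
def truncWeight (β : ℝ) (n : ℕ) (t : ℝ) : ℝ≥0∞ := min 1 (n * ENNReal.ofReal (Real.exp (-(β * t))))

lemma measurable_truncWeight (β : ℝ) (n : ℕ) : Measurable (truncWeight β n) := by
  unfold truncWeight; fun_prop

/-- The truncated weight is at most `1`, at most `n` times an exponential under which the functions
at hand are integrable, and tends to `1` with `n`. It is moderate with respect to `max 1 (e^{-βx})`,
which is identically `1` on the support of a causal function when `β ≥ 0`. -/
lemma truncWeight_add_le (β : ℝ) (n : ℕ) (x y : ℝ) :
    truncWeight β n (x + y) ≤
      ENNReal.ofReal (max 1 (Real.exp (-(β * x)))) * truncWeight β n y := by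
  have e : ENNReal.ofReal (Real.exp (-(β * (x + y)))) =
      ENNReal.ofReal (Real.exp (-(β * x))) * ENNReal.ofReal (Real.exp (-(β * y))) := by
    rw [← ENNReal.ofReal_mul (Real.exp_pos _).le, ← Real.exp_add]; congr 2; ring
  have h1 : (1 : ℝ≥0∞) ≤ ENNReal.ofReal (max 1 (Real.exp (-(β * x)))) := by
    rw [← ENNReal.ofReal_one]; exact ENNReal.ofReal_le_ofReal (le_max_left _ _)
  have h2 : ENNReal.ofReal (Real.exp (-(β * x))) ≤ ENNReal.ofReal (max 1 (Real.exp (-(β * x)))) :=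
    ENNReal.ofReal_le_ofReal (le_max_right _ _)
  unfold truncWeight
  rw [mul_min]
  refine min_le_min (by rw [mul_one]; exact h1) ?_
  rw [e, ← mul_assoc, ← mul_assoc, mul_comm (n : ℝ≥0∞)]
  gcongr

lemma tendsto_truncWeight (β t : ℝ) : Tendsto (fun n => truncWeight β n t) atTop (𝓝 1) := by
  have h : Tendsto (fun n : ℕ => (n : ℝ≥0∞) * ENNReal.ofReal (Real.exp (-(β * t)))) atTop (𝓝 ⊤) := by
    have h0 : ENNReal.ofReal (Real.exp (-(β * t))) ≠ 0 := by
      simpa using Real.exp_pos _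
    have := ENNReal.Tendsto.mul_const (b := ENNReal.ofReal (Real.exp (-(β * t))))
      ENNReal.tendsto_nat_nhds_top (Or.inl ENNReal.top_ne_zero)
    rwa [ENNReal.top_mul h0] at this
  have := (tendsto_const_nhds (x := (1 : ℝ≥0∞))).min h
  simpa [truncWeight] using this

lemma lintegral_one_mul_causal {β : ℝ} (hβ : 0 ≤ β) {f : ℝ → ℂ} (h0 : ∀ t ≤ 0, f t = 0) :
    ∫⁻ t, ENNReal.ofReal (max 1 (Real.exp (-(β * t)))) * ‖f t‖ₑ = ∫⁻ t, ‖f t‖ₑ := by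
  refine lintegral_congr fun t => ?_
  rcases le_or_gt t 0 with ht | ht
  · simp [h0 t ht]
  · rw [max_eq_left, ENNReal.ofReal_one, one_mul]
    rw [Real.exp_le_one_iff]
    have := mul_nonneg hβ ht.le
    linarith

/-- If the damped resolvent is integrable, it remains so for slightly smaller damping. -/
lemma integrable_damp_of_close {γ γ' C : ℝ} (hr : 0 < r) (hA : 0 ≤ A)
    (hk : IsDecayKernel r A 3 k) (hh : IsResolvent k h) (hγ' : 0 ≤ γ') (hγ : γ' ≤ γ)
    (hint : Integrable (damp γ h)) (hC : ∫ t, ‖damp γ h t‖ ≤ C)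
    (hstep : (1 + C) * ((γ - γ') * (A / r)) ≤ 1 / 2) : Integrable (damp γ' h) := by
  have hC0 : 0 ≤ C := (integral_nonneg fun t => norm_nonneg _).trans hC
  obtain ⟨β₀, hβ₀⟩ := hh.exp_integrable
  set β := max β₀ γ with hβdef
  have hβ : Integrable (damp β h) := integrable_damp_mono (le_max_left _ _) hh.meas hh.causal hβ₀
  have hβγ : γ ≤ β := le_max_right _ _
  set δ := β - γ' with hδ
  have hδ0 : 0 ≤ δ := by linarith
  set u := damp γ' h with hu
  -- The equation at damping `γ'` is treated as a perturbation of the one at `γ`, whose resolvent is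
  -- already integrable; `m` is the perturbation of the kernel.
  set m : ℝ → ℂ := fun t => damp γ' k t - damp γ k t with hm
  have hkγ := hk.damp (hγ'.trans hγ)
  have hkγ' := hk.damp hγ'
  have hkγi := hkγ.integrable hr hA (by norm_num)
  have hkγ'i := hkγ'.integrable hr hA (by norm_num)
  have hmc : ∀ t ≤ 0, m t = 0 := fun t ht => by
    simp [hm, hkγ'.causal t ht, hkγ.causal t ht]
  have hmi : Integrable m := hkγ'i.1.sub hkγi.1
  -- The difference of the exponentials is at most `(γ - γ') t`. The factor `t` consumes one power
  -- of the decay, so the exponent `3` is what leaves an integrable profile.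
  have hmd : ∀ᵐ t, 0 < t → ‖m t‖ ≤ ((γ - γ') * (A / r)) * (r / (1 + r * t) ^ 2) := by
    refine Eventually.of_forall fun t ht => ?_
    have e : m t = ((Real.exp (-(γ' * t)) - Real.exp (-(γ * t)) : ℝ) : ℂ) * k t := by
      simp only [hm, damp]; push_cast; ring
    have h1 : |Real.exp (-(γ' * t)) - Real.exp (-(γ * t))| ≤ (γ - γ') * t := by
      have hle : Real.exp (-(γ * t)) ≤ Real.exp (-(γ' * t)) := by gcongr
      rw [abs_of_nonneg (sub_nonneg.2 hle)]
      have e2 : Real.exp (-(γ * t)) = Real.exp (-(γ' * t)) * Real.exp (-((γ - γ') * t)) := by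
        rw [← Real.exp_add]; congr 1; ring
      have h3 : Real.exp (-(γ' * t)) ≤ 1 := by
        rw [Real.exp_le_one_iff]; have := mul_nonneg hγ' ht.le; linarith
      have h4 := Real.add_one_le_exp (-((γ - γ') * t))
      have h5 : 0 ≤ (γ - γ') * t := mul_nonneg (by linarith) ht.le
      have h6 := Real.exp_pos (-(γ' * t))
      rw [e2]
      nlinarith
    have hp := one_le_one_add_mul hr ht
    rw [e, norm_mul, Complex.norm_real, Real.norm_eq_abs]
    calc _ ≤ ((γ - γ') * t) * (A * (r / (1 + r * t) ^ 3)) := by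
          gcongr
          exact hk.bound t ht
      _ = ((γ - γ') * (A / r)) * (r / (1 + r * t) ^ 2) * ((r * t) / (1 + r * t)) := by
          field_simp
      _ ≤ _ := by
          refine mul_le_of_le_one_right ?_ ?_
          · have : 0 ≤ γ - γ' := by linarith
            positivity
          · rw [div_le_one (by linarith)]; linarith
  have hmI := (integrable_of_decay hr hmi.1 hmc hmd).2
  -- the perturbed equation
  have hui : Integrable (damp δ u) := by
    rw [hu, damp_damp, hδ, sub_add_cancel]; exact hβ
  have hum : AEStronglyMeasurable u := measurable_damp hh.meas
  have huc : ∀ t ≤ 0, u t = 0 := damp_of_nonpos hh.causal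
  have hu1 : u =ᵐ[volume] damp γ' k + damp γ' k ⋆[mul ℂ ℂ, volume] u := damp_ae_eq γ' hh.eq
  -- Moving `m * u` to the source leaves an equation with the kernel at damping `γ`. The
  -- manipulations are carried out under the extra damping `δ`, for which every function involved is
  -- known to be integrable.
  set q : ℝ → ℂ := damp γ' k + m ⋆[mul ℂ ℂ, volume] u with hq
  have hdk : Integrable (damp δ (damp γ k)) := ((hkγ.damp hδ0).integrable hr hA (by norm_num)).1
  have hdk' : Integrable (damp δ (damp γ' k)) := ((hkγ'.damp hδ0).integrable hr hA (by norm_num)).1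
  have hdm : Integrable (damp δ m) := integrable_damp_mono hδ0 hmi.1 hmc (by rwa [damp_zero])
  have hdh : Integrable (damp δ (damp γ h)) :=
    integrable_damp_mono hδ0 hint.1 (damp_of_nonpos hh.causal) (by rwa [damp_zero])
  have hqi : Integrable (damp δ q) := by
    refine (hdk'.add (hdm.integrable_convolution (mul ℂ ℂ) hui)).congr ?_
    refine Eventually.of_forall fun t => ?_
    simp only [hq, Pi.add_apply]
    rw [← damp_convolution]
    simp only [damp, Pi.add_apply]
    ring
  have hu2 : u =ᵐ[volume] q + damp γ k ⋆[mul ℂ ℂ, volume] u := by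
    filter_upwards [hu1, hdm.ae_convolution_exists (mul ℂ ℂ) hui,
      hdk.ae_convolution_exists (mul ℂ ℂ) hui] with t h1 h2 h3
    rw [h1]
    have e : damp δ (damp γ' k) = damp δ m + damp δ (damp γ k) := by
      ext s; simp only [damp, hm, Pi.add_apply]; ring
    have h4 := h2.add_distrib h3
    rw [← e] at h4
    rw [← damp_convolution, ← damp_convolution, ← damp_convolution] at h4
    simp only [damp, ← mul_add] at h4
    have := mul_left_cancel₀ (exp_char_ne_zero δ t) h4
    simp only [hq, Pi.add_apply]
    rw [this]; ring
  have hu3 := eq_add_resolvent_convolution_char (exp_char δ) (exp_char_ne_zero δ) hdk hdh hqi hui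
    (damp_ae_eq γ hh.eq) hu2
  have hqm : AEStronglyMeasurable q := hkγ'i.1.1.add (aestronglyMeasurable_convolution hmi.1 hum)
  -- truncated estimates
  have key : ∀ n : ℕ, ∫⁻ t, truncWeight δ n t * ‖u t‖ₑ ≤ 2 * (ENNReal.ofReal (1 + C) * ENNReal.ofReal A) := by
    intro n
    have hWm := measurable_truncWeight δ n
    have hwm : Measurable fun x : ℝ => ENNReal.ofReal (max 1 (Real.exp (-(δ * x)))) := by fun_prop
    -- Finite because of the truncation alone; without it the absorption below would assume its own
    -- conclusion.
    have fin : ∫⁻ t, truncWeight δ n t * ‖u t‖ₑ < ⊤ := by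
      have h1 : ∫⁻ t, (n : ℝ≥0∞) * ‖damp δ u t‖ₑ < ⊤ := by
        rw [lintegral_const_mul' _ _ (by simp)]
        exact ENNReal.mul_lt_top (by simp) hui.2
      refine lt_of_le_of_lt (lintegral_mono fun t => ?_) h1
      have e : ‖damp δ u t‖ₑ = ENNReal.ofReal (Real.exp (-(δ * t))) * ‖u t‖ₑ := by
        rw [← ofReal_norm, norm_damp, ENNReal.ofReal_mul (Real.exp_pos _).le, ofReal_norm]
      rw [e, ← mul_assoc]
      gcongr
      exact min_le_right _ _
    have s1 : ∫⁻ t, truncWeight δ n t * ‖q t‖ₑ ≤ ENNReal.ofReal A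
        + ENNReal.ofReal ((γ - γ') * (A / r)) * ∫⁻ t, truncWeight δ n t * ‖u t‖ₑ := by
      calc _ ≤ ∫⁻ t, (‖damp γ' k t‖ₑ + truncWeight δ n t *
              lconv (fun s => ‖m s‖ₑ) (fun s => ‖u s‖ₑ) t) := by
            refine lintegral_mono fun t => ?_
            calc _ ≤ truncWeight δ n t * (‖damp γ' k t‖ₑ + lconv (fun s => ‖m s‖ₑ) (fun s => ‖u s‖ₑ) t) := by
                  gcongr
                  exact (enorm_add_le _ _).trans (by gcongr; exact enorm_convolution_le _ _ _)
              _ ≤ _ := by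
                  rw [mul_add]
                  gcongr
                  exact mul_le_of_le_one_left (zero_le) (min_le_left _ _)
        _ = (∫⁻ t, ‖damp γ' k t‖ₑ) + ∫⁻ t, truncWeight δ n t *
              lconv (fun s => ‖m s‖ₑ) (fun s => ‖u s‖ₑ) t := lintegral_add_left' hkγ'i.1.1.enorm _
        _ ≤ _ := by
            gcongr
            · rw [lintegral_enorm_eq hkγ'i.1]
              exact ENNReal.ofReal_le_ofReal hkγ'i.2
            · refine (lintegral_mul_lconv_le hmi.1.enorm hum.enorm hwm hWm
                (truncWeight_add_le δ n)).trans ?_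
              rw [lintegral_one_mul_causal hδ0 hmc, lintegral_enorm_eq hmi]
              gcongr
    have s2 : ∫⁻ t, truncWeight δ n t * ‖u t‖ₑ ≤
        ENNReal.ofReal (1 + C) * ∫⁻ t, truncWeight δ n t * ‖q t‖ₑ := by
      calc _ ≤ ∫⁻ t, (truncWeight δ n t * ‖q t‖ₑ + truncWeight δ n t *
              lconv (fun s => ‖damp γ h s‖ₑ) (fun s => ‖q s‖ₑ) t) := by
            refine lintegral_mono_ae ?_
            filter_upwards [hu3] with t ht
            rw [ht, ← mul_add]
            gcongr
            exact (enorm_add_le _ _).trans (by gcongr; exact enorm_convolution_le _ _ _)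
        _ = (∫⁻ t, truncWeight δ n t * ‖q t‖ₑ) + ∫⁻ t, truncWeight δ n t *
              lconv (fun s => ‖damp γ h s‖ₑ) (fun s => ‖q s‖ₑ) t :=
            lintegral_add_left' (hWm.aemeasurable.mul hqm.enorm) _
        _ ≤ (∫⁻ t, truncWeight δ n t * ‖q t‖ₑ) +
              ENNReal.ofReal C * ∫⁻ t, truncWeight δ n t * ‖q t‖ₑ := by
            gcongr
            refine (lintegral_mul_lconv_le hint.1.enorm hqm.enorm hwm hWm
                (truncWeight_add_le δ n)).trans ?_
            rw [lintegral_one_mul_causal hδ0 (damp_of_nonpos hh.causal), lintegral_enorm_eq hint]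
            gcongr
        _ = _ := by
            rw [ENNReal.ofReal_add zero_le_one hC0, ENNReal.ofReal_one]; ring
    have s4 : ENNReal.ofReal ((1 + C) * ((γ - γ') * (A / r))) ≤ 1 / 2 := by
      refine (ENNReal.ofReal_le_ofReal hstep).trans (le_of_eq ?_)
      rw [ENNReal.ofReal_div_of_pos two_pos]; simp
    -- Solving with the resolvent costs the factor `1 + C`, and the part of the source that contains
    -- `u` carries the norm of `m`. The step-size hypothesis makes the product at most `1/2`,
    -- uniformly in `n`.
    have s5 : ∫⁻ t, truncWeight δ n t * ‖u t‖ₑ ≤ ENNReal.ofReal (1 + C) * ENNReal.ofReal A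
        + 1 / 2 * ∫⁻ t, truncWeight δ n t * ‖u t‖ₑ := by
      calc _ ≤ ENNReal.ofReal (1 + C) * (ENNReal.ofReal A + ENNReal.ofReal ((γ - γ') * (A / r)) *
              ∫⁻ t, truncWeight δ n t * ‖u t‖ₑ) := s2.trans (by gcongr)
        _ = ENNReal.ofReal (1 + C) * ENNReal.ofReal A + ENNReal.ofReal ((1 + C) * ((γ - γ') * (A / r))) *
              ∫⁻ t, truncWeight δ n t * ‖u t‖ₑ := by
            rw [ENNReal.ofReal_mul (p := 1 + C) (q := (γ - γ') * (A / r)) (by linarith)]; ring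
        _ ≤ _ := by gcongr
    generalize ∫⁻ t, truncWeight δ n t * ‖u t‖ₑ = X at *
    have fY : ENNReal.ofReal (1 + C) * ENNReal.ofReal A ≠ ⊤ :=
      ENNReal.mul_ne_top ENNReal.ofReal_ne_top ENNReal.ofReal_ne_top
    generalize ENNReal.ofReal (1 + C) * ENNReal.ofReal A = Y at *
    lift X to ℝ≥0 using fin.ne
    lift Y to ℝ≥0 using fY
    have e : (1 / 2 : ℝ≥0∞) = ((1 / 2 : ℝ≥0) : ℝ≥0∞) := by
      rw [ENNReal.coe_div (by norm_num)]; simp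
    rw [e] at s5
    norm_cast at s5 ⊢
    rw [← NNReal.coe_le_coe] at s5 ⊢
    push_cast at s5 ⊢
    linarith
  refine ⟨hum, ?_⟩
  rw [hasFiniteIntegral_iff_enorm]
  refine lt_of_le_of_lt (lintegral_le_of_tendsto_of_le (f := fun n t => truncWeight δ n t * ‖u t‖ₑ)
    (fun n => (measurable_truncWeight δ n).aemeasurable.mul hum.enorm) ?_ key)
    (ENNReal.mul_lt_top (by simp) (ENNReal.mul_lt_top ENNReal.ofReal_lt_top ENNReal.ofReal_lt_top))
  refine Eventually.of_forall fun t => ?_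
  have := ENNReal.Tendsto.mul_const (b := ‖u t‖ₑ) (tendsto_truncWeight δ t) (Or.inr enorm_ne_top)
  simpa using this

/-- The half-line Wiener lemma with a quantitative bound. -/
lemma integrable_resolvent {κ : ℝ} (hr : 0 < r) (hA : 0 ≤ A) (hκ : 0 < κ)
    (hk : IsDecayKernel r A 3 k) (hh : IsResolvent k h)
    (hpen : ∀ γ, 0 ≤ γ → ∀ τ, κ ≤ ‖1 - 𝓕 (damp γ k) τ‖) :
    Integrable h ∧ ∫ t, ‖h t‖ ≤ 1 + A ^ 2 * ((κ⁻¹) ^ 2 + (κ⁻¹ ^ 2) ^ 2) := by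
  set C := 1 + A ^ 2 * ((κ⁻¹) ^ 2 + (κ⁻¹ ^ 2) ^ 2) with hC
  have hC0 : 0 ≤ C := by positivity
  have apriori : ∀ {γ γ' : ℝ}, 0 ≤ γ' → γ' < γ → Integrable (damp γ' h) →
      ∫ t, ‖damp γ h t‖ ≤ C := fun h1 h2 h3 =>
    integral_norm_damp_resolvent_le hr hA hκ hk hh h1 h2 h3 (hpen _ (h1.trans h2.le))
  -- The step depends on `A`, `C` and `r` but not on the current damping, so finitely many steps
  -- reach zero.
  obtain ⟨ε, hε, hεs⟩ : ∃ ε : ℝ, 0 < ε ∧ (1 + C) * (ε * (A / r)) ≤ 1 / 2 := by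
    refine ⟨1 / (2 * (1 + C) * (A / r + 1)), by positivity, ?_⟩
    have : 0 ≤ A / r := by positivity
    rw [show (1 + C) * (1 / (2 * (1 + C) * (A / r + 1)) * (A / r)) = (1 / 2) * ((A / r) / (A / r + 1)) by
      field_simp]
    have : A / r / (A / r + 1) ≤ 1 := by rw [div_le_one (by positivity)]; linarith
    linarith
  obtain ⟨β₀, hβ₀⟩ := hh.exp_integrable
  set β := max β₀ 0
  have hβ : Integrable (damp β h) := integrable_damp_mono (le_max_left _ _) hh.meas hh.causal hβ₀
  -- The a priori bound holds only strictly above a damping known to be admissible. From an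
  -- admissible `γ'` it is therefore used at `γ' + ε / 2`, and the perturbation lemma descends to
  -- `γ' - ε / 2`: a total step of at most `ε` for a net gain of `ε / 2`.
  have iter : ∀ n : ℕ, Integrable (damp (max 0 (β - n * (ε / 2))) h) := by
    intro n
    induction n with
    | zero => simpa [β] using hβ
    | succ n ih =>
      set γ' := max 0 (β - n * (ε / 2)) with hγ'
      have h0 : 0 ≤ γ' := le_max_left _ _
      have h1 : γ' < γ' + ε / 2 := by linarith
      have hle : max 0 (β - (n + 1 : ℕ) * (ε / 2)) ≤ γ' := by
        apply max_le_max_left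
        push_cast; nlinarith
      have hge : γ' - ε / 2 ≤ max 0 (β - (n + 1 : ℕ) * (ε / 2)) := by
        rw [sub_le_iff_le_add, hγ']
        refine max_le ?_ ?_
        · have := le_max_left 0 (β - (n + 1 : ℕ) * (ε / 2)); linarith
        · have := le_max_right 0 (β - (n + 1 : ℕ) * (ε / 2)); push_cast at this ⊢; linarith
      refine integrable_damp_of_close hr hA hk hh (le_max_left _ _) (hle.trans h1.le)
        (integrable_damp_mono h1.le hh.meas hh.causal ih) (apriori h0 h1 ih) (le_trans ?_ hεs)
      gcongr
      linarith
  have h0 : Integrable (damp 0 h) := by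
    obtain ⟨n, hn⟩ := exists_nat_gt (β / (ε / 2))
    have := iter n
    rwa [max_eq_left] at this
    rw [div_lt_iff₀ (by positivity)] at hn
    linarith
  have hhi : Integrable h := by rwa [damp_zero] at h0
  refine ⟨hhi, ?_⟩
  -- At zero damping there is no gap left for the a priori bound, so the constant is transferred by
  -- Fatou along dampings tending to `0`.
  have h1 : ∫⁻ t, ‖h t‖ₑ ≤ ENNReal.ofReal C := by
    refine lintegral_le_of_tendsto_of_le (f := fun n t => ‖damp (1 / ((n : ℝ) + 1)) h t‖ₑ)
      (fun n => (measurable_damp hh.meas).enorm) (Eventually.of_forall fun t => ?_) fun n => ?_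
    · refine (Continuous.tendsto continuous_enorm _).comp ?_
      have e : h t = damp 0 h t := by rw [damp_zero]
      rw [e]
      simp only [damp]
      refine Tendsto.mul_const _ ?_
      have hc : Continuous fun x : ℝ => ((Real.exp (-(x * t)) : ℝ) : ℂ) := by fun_prop
      exact (hc.tendsto 0).comp tendsto_one_div_add_atTop_nhds_zero_nat
    · have hp : (0 : ℝ) < 1 / ((n : ℝ) + 1) := by positivity
      rw [lintegral_enorm_eq (integrable_damp_mono hp.le hh.meas hh.causal h0)]
      exact ENNReal.ofReal_le_ofReal (apriori le_rfl hp h0)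
  rw [lintegral_enorm_eq hhi] at h1
  exact (ENNReal.ofReal_le_ofReal_iff hC0).1 h1

end
end ScreenedVlasov
end

/-! ### Moments and pointwise decay of scalar resolvents -/

noncomputable section
namespace ScreenedVlasov
open scoped ENNReal NNReal FourierTransform
open ContinuousLinearMap (mul)
set_option linter.unusedSectionVars false

lemma convolutionExistsAt_of_damp {β t : ℝ} {f g : ℝ → ℂ}
    (h : ConvolutionExistsAt (damp β f) (damp β g) t (mul ℂ ℂ) volume) :
    ConvolutionExistsAt f g t (mul ℂ ℂ) volume := by
  have h1 : Integrable (fun s => ((Real.exp (-(β * t)) : ℝ) : ℂ)⁻¹ *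
    (mul ℂ ℂ (damp β f s)) (damp β g (t - s))) := Integrable.const_mul h _
  refine h1.congr (Eventually.of_forall fun s => ?_)
  have e := exp_char β s (t - s)
  rw [add_sub_cancel] at e
  simp only [ContinuousLinearMap.mul_apply', damp]
  rw [inv_mul_eq_iff_eq_mul₀ (exp_char_ne_zero β t), e]
  ring

lemma integrable_damp_convolution {β : ℝ} {f g : ℝ → ℂ} (hf : Integrable (damp β f))
    (hg : Integrable (damp β g)) : Integrable (damp β (f ⋆[mul ℂ ℂ, volume] g)) := by
  refine (hf.integrable_convolution (mul ℂ ℂ) hg).congr (Eventually.of_forall fun t => ?_)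
  exact (damp_convolution β f g t).symm

lemma integrable_damp_add {β : ℝ} {f g : ℝ → ℂ} (hf : Integrable (damp β f))
    (hg : Integrable (damp β g)) : Integrable (damp β (f + g)) := by
  refine (hf.add hg).congr (Eventually.of_forall fun t => ?_)
  simp [damp, mul_add]

lemma integrable_damp_sum {β : ℝ} {ι : Type*} (s : Finset ι) {f : ι → ℝ → ℂ}
    (hf : ∀ i ∈ s, Integrable (damp β (f i))) : Integrable (damp β (∑ i ∈ s, f i)) := by
  refine (integrable_finsetSum s hf).congr (Eventually.of_forall fun t => ?_)
  simp [damp, Finset.mul_sum]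

/-- The forcing term of the Volterra equation solved by the `m`-th derivation of a resolvent. -/
def derivForcing (k h : ℕ → ℝ → ℂ) (m : ℕ) : ℝ → ℂ :=
  k m + ∑ i ∈ Finset.range m, fun t => (m.choose (i + 1) : ℂ) *
    (k (i + 1) ⋆[mul ℂ ℂ, volume] h (m - (i + 1))) t

lemma integrable_damp_derivForcing {β : ℝ} {k h : ℕ → ℝ → ℂ} {m : ℕ}
    (hk : ∀ i ≤ m, Integrable (damp β (k i))) (hh : ∀ i < m, Integrable (damp β (h i))) :
    Integrable (damp β (derivForcing k h m)) := by
  refine integrable_damp_add (hk m le_rfl) (integrable_damp_sum _ fun i hi => ?_)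
  rw [Finset.mem_range] at hi
  have := (integrable_damp_convolution (hk (i + 1) hi) (hh (m - (i + 1)) (by omega))).const_mul
    (m.choose (i + 1) : ℂ)
  refine this.congr (Eventually.of_forall fun t => ?_)
  simp only [damp]; ring

/-- In the Leibniz formula the term `i = 0` is `k 0 * h m`, so `h m` solves the original Volterra
equation; all other terms involve only `h` of lower index and form the forcing. The resolvent
formula then applies. The common damping `β` is qualitative and enters no estimate. -/
lemma ae_eq_derivation_resolvent {β : ℝ} {k h : ℕ → ℝ → ℂ} {m : ℕ}
    (hk : ∀ i ≤ m, Integrable (damp β (k i))) (hh : ∀ i ≤ m, Integrable (damp β (h i)))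
    (h0 : h 0 =ᵐ[volume] k 0 + k 0 ⋆[mul ℂ ℂ, volume] h 0)
    (hm : ∀ᵐ t, h m t = k m t + ∑ i ∈ Finset.range (m + 1), (m.choose i : ℂ) *
      (k i ⋆[mul ℂ ℂ, volume] h (m - i)) t) :
    h m =ᵐ[volume] derivForcing k h m + h 0 ⋆[mul ℂ ℂ, volume] derivForcing k h m := by
  refine eq_add_resolvent_convolution_char (exp_char β) (exp_char_ne_zero β) (hk 0 (zero_le))
    (hh 0 (zero_le)) (integrable_damp_derivForcing hk fun i hi => hh i hi.le) (hh m le_rfl) h0 ?_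
  filter_upwards [hm] with t ht
  rw [ht, Finset.sum_range_succ']
  simp [derivForcing, add_assoc]

section

variable {r : ℝ}

/-- From `t^m ≤ m! e^t`. This supplies the qualitative integrability needed to apply the resolvent
formula before the moments are known to be integrable without damping. -/
lemma integrable_damp_pow_mul (hr : 0 < r) {h : ℝ → ℂ} (h0 : ∀ t ≤ 0, h t = 0)
    (hh : Integrable h) (m : ℕ) : Integrable (damp 1 (fun t => ((r * t : ℝ) : ℂ) ^ m * h t)) := by
  refine (hh.norm.const_mul (r ^ m * m.factorial)).mono' ?_ (Eventually.of_forall fun t => ?_)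
  · refine measurable_damp (AEStronglyMeasurable.mul ?_ hh.1)
    apply Continuous.aestronglyMeasurable; fun_prop
  · rcases le_or_gt t 0 with ht | ht
    · simp [damp, h0 t ht]
    · rw [norm_damp, norm_mul, norm_pow, Complex.norm_real, Real.norm_of_nonneg (mul_pos hr ht).le,
        ← mul_assoc]
      refine mul_le_mul_of_nonneg_right ?_ (norm_nonneg _)
      have h1 := Real.pow_div_factorial_le_exp t ht.le m
      rw [div_le_iff₀ (by positivity)] at h1
      rw [one_mul, Real.exp_neg, inv_mul_le_iff₀ (Real.exp_pos t), mul_pow]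
      calc r ^ m * t ^ m ≤ r ^ m * (Real.exp t * m.factorial) := by gcongr
        _ = _ := by ring

lemma norm_derivForcing_le {k h : ℕ → ℝ → ℂ} {m : ℕ} (t : ℝ) {B : ℝ} (hB : ‖k m t‖ ≤ B)
    (hc : ∀ i < m, ‖(k (i + 1) ⋆[mul ℂ ℂ, volume] h (m - (i + 1))) t‖ ≤ B) :
    ‖derivForcing k h m t‖ ≤ 2 ^ m * B := by
  have hB0 : 0 ≤ B := (norm_nonneg _).trans hB
  have e : (2 : ℝ) ^ m = 1 + ∑ i ∈ Finset.range m, (m.choose (i + 1) : ℝ) := by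
    have := (Nat.sum_range_choose m)
    rw [Finset.sum_range_succ'] at this
    have h2 := congrArg (fun n : ℕ => (n : ℝ)) this
    push_cast at h2
    rw [← h2]; simp [add_comm]
  rw [e, add_mul, one_mul, Finset.sum_mul]
  simp only [derivForcing, Pi.add_apply, Finset.sum_apply]
  refine (norm_add_le _ _).trans (add_le_add hB ((norm_sum_le _ _).trans
    (Finset.sum_le_sum fun i hi => ?_)))
  rw [norm_mul, Complex.norm_natCast]
  gcongr
  exact hc i (Finset.mem_range.1 hi)

lemma integral_norm_derivForcing_le {k h : ℕ → ℝ → ℂ} {m : ℕ} {B : ℝ}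
    (hk : Integrable (k m)) (hB : ∫ t, ‖k m t‖ ≤ B)
    (hi : ∀ i < m, Integrable (k (i + 1) ⋆[mul ℂ ℂ, volume] h (m - (i + 1))))
    (hc : ∀ i < m, ∫ t, ‖(k (i + 1) ⋆[mul ℂ ℂ, volume] h (m - (i + 1))) t‖ ≤ B) :
    Integrable (derivForcing k h m) ∧ ∫ t, ‖derivForcing k h m t‖ ≤ 2 ^ m * B := by
  have hI : Integrable (derivForcing k h m) := by
    refine hk.add (integrable_finsetSum' _ fun i him => ?_)
    exact (hi i (Finset.mem_range.1 him)).const_mul _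
  refine ⟨hI, ?_⟩
  have e : (2 : ℝ) ^ m = 1 + ∑ i ∈ Finset.range m, (m.choose (i + 1) : ℝ) := by
    have := (Nat.sum_range_choose m)
    rw [Finset.sum_range_succ'] at this
    have h2 := congrArg (fun n : ℕ => (n : ℝ)) this
    push_cast at h2
    rw [← h2]; simp [add_comm]
  have hs : Integrable fun t => ∑ i ∈ Finset.range m, (m.choose (i + 1) : ℝ) *
      ‖(k (i + 1) ⋆[mul ℂ ℂ, volume] h (m - (i + 1))) t‖ :=
    integrable_finsetSum _ fun i him => (hi i (Finset.mem_range.1 him)).norm.const_mul _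
  calc ∫ t, ‖derivForcing k h m t‖ ≤ ∫ t, (‖k m t‖ + ∑ i ∈ Finset.range m, (m.choose (i + 1) : ℝ) *
      ‖(k (i + 1) ⋆[mul ℂ ℂ, volume] h (m - (i + 1))) t‖) := by
        refine integral_mono hI.norm (hk.norm.add hs) fun t => ?_
        simp only [derivForcing, Pi.add_apply, Finset.sum_apply]
        refine (norm_add_le _ _).trans (add_le_add le_rfl ((norm_sum_le _ _).trans
          (Finset.sum_le_sum fun i hi => ?_)))
        rw [norm_mul, Complex.norm_natCast]
    _ = (∫ t, ‖k m t‖) + ∑ i ∈ Finset.range m, (m.choose (i + 1) : ℝ) *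
      ∫ t, ‖(k (i + 1) ⋆[mul ℂ ℂ, volume] h (m - (i + 1))) t‖ := by
        rw [integral_add hk.norm hs, integral_finsetSum]
        · simp_rw [integral_const_mul]
        · exact fun i him => (hi i (Finset.mem_range.1 him)).norm.const_mul _
    _ ≤ B + ∑ i ∈ Finset.range m, (m.choose (i + 1) : ℝ) * B := by
        gcongr with i him
        exact hc i (Finset.mem_range.1 him)
    _ = _ := by rw [e, add_mul, one_mul, Finset.sum_mul]

/-- Polynomial moments of a resolvent. -/
lemma resolvent_moments {A C : ℝ} (hA : 0 ≤ A) (hC : 0 ≤ C) (N : ℕ) :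
    ∃ D : ℝ, 0 ≤ D ∧ ∀ (r : ℝ) (k h : ℝ → ℂ),
    0 < r → IsDecayKernel r A (N + 2) k → IsResolvent k h → Integrable h → ∫ t, ‖h t‖ ≤ C →
    ∀ i ≤ N, Integrable (fun t => ((r * t : ℝ) : ℂ) ^ i * h t) ∧
      ∫ t, ‖((r * t : ℝ) : ℂ) ^ i * h t‖ ≤ D ∧ ∀ᵐ t, ‖((r * t : ℝ) : ℂ) ^ i * h t‖ ≤ D * r := by
  induction N with
  | zero =>
    refine ⟨C + (A + C * A), by positivity, fun r k h hr hk hh hi hCi i hi0 => ?_⟩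
    obtain rfl : i = 0 := by omega
    simp only [pow_zero, one_mul]
    refine ⟨hi, hCi.trans (by linarith [mul_nonneg hC hA]), ?_⟩
    filter_upwards [hh.eq] with t ht
    rw [ht, Pi.add_apply, convolution_mul_comm]
    calc _ ≤ A * r + (∫ t, ‖h t‖) * (A * r) :=
          (norm_add_le _ _).trans (add_le_add (hk.norm_le hr hA t)
            (norm_convolution_le_of_bound hi (Eventually.of_forall (hk.norm_le hr hA)) t))
      _ ≤ A * r + C * (A * r) := by gcongr
      _ ≤ _ := by nlinarith [mul_nonneg hC hr.le]
  | succ N ih =>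
    obtain ⟨D, hD, ih⟩ := ih
    set M := 2 ^ (N + 1) * (A + D * A) with hM
    have hM0 : 0 ≤ M := by positivity
    refine ⟨D + (M + C * M), by positivity, fun r k h hr hk hh hi hCi i hiN => ?_⟩
    have ih' := ih r k h hr (hk.mono hr hA (by omega)) hh hi hCi
    rcases Nat.lt_or_ge N i with hlt | hle
    swap
    · obtain ⟨h1, h2, h3⟩ := ih' i hle
      have : 0 ≤ M + C * M := by positivity
      refine ⟨h1, by linarith, ?_⟩
      filter_upwards [h3] with t ht
      refine ht.trans ?_
      gcongr
      linarith
    obtain rfl : i = N + 1 := by omega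
    set kk : ℕ → ℝ → ℂ := fun i t => ((r * t : ℝ) : ℂ) ^ i * k t with hkk
    set hs : ℕ → ℝ → ℂ := fun i t => ((r * t : ℝ) : ℂ) ^ i * h t with hhs
    have hkd : ∀ i ≤ N + 1, IsDecayKernel r A 2 (kk i) := fun i hi =>
      IsDecayKernel.pow_mul hr (hk.mono hr hA (by omega))
    have hki : ∀ i ≤ N + 1, Integrable (kk i) ∧ ∫ t, ‖kk i t‖ ≤ A := fun i hi =>
      (hkd i hi).integrable hr hA le_rfl
    have hkdi : ∀ i ≤ N + 1, Integrable (damp 1 (kk i)) := fun i hi =>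
      (((hkd i hi).damp zero_le_one).integrable hr hA le_rfl).1
    have hhdi : ∀ i, Integrable (damp 1 (hs i)) := integrable_damp_pow_mul hr hh.causal hi
    have hm : ∀ᵐ t, hs (N + 1) t = kk (N + 1) t + ∑ i ∈ Finset.range (N + 1 + 1),
        ((N + 1).choose i : ℂ) * (kk i ⋆[mul ℂ ℂ, volume] hs (N + 1 - i)) t := by
      have hex : ∀ᵐ t, ∀ i ∈ Finset.range (N + 2),
          ConvolutionExistsAt (kk i) (hs (N + 1 - i)) t (mul ℂ ℂ) volume := by
        rw [eventually_all_finset]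
        intro i hi
        filter_upwards [(hkdi i (by simpa [Nat.lt_succ_iff] using hi)).ae_convolution_exists (mul ℂ ℂ)
          (hhdi (N + 1 - i))] with t ht using convolutionExistsAt_of_damp ht
      filter_upwards [hh.eq, hex] with t ht hext
      rw [← pow_mul_convolution (l := fun t : ℝ => ((r * t : ℝ) : ℂ)) (mul_char_add r) k h (N + 1) t
        (fun i hi => hext i (by simpa [Nat.lt_succ_iff] using hi))]
      simp only [hhs, hkk]
      rw [ht, Pi.add_apply]; ring
    have h00 : hs 0 = h := by ext t; simp [hhs]
    have k00 : kk 0 = k := by ext t; simp [hkk]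
    have heq := ae_eq_derivation_resolvent hkdi (fun i _ => hhdi i) (by rw [h00, k00]; exact hh.eq) hm
    rw [h00] at heq
    have hq := integral_norm_derivForcing_le (k := kk) (h := hs) (m := N + 1) (B := A + D * A)
      (hki _ le_rfl).1 ((hki _ le_rfl).2.trans (by linarith [mul_nonneg hD hA]))
      (fun i hi => (hki (i + 1) hi).1.integrable_convolution (mul ℂ ℂ) (ih' (N + 1 - (i + 1)) (by omega)).1)
      (fun i hi => by
        refine (integral_norm_convolution_le (hki (i + 1) hi).1
          (ih' (N + 1 - (i + 1)) (by omega)).1).trans ?_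
        calc _ ≤ A * D := by
              gcongr
              · exact (hki (i + 1) hi).2
              · exact (ih' (N + 1 - (i + 1)) (by omega)).2.1
          _ ≤ _ := by linarith)
    have hqb : ∀ t, ‖derivForcing kk hs (N + 1) t‖ ≤ M * r := by
      intro t
      have := norm_derivForcing_le (k := kk) (h := hs) (m := N + 1) t (B := (A + D * A) * r)
        (((hkd _ le_rfl).norm_le hr hA t).trans (by nlinarith [mul_nonneg (mul_nonneg hD hA) hr.le]))
        (fun i hi => by
          rw [convolution_mul_comm]
          refine (norm_convolution_le_of_bound (ih' (N + 1 - (i + 1)) (by omega)).1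
            (Eventually.of_forall ((hkd (i + 1) hi).norm_le hr hA)) t).trans ?_
          calc _ ≤ D * (A * r) := by
                gcongr
                exact (ih' (N + 1 - (i + 1)) (by omega)).2.1
            _ ≤ _ := by nlinarith [mul_nonneg hA hr.le])
      rw [hM, mul_assoc]; exact this
    have hconv := hi.integrable_convolution (mul ℂ ℂ) hq.1
    refine ⟨(hq.1.add hconv).congr heq.symm, ?_, ?_⟩
    · have e : ∫ t, ‖((r * t : ℝ) : ℂ) ^ (N + 1) * h t‖ = ∫ t, ‖derivForcing kk hs (N + 1) t +
          (h ⋆[mul ℂ ℂ, volume] derivForcing kk hs (N + 1)) t‖ := by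
        refine integral_congr_ae ?_
        filter_upwards [heq] with t ht
        rw [Pi.add_apply] at ht
        rw [← ht]
      rw [e]
      calc _ ≤ ∫ t, (‖derivForcing kk hs (N + 1) t‖ +
            ‖(h ⋆[mul ℂ ℂ, volume] derivForcing kk hs (N + 1)) t‖) :=
            integral_mono (hq.1.add hconv).norm (hq.1.norm.add hconv.norm) fun t => norm_add_le _ _
        _ = _ := integral_add hq.1.norm hconv.norm
        _ ≤ M + C * M := by
            gcongr
            · exact hq.2
            · refine (integral_norm_convolution_le hi hq.1).trans ?_
              gcongr
              exact hq.2
        _ ≤ _ := by linarith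
    · filter_upwards [heq] with t ht
      change ‖hs (N + 1) t‖ ≤ _
      rw [ht, Pi.add_apply]
      calc _ ≤ M * r + (∫ t, ‖h t‖) * (M * r) := (norm_add_le _ _).trans (add_le_add (hqb t)
            (norm_convolution_le_of_bound hi (Eventually.of_forall hqb) t))
        _ ≤ M * r + C * (M * r) := by gcongr
        _ ≤ _ := by nlinarith [mul_nonneg hD hr.le]

/-- Convolution of causal functions with polynomial weights. -/
lemma norm_convolution_le_setIntegral {f g : ℝ → ℂ} (hf0 : ∀ t ≤ 0, f t = 0)
    (hg0 : ∀ t ≤ 0, g t = 0) {t : ℝ} {F : ℝ → ℝ} (hF : IntegrableOn F (Ioo 0 t))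
    (h : ∀ᵐ s, s ∈ Ioo 0 t → ‖f s‖ * ‖g (t - s)‖ ≤ F s) :
    ‖(f ⋆[mul ℂ ℂ, volume] g) t‖ ≤ ∫ s in Ioo 0 t, F s := by
  rw [convolution_def]
  simp only [ContinuousLinearMap.mul_apply']
  rw [← setIntegral_eq_integral_of_forall_compl_eq_zero (s := Ioo 0 t)]
  · refine norm_integral_le_of_norm_le hF ?_
    rw [ae_restrict_iff' measurableSet_Ioo]
    simpa only [norm_mul] using h
  · intro s hs
    rw [mem_Ioo, not_and_or, not_lt, not_lt] at hs
    rcases hs with hs | hs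
    · rw [hf0 s hs, zero_mul]
    · rw [hg0 (t - s) (by linarith), mul_zero]

lemma ae_comp_sub_left {p : ℝ → Prop} (t : ℝ) (h : ∀ᵐ s, p s) : ∀ᵐ s, p (t - s) :=
  (quasiMeasurePreserving_sub_left_of_right_invariant (volume : Measure ℝ) t).ae h

/-- `1 + r t ≤ (1 + r s)(1 + r (t - s))` preserves the decay, and the length of `(0, t)` costs one
power of `1 + t`. It applies when neither factor has the integrable prefactor `r`. -/
lemma norm_convolution_le_poly (hr : 0 < r) {N p q : ℕ} {P Q : ℝ} (hP : 0 ≤ P) (hQ : 0 ≤ Q)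
    {f g : ℝ → ℂ} (hf0 : ∀ t ≤ 0, f t = 0) (hg0 : ∀ t ≤ 0, g t = 0)
    (hf : ∀ᵐ t, 0 < t → ‖f t‖ ≤ P * ((1 + t) ^ p / (1 + r * t) ^ N))
    (hg : ∀ᵐ t, 0 < t → ‖g t‖ ≤ Q * ((1 + t) ^ q / (1 + r * t) ^ N)) (t : ℝ) (ht : 0 < t) :
    ‖(f ⋆[mul ℂ ℂ, volume] g) t‖ ≤ P * Q * ((1 + t) ^ (p + q + 1) / (1 + r * t) ^ N) := by
  refine (norm_convolution_le_setIntegral hf0 hg0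
    (F := fun _ => P * Q * ((1 + t) ^ (p + q) / (1 + r * t) ^ N))
    (continuous_const.integrableOn_Icc.mono_set Ioo_subset_Icc_self) ?_).trans ?_
  · filter_upwards [hf, ae_comp_sub_left t hg] with s h1 h2 hs
    have hs0 := hs.1
    have hs1 : 0 < t - s := sub_pos.2 hs.2
    calc ‖f s‖ * ‖g (t - s)‖ ≤ (P * ((1 + s) ^ p / (1 + r * s) ^ N)) *
          (Q * ((1 + (t - s)) ^ q / (1 + r * (t - s)) ^ N)) := by
          gcongr
          · exact h1 hs0
          · exact h2 hs1
      _ = P * Q * ((1 + s) ^ p * (1 + (t - s)) ^ q / ((1 + r * s) * (1 + r * (t - s))) ^ N) := by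
          rw [mul_pow]; field_simp
      _ ≤ P * Q * ((1 + t) ^ p * (1 + t) ^ q / (1 + r * t) ^ N) := by
          have : 1 + r * t ≤ (1 + r * s) * (1 + r * (t - s)) := by
            nlinarith [mul_nonneg (mul_nonneg hr.le hs0.le) (mul_nonneg hr.le hs1.le)]
          have h3 : s ≤ t := hs.2.le
          gcongr
          linarith
      _ = _ := by rw [pow_add]
  · rw [setIntegral_const, smul_eq_mul, measureReal_def, Real.volume_Ioo, sub_zero,
      ENNReal.toReal_ofReal ht.le, pow_succ]
    calc _ ≤ (1 + t) * (P * Q * ((1 + t) ^ (p + q) / (1 + r * t) ^ N)) := by gcongr; linarith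
      _ = _ := by ring

/-- One of `s`, `t - s` is at least `t / 2`; the corresponding denominator yields `2^N / (1 + r
t)^N`, while the other factor is bounded by a profile of mass at most `1`. Thus convolution with an
`r`-normalized function loses no power of time. -/
lemma norm_convolution_le_decay (hr : 0 < r) {N q : ℕ} (hN : 2 ≤ N) {P Q : ℝ} (hP : 0 ≤ P) (hQ : 0 ≤ Q)
    {f g : ℝ → ℂ} (hf0 : ∀ t ≤ 0, f t = 0) (hg0 : ∀ t ≤ 0, g t = 0)
    (hf : ∀ᵐ t, 0 < t → ‖f t‖ ≤ P * (r / (1 + r * t) ^ N))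
    (hg : ∀ᵐ t, 0 < t → ‖g t‖ ≤ Q * ((1 + t) ^ q / (1 + r * t) ^ N)) (t : ℝ) (ht : 0 < t) :
    ‖(f ⋆[mul ℂ ℂ, volume] g) t‖ ≤ 2 ^ (N + 1) * (P * Q) * ((1 + t) ^ q / (1 + r * t) ^ N) := by
  set D : ℝ → ℝ := fun s => r / (1 + r * s) ^ 2 with hD
  have hDi : IntegrableOn D (Ioo 0 t) := (integrableOn_decay hr).1.mono_set Ioo_subset_Ioi_self
  have hDle : ∫ s in Ioo 0 t, D s ≤ 1 := by
    rw [← (integrableOn_decay hr).2]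
    refine setIntegral_mono_set (integrableOn_decay hr).1 ?_ (Ioo_subset_Ioi_self).eventuallyLE
    exact Eventually.of_forall fun s => by simp only [Pi.zero_apply]; positivity
  have hDr : IntegrableOn (fun s => D (t - s)) (Ioo 0 t) ∧ ∫ s in Ioo 0 t, D (t - s) ≤ 1 := by
    have e : (fun s => t - s) ⁻¹' (Ioo 0 t) = Ioo 0 t := by
      ext s; simp only [mem_preimage, mem_Ioo]; constructor <;> rintro ⟨h1, h2⟩ <;> constructor <;> linarith
    have hmp := Measure.measurePreserving_sub_left (volume : Measure ℝ) t
    have hme : MeasurableEmbedding fun s : ℝ => t - s := (Homeomorph.subLeft t).measurableEmbedding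
    have h1 := hmp.integrableOn_comp_preimage hme (f := D) (s := Ioo 0 t)
    have h2 := hmp.setIntegral_preimage_emb hme D (Ioo 0 t)
    rw [e] at h1 h2
    exact ⟨h1.2 hDi, by rw [h2]; exact hDle⟩
  set c := 2 ^ N * (P * Q) * ((1 + t) ^ q / (1 + r * t) ^ N) with hc
  have hc0 : 0 ≤ c := by positivity
  refine (norm_convolution_le_setIntegral hf0 hg0 (F := fun s => c * (D s + D (t - s)))
    ((hDi.add hDr.1).const_mul c) ?_).trans ?_
  · filter_upwards [hf, ae_comp_sub_left t hg] with s h1 h2 hs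
    have hs0 := hs.1
    have hs1 : 0 < t - s := sub_pos.2 hs.2
    have ha := one_le_one_add_mul hr hs0
    have hb := one_le_one_add_mul hr hs1
    set a := 1 + r * s with ha'
    set b := 1 + r * (t - s) with hb'
    have hab : 1 + r * t ≤ a + b := by rw [ha', hb']; nlinarith
    have hT : 0 < 1 + r * t := by have := mul_pos hr ht; linarith
    have key : 1 / (a ^ N * b ^ N) ≤ 2 ^ N / (1 + r * t) ^ N * (1 / a ^ 2 + 1 / b ^ 2) := by
      have aux : ∀ x y : ℝ, 1 ≤ x → 1 ≤ y → x ≤ y → 1 + r * t ≤ x + y →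
          1 / (x ^ N * y ^ N) ≤ 2 ^ N / (1 + r * t) ^ N * (1 / x ^ 2 + 1 / y ^ 2) := by
        intro x y hx hy hxy h
        have e1 : 1 / y ^ N ≤ 2 ^ N / (1 + r * t) ^ N := by
          rw [div_le_div_iff₀ (by positivity) (by positivity), one_mul, ← mul_pow]
          exact pow_le_pow_left₀ hT.le (by linarith) N
        have e2 : 1 / x ^ N ≤ 1 / x ^ 2 := by
          exact one_div_le_one_div_of_le (by positivity) (pow_le_pow_right₀ hx hN)
        calc 1 / (x ^ N * y ^ N) = (1 / y ^ N) * (1 / x ^ N) := by field_simp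
          _ ≤ (2 ^ N / (1 + r * t) ^ N) * (1 / x ^ 2) := by gcongr
          _ ≤ _ := by
            gcongr
            have : 0 ≤ 1 / y ^ 2 := by positivity
            linarith
      rcases le_total a b with h | h
      · exact aux a b ha hb h hab
      · rw [mul_comm (a ^ N), add_comm (1 / a ^ 2)]
        exact aux b a hb ha h (by linarith)
    calc ‖f s‖ * ‖g (t - s)‖ ≤ (P * (r / a ^ N)) * (Q * ((1 + (t - s)) ^ q / b ^ N)) := by
          gcongr
          · exact h1 hs0
          · exact h2 hs1
      _ = (P * Q) * (r * (1 + (t - s)) ^ q) * (1 / (a ^ N * b ^ N)) := by field_simp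
      _ ≤ (P * Q) * (r * (1 + t) ^ q) * (2 ^ N / (1 + r * t) ^ N * (1 / a ^ 2 + 1 / b ^ 2)) := by
          gcongr
          linarith
      _ = _ := by simp only [hc, hD, ← ha', ← hb']; field_simp
  · rw [integral_const_mul, integral_add hDi hDr.1]
    calc c * (_ + _) ≤ c * (1 + 1) := by gcongr; exact hDr.2
      _ = _ := by rw [hc, pow_succ]; ring

/-- Uniform pointwise decay of a resolvent, linear in the size of the kernel. -/
lemma resolvent_decay {A κ : ℝ} (hA : 0 ≤ A) (hκ : 0 < κ) {N : ℕ} (hN : 2 ≤ N) :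
    ∃ D : ℝ, 0 ≤ D ∧ ∀ (r b : ℝ) (k h : ℝ → ℂ), 0 < r → 0 ≤ b → b ≤ 1 →
      IsDecayKernel r (A * b) (N + 2) k → IsResolvent k h →
      (∀ γ, 0 ≤ γ → ∀ τ, κ ≤ ‖1 - 𝓕 (damp γ k) τ‖) →
      ∀ᵐ t, 0 < t → ‖h t‖ ≤ D * b * (r / (1 + r * t) ^ N) := by
  obtain ⟨D, hD, hmom⟩ := resolvent_moments (A := A)
    (C := 1 + A ^ 2 * ((κ⁻¹) ^ 2 + (κ⁻¹ ^ 2) ^ 2)) hA (by positivity) N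
  set D' := 2 ^ N * (D + D) with hD'
  have hD'0 : 0 ≤ D' := by positivity
  refine ⟨A + 2 ^ (N + 1) * (D' * A), by positivity, fun r b k h hr hb hb1 hk hh hpen => ?_⟩
  -- The size `b ≤ 1` is discarded first, so that the moment constants do not depend on it.
  have hk1 : IsDecayKernel r A (N + 2) k := ⟨hk.meas, hk.causal, fun t ht => (hk.bound t ht).trans (by
    have := one_le_one_add_mul hr ht
    gcongr
    exact mul_le_of_le_one_right hA hb1)⟩
  obtain ⟨hi, hC⟩ := integrable_resolvent hr hA hκ (hk1.mono hr hA (by omega)) hh hpen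
  have hm := hmom r k h hr hk1 hh hi hC
  -- Only the moments of order `0` and `N` enter, since `(1 + y)^N ≤ 2^N (1 + y^N)`.
  have hdec : ∀ᵐ t, 0 < t → ‖h t‖ ≤ D' * (r / (1 + r * t) ^ N) := by
    filter_upwards [(hm 0 (by omega)).2.2, (hm N le_rfl).2.2] with t h0 h1 ht
    have hp := mul_pos hr ht
    rw [norm_mul, norm_pow, Complex.norm_real, Real.norm_of_nonneg hp.le] at h0 h1
    rw [pow_zero, one_mul] at h0
    rw [← mul_div_assoc, le_div_iff₀ (by positivity)]
    have h3 : (1 + r * t) ^ N ≤ 2 ^ N * (1 + (r * t) ^ N) := by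
      calc (1 + r * t) ^ N ≤ (2 * max 1 (r * t)) ^ N := by
            gcongr
            have := le_max_left 1 (r * t); have := le_max_right 1 (r * t); linarith
        _ = 2 ^ N * (max 1 (r * t)) ^ N := mul_pow _ _ _
        _ ≤ _ := by
            gcongr
            rcases le_total 1 (r * t) with h | h
            · rw [max_eq_right h]; linarith
            · rw [max_eq_left h, one_pow]; have := pow_pos hp N; linarith
    calc ‖h t‖ * (1 + r * t) ^ N ≤ ‖h t‖ * (2 ^ N * (1 + (r * t) ^ N)) := by gcongr
      _ = 2 ^ N * (‖h t‖ + (r * t) ^ N * ‖h t‖) := by ring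
      _ ≤ 2 ^ N * (D * r + D * r) := by gcongr
      _ = _ := by rw [hD']; ring
  -- Inserting this decay once into `h = k + h * k` recovers the factor `b`, because each term
  -- contains one `k`.
  filter_upwards [hh.eq] with t ht htp
  rw [ht, Pi.add_apply, convolution_mul_comm]
  have hk2 := hk.mono hr (mul_nonneg hA hb) (show N ≤ N + 2 by omega)
  have h1 := norm_convolution_le_decay (q := 0) hr hN hD'0
    (show 0 ≤ A * b * r by positivity) hh.causal hk.causal hdec
    (Eventually.of_forall fun t ht => by
      rw [pow_zero, mul_assoc, mul_one_div]; exact hk2.bound t ht) t htp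
  refine (norm_add_le _ _).trans ((add_le_add (hk2.bound t htp) h1).trans (le_of_eq ?_))
  rw [pow_zero]; ring

end
end ScreenedVlasov
end

/-! ### Decay of frequency derivatives of resolvents -/

noncomputable section
namespace ScreenedVlasov
open scoped ENNReal NNReal FourierTransform
open ContinuousLinearMap (mul)
set_option linter.unusedSectionVars false

/-- A resolvent `h 0` of `k 0` together with the iterates `k i`, `h i` of a derivation of the
convolution algebra, up to order `M`. -/
structure IsDerivedResolvent (M : ℕ) (k h : ℕ → ℝ → ℂ) : Prop where
  causal_kernel : ∀ i ≤ M, ∀ t ≤ 0, k i t = 0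
  causal : ∀ i ≤ M, ∀ t ≤ 0, h i t = 0
  integrable : ∃ β : ℝ, (∀ i ≤ M, Integrable (damp β (k i))) ∧ ∀ i ≤ M, Integrable (damp β (h i))
  leibniz : ∀ m ≤ M, ∀ᵐ t, h m t = k m t + ∑ i ∈ Finset.range (m + 1), (m.choose i : ℂ) *
      (k i ⋆[mul ℂ ℂ, volume] h (m - i)) t

lemma IsDerivedResolvent.mono {M M' : ℕ} {k h : ℕ → ℝ → ℂ} (H : IsDerivedResolvent M k h)
    (hM : M' ≤ M) : IsDerivedResolvent M' k h := by
  obtain ⟨β, h1, h2⟩ := H.integrable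
  exact ⟨fun i hi => H.causal_kernel i (hi.trans hM), fun i hi => H.causal i (hi.trans hM),
    ⟨β, fun i hi => h1 i (hi.trans hM), fun i hi => h2 i (hi.trans hM)⟩,
    fun i hi => H.leibniz i (hi.trans hM)⟩

lemma IsDerivedResolvent.eq_zero {M : ℕ} {k h : ℕ → ℝ → ℂ} (H : IsDerivedResolvent M k h) :
    h 0 =ᵐ[volume] k 0 + k 0 ⋆[mul ℂ ℂ, volume] h 0 := by
  filter_upwards [H.leibniz 0 (zero_le)] with t ht
  simpa using ht

lemma convolution_causal {f g : ℝ → ℂ} (hf0 : ∀ t ≤ 0, f t = 0) (hg0 : ∀ t ≤ 0, g t = 0) :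
    ∀ t ≤ 0, (f ⋆[mul ℂ ℂ, volume] g) t = 0 := by
  intro t ht
  rw [convolution_def]
  refine integral_eq_zero_of_ae (Eventually.of_forall fun s => ?_)
  simp only [ContinuousLinearMap.mul_apply', Pi.zero_apply]
  rcases le_or_gt s 0 with hs | hs
  · rw [hf0 s hs, zero_mul]
  · rw [hg0 (t - s) (by linarith), mul_zero]

lemma derivForcing_causal {M m : ℕ} {k h : ℕ → ℝ → ℂ} (H : IsDerivedResolvent M k h) (hm : m ≤ M) :
    ∀ t ≤ 0, derivForcing k h m t = 0 := by
  intro t ht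
  simp only [derivForcing, Pi.add_apply, Finset.sum_apply]
  rw [H.causal_kernel m hm t ht, zero_add]
  refine Finset.sum_eq_zero fun i hi => ?_
  rw [Finset.mem_range] at hi
  rw [convolution_causal (H.causal_kernel _ (by omega)) (H.causal _ (by omega)) t ht, mul_zero]

/-- Decay of the derived resolvents. -/
lemma derived_resolvent_decay {A D : ℝ} (hA : 0 ≤ A) (hD : 0 ≤ D) {N : ℕ} (hN : 2 ≤ N) (M : ℕ) :
    ∃ B : ℝ, 0 ≤ B ∧ ∀ (r : ℝ) (k h : ℕ → ℝ → ℂ), 0 < r → IsDerivedResolvent M k h →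
      (∀ᵐ t, 0 < t → ‖h 0 t‖ ≤ D * (r / (1 + r * t) ^ N)) →
      (∀ i, i + 1 ≤ M → ∀ t, 0 < t → ‖k (i + 1) t‖ ≤ A * ((1 + t) ^ i / (1 + r * t) ^ N)) →
      ∀ i, i + 1 ≤ M → ∀ᵐ t, 0 < t → ‖h (i + 1) t‖ ≤ B * ((1 + t) ^ i / (1 + r * t) ^ N) := by
  induction M with
  | zero => exact ⟨0, le_rfl, fun r k h _ _ _ _ i hi => by omega⟩
  | succ M ih =>
    obtain ⟨B, hB, ih⟩ := ih
    -- The three summands bound the three kinds of forcing terms: the kernel derivative itself, its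
    -- convolution with `h 0`, and the convolutions with the lower `h (l + 1)` controlled by the
    -- induction.
    set Q := A + (2 ^ (N + 1) * (D * A) + A * B) with hQ
    set P := 2 ^ (M + 1) * Q with hP
    have hQ0 : 0 ≤ Q := by positivity
    have hP0 : 0 ≤ P := by positivity
    refine ⟨B + (P + 2 ^ (N + 1) * (D * P)), by positivity, fun r k h hr H h0 hk i hi => ?_⟩
    have ih' := ih r k h hr (H.mono (by omega)) h0 (fun i hi => hk i (by omega))
    rcases Nat.lt_or_ge i M with hlt | hle
    · filter_upwards [ih' i hlt] with t ht htp
      refine (ht htp).trans ?_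
      have := one_le_one_add_mul hr htp
      gcongr
      have : 0 ≤ P + 2 ^ (N + 1) * (D * P) := by positivity
      linarith
    obtain rfl : i = M := by omega
    obtain ⟨β, hki, hhi⟩ := H.integrable
    have heq := ae_eq_derivation_resolvent hki hhi H.eq_zero (H.leibniz _ le_rfl)
    have hq : ∀ t, 0 < t → ‖derivForcing k h (i + 1) t‖ ≤ P * ((1 + t) ^ i / (1 + r * t) ^ N) := by
      intro t htp
      have hp := one_le_one_add_mul hr htp
      set z := (1 + t) ^ i / (1 + r * t) ^ N with hz
      have hz0 : 0 ≤ z := by positivity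
      rw [hP, mul_assoc]
      refine norm_derivForcing_le t ((hk i le_rfl t htp).trans ?_) fun j hj => ?_
      · gcongr
        rw [hQ]
        have : 0 ≤ 2 ^ (N + 1) * (D * A) + A * B := by positivity
        linarith
      -- For `j < i` both factors grow polynomially, with powers `j` and `l` where `i = j + 1 + l`;
      -- the extra power lost by the convolution brings the total exactly to `i`. For `j = i` the
      -- second factor is `h 0`, which is normalized and costs nothing.
      · rcases Nat.lt_or_ge j i with hji | hji
        · obtain ⟨l, rfl⟩ : ∃ l, i = j + 1 + l := ⟨i - (j + 1), by omega⟩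
          have e : j + 1 + l + 1 - (j + 1) = l + 1 := by omega
          rw [e]
          refine (norm_convolution_le_poly hr hA hB (H.causal_kernel _ (by omega))
            (H.causal _ (by omega)) (Eventually.of_forall (hk j (by omega)))
            (ih' l (by omega)) t htp).trans ?_
          rw [hz, show j + l + 1 = j + 1 + l by ring]
          gcongr
          rw [hQ]
          have : 0 ≤ 2 ^ (N + 1) * (D * A) := by positivity
          linarith
        · obtain rfl : j = i := by omega
          rw [Nat.sub_self, convolution_mul_comm]
          refine (norm_convolution_le_decay hr hN hD hA (H.causal 0 (by omega))
            (H.causal_kernel _ le_rfl) h0 (Eventually.of_forall (hk j le_rfl)) t htp).trans ?_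
          gcongr
          rw [hQ]
          have : 0 ≤ A * B := by positivity
          linarith
    filter_upwards [heq] with t ht htp
    rw [ht, Pi.add_apply]
    have h2 := norm_convolution_le_decay hr hN hD hP0 (H.causal 0 (by omega))
      (derivForcing_causal H le_rfl) h0 (Eventually.of_forall hq) t htp
    have hp := one_le_one_add_mul hr htp
    have hz0 : 0 ≤ (1 + t) ^ i / (1 + r * t) ^ N := by positivity
    calc _ ≤ P * ((1 + t) ^ i / (1 + r * t) ^ N) + 2 ^ (N + 1) * (D * P) *
          ((1 + t) ^ i / (1 + r * t) ^ N) := (norm_add_le _ _).trans (add_le_add (hq t htp) h2)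
      _ ≤ _ := by nlinarith [mul_nonneg hB hz0]

end ScreenedVlasov
end

/-! ### The Green function: gradient, moments and Fourier transform -/

noncomputable section
namespace ScreenedVlasov
open scoped ENNReal NNReal FourierTransform
open ContinuousLinearMap (mul)
set_option linter.unusedSectionVars false

/-- The Euclidean space `ℝ^d`. -/
abbrev Space (d : ℕ) := EuclideanSpace ℝ (Fin d)

variable {d : ℕ}

/-- The damped heat kernel at time `s`. -/
def heat (s : ℝ) (x : Space d) : ℝ :=
  (4 * Real.pi * s) ^ (-(d : ℝ) / 2) * Real.exp (-s - ‖x‖ ^ 2 / (4 * s))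

lemma heat_nonneg {s : ℝ} (hs : 0 < s) (x : Space d) : 0 ≤ heat s x := by
  unfold heat; positivity

lemma measurable_heat : Measurable (fun q : Space d × ℝ => heat q.2 q.1) := by
  unfold heat; fun_prop

lemma measurable_heat_left (s : ℝ) : Measurable (fun x : Space d => heat s x) := by
  unfold heat; fun_prop

lemma measurable_heat_right (x : Space d) : Measurable (fun s => heat s x) := by
  unfold heat; fun_prop

lemma integral_heat {s : ℝ} (hs : 0 < s) :
    Integrable (fun x : Space d => heat s x) ∧ ∫ x : Space d, heat s x = Real.exp (-s) := by
  have h := fourier_heat (d := d) hs 0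
  simp only [inner_zero_right, Complex.ofReal_zero, mul_zero, neg_zero, Complex.exp_zero, one_mul] at h
  rw [integral_complex_ofReal] at h
  have h2 : ∫ x : Space d, heat s x = Real.exp (-s) := by
    apply Complex.ofReal_injective
    refine h.trans ?_
    simp
  refine ⟨?_, h2⟩
  by_contra hc
  rw [integral_undef hc] at h2
  exact (Real.exp_pos _).ne h2

lemma lintegral_heat {s : ℝ} (hs : 0 < s) :
    ∫⁻ x : Space d, ENNReal.ofReal (heat s x) = ENNReal.ofReal (Real.exp (-s)) := by
  rw [← (integral_heat hs).2, ofReal_integral_eq_lintegral_ofReal (integral_heat hs).1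
    (Eventually.of_forall (heat_nonneg hs))]

lemma heat_anti {s : ℝ} (hs : 0 < s) {x y : Space d} (h : ‖x‖ ≤ ‖y‖) : heat s y ≤ heat s x := by
  unfold heat; gcongr

/-- Fubini gives integrability in time for almost every point, hence for some `y` with `‖y‖ < ‖x‖`,
and the heat kernel decreases with the norm. -/
lemma integrableOn_heat_time (hd : 0 < d) {x : Space d} (hx : x ≠ 0) :
    IntegrableOn (fun s => heat s x) (Ioi 0) := by
  have h := (heat_integrable (d := d)).prod_right_ae
  have : Nonempty (Fin d) := ⟨⟨0, hd⟩⟩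
  have : Nontrivial (Space d) := inferInstance
  obtain ⟨y, hy1, hy2⟩ : ∃ y : Space d, ‖y‖ < ‖x‖ ∧
      IntegrableOn (fun s => heat s y) (Ioi 0) := by
    by_contra hc
    push Not at hc
    have h2 : ∀ᵐ y : Space d, y ∉ Metric.ball (0 : Space d) ‖x‖ := by
      filter_upwards [h] with y hy hyb
      exact hc y (by simpa using hyb) hy
    have h3 : volume (Metric.ball (0 : Space d) ‖x‖) = 0 := by
      rw [← nonpos_iff_eq_zero]
      refine (measure_mono fun y hy => ?_).trans (le_of_eq (ae_iff.1 h2))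
      simpa using hy
    exact (Metric.measure_ball_pos volume (0 : Space d) (norm_pos_iff.2 hx)).ne' h3
  refine hy2.mono' (measurable_heat_right x).aestronglyMeasurable ?_
  rw [ae_restrict_iff' measurableSet_Ioi]
  refine Eventually.of_forall fun s hs => ?_
  rw [Real.norm_of_nonneg (heat_nonneg hs x)]
  exact heat_anti hs hy1.le

/-- The radial profile of the gradient of the Green function. -/
def greenRadial (x : Space d) : ℝ := ∫ s in Ioi (0 : ℝ), 1 / (2 * s) * heat s x

/-- The gradient of the Green function away from the origin. -/
def greenGrad (x : Space d) : Space d := -(greenRadial x) • x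

/-- Differentiation under the integral in the variable `y = ‖x‖²`. For `y > ‖x‖² / 2` the singular
factor `1/(4s)` is absorbed by `exp (‖x‖² / (16 s))`, and what remains is a multiple of the heat
kernel at `x / 2`, integrable in time away from the origin. -/
lemma gradient_greenKernel (hd : 0 < d) {x : Space d} (hx : x ≠ 0) :
    ∇ greenKernel x = greenGrad x := by
  have hx0 : 0 < ‖x‖ ^ 2 := by have := norm_pos_iff.2 hx; positivity
  set F : ℝ → ℝ → ℝ := fun y s => (4 * Real.pi * s) ^ (-(d : ℝ) / 2) * Real.exp (-s - y / (4 * s))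
  set F' : ℝ → ℝ → ℝ := fun y s => -(1 / (4 * s)) * F y s
  set z : Space d := (1 / 2 : ℝ) • x with hz
  have hzn : ‖z‖ ^ 2 = ‖x‖ ^ 2 / 4 := by
    rw [hz, norm_smul, mul_pow, Real.norm_of_nonneg (by norm_num)]; ring
  have hz0 : z ≠ 0 := by rw [hz]; simpa using hx
  have hbd : ∀ y, ‖x‖ ^ 2 / 2 < y → ∀ s, 0 < s → ‖F' y s‖ ≤ (4 / ‖x‖ ^ 2) * heat s z := by
    intro y hy s hs
    have hF : 0 ≤ F y s := by simp only [F]; positivity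
    rw [norm_mul, norm_neg, Real.norm_of_nonneg (by positivity), Real.norm_of_nonneg hF]
    have h1 : 1 / (4 * s) ≤ (4 / ‖x‖ ^ 2) * Real.exp (‖x‖ ^ 2 / 4 / (4 * s)) := by
      have := Real.add_one_le_exp (‖x‖ ^ 2 / 4 / (4 * s))
      have h2 : 1 / (4 * s) = (4 / ‖x‖ ^ 2) * (‖x‖ ^ 2 / 4 / (4 * s)) := by field_simp
      rw [h2]
      gcongr
      linarith
    calc _ ≤ (4 / ‖x‖ ^ 2) * Real.exp (‖x‖ ^ 2 / 4 / (4 * s)) *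
          ((4 * Real.pi * s) ^ (-(d : ℝ) / 2) * Real.exp (-s - (‖x‖ ^ 2 / 2) / (4 * s))) := by
          simp only [F]; gcongr
      _ = (4 / ‖x‖ ^ 2) * ((4 * Real.pi * s) ^ (-(d : ℝ) / 2) *
          (Real.exp (‖x‖ ^ 2 / 4 / (4 * s)) * Real.exp (-s - (‖x‖ ^ 2 / 2) / (4 * s)))) := by ring
      _ = _ := by
          rw [← Real.exp_add, heat, hzn]
          have : ‖x‖ ^ 2 / 4 / (4 * s) + (-s - ‖x‖ ^ 2 / 2 / (4 * s)) = -s - ‖x‖ ^ 2 / 4 / (4 * s) := by ring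
          rw [this]
  have hFi : Integrable (F (‖x‖ ^ 2)) (volume.restrict (Ioi 0)) := integrableOn_heat_time hd hx
  have hFm : ∀ y, Measurable (F y) := fun y => by simp only [F]; fun_prop
  have hder := hasDerivAt_integral_of_dominated_loc_of_deriv_le (μ := volume.restrict (Ioi (0:ℝ)))
    (F := F) (F' := F') (x₀ := ‖x‖ ^ 2) (s := Ioi (‖x‖ ^ 2 / 2))
    (bound := fun s => (4 / ‖x‖ ^ 2) * heat s z) (Ioi_mem_nhds (by linarith))
    (Eventually.of_forall fun y => (hFm y).aestronglyMeasurable) hFi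
    (by apply Measurable.aestronglyMeasurable; simp only [F']; have := hFm (‖x‖ ^ 2); fun_prop)
    ?_ ((integrableOn_heat_time hd hz0).const_mul _) ?_
  rotate_left
  · rw [ae_restrict_iff' measurableSet_Ioi]
    exact Eventually.of_forall fun s hs y hy => hbd y hy s hs
  · refine Eventually.of_forall fun s y _ => ?_
    have h1 : HasDerivAt (fun y : ℝ => -s - y / (4 * s)) (-(1 / (4 * s))) y := by
      simpa using ((hasDerivAt_id y).div_const (4 * s)).const_sub (-s)
    refine ((h1.exp).const_mul ((4 * Real.pi * s) ^ (-(d : ℝ) / 2))).congr_deriv ?_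
    simp only [F', F]; ring
  have h2 : HasFDerivAt (fun x : Space d => ‖x‖ ^ 2) (2 • innerSL ℝ x) x :=
    (hasStrictFDerivAt_norm_sq x).hasFDerivAt
  have h3 := hder.2.comp_hasFDerivAt x h2
  refine HasGradientAt.gradient ?_
  rw [hasGradientAt_iff_hasFDerivAt]
  refine h3.congr_fderiv ?_
  ext y
  have e : ∫ s in Ioi (0:ℝ), F' (‖x‖ ^ 2) s = -(greenRadial x) / 2 := by
    rw [greenRadial, ← integral_neg, ← integral_div]
    congr 1; ext s
    simp only [F', F, heat]
    ring
  rw [e]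
  simp [greenGrad, two_mul]
  ring

lemma ae_gradient_greenKernel (hd : 0 < d) :
    (fun x : Space d => ∇ greenKernel x) =ᵐ[volume] greenGrad := by
  have : Nonempty (Fin d) := ⟨⟨0, hd⟩⟩
  have : Nontrivial (Space d) := inferInstance
  have h : ∀ᵐ x : Space d, x ≠ 0 := by
    rw [ae_iff]; simp
  filter_upwards [h] with x hx using gradient_greenKernel hd hx

lemma measurable_greenGrad : Measurable (greenGrad (d := d)) := by
  have h : StronglyMeasurable (greenRadial (d := d)) := by
    unfold greenRadial
    refine StronglyMeasurable.integral_prod_right (f := fun (x : Space d) s => 1 / (2 * s) * heat s x) ?_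
    apply Measurable.stronglyMeasurable
    have := measurable_heat (d := d)
    simp only [Function.uncurry_def]
    fun_prop
  have := h.measurable
  unfold greenGrad
  fun_prop

lemma pow_mul_exp_neg_sq_le (n : ℕ) {y : ℝ} (hy : 0 ≤ y) :
    y ^ n * Real.exp (-y ^ 2) ≤ n.factorial * Real.exp 1 := by
  have h1 := Real.pow_div_factorial_le_exp y hy n
  rw [div_le_iff₀ (by positivity)] at h1
  have h2 : Real.exp y * Real.exp (-y ^ 2) ≤ Real.exp 1 := by
    rw [← Real.exp_add]
    apply Real.exp_le_exp.2
    nlinarith [sq_nonneg (y - 1 / 2)]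
  calc _ ≤ (Real.exp y * n.factorial) * Real.exp (-y ^ 2) := by gcongr
    _ = n.factorial * (Real.exp y * Real.exp (-y ^ 2)) := by ring
    _ ≤ _ := by gcongr

/-- Half of the Gaussian exponent absorbs `‖x‖^n`; the other half is the heat kernel at time `2 s`,
whose stronger damping is compensated by `e^s`. -/
lemma pow_mul_heat_le (n : ℕ) {s : ℝ} (hs : 0 < s) (x : Space d) :
    ‖x‖ ^ n * heat s x ≤ (n.factorial * Real.exp 1 * 2 ^ ((d : ℝ) / 2)) *
      (Real.sqrt (8 * s) ^ n * Real.exp s) * heat (2 * s) x := by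
  have h8 : 0 < Real.sqrt (8 * s) := Real.sqrt_pos.2 (by positivity)
  have h1 := pow_mul_exp_neg_sq_le n (y := ‖x‖ / Real.sqrt (8 * s)) (by positivity)
  rw [div_pow, div_pow, Real.sq_sqrt (by positivity)] at h1
  have e1 : heat s x = (4 * Real.pi * s) ^ (-(d : ℝ) / 2) * Real.exp (-s) *
      (Real.exp (-(‖x‖ ^ 2 / (8 * s))) * Real.exp (-(‖x‖ ^ 2 / (8 * s)))) := by
    rw [heat, mul_assoc ((4 * Real.pi * s) ^ (-(d : ℝ) / 2)), ← Real.exp_add, ← Real.exp_add]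
    congr 2; ring
  have e2 : heat (2 * s) x = 2 ^ (-(d : ℝ) / 2) * (4 * Real.pi * s) ^ (-(d : ℝ) / 2) *
      (Real.exp (-s) * Real.exp (-s) * Real.exp (-(‖x‖ ^ 2 / (8 * s)))) := by
    rw [heat, show 4 * Real.pi * (2 * s) = 2 * (4 * Real.pi * s) by ring,
      Real.mul_rpow (by norm_num) (by positivity), ← Real.exp_add, ← Real.exp_add]; congr 2; ring
  have e3 : (2 : ℝ) ^ ((d : ℝ) / 2) * 2 ^ (-(d : ℝ) / 2) = 1 := by
    rw [← Real.rpow_add two_pos]; simp [neg_div]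
  have e4 : Real.exp s * Real.exp (-s) = 1 := by rw [← Real.exp_add]; simp
  have h2 : ‖x‖ ^ n * Real.exp (-(‖x‖ ^ 2 / (8 * s))) ≤
      (n.factorial * Real.exp 1) * Real.sqrt (8 * s) ^ n := by
    rw [div_mul_eq_mul_div, div_le_iff₀ (by positivity)] at h1
    exact h1
  calc ‖x‖ ^ n * heat s x = (4 * Real.pi * s) ^ (-(d : ℝ) / 2) * Real.exp (-s) *
      Real.exp (-(‖x‖ ^ 2 / (8 * s))) * (‖x‖ ^ n * Real.exp (-(‖x‖ ^ 2 / (8 * s)))) := by rw [e1]; ring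
    _ ≤ (4 * Real.pi * s) ^ (-(d : ℝ) / 2) * Real.exp (-s) *
      Real.exp (-(‖x‖ ^ 2 / (8 * s))) * ((n.factorial * Real.exp 1) * Real.sqrt (8 * s) ^ n) := by
        gcongr
    _ = _ := by
        rw [e2]
        linear_combination (-(4 * Real.pi * s) ^ (-(d : ℝ) / 2) * Real.exp (-s) *
          Real.exp (-(‖x‖ ^ 2 / (8 * s))) * ((n.factorial * Real.exp 1) * Real.sqrt (8 * s) ^ n)) *
          (Real.exp s * Real.exp (-s) * e3 + e4)

/-- All moments of the gradient of the Green function are finite. -/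
lemma integrable_pow_mul_greenGrad_integrand (m : ℕ) :
    Integrable (fun q : Space d × ℝ => ‖q.1‖ ^ (m + 1) * (1 / (2 * q.2) * heat q.2 q.1))
      (volume.prod (volume.restrict (Ioi (0:ℝ)))) := by
  have hm : Measurable (fun q : Space d × ℝ => ‖q.1‖ ^ (m + 1) * (1 / (2 * q.2) * heat q.2 q.1)) := by
    have := measurable_heat (d := d)
    fun_prop
  refine ⟨hm.aestronglyMeasurable, ?_⟩
  rw [hasFiniteIntegral_iff_enorm, lintegral_prod_symm _ hm.enorm.aemeasurable]
  set c : ℝ := ((m + 1).factorial * Real.exp 1 * 2 ^ ((d : ℝ) / 2)) * (Real.sqrt 8 ^ (m + 1) / 2) with hc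
  have hc0 : 0 ≤ c := by positivity
  -- After integration in `x` the factor `s⁻¹` has met `s^{(m+1)/2}`, and `e^s` has met the mass
  -- `e^{-2s}` of the heat kernel at time `2 s`: this is a Gamma integrand with positive parameter.
  -- The moment must have order at least one, hence `m + 1`; the extra power is the factor `x` of
  -- the gradient.
  set g : ℝ → ℝ := fun s => c * (Real.exp (-s) * s ^ (((m : ℝ) + 1) / 2 - 1)) with hg
  have hgi : IntegrableOn g (Ioi 0) :=
    (Real.GammaIntegral_convergent (by positivity)).const_mul c
  have key : ∀ s ∈ Ioi (0:ℝ), ∫⁻ x : Space d, ‖‖x‖ ^ (m + 1) * (1 / (2 * s) * heat s x)‖ₑ ≤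
      ENNReal.ofReal (g s) := by
    intro s hs
    have hs : 0 < s := hs
    have hpt : ∀ x : Space d, ‖‖x‖ ^ (m + 1) * (1 / (2 * s) * heat s x)‖ₑ ≤
        ENNReal.ofReal (g s * Real.exp (2 * s)) * ENNReal.ofReal (heat (2 * s) x) := by
      intro x
      have hgs : 0 ≤ g s := by simp only [hg]; positivity
      rw [Real.enorm_of_nonneg (by have := heat_nonneg hs x; positivity),
        ← ENNReal.ofReal_mul (by positivity)]
      apply ENNReal.ofReal_le_ofReal
      have h1 := pow_mul_heat_le (m + 1) hs x
      have e1 : Real.sqrt (8 * s) ^ (m + 1) = Real.sqrt 8 ^ (m + 1) * (s * s ^ (((m : ℝ) + 1) / 2 - 1)) := by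
        rw [Real.sqrt_mul (by norm_num), mul_pow]
        congr 1
        rw [Real.sqrt_eq_rpow, ← Real.rpow_natCast, ← Real.rpow_mul hs.le]
        nth_rewrite 2 [← Real.rpow_one s]
        rw [← Real.rpow_add hs]
        congr 1; push_cast; ring
      have e2 : Real.exp s = Real.exp (-s) * Real.exp (2 * s) := by
        rw [← Real.exp_add]; congr 1; ring
      calc _ = 1 / (2 * s) * (‖x‖ ^ (m + 1) * heat s x) := by ring
        _ ≤ 1 / (2 * s) * (((m + 1).factorial * Real.exp 1 * 2 ^ ((d : ℝ) / 2)) *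
            (Real.sqrt (8 * s) ^ (m + 1) * Real.exp s) * heat (2 * s) x) := by gcongr
        _ = _ := by
          rw [e1, hg, hc, e2]; field_simp
    calc _ ≤ ∫⁻ x : Space d, ENNReal.ofReal (g s * Real.exp (2 * s)) * ENNReal.ofReal (heat (2 * s) x) :=
          lintegral_mono hpt
      _ = ENNReal.ofReal (g s) := by
          rw [lintegral_const_mul _ (measurable_heat_left _).ennreal_ofReal,
            lintegral_heat (by positivity), ← ENNReal.ofReal_mul (by simp only [hg]; positivity),
            mul_assoc, ← Real.exp_add]
          simp
  calc _ ≤ ∫⁻ s in Ioi (0:ℝ), ENNReal.ofReal (g s) := setLIntegral_mono' measurableSet_Ioi key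
    _ < ⊤ := by
      have := hgi.2
      rw [hasFiniteIntegral_iff_enorm] at this
      refine lt_of_le_of_lt (lintegral_mono fun s => ?_) this
      rw [← ofReal_norm]
      exact ENNReal.ofReal_le_ofReal (le_abs_self _)

lemma integrable_pow_mul_greenGrad (m : ℕ) :
    Integrable (fun x : Space d => ‖x‖ ^ m * ‖greenGrad x‖) := by
  refine (integrable_pow_mul_greenGrad_integrand (d := d) m).integral_prod_left.congr ?_
  refine Eventually.of_forall fun x => ?_
  simp only
  rw [integral_const_mul]
  have h : 0 ≤ greenRadial x := by
    refine setIntegral_nonneg measurableSet_Ioi fun s hs => ?_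
    have := heat_nonneg hs x
    have hs : 0 < s := hs
    positivity
  rw [greenGrad, norm_smul, norm_neg, Real.norm_of_nonneg h, greenRadial]
  ring

/-- The function is `-∂_j` of the heat kernel, so its transform is `-i ξ_j` times the known one,
with `ξ = 2π w`. -/
lemma fourier_coord_mul_heat (j : Fin d) {s : ℝ} (hs : 0 < s) (w : Space d) :
    𝓕 (fun x : Space d => ((x j * (1 / (2 * s) * heat s x) : ℝ) : ℂ)) w =
      -(Complex.I * ((2 * Real.pi * w j : ℝ) : ℂ) *
        Complex.exp (-((1 + ‖(2 * Real.pi) • w‖ ^ 2 : ℝ) : ℂ) * (s : ℂ))) := by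
  set f : Space d → ℂ := fun x => ((heat s x : ℝ) : ℂ) with hf
  have hi : Integrable f := (integral_heat hs).1.ofReal
  have hd : ∀ x : Space d, HasFDerivAt (fun x : Space d => heat s x)
      ((-(1 / (2 * s)) * heat s x) • innerSL ℝ x) x := by
    intro x
    have h2 : HasFDerivAt (fun x : Space d => ‖x‖ ^ 2) (2 • innerSL ℝ x) x :=
      (hasStrictFDerivAt_norm_sq x).hasFDerivAt
    have h3 : HasDerivAt (fun y : ℝ => (4 * Real.pi * s) ^ (-(d : ℝ) / 2) * Real.exp (-s - y / (4 * s)))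
        (-(1 / (4 * s)) * heat s x) (‖x‖ ^ 2) := by
      have h1 : HasDerivAt (fun y : ℝ => -s - y / (4 * s)) (-(1 / (4 * s))) (‖x‖ ^ 2) := by
        simpa using ((hasDerivAt_id (‖x‖ ^ 2)).div_const (4 * s)).const_sub (-s)
      refine ((h1.exp).const_mul ((4 * Real.pi * s) ^ (-(d : ℝ) / 2))).congr_deriv ?_
      simp only [heat]; ring
    refine (h3.comp_hasFDerivAt x h2).congr_fderiv ?_
    ext y
    simp [two_mul]
    field_simp
    ring
  have hdc : ∀ x : Space d, HasFDerivAt f (Complex.ofRealCLM.comp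
      ((-(1 / (2 * s)) * heat s x) • innerSL ℝ x)) x := fun x =>
    Complex.ofRealCLM.hasFDerivAt.comp x (hd x)
  have hderiv : fderiv ℝ f = fun x => Complex.ofRealCLM.comp
      ((-(1 / (2 * s)) * heat s x) • innerSL ℝ x) := funext fun x => (hdc x).fderiv
  have hdi : Integrable (fderiv ℝ f) := by
    rw [hderiv]
    refine Integrable.mono' (g := fun x : Space d => (1 / (2 * s)) * ((Nat.factorial 1 * Real.exp 1 * 2 ^ ((d : ℝ) / 2)) *
      (Real.sqrt (8 * s) ^ 1 * Real.exp s) * heat (2 * s) x))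
      (((integral_heat (by positivity)).1.const_mul _).const_mul _) ?_ (Eventually.of_forall fun x => ?_)
    · have : Measurable fun x : Space d => heat s x := measurable_heat_left s
      refine (ContinuousLinearMap.compL ℝ (Space d) ℝ ℂ Complex.ofRealCLM).continuous.comp_aestronglyMeasurable ?_
      refine AEStronglyMeasurable.smul (this.const_mul _).aestronglyMeasurable ?_
      exact (innerSL ℝ (E := Space d)).continuous.aestronglyMeasurable
    · refine (ContinuousLinearMap.opNorm_comp_le _ _).trans ?_
      rw [Complex.ofRealCLM_norm, one_mul, norm_smul, innerSL_apply_norm, norm_mul, norm_neg,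
        Real.norm_of_nonneg (by positivity), Real.norm_of_nonneg (heat_nonneg hs x)]
      have := pow_mul_heat_le 1 hs x
      calc _ = 1 / (2 * s) * (‖x‖ ^ 1 * heat s x) := by ring
        _ ≤ _ := by gcongr
  have h1 := congrFun (Real.fourier_fderiv hi (fun x => (hdc x).differentiableAt) hdi) w
  have h2 := Real.fourier_continuousLinearMap_apply (a := EuclideanSpace.single j (1:ℝ)) (v := w) hdi
  rw [h1] at h2
  have e1 : (fun x : Space d => ((x j * (1 / (2 * s) * heat s x) : ℝ) : ℂ)) =
      fun x => -(fderiv ℝ f x (EuclideanSpace.single j (1:ℝ))) := by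
    ext x
    rw [hderiv]
    simp [EuclideanSpace.inner_single_right]
    ring
  have e2 : 𝓕 f w = Complex.exp (-((1 + ‖(2 * Real.pi) • w‖ ^ 2 : ℝ) : ℂ) * (s : ℂ)) := by
    rw [← fourier_heat hs ((2 * Real.pi) • w), Real.fourier_eq']
    congr 1; ext x
    rw [smul_eq_mul, inner_smul_right]
    congr 2
    push_cast; ring
  have e3 : 𝓕 (fun x => -(fderiv ℝ f x (EuclideanSpace.single j (1:ℝ)))) w =
      -𝓕 (fun x => (fderiv ℝ f x (EuclideanSpace.single j (1:ℝ)))) w := by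
    simp only [Real.fourier_eq, smul_neg, integral_neg]
  rw [e1, e3, ← h2, ← e2]
  have e4 : (innerSL ℝ w) (EuclideanSpace.single j (1:ℝ)) = w j := by
    rw [innerSL_apply_apply, EuclideanSpace.inner_single_right]; simp
  simp [VectorFourier.fourierSMulRight_apply, e4]
  ring

/-- The Fourier transform of the gradient of the Green function. -/
lemma fourier_greenGrad (j : Fin d) (w : Space d) :
    𝓕 (fun x : Space d => ((greenGrad x j : ℝ) : ℂ)) w =
      Complex.I * ((2 * Real.pi * w j : ℝ) : ℂ) * (1 / (1 + ((‖(2 * Real.pi) • w‖ : ℝ) : ℂ) ^ 2)) := by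
  have hI := integrable_pow_mul_greenGrad_integrand (d := d) 0
  have hI' : Integrable (fun q : Space d × ℝ => q.1 j * (1 / (2 * q.2) * heat q.2 q.1))
      (volume.prod (volume.restrict (Ioi (0:ℝ)))) := by
    refine hI.mono ?_ (Eventually.of_forall fun q => ?_)
    · apply Measurable.aestronglyMeasurable
      have := measurable_heat (d := d)
      fun_prop
    · simp only [norm_mul, zero_add, pow_one, norm_norm]
      gcongr
      exact PiLp.norm_apply_le q.1 j
  have e1 : ∀ x : Space d, ((greenGrad x j : ℝ) : ℂ) =
      -∫ s in Ioi (0:ℝ), ((x j * (1 / (2 * s) * heat s x) : ℝ) : ℂ) := by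
    intro x
    rw [integral_complex_ofReal, integral_const_mul, greenGrad, greenRadial]
    simp; ring
  calc 𝓕 (fun x : Space d => ((greenGrad x j : ℝ) : ℂ)) w
      = ∫ x : Space d, -∫ s in Ioi (0:ℝ), Real.fourierChar (-(inner ℝ x w)) •
        ((x j * (1 / (2 * s) * heat s x) : ℝ) : ℂ) := by
        rw [Real.fourier_eq]
        congr 1; ext x
        rw [e1, smul_neg]
        simp only [Circle.smul_def]
        rw [integral_smul]
    _ = -∫ s in Ioi (0:ℝ), 𝓕 (fun x : Space d => ((x j * (1 / (2 * s) * heat s x) : ℝ) : ℂ)) w := by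
        rw [integral_neg, integral_integral_swap]
        · rfl
        · refine Integrable.mono (hI'.ofReal (𝕜 := ℂ)) ?_ (Eventually.of_forall fun q => ?_)
          · refine AEStronglyMeasurable.smul (𝕜 := Circle) ?_ hI'.ofReal.1
            apply Continuous.aestronglyMeasurable
            fun_prop
          · simp only [Function.uncurry_def, Circle.norm_smul]
            exact le_rfl
    _ = -∫ s in Ioi (0:ℝ), -(Complex.I * ((2 * Real.pi * w j : ℝ) : ℂ) *
        Complex.exp (-((1 + ‖(2 * Real.pi) • w‖ ^ 2 : ℝ) : ℂ) * (s : ℂ))) := by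
        congr 1
        exact setIntegral_congr_fun measurableSet_Ioi fun s hs => fourier_coord_mul_heat j hs w
    _ = _ := by
        rw [integral_neg, neg_neg, integral_const_mul, integral_exp_resolvent]

end ScreenedVlasov
end

/-! ### Fourier decay of the moments of the equilibrium gradient -/

noncomputable section
namespace ScreenedVlasov
open scoped ENNReal NNReal FourierTransform
open ContinuousLinearMap (mul)
set_option linter.unusedSectionVars false

variable {d : ℕ} {F F' : Type*} [NormedAddCommGroup F] [NormedSpace ℝ F]
  [NormedAddCommGroup F'] [NormedSpace ℝ F']

/-- A smooth function whose derivatives of order at most `n` are controlled by the weight `g`. -/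
structure DerivBound (n : ℕ) (g : Space d → ℝ) (f : Space d → F) : Prop where
  smooth : ContDiff ℝ (⊤ : ℕ∞) f
  bound : ∃ C : ℝ, 0 ≤ C ∧ ∀ i ≤ n, ∀ v, ‖iteratedFDeriv ℝ i f v‖ ≤ C * g v

lemma DerivBound.mono {n m : ℕ} {g g' : Space d → ℝ} {f : Space d → F} (h : DerivBound n g f)
    (hm : m ≤ n) (hg : ∀ v, g v ≤ g' v) : DerivBound m g' f := by
  obtain ⟨hs, C, hC, hb⟩ := h
  refine ⟨hs, C, hC, fun i hi v => (hb i (hi.trans hm) v).trans ?_⟩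
  have := hg v
  gcongr

lemma DerivBound.smul {n : ℕ} {g₁ g₂ : Space d → ℝ} {f₁ : Space d → ℝ} {f₂ : Space d → F}
    (h₁ : DerivBound n g₁ f₁) (h₂ : DerivBound n g₂ f₂) :
    DerivBound n (fun v => g₁ v * g₂ v) (fun v => f₁ v • f₂ v) := by
  obtain ⟨hs₁, C₁, hC₁, hb₁⟩ := h₁
  obtain ⟨hs₂, C₂, hC₂, hb₂⟩ := h₂
  refine ⟨hs₁.smul hs₂, 2 ^ n * (C₁ * C₂), by positivity, fun i hi v => ?_⟩
  have hp : 0 ≤ (C₁ * g₁ v) * (C₂ * g₂ v) :=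
    mul_nonneg ((norm_nonneg _).trans (hb₁ 0 (Nat.zero_le _) v))
      ((norm_nonneg _).trans (hb₂ 0 (Nat.zero_le _) v))
  calc ‖iteratedFDeriv ℝ i (fun v => f₁ v • f₂ v) v‖
      ≤ ∑ j ∈ Finset.range (i + 1), (i.choose j : ℝ) * ‖iteratedFDeriv ℝ j f₁ v‖ *
        ‖iteratedFDeriv ℝ (i - j) f₂ v‖ :=
        norm_iteratedFDeriv_smul_le hs₁ hs₂ v (by exact_mod_cast le_top)
    _ ≤ ∑ j ∈ Finset.range (i + 1), (i.choose j : ℝ) * ((C₁ * g₁ v) * (C₂ * g₂ v)) := by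
        refine Finset.sum_le_sum fun j hj => ?_
        have hj' : j ≤ i := Nat.lt_succ_iff.1 (Finset.mem_range.1 hj)
        rw [mul_assoc]
        gcongr
        · exact (norm_nonneg _).trans (hb₁ 0 (Nat.zero_le _) v)
        · exact hb₁ j (hj'.trans hi) v
        · exact hb₂ (i - j) ((Nat.sub_le _ _).trans hi) v
    _ = 2 ^ i * ((C₁ * g₁ v) * (C₂ * g₂ v)) := by
        rw [← Finset.sum_mul]
        congr 1
        exact_mod_cast Nat.sum_range_choose i
    _ ≤ 2 ^ n * ((C₁ * g₁ v) * (C₂ * g₂ v)) := by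
        gcongr
        · norm_num
    _ = _ := by ring

lemma DerivBound.pow {n : ℕ} {g f : Space d → ℝ} (h : DerivBound n g f) (k : ℕ) :
    DerivBound n (fun v => g v ^ k) (fun v => f v ^ k) := by
  induction k with
  | zero =>
    simp only [pow_zero]
    refine ⟨contDiff_const, 1, zero_le_one, fun i _ v => ?_⟩
    rcases Nat.eq_zero_or_pos i with rfl | hi
    · simp
    · rw [iteratedFDeriv_const_of_ne hi.ne']; simp
  | succ k ih =>
    have := ih.smul h
    simpa only [pow_succ, smul_eq_mul] using this

lemma DerivBound.clm_comp {n : ℕ} {g : Space d → ℝ} {f : Space d → F} (h : DerivBound n g f)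
    (L : F →L[ℝ] F') : DerivBound n g (fun v => L (f v)) := by
  obtain ⟨hs, C, hC, hb⟩ := h
  refine ⟨L.contDiff.comp hs, ‖L‖ * C, by positivity, fun i hi v => ?_⟩
  rw [mul_assoc]
  refine (L.norm_iteratedFDeriv_comp_left (x := v) (f := f) hs.contDiffAt
    (by exact_mod_cast le_top)).trans ?_
  gcongr
  exact hb i hi v

lemma one_le_bracket (v : Space d) : 1 ≤ bracket v := by
  unfold bracket
  rw [Real.one_le_sqrt]
  nlinarith [sq_nonneg ‖v‖]

lemma bracket_sq (v : Space d) : bracket v ^ 2 = 1 + ‖v‖ ^ 2 := by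
  unfold bracket
  exact Real.sq_sqrt (by positivity)

lemma norm_le_bracket (v : Space d) : ‖v‖ ≤ bracket v := by
  unfold bracket
  exact Real.le_sqrt_of_sq_le (by linarith)

lemma derivBound_clm (n : ℕ) (L : Space d →L[ℝ] F) : DerivBound n bracket (fun v => L v) := by
  refine ⟨L.contDiff, ‖L‖, norm_nonneg _, fun i _ v => ?_⟩
  rcases i with _ | i
  · rw [norm_iteratedFDeriv_zero]
    exact (L.le_opNorm v).trans (by gcongr; exact norm_le_bracket v)
  · rw [← norm_iteratedFDeriv_fderiv, show fderiv ℝ (fun v => L v) = fun _ => L from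
      funext fun v => L.fderiv]
    rcases Nat.eq_zero_or_pos i with rfl | hi
    · rw [norm_iteratedFDeriv_zero]
      exact le_mul_of_one_le_right (norm_nonneg _) (one_le_bracket v)
    · rw [iteratedFDeriv_const_of_ne hi.ne']
      have := one_le_bracket v
      simp only [Pi.zero_apply, norm_zero]
      positivity

lemma hasFDerivAt_inv_one_add_sq (v : Space d) :
    HasFDerivAt (fun v : Space d => (1 + ‖v‖ ^ 2)⁻¹)
      (((1 + ‖v‖ ^ 2)⁻¹ * (1 + ‖v‖ ^ 2)⁻¹) • ((-2 : ℝ) • innerSL ℝ) v) v := by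
  have h2 : HasFDerivAt (fun x : Space d => 1 + ‖x‖ ^ 2) (2 • innerSL ℝ v) v :=
    ((hasStrictFDerivAt_norm_sq v).hasFDerivAt).const_add 1
  have h := (hasDerivAt_inv (x := 1 + ‖v‖ ^ 2) (by positivity)).comp_hasFDerivAt v h2
  refine h.congr_fderiv ?_
  ext y
  simp only [smul_apply, smul_eq_mul, nsmul_eq_mul, innerSL_apply_apply, Nat.cast_ofNat]
  field_simp

/-- With `p = (1 + ‖v‖²)⁻¹` the derivative is `-2 p² v`, and `p² ⟨v⟩ ≤ p`; so the bound reproduces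
itself by induction on the order. -/
lemma derivBound_inv_one_add_sq (n : ℕ) :
    DerivBound n (fun v : Space d => (1 + ‖v‖ ^ 2)⁻¹) (fun v => (1 + ‖v‖ ^ 2)⁻¹) := by
  have hs : ContDiff ℝ (⊤ : ℕ∞) (fun v : Space d => (1 + ‖v‖ ^ 2)⁻¹) :=
    (contDiff_const.add (contDiff_norm_sq ℝ)).inv fun v => by positivity
  induction n with
  | zero =>
    refine ⟨hs, 1, zero_le_one, fun i hi v => ?_⟩
    obtain rfl : i = 0 := by omega
    rw [norm_iteratedFDeriv_zero, Real.norm_of_nonneg (by positivity), one_mul]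
  | succ n ih =>
    have hd : DerivBound n (fun v : Space d => (1 + ‖v‖ ^ 2)⁻¹)
        (fderiv ℝ (fun v : Space d => (1 + ‖v‖ ^ 2)⁻¹)) := by
      rw [show fderiv ℝ (fun v : Space d => (1 + ‖v‖ ^ 2)⁻¹) = fun v =>
        (((1 + ‖v‖ ^ 2)⁻¹ • (1 + ‖v‖ ^ 2)⁻¹) • ((-2 : ℝ) • innerSL ℝ) v) from
        funext fun v => (hasFDerivAt_inv_one_add_sq v).fderiv]
      refine ((ih.smul ih).smul (derivBound_clm n ((-2 : ℝ) • innerSL ℝ))).mono le_rfl fun v => ?_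
      rw [← bracket_sq]
      have := one_le_bracket v
      field_simp
      nlinarith
    obtain ⟨C, hC, hb⟩ := hd.bound
    refine ⟨hs, max C 1, by positivity, fun i hi v => ?_⟩
    have h0 : 0 ≤ (1 + ‖v‖ ^ 2)⁻¹ := by positivity
    rcases i with _ | i
    · rw [norm_iteratedFDeriv_zero, Real.norm_of_nonneg (by positivity)]
      exact le_mul_of_one_le_left h0 (le_max_right _ _)
    · rw [← norm_iteratedFDeriv_fderiv]
      exact (hb i (by omega) v).trans (by gcongr; exact le_max_left _ _)

/-- A function with integrable derivatives up to order `n` has a Fourier transform decaying like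
`(1 + ‖w‖)⁻ⁿ`. -/
lemma DerivBound.fourier_decay {n : ℕ} {g : Space d → ℝ} {f : Space d → ℂ}
    (h : DerivBound n g f) (hg : Integrable g) :
    ∃ C : ℝ, 0 ≤ C ∧ ∀ w, ‖𝓕 f w‖ ≤ C * (1 / (1 + ‖w‖) ^ n) := by
  obtain ⟨hs, C, hC, hb⟩ := h
  have hi : ∀ k m : ℕ, (k : ℕ∞) ≤ ((0 : ℕ) : ℕ∞) → (m : ℕ∞) ≤ (n : ℕ∞) →
      Integrable (fun v => ‖v‖ ^ k * ‖iteratedFDeriv ℝ m f v‖) := by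
    intro k m hk hm
    obtain rfl : k = 0 := by simpa using hk
    have hm : m ≤ n := by exact_mod_cast hm
    simp only [pow_zero, one_mul]
    refine (hg.const_mul C).mono' ?_ (Eventually.of_forall fun v => ?_)
    · exact ((hs.continuous_iteratedFDeriv (by exact_mod_cast le_top)).norm).aestronglyMeasurable
    · rw [norm_norm]; exact hb m hm v
  have hf : ∀ m ≤ n, ∃ D : ℝ, ∀ w, ‖w‖ ^ m * ‖𝓕 f w‖ ≤ D := by
    intro m hm
    refine ⟨(2 * Real.pi) ^ 0 * (2 * (0 : ℕ) + 2) ^ m * ∑ p ∈ Finset.range (0 + 1) ×ˢ Finset.range (m + 1),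
      ∫ v, ‖v‖ ^ p.1 * ‖iteratedFDeriv ℝ p.2 f v‖, fun w => ?_⟩
    have := Real.pow_mul_norm_iteratedFDeriv_fourier_le (K := ((0 : ℕ) : ℕ∞)) (N := (n : ℕ∞))
      (hs.of_le (by exact_mod_cast le_top)) hi (k := 0) (n := m) le_rfl (by exact_mod_cast hm) w
    rwa [norm_iteratedFDeriv_zero] at this
  obtain ⟨D₀, h₀⟩ := hf 0 (Nat.zero_le _)
  obtain ⟨D₁, h₁⟩ := hf n le_rfl
  have hD₀ : 0 ≤ D₀ := le_trans (by positivity) (h₀ 0)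
  have hD₁ : 0 ≤ D₁ := le_trans (by positivity) (h₁ 0)
  refine ⟨2 ^ n * (D₀ + D₁), by positivity, fun w => ?_⟩
  rw [mul_one_div, le_div_iff₀ (by positivity)]
  have h2 : (1 + ‖w‖) ^ n ≤ 2 ^ n * (1 + ‖w‖ ^ n) := by
    refine (add_pow_le zero_le_one (norm_nonneg w) n).trans ?_
    rw [one_pow]
    gcongr
    · norm_num
    · omega
  calc _ ≤ ‖𝓕 f w‖ * (2 ^ n * (1 + ‖w‖ ^ n)) := by gcongr
    _ = 2 ^ n * (‖w‖ ^ 0 * ‖𝓕 f w‖ + ‖w‖ ^ n * ‖𝓕 f w‖) := by ring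
    _ ≤ _ := by gcongr; exacts [h₀ w, h₁ w]

/-- The sum of the norms of the derivatives of the weighted equilibrium gradient. -/
def weightSum (μ : Space d → ℝ) (v : Space d) : ℝ :=
  ∑ i ∈ Finset.range (2 * d + 6),
    ‖iteratedFDeriv ℝ i (fun v => bracket v ^ (4 * d + 6) • ∇ μ v) v‖

lemma integrable_weightSum {μ : Space d → ℝ} (hreg : RegularEquilibrium μ) :
    Integrable (weightSum μ) := by
  unfold weightSum
  refine integrable_finsetSum _ fun i hi => ?_
  have := (hreg.weighted_integrable.2 i (by have := Finset.mem_range.1 hi; omega))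
  exact (memLp_one_iff_integrable.1 this).norm

lemma derivBound_weighted {μ : Space d → ℝ} (hreg : RegularEquilibrium μ) :
    DerivBound (2 * d + 5) (weightSum μ) (fun v => bracket v ^ (4 * d + 6) • ∇ μ v) := by
  refine ⟨hreg.weighted_integrable.1, 1, zero_le_one, fun i hi v => ?_⟩
  rw [one_mul, weightSum]
  exact Finset.single_le_sum (f := fun i => ‖iteratedFDeriv ℝ i (fun v => bracket v ^ (4 * d + 6) • ∇ μ v) v‖)
    (fun _ _ => norm_nonneg _) (Finset.mem_range.2 (by omega))

/-- The weight is removed through an integer power of the smooth function `(1 + ‖v‖²)⁻¹`, whose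
derivatives have just been bounded; `4 d + 6 = 2 (2 d + 3)` makes this possible. -/
lemma gradient_eq_weighted (μ : Space d → ℝ) (v : Space d) :
    ∇ μ v = ((1 + ‖v‖ ^ 2)⁻¹) ^ (2 * d + 3) • (bracket v ^ (4 * d + 6) • ∇ μ v) := by
  rw [smul_smul, show 4 * d + 6 = 2 * (2 * d + 3) by ring, pow_mul, bracket_sq, ← mul_pow,
    inv_mul_cancel₀ (by positivity), one_pow, one_smul]

lemma continuous_gradient {μ : Space d → ℝ} (hreg : RegularEquilibrium μ) :
    Continuous (∇ μ) := by
  have h : ∇ μ = fun v => ((1 + ‖v‖ ^ 2)⁻¹) ^ (2 * d + 3) • (bracket v ^ (4 * d + 6) • ∇ μ v) :=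
    funext fun v => gradient_eq_weighted μ v
  rw [h]
  have h1 := hreg.weighted_integrable.1.continuous
  exact (Continuous.pow ((by fun_prop : Continuous fun v : Space d => 1 + ‖v‖ ^ 2).inv₀
    fun v => by positivity) _).smul h1

lemma integrable_pow_mul_gradient {μ : Space d → ℝ} (hreg : RegularEquilibrium μ) {l : ℕ}
    (hl : l ≤ d + 1) : Integrable (fun v => ‖v‖ ^ l * ‖∇ μ v‖) := by
  refine (integrable_weightSum hreg).mono'
    ((continuous_norm.pow l).mul (continuous_gradient hreg).norm).aestronglyMeasurable
    (Eventually.of_forall fun v => ?_)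
  rw [Real.norm_of_nonneg (by positivity)]
  obtain ⟨-, -⟩ := derivBound_weighted hreg
  have h1 : ‖bracket v ^ (4 * d + 6) • ∇ μ v‖ ≤ weightSum μ v := by
    rw [weightSum, ← norm_iteratedFDeriv_zero (𝕜 := ℝ) (f := fun v => bracket v ^ (4 * d + 6) • ∇ μ v)]
    exact Finset.single_le_sum (f := fun i => ‖iteratedFDeriv ℝ i (fun v => bracket v ^ (4 * d + 6) • ∇ μ v) v‖)
      (fun _ _ => norm_nonneg _) (Finset.mem_range.2 (by omega))
  have hb := one_le_bracket v
  rw [norm_smul, Real.norm_of_nonneg (by positivity)] at h1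
  refine le_trans ?_ h1
  gcongr
  calc ‖v‖ ^ l ≤ bracket v ^ l := by gcongr; exact norm_le_bracket v
    _ ≤ _ := pow_le_pow_right₀ hb (by omega)

lemma integrable_moment_gradient {μ : Space d → ℝ} (hreg : RegularEquilibrium μ) {l : ℕ}
    (hl : l ≤ d + 1) (j p : Fin d) : Integrable (fun v : Space d => v j ^ l * ∇ μ v p) := by
  have hc := continuous_gradient hreg
  refine (integrable_pow_mul_gradient hreg hl).mono'
    (Continuous.aestronglyMeasurable (by fun_prop)) (Eventually.of_forall fun v => ?_)
  rw [norm_mul, norm_pow]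
  gcongr
  · exact PiLp.norm_apply_le v j
  · exact PiLp.norm_apply_le (∇ μ v) p

/-- The factor `v_j^l (1 + ‖v‖²)^{-(2d+3)}` is bounded with its derivatives, because `l ≤ d + 1` is
below `4 d + 6`. Times the weighted gradient it therefore has `2 d + 5` integrable derivatives. -/
lemma fourier_moment_gradient_le {μ : Space d → ℝ} (hreg : RegularEquilibrium μ) :
    ∃ C : ℝ, 0 ≤ C ∧ ∀ (j p : Fin d), ∀ l ≤ d + 1, ∀ w,
      ‖𝓕 (fun v : Space d => ((v j ^ l * ∇ μ v p : ℝ) : ℂ)) w‖ ≤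
        C * (1 / (1 + ‖w‖) ^ (2 * d + 5)) := by
  have h : ∀ (q : Fin d × Fin d × Fin (d + 2)), ∃ C : ℝ, 0 ≤ C ∧ ∀ w,
      ‖𝓕 (fun v : Space d => ((v q.1 ^ (q.2.2 : ℕ) * ∇ μ v q.2.1 : ℝ) : ℂ)) w‖ ≤
        C * (1 / (1 + ‖w‖) ^ (2 * d + 5)) := by
    intro ⟨j, p, l⟩
    have h1 := (((derivBound_clm (2 * d + 5) (EuclideanSpace.proj (𝕜 := ℝ) j)).pow l).smul
      ((derivBound_inv_one_add_sq (2 * d + 5)).pow (2 * d + 3))).smul (derivBound_weighted hreg)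
    have h2 := (h1.clm_comp ((Complex.ofRealCLM).comp (EuclideanSpace.proj (𝕜 := ℝ) p))).mono
      (g' := weightSum μ) le_rfl ?_
    · have h3 := h2.fourier_decay (integrable_weightSum hreg)
      refine h3.imp fun C hC => ⟨hC.1, fun w => ?_⟩
      refine le_trans (le_of_eq (congrArg (fun f : Space d → ℂ => ‖𝓕 f w‖)
        (funext fun v => ?_))) (hC.2 w)
      nth_rewrite 1 [gradient_eq_weighted μ v]
      simp [mul_assoc]
    · intro v
      have h0 : 0 ≤ weightSum μ v := Finset.sum_nonneg fun _ _ => norm_nonneg _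
      refine mul_le_of_le_one_left h0 ?_
      have hb := one_le_bracket v
      rw [← bracket_sq, ← inv_pow, ← pow_mul, inv_pow, ← div_eq_mul_inv, div_le_one (by positivity)]
      exact pow_le_pow_right₀ hb (by have := l.2; omega)
  choose C hC0 hC using h
  -- Summing the constants over the finite index set makes the bound uniform in `j`, `p` and `l`.
  refine ⟨∑ q, C q, Finset.sum_nonneg fun q _ => hC0 q, fun j p l hl w => ?_⟩
  refine (hC (j, p, ⟨l, by omega⟩) w).trans ?_
  gcongr
  exact Finset.single_le_sum (fun q _ => hC0 q) (Finset.mem_univ _)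

end ScreenedVlasov
end

/-! ### The space-time kernel and its Fourier transform -/

noncomputable section
namespace ScreenedVlasov
open scoped ENNReal NNReal FourierTransform
open ContinuousLinearMap (mul)
set_option linter.unusedSectionVars false

variable {d : ℕ}

/-- The space-time kernel of the linearized density equation. -/
def kernel (μ : Space d → ℝ) (q : ℝ × Space d) : ℝ :=
  if 0 < q.1 then ∫ v, inner ℝ (greenGrad (q.2 - q.1 • v)) (∇ μ v) else 0

lemma kernel_of_nonpos {μ : Space d → ℝ} {t : ℝ} (ht : t ≤ 0) (x : Space d) : kernel μ (t, x) = 0 := by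
  simp [kernel, not_lt.2 ht]

lemma kernel_of_pos {μ : Space d → ℝ} {t : ℝ} (ht : 0 < t) (x : Space d) :
    kernel μ (t, x) = ∫ v, inner ℝ (greenGrad (x - t • v)) (∇ μ v) := by
  simp [kernel, ht]

lemma measurable_kernel {μ : Space d → ℝ} (hreg : RegularEquilibrium μ) : Measurable (kernel μ) := by
  unfold kernel
  refine Measurable.ite (measurableSet_lt measurable_const measurable_fst) ?_ measurable_const
  refine (StronglyMeasurable.integral_prod_right (f := fun (q : ℝ × Space d) v =>
    (inner ℝ (greenGrad (q.2 - q.1 • v)) (∇ μ v) : ℝ)) ?_).measurable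
  apply Measurable.stronglyMeasurable
  have h1 := measurable_greenGrad (d := d)
  have h2 := (continuous_gradient hreg).measurable
  simp only [Function.uncurry_def]
  refine Measurable.inner ?_ ?_
  · exact h1.comp (by fun_prop)
  · exact h2.comp measurable_snd

/-- The absolute value version of the kernel. -/
def absKernel (μ : Space d → ℝ) (q : ℝ × Space d) : ℝ≥0∞ :=
  if 0 < q.1 then ∫⁻ v, ‖greenGrad (q.2 - q.1 • v)‖ₑ * ‖∇ μ v‖ₑ else 0

lemma absKernel_of_nonpos {μ : Space d → ℝ} {t : ℝ} (ht : t ≤ 0) (x : Space d) :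
    absKernel μ (t, x) = 0 := by
  simp [absKernel, not_lt.2 ht]

lemma absKernel_of_pos {μ : Space d → ℝ} {t : ℝ} (ht : 0 < t) (x : Space d) :
    absKernel μ (t, x) = ∫⁻ v, ‖greenGrad (x - t • v)‖ₑ * ‖∇ μ v‖ₑ := by
  simp [absKernel, ht]

lemma measurable_absKernel {μ : Space d → ℝ} (hreg : RegularEquilibrium μ) :
    Measurable (absKernel μ) := by
  unfold absKernel
  refine Measurable.ite (measurableSet_lt measurable_const measurable_fst) ?_ measurable_const
  refine Measurable.lintegral_prod_right' (f := fun p : (ℝ × Space d) × Space d =>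
    ‖greenGrad (p.1.2 - p.1.1 • p.2)‖ₑ * ‖∇ μ p.2‖ₑ) ?_
  have h1 := measurable_greenGrad (d := d)
  have h2 := (continuous_gradient hreg).measurable
  fun_prop

lemma enorm_kernel_le {μ : Space d → ℝ} (q : ℝ × Space d) : ‖kernel μ q‖ₑ ≤ absKernel μ q := by
  obtain ⟨t, x⟩ := q
  rcases le_or_gt t 0 with ht | ht
  · simp [kernel_of_nonpos ht]
  · rw [kernel_of_pos ht, absKernel_of_pos ht]
    refine (enorm_integral_le_lintegral_enorm _).trans (lintegral_mono fun v => ?_)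
    rw [← ofReal_norm, ← ofReal_norm, ← ofReal_norm, ← ENNReal.ofReal_mul (norm_nonneg _)]
    exact ENNReal.ofReal_le_ofReal (norm_inner_le_norm _ _)

lemma integrable_weight_of_pow {F : Type*} [NormedAddCommGroup F] {f : Space d → F}
    (hf : AEStronglyMeasurable f) (m : ℕ)
    (h : ∀ l ≤ m, Integrable (fun x => ‖x‖ ^ l * ‖f x‖)) :
    Integrable (fun x => (1 + ‖x‖) ^ m * ‖f x‖) := by
  refine (((h 0 (Nat.zero_le _)).add (h m le_rfl)).const_mul (2 ^ m)).mono' ?_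
    (Eventually.of_forall fun x => ?_)
  · exact (Continuous.aestronglyMeasurable (by fun_prop)).mul hf.norm
  · rw [Real.norm_of_nonneg (by positivity)]
    have h2 : (1 + ‖x‖) ^ m ≤ 2 ^ m * (1 + ‖x‖ ^ m) := by
      refine (add_pow_le zero_le_one (norm_nonneg x) m).trans ?_
      rw [one_pow]
      gcongr
      · norm_num
      · omega
    calc _ ≤ (2 ^ m * (1 + ‖x‖ ^ m)) * ‖f x‖ := by gcongr
      _ = _ := by simp only [Pi.add_apply]; ring

lemma weight_le (m : ℕ) {t : ℝ} (ht : 0 < t) (x v : Space d) :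
    (1 + ‖x‖) ^ m ≤ (1 + t) ^ m * (1 + ‖x - t • v‖) ^ m * (1 + ‖v‖) ^ m := by
  rw [← mul_pow, ← mul_pow]
  gcongr
  have h1 : ‖x‖ ≤ ‖x - t • v‖ + t * ‖v‖ := by
    calc ‖x‖ = ‖(x - t • v) + t • v‖ := by rw [sub_add_cancel]
      _ ≤ _ := (norm_add_le _ _).trans (by rw [norm_smul, Real.norm_of_nonneg ht.le])
  have h2 := norm_nonneg (x - t • v)
  have h3 := norm_nonneg v
  have := mul_nonneg ht.le h2
  have := mul_nonneg ht.le h3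
  have := mul_nonneg h2 h3
  nlinarith [mul_nonneg (mul_nonneg ht.le h2) h3]

/-- By `weight_le` the spatial weight splits between `x - t v`, `v` and `t`, and Tonelli separates
the Green factor from the equilibrium. The growth in `t` is only polynomial and will be absorbed by
`e^{-βt}`. The restriction on `m` comes from the available moments of `∇μ`. -/
lemma lintegral_weight_absKernel_le {μ : Space d → ℝ} (hreg : RegularEquilibrium μ) {m : ℕ}
    (hm : m ≤ d + 1) :
    ∃ C : ℝ, 0 ≤ C ∧ ∀ t, 0 < t → ∫⁻ x, ENNReal.ofReal ((1 + ‖x‖) ^ m) * absKernel μ (t, x) ≤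
      ENNReal.ofReal (C * (1 + t) ^ m) := by
  have hB := integrable_weight_of_pow (measurable_greenGrad (d := d)).aestronglyMeasurable m
    fun l _ => integrable_pow_mul_greenGrad l
  have hM := integrable_weight_of_pow (continuous_gradient hreg).aestronglyMeasurable m
    fun l hl => integrable_pow_mul_gradient hreg (hl.trans hm)
  have hmB := measurable_greenGrad (d := d)
  have hmM := (continuous_gradient hreg).measurable
  set bb : Space d → ℝ≥0∞ := fun y => ENNReal.ofReal ((1 + ‖y‖) ^ m * ‖greenGrad y‖) with hbb
  set mm : Space d → ℝ≥0∞ := fun v => ENNReal.ofReal ((1 + ‖v‖) ^ m * ‖∇ μ v‖) with hmm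
  have hbm : Measurable bb := by simp only [hbb]; fun_prop
  have hmm' : Measurable mm := by simp only [hmm]; fun_prop
  have e1 : ∫⁻ y, bb y = ENNReal.ofReal (∫ y : Space d, (1 + ‖y‖) ^ m * ‖greenGrad y‖) :=
    (ofReal_integral_eq_lintegral_ofReal hB (Eventually.of_forall fun _ => by positivity)).symm
  have e2 : ∫⁻ y, mm y = ENNReal.ofReal (∫ v : Space d, (1 + ‖v‖) ^ m * ‖∇ μ v‖) :=
    (ofReal_integral_eq_lintegral_ofReal hM (Eventually.of_forall fun _ => by positivity)).symm
  refine ⟨(∫ y : Space d, (1 + ‖y‖) ^ m * ‖greenGrad y‖) * ∫ v : Space d, (1 + ‖v‖) ^ m * ‖∇ μ v‖,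
    mul_nonneg (integral_nonneg fun _ => by positivity) (integral_nonneg fun _ => by positivity),
    fun t ht => ?_⟩
  calc _ ≤ ∫⁻ x : Space d, ∫⁻ v, ENNReal.ofReal ((1 + t) ^ m) * (bb (x - t • v) * mm v) := by
        refine lintegral_mono fun x => ?_
        rw [absKernel_of_pos ht]
        refine (lintegral_const_mul_le _ _).trans (lintegral_mono fun v => ?_)
        simp only [hbb, hmm]
        rw [← ofReal_norm, ← ofReal_norm, ← ENNReal.ofReal_mul (by positivity),
          ← ENNReal.ofReal_mul (by positivity), ← ENNReal.ofReal_mul (by positivity),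
          ← ENNReal.ofReal_mul (by positivity)]
        apply ENNReal.ofReal_le_ofReal
        calc _ ≤ ((1 + t) ^ m * (1 + ‖x - t • v‖) ^ m * (1 + ‖v‖) ^ m) * _ :=
              mul_le_mul_of_nonneg_right (weight_le m ht x v) (by positivity)
          _ = _ := by ring
    _ = ∫⁻ v : Space d, ∫⁻ x, ENNReal.ofReal ((1 + t) ^ m) * (bb (x - t • v) * mm v) := by
        rw [lintegral_lintegral_swap]
        exact Measurable.aemeasurable (by simp only [Function.uncurry_def]; fun_prop)
    _ = ∫⁻ v : Space d, ENNReal.ofReal ((1 + t) ^ m) * ((∫⁻ y, bb y) * mm v) := by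
        congr 1; ext v
        rw [lintegral_const_mul _ (by fun_prop), lintegral_mul_const _ (by fun_prop),
          lintegral_sub_right_eq_self bb]
    _ = _ := by
        rw [lintegral_const_mul _ (by fun_prop), lintegral_const_mul _ hmm', e1, e2,
          ← ENNReal.ofReal_mul (integral_nonneg fun _ => by positivity),
          ← ENNReal.ofReal_mul (by positivity), mul_comm]

lemma lintegral_weight_kernel_le {μ : Space d → ℝ} (hreg : RegularEquilibrium μ) {m : ℕ}
    (hm : m ≤ d + 1) :
    ∃ C : ℝ, 0 ≤ C ∧ ∀ t, 0 < t → ∫⁻ x, ENNReal.ofReal ((1 + ‖x‖) ^ m) * ‖kernel μ (t, x)‖ₑ ≤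
      ENNReal.ofReal (C * (1 + t) ^ m) := by
  obtain ⟨C, hC, h⟩ := lintegral_weight_absKernel_le hreg hm
  refine ⟨C, hC, fun t ht => (lintegral_mono fun x => ?_).trans (h t ht)⟩
  gcongr
  exact enorm_kernel_le (t, x)

lemma integrable_shear {b m : Space d → ℂ} (hb : Integrable b) (hm : Integrable m) (t : ℝ) :
    Integrable (fun q : Space d × Space d => b (q.2 - t • q.1) * m q.1) (volume.prod volume) := by
  have h := (hm.mul_prod hb)
  have hp : MeasurePreserving (fun q : Space d × Space d => (q.1, q.2 - t • q.1))
      (volume.prod volume) (volume.prod volume) := by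
    refine (MeasurePreserving.id volume).skew_product (g := fun v x => x - t • v)
      (by simp only [Function.uncurry_def]; fun_prop) (Eventually.of_forall fun v => ?_)
    exact (measurePreserving_sub_right volume (t • v)).map_eq
  refine (hp.integrable_comp_of_integrable h).congr (Eventually.of_forall fun q => ?_)
  simp [mul_comm]

/-- Shifting `x` by `t v` leaves the phase of frequency `t w` on the velocity variable: free
transport becomes evaluation at `t w`, which is phase mixing. -/
lemma fourier_shear {b m : Space d → ℂ} (hb : Integrable b) (hm : Integrable m) (t : ℝ)
    (w : Space d) :
    𝓕 (fun x => ∫ v, b (x - t • v) * m v) w = 𝓕 b w * 𝓕 m (t • w) := by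
  have hi := (integrable_shear hb hm t).swap
  have e1 : ∀ v : Space d, ∫ x, Real.fourierChar (-(inner ℝ x w)) • (b (x - t • v) * m v)
      = 𝓕 b w * (Real.fourierChar (-(inner ℝ v (t • w))) • m v) := by
    intro v
    rw [← integral_add_right_eq_self _ (t • v), Real.fourier_eq, ← integral_mul_const]
    congr 1; ext y
    rw [add_sub_cancel_right, inner_add_left, neg_add, AddChar.map_add_eq_mul, real_inner_smul_left,
      real_inner_smul_right]
    simp only [Circle.smul_def, Circle.coe_mul, smul_eq_mul]
    ring
  calc _ = ∫ x, ∫ v, Real.fourierChar (-(inner ℝ x w)) • (b (x - t • v) * m v) := by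
        rw [Real.fourier_eq]
        congr 1; ext x
        simp only [Circle.smul_def]
        rw [integral_smul]
    _ = ∫ v, ∫ x, Real.fourierChar (-(inner ℝ x w)) • (b (x - t • v) * m v) := by
        rw [integral_integral_swap]
        refine Integrable.mono hi ?_ (Eventually.of_forall fun q => ?_)
        · refine AEStronglyMeasurable.smul (𝕜 := Circle) ?_ hi.1
          apply Continuous.aestronglyMeasurable
          fun_prop
        · simp only [Function.uncurry_def, Circle.norm_smul]
          exact le_rfl
    _ = _ := by
        simp_rw [e1]
        rw [integral_const_mul, Real.fourier_eq m]

/-- The spatial Fourier transform of the `i`-th moment in direction `j` of a space-time function. -/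
def momentHat (f : ℝ × Space d → ℝ) (j : Fin d) (i : ℕ) (w : Space d) (t : ℝ) : ℂ :=
  𝓕 (fun x : Space d => ((x j ^ i * f (t, x) : ℝ) : ℂ)) w

lemma integrable_moment_greenGrad (j p : Fin d) (i : ℕ) :
    Integrable (fun y : Space d => ((y j ^ i * greenGrad y p : ℝ) : ℂ)) := by
  have hm := measurable_greenGrad (d := d)
  refine (Integrable.mono' (integrable_pow_mul_greenGrad (d := d) i)
    (Measurable.aestronglyMeasurable ?_) (Eventually.of_forall fun v => ?_)).ofReal
  · exact (by fun_prop : Measurable fun y : Space d => y j ^ i).mul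
      ((by fun_prop : Measurable fun y : Space d => y p).comp hm)
  · refine (norm_mul_le _ _).trans ?_
    rw [norm_pow]
    gcongr
    · exact PiLp.norm_apply_le v j
    · exact PiLp.norm_apply_le (greenGrad v) p

/-- Write `x_j = t v_j + (x - t v)_j` and expand the power. Each term is a sheared product of a
moment of the Green gradient and a moment of `∇μ`, and carries a factor `t^l`. -/
lemma momentHat_kernel {μ : Space d → ℝ} (hreg : RegularEquilibrium μ) (j : Fin d) {i : ℕ}
    (hi : i ≤ d + 1) (w : Space d) {t : ℝ} (ht : 0 < t) :
    momentHat (kernel μ) j i w t = ∑ l ∈ Finset.range (i + 1), ((i.choose l : ℂ) * (t : ℂ) ^ l) *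
      ∑ p : Fin d, 𝓕 (fun y : Space d => ((y j ^ (i - l) * greenGrad y p : ℝ) : ℂ)) w *
        𝓕 (fun v : Space d => ((v j ^ l * ∇ μ v p : ℝ) : ℂ)) (t • w) := by
  set b : ℕ → Fin d → Space d → ℂ := fun l p y => ((y j ^ (i - l) * greenGrad y p : ℝ) : ℂ) with hb
  set m : ℕ → Fin d → Space d → ℂ := fun l p v => ((v j ^ l * ∇ μ v p : ℝ) : ℂ) with hm
  have hbi : ∀ l p, Integrable (b l p) := fun l p => integrable_moment_greenGrad j p _
  have hmi : ∀ l ≤ i, ∀ p, Integrable (m l p) := fun l hl p =>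
    (integrable_moment_gradient hreg (hl.trans hi) j p).ofReal
  have hsh : ∀ l ≤ i, ∀ p, Integrable (fun x => ∫ v, b l p (x - t • v) * m l p v) := fun l hl p =>
    (integrable_shear (hbi l p) (hmi l hl p) t).integral_prod_right
  have hae : (fun x : Space d => ((x j ^ i * kernel μ (t, x) : ℝ) : ℂ)) =ᵐ[volume]
      fun x => ∑ l ∈ Finset.range (i + 1), ((i.choose l : ℂ) * (t : ℂ) ^ l) *
        ∑ p : Fin d, ∫ v, b l p (x - t • v) * m l p v := by
    have h1 : ∀ᵐ x : Space d, ∀ l ∈ Finset.range (i + 1), ∀ p, Integrable fun v =>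
        b l p (x - t • v) * m l p v := by
      rw [Finset.eventually_all]
      intro l hl
      rw [eventually_all]
      intro p
      exact (integrable_shear (hbi l p) (hmi l (Nat.lt_succ_iff.1 (Finset.mem_range.1 hl)) p) t).prod_left_ae
    filter_upwards [h1] with x hx
    rw [kernel_of_pos ht, ← integral_const_mul, ← integral_complex_ofReal]
    calc _ = ∫ v, ∑ l ∈ Finset.range (i + 1), ((i.choose l : ℂ) * (t : ℂ) ^ l) *
        ∑ p : Fin d, b l p (x - t • v) * m l p v := by
          congr 1; ext v
          have hxj : x j = t * v j + (x - t • v) j := by simp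
          rw [PiLp.inner_apply, hxj, add_pow]
          simp only [hb, hm]
          push_cast
          rw [Finset.sum_mul]
          refine Finset.sum_congr rfl fun l _ => ?_
          rw [Finset.mul_sum, Finset.mul_sum]
          refine Finset.sum_congr rfl fun p _ => ?_
          simp
          ring
      _ = _ := by
          rw [integral_finsetSum _ fun l hl => (integrable_finsetSum _ fun p _ => hx l hl p).const_mul _]
          refine Finset.sum_congr rfl fun l hl => ?_
          rw [integral_const_mul, integral_finsetSum _ fun p _ => hx l hl p]
  have hcongr : momentHat (kernel μ) j i w t = 𝓕 (fun x => ∑ l ∈ Finset.range (i + 1),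
      ((i.choose l : ℂ) * (t : ℂ) ^ l) * ∑ p : Fin d, ∫ v, b l p (x - t • v) * m l p v) w := by
    rw [momentHat, Real.fourier_eq, Real.fourier_eq]
    refine integral_congr_ae ?_
    filter_upwards [hae] with x hx
    rw [hx]
  have hch : ∀ {f : Space d → ℂ}, Integrable f → Integrable fun x : Space d =>
      (Real.fourierChar (-(inner ℝ x w)) : ℂ) * f x := fun hf =>
    (Real.fourierIntegral_convergent_iff w).2 hf
  rw [hcongr, Real.fourier_eq]
  simp only [Circle.smul_def, smul_eq_mul, Finset.mul_sum]
  rw [integral_finsetSum _ fun l hl => integrable_finsetSum _ fun p _ => hch ((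
    hsh l (Nat.lt_succ_iff.1 (Finset.mem_range.1 hl)) p).const_mul _)]
  refine Finset.sum_congr rfl fun l hl => ?_
  have hl' := Nat.lt_succ_iff.1 (Finset.mem_range.1 hl)
  rw [integral_finsetSum _ fun p _ => hch ((hsh l hl' p).const_mul _)]
  refine Finset.sum_congr rfl fun p _ => ?_
  rw [← fourier_shear (hbi l p) (hmi l hl' p), Real.fourier_eq, ← integral_const_mul]
  congr 1; ext x
  simp only [Circle.smul_def, smul_eq_mul]
  ring

end ScreenedVlasov
end

/-! ### Frequency bounds for the kernel and the Penrose symbol -/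

noncomputable section
namespace ScreenedVlasov
open scoped ENNReal NNReal FourierTransform
open ContinuousLinearMap (mul)
set_option linter.unusedSectionVars false

variable {d : ℕ}

lemma momentHat_of_nonpos {f : ℝ × Space d → ℝ} (hf : ∀ t ≤ 0, ∀ x, f (t, x) = 0) (j : Fin d) (i : ℕ)
    (w : Space d) {t : ℝ} (ht : t ≤ 0) : momentHat f j i w t = 0 := by
  simp [momentHat, hf t ht, Real.fourier_eq]

lemma norm_fourier_le {f : Space d → ℂ} (w : Space d) : ‖𝓕 f w‖ ≤ ∫ x, ‖f x‖ := by
  rw [Real.fourier_eq]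
  refine (norm_integral_le_integral_norm _).trans (le_of_eq ?_)
  simp only [Circle.norm_smul]

/-- The frequency `|ξ| = 2π‖w‖`. -/
def freq (w : Space d) : ℝ := ‖(2 * Real.pi) • w‖

lemma freq_nonneg (w : Space d) : 0 ≤ freq w := norm_nonneg _

lemma freq_eq (w : Space d) : freq w = 2 * Real.pi * ‖w‖ := by
  rw [freq, norm_smul, Real.norm_of_nonneg (by positivity)]

lemma freq_pos {w : Space d} (hw : w ≠ 0) : 0 < freq w := by
  rw [freq_eq]
  have := norm_pos_iff.2 hw
  positivity

lemma norm_fourier_greenGrad_le (p : Fin d) (w : Space d) :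
    ‖𝓕 (fun y : Space d => ((greenGrad y p : ℝ) : ℂ)) w‖ ≤ freq w * (1 / (1 + freq w ^ 2)) := by
  rw [fourier_greenGrad, norm_mul, norm_mul, Complex.norm_I, one_mul, Complex.norm_real]
  have h : (1 : ℂ) / (1 + ((‖(2 * Real.pi) • w‖ : ℝ) : ℂ) ^ 2) = ((1 / (1 + freq w ^ 2) : ℝ) : ℂ) := by
    rw [freq]; push_cast; rfl
  rw [h, Complex.norm_real, Real.norm_of_nonneg (r := 1 / (1 + freq w ^ 2)) (by positivity)]
  gcongr
  exact PiLp.norm_apply_le ((2 * Real.pi) • w) p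

/-- The constant `7` is an integer above `2π`, the ratio between the two frequency conventions. -/
lemma decay_freq_le {n m : ℕ} (h : m ≤ n) {t : ℝ} (ht : 0 < t) (w : Space d) :
    1 / (1 + ‖t • w‖) ^ n ≤ 7 ^ n * (1 / (1 + freq w * t) ^ m) := by
  have h1 : 1 + freq w * t ≤ 7 * (1 + ‖t • w‖) := by
    rw [freq_eq, norm_smul, Real.norm_of_nonneg ht.le]
    have := Real.pi_lt_d2
    have h0 : 0 ≤ t * ‖w‖ := by positivity
    nlinarith
  have h2 : 1 ≤ 1 + freq w * t := by have := freq_nonneg w; nlinarith [mul_nonneg this ht.le]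
  calc 1 / (1 + ‖t • w‖) ^ n = 7 ^ n * (1 / (7 * (1 + ‖t • w‖)) ^ n) := by
        rw [mul_pow]; field_simp
    _ ≤ 7 ^ n * (1 / (1 + freq w * t) ^ n) := by gcongr
    _ ≤ _ := by gcongr

/-- The terms in which a moment remains on the Green factor: that factor is merely bounded, and at
most `i` powers of `t` occur. -/
lemma pow_mul_mul_le_of_lt {r t B L X Y : ℝ} {i l n : ℕ} (_ : 0 ≤ r) (ht : 0 < t) (hl : l ≤ i)
    (hB : 0 ≤ B) (_ : 0 ≤ L) (hX0 : 0 ≤ X) (hY0 : 0 ≤ Y) (hX : X ≤ B)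
    (hY : Y ≤ L * (1 / (1 + r * t) ^ n)) :
    t ^ l * (X * Y) ≤ (B + 1) * L * ((1 + t) ^ i / (1 + r * t) ^ n) := by
  have e3 : t ^ l ≤ (1 + t) ^ i := calc
    t ^ l ≤ (1 + t) ^ l := by gcongr; linarith
    _ ≤ (1 + t) ^ i := pow_le_pow_right₀ (by linarith) hl
  calc _ ≤ (1 + t) ^ i * ((B + 1) * (L * (1 / (1 + r * t) ^ n))) := by
        gcongr; linarith
    _ = _ := by ring

/-- The top term has one power of `t` too many, but its Green factor is of size `r`, and `r t / (1 +
r t) ≤ 1` trades the excess for one power of decay. -/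
lemma pow_mul_mul_le_of_eq {r t B L X Y : ℝ} {i n : ℕ} (hr : 0 ≤ r) (ht : 0 < t)
    (hB : 0 ≤ B) (hL : 0 ≤ L) (_ : 0 ≤ X) (hY0 : 0 ≤ Y) (hX : X ≤ r)
    (hY : Y ≤ L * (1 / (1 + r * t) ^ (n + 1))) :
    t ^ (i + 1) * (X * Y) ≤ (B + 1) * L * ((1 + t) ^ i / (1 + r * t) ^ n) := by
  have h1 : (1:ℝ) ≤ 1 + r * t := by nlinarith [mul_nonneg hr ht.le]
  have e3 : t ^ i ≤ (1 + t) ^ i := by gcongr; linarith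
  have e5 : 0 ≤ (1 + t) ^ i * (1 / (1 + r * t) ^ n) := by positivity
  calc _ ≤ t ^ (i + 1) * (r * (L * (1 / (1 + r * t) ^ (n + 1)))) := by gcongr
    _ = t ^ i * L * ((r * t) / (1 + r * t) * (1 / (1 + r * t) ^ n)) := by
        rw [pow_succ (1 + r * t) n]
        field_simp
        ring
    _ ≤ (1 + t) ^ i * L * (1 * (1 / (1 + r * t) ^ n)) := by
        gcongr
        rw [div_le_one (by linarith)]
        linarith
    _ = L * ((1 + t) ^ i * (1 / (1 + r * t) ^ n)) := by ring
    _ ≤ ((B + 1) * L) * ((1 + t) ^ i * (1 / (1 + r * t) ^ n)) := by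
        gcongr
        nlinarith [mul_nonneg hB hL]
    _ = _ := by ring

/-- The exponent `d + 5` is the `N + 2` asked for by `resolvent_decay` with `N = d + 3`. The
transform of the Green gradient gives the factor `freq / (1 + freq²)` for the zeroth moment; higher
moments lose this factor but gain one power of `t` fewer than their order. -/
lemma momentHat_kernel_bound {μ : Space d → ℝ} (hreg : RegularEquilibrium μ) :
    ∃ A : ℝ, 0 ≤ A ∧ ∀ (j : Fin d) (w : Space d) (t : ℝ), 0 < t →
      ‖momentHat (kernel μ) j 0 w t‖ ≤
        A * (1 / (1 + freq w ^ 2)) * (freq w / (1 + freq w * t) ^ (d + 5)) ∧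
      ∀ i, i + 1 ≤ d + 1 → ‖momentHat (kernel μ) j (i + 1) w t‖ ≤
        A * ((1 + t) ^ i / (1 + freq w * t) ^ (d + 3)) := by
  obtain ⟨C, hC, hF⟩ := fourier_moment_gradient_le hreg
  set L : ℝ := C * 7 ^ (2 * d + 5) with hL
  have hL0 : 0 ≤ L := by positivity
  set B : ℝ := ∑ m ∈ Finset.range (d + 2), ∫ y : Space d, ‖y‖ ^ m * ‖greenGrad y‖ with hB
  have hBm : ∀ m, 0 ≤ ∫ y : Space d, ‖y‖ ^ m * ‖greenGrad y‖ := fun m =>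
    integral_nonneg fun _ => by positivity
  have hB0 : 0 ≤ B := Finset.sum_nonneg fun m _ => hBm m
  have hb : ∀ m ≤ d + 1, ∀ (j p : Fin d) (w : Space d),
      ‖𝓕 (fun y : Space d => ((y j ^ m * greenGrad y p : ℝ) : ℂ)) w‖ ≤ B := by
    intro m hm j p w
    refine (norm_fourier_le w).trans (le_trans (integral_mono
      (integrable_moment_greenGrad j p m).norm (integrable_pow_mul_greenGrad m) fun y => ?_)
      (Finset.single_le_sum (f := fun m => ∫ y : Space d, ‖y‖ ^ m * ‖greenGrad y‖)
        (fun m _ => hBm m) (Finset.mem_range.2 (by omega : m < d + 2))))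
    simp only [Complex.norm_real]
    refine (norm_mul_le _ _).trans ?_
    rw [norm_pow]
    gcongr
    · exact PiLp.norm_apply_le y j
    · exact PiLp.norm_apply_le (greenGrad y) p
  have hm : ∀ (j p : Fin d) (l : ℕ), l ≤ d + 1 → ∀ (n : ℕ), n ≤ 2 * d + 5 → ∀ w t, 0 < t →
      ‖𝓕 (fun v : Space d => ((v j ^ l * ∇ μ v p : ℝ) : ℂ)) (t • w)‖ ≤
        L * (1 / (1 + freq w * t) ^ n) := by
    intro j p l hl n hn w t ht
    refine (hF j p l hl (t • w)).trans ?_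
    rw [hL, mul_assoc]
    gcongr
    exact decay_freq_le hn ht w
  have h00 : ∀ (p j : Fin d) (w : Space d), ‖𝓕 (fun y : Space d => ((y j ^ 0 * greenGrad y p : ℝ) : ℂ)) w‖
      ≤ freq w * (1 / (1 + freq w ^ 2)) := by
    intro p j w
    simpa using norm_fourier_greenGrad_le p w
  clear_value B L
  obtain ⟨A, hA0, hA1, hA2⟩ : ∃ A : ℝ, 0 ≤ A ∧ d * L ≤ A ∧ 2 ^ (d + 1) * (d * ((B + 1) * L)) ≤ A :=
    ⟨max (d * L) (2 ^ (d + 1) * (d * ((B + 1) * L))), le_max_of_le_left (by positivity),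
      le_max_left _ _, le_max_right _ _⟩
  refine ⟨A, hA0, fun j w t ht => ⟨?_, ?_⟩⟩
  · rw [momentHat_kernel hreg j (Nat.zero_le _) w ht]
    have hr := freq_nonneg w
    have h1 : (1:ℝ) + freq w * t ≥ 1 := by nlinarith [mul_nonneg hr ht.le]
    calc _ ≤ ∑ p : Fin d, (freq w * (1 / (1 + freq w ^ 2))) * (L * (1 / (1 + freq w * t) ^ (d + 5))) := by
          simp only [zero_add, Finset.range_one, Finset.sum_singleton, Nat.choose_self, Nat.cast_one,
            pow_zero, one_mul, Nat.sub_self]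
          refine (norm_sum_le _ _).trans (Finset.sum_le_sum fun p _ => ?_)
          rw [norm_mul]
          have h0 := h00 p j w
          have h0' := hm j p 0 (Nat.zero_le _) (d + 5) (by omega) w t ht
          simp only [pow_zero, one_mul] at h0 h0'
          gcongr
      _ = (d * L) * (1 / (1 + freq w ^ 2)) * (freq w / (1 + freq w * t) ^ (d + 5)) := by
          rw [Finset.sum_const, Finset.card_univ, Fintype.card_fin, nsmul_eq_mul]; ring
      _ ≤ _ := by
          gcongr
  · intro i hi
    have hr := freq_nonneg w
    have h1 : (1:ℝ) ≤ 1 + freq w * t := by nlinarith [mul_nonneg hr ht.le]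
    rw [momentHat_kernel hreg j hi w ht]
    have hterm : ∀ l ≤ i + 1, ∀ p : Fin d,
        t ^ l * (‖𝓕 (fun y : Space d => ((y j ^ (i + 1 - l) * greenGrad y p : ℝ) : ℂ)) w‖ *
        ‖𝓕 (fun v : Space d => ((v j ^ l * ∇ μ v p : ℝ) : ℂ)) (t • w)‖) ≤
        (B + 1) * L * ((1 + t) ^ i / (1 + freq w * t) ^ (d + 3)) := by
      intro l hl p
      rcases Nat.lt_or_ge l (i + 1) with hl' | hl'
      · exact pow_mul_mul_le_of_lt hr ht (by omega) hB0 hL0 (norm_nonneg _) (norm_nonneg _)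
          (hb (i + 1 - l) (by omega) j p w) (hm j p l (by omega) (d + 3) (by omega) w t ht)
      · obtain rfl : l = i + 1 := by omega
        rw [Nat.sub_self]
        have e4 : freq w * (1 / (1 + freq w ^ 2)) ≤ freq w := by
          refine mul_le_of_le_one_right hr ?_
          rw [div_le_one (by positivity)]
          nlinarith
        exact pow_mul_mul_le_of_eq hr ht hB0 hL0 (norm_nonneg _) (norm_nonneg _)
          ((h00 p j w).trans e4) (hm j p (i + 1) hi (d + 4) (by omega) w t ht)
    calc _ ≤ ∑ l ∈ Finset.range (i + 1 + 1), ((i + 1).choose l : ℝ) *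
          ∑ p : Fin d, ((B + 1) * L * ((1 + t) ^ i / (1 + freq w * t) ^ (d + 3))) := by
          refine (norm_sum_le _ _).trans (Finset.sum_le_sum fun l hl => ?_)
          have hl' := Nat.lt_succ_iff.1 (Finset.mem_range.1 hl)
          rw [norm_mul, norm_mul, norm_pow, Complex.norm_natCast, Complex.norm_real,
            Real.norm_of_nonneg ht.le, mul_assoc]
          gcongr
          calc _ ≤ t ^ l * ∑ p : Fin d, (‖𝓕 (fun y : Space d => ((y j ^ (i + 1 - l) * greenGrad y p : ℝ) : ℂ)) w‖ *
              ‖𝓕 (fun v : Space d => ((v j ^ l * ∇ μ v p : ℝ) : ℂ)) (t • w)‖) := by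
                gcongr
                exact (norm_sum_le _ _).trans (Finset.sum_le_sum fun p _ => (norm_mul_le _ _))
            _ ≤ _ := by
                rw [Finset.mul_sum]
                exact Finset.sum_le_sum fun p _ => hterm l hl' p
      _ = 2 ^ (i + 1) * (d * ((B + 1) * L)) * ((1 + t) ^ i / (1 + freq w * t) ^ (d + 3)) := by
          rw [← Finset.sum_mul, Finset.sum_const, Finset.card_univ, Fintype.card_fin, nsmul_eq_mul]
          have hch : ∑ l ∈ Finset.range (i + 1 + 1), ((i + 1).choose l : ℝ) = 2 ^ (i + 1) := by
            exact_mod_cast Nat.sum_range_choose (i + 1)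
          rw [hch, mul_assoc (2 ^ (i + 1)), mul_assoc (d : ℝ)]
      _ ≤ _ := by
          refine mul_le_mul_of_nonneg_right (le_trans ?_ hA2) (by positivity)
          exact mul_le_mul_of_nonneg_right (pow_le_pow_right₀ (by norm_num) hi) (by positivity)

lemma fourierHat_two_pi (g : Space d → ℂ) (w : Space d) :
    fourierHat g ((2 * Real.pi) • w) = 𝓕 g w := by
  rw [fourierHat, Real.fourier_eq']
  congr 1; ext x
  rw [smul_eq_mul, inner_smul_right]
  congr 2
  push_cast; ring

/-- For `s > 0` the integrand of the Penrose integral is the transformed kernel at time `s`, and a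
Laplace transform on a vertical line is the Fourier transform of the damped function. The direction
`j` is immaterial for the zeroth moment. -/
lemma penroseIntegral_eq {μ : Space d → ℝ} (hreg : RegularEquilibrium μ) (j : Fin d) (γ τ : ℝ)
    (w : Space d) :
    penroseIntegral μ γ (2 * Real.pi * τ) ((2 * Real.pi) • w) =
      𝓕 (damp γ (momentHat (kernel μ) j 0 w)) τ := by
  rw [penroseIntegral, Real.fourier_eq', ← integral_indicator measurableSet_Ioi]
  congr 1; ext s
  rcases le_or_gt s 0 with hs | hs
  · rw [indicator_of_notMem (by simpa using hs), damp,
      momentHat_of_nonpos (fun t ht x => kernel_of_nonpos ht x) j 0 w hs]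
    simp
  · rw [indicator_of_mem (by exact hs), damp, momentHat_kernel hreg j (Nat.zero_le _) w hs]
    simp only [zero_add, Finset.range_one, Finset.sum_singleton, Nat.choose_self, Nat.cast_one,
      pow_zero, one_mul, Nat.sub_self]
    rw [Finset.mul_sum, Finset.mul_sum, Finset.smul_sum]
    refine Finset.sum_congr rfl fun p _ => ?_
    have e1 : s • (2 * Real.pi) • w = (2 * Real.pi) • (s • w) := smul_comm _ _ _
    have e2 : 𝓕 (fun y : Space d => ((greenGrad y p : ℝ) : ℂ)) w = _ := fourier_greenGrad p w
    have e3 : Complex.exp (-(((γ : ℂ) + Complex.I * ((2 * Real.pi * τ : ℝ) : ℂ)) * (s : ℂ))) =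
        Complex.exp (((-2 * Real.pi * inner ℝ s τ : ℝ) : ℂ) * Complex.I) * ((Real.exp (-(γ * s)) : ℝ) : ℂ) := by
      rw [Complex.ofReal_exp, ← Complex.exp_add]
      congr 1
      simp
      ring
    rw [e1, fourierHat_two_pi, e2, e3]
    simp only [PiLp.smul_apply, smul_eq_mul]
    push_cast
    ring

end ScreenedVlasov
end

/-! ### Construction of the space-time resolvent -/

noncomputable section
namespace ScreenedVlasov
open scoped ENNReal NNReal FourierTransform
open ContinuousLinearMap (mul)
set_option linter.unusedSectionVars false

section
variable {V 𝕜 : Type*} [NormedAddCommGroup V] [MeasureSpace V] [BorelSpace V]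
  [SecondCountableTopology V] [SFinite (volume : Measure V)]
  [(volume : Measure V).IsAddLeftInvariant] [(volume : Measure V).IsNegInvariant] [RCLike 𝕜]

/-- An integrable kernel of small norm has an integrable resolvent. -/
lemma exists_integrable_resolvent {k : V → 𝕜} (hk : Integrable k) (hs : ∫ x, ‖k x‖ ≤ 1 / 2) :
    ∃ h : V → 𝕜, Integrable h ∧ h =ᵐ[volume] k + k ⋆[mul 𝕜 𝕜, volume] h := by
  have hc : ∀ f : Lp 𝕜 1 (volume : Measure V), Integrable (k + k ⋆[mul 𝕜 𝕜, volume] (f : V → 𝕜)) :=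
    fun f => hk.add (hk.integrable_convolution (mul 𝕜 𝕜) (L1.integrable_coeFn f))
  set T : Lp 𝕜 1 (volume : Measure V) → Lp 𝕜 1 (volume : Measure V) := fun f => (hc f).toL1 with hT
  have hlip : ContractingWith (1 / 2) T := by
    refine ⟨by rw [← NNReal.coe_lt_coe]; norm_num, LipschitzWith.of_dist_le_mul fun f g => ?_⟩
    rw [dist_eq_norm, dist_eq_norm, hT]
    simp only
    rw [← Integrable.toL1_sub, L1.norm_of_fun_eq_integral_norm, L1.norm_eq_integral_norm]
    have hfg : Integrable (fun x => (f - g : Lp 𝕜 1 (volume : Measure V)) x) := L1.integrable_coeFn _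
    calc _ = ∫ x, ‖(k ⋆[mul 𝕜 𝕜, volume] fun x => (f - g : Lp 𝕜 1 (volume : Measure V)) x) x‖ := by
          refine integral_congr_ae ?_
          have e : k ⋆[mul 𝕜 𝕜, volume] (fun x => (f - g : Lp 𝕜 1 (volume : Measure V)) x) =
              k ⋆[mul 𝕜 𝕜, volume] (fun x => f x - g x) :=
            convolution_congr_right _ (Lp.coeFn_sub f g)
          filter_upwards [hk.ae_convolution_exists (mul 𝕜 𝕜) (L1.integrable_coeFn f),
            hk.ae_convolution_exists (mul 𝕜 𝕜) (L1.integrable_coeFn g)] with x hf hg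
          rw [e]
          congr 1
          simp only [Pi.sub_apply, Pi.add_apply, convolution_def, ContinuousLinearMap.mul_apply', mul_sub]
          rw [integral_sub (by exact hf) (by exact hg)]
          ring
      _ ≤ (∫ x, ‖k x‖) * ∫ x, ‖(f - g : Lp 𝕜 1 (volume : Measure V)) x‖ :=
          integral_norm_convolution_le hk hfg
      _ ≤ _ := by
          simp only [NNReal.coe_div, NNReal.coe_one, NNReal.coe_ofNat]
          gcongr
  obtain ⟨f, hf, -⟩ := hlip.exists_fixedPoint 0 (edist_ne_top _ _)
  refine ⟨f, L1.integrable_coeFn f, ?_⟩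
  have h1 : T f = f := hf
  have h2 := (hc f).coeFn_toL1
  have h3 : ((hc f).toL1 : V → 𝕜) = f := by
    rw [show (hc f).toL1 = T f from rfl, h1]
  rwa [h3] at h2

end

variable {d : ℕ}

instance : (volume : Measure (ℝ × Space d)).IsAddLeftInvariant :=
  inferInstanceAs ((volume : Measure ℝ).prod (volume : Measure (Space d))).IsAddLeftInvariant

instance : (volume : Measure (ℝ × Space d)).IsNegInvariant :=
  ⟨by
    change ((volume : Measure ℝ).prod (volume : Measure (Space d))).map Neg.neg = _
    have := Measure.map_prod_map (volume : Measure ℝ) (volume : Measure (Space d)) measurable_neg measurable_neg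
    simp only [Measure.map_neg_eq_self] at this
    exact this.symm⟩

/-- The submultiplicative space-time weight. -/
def weight (β : ℝ) (q : ℝ × Space d) : ℝ := Real.exp (-(β * q.1)) * (1 + ‖q.2‖) ^ (d + 1)

lemma weight_pos (β : ℝ) (q : ℝ × Space d) : 0 < weight β q := by unfold weight; positivity

lemma measurable_weight (β : ℝ) : Measurable (weight (d := d) β) := by unfold weight; fun_prop

lemma exp_le_weight (β : ℝ) (q : ℝ × Space d) : Real.exp (-(β * q.1)) ≤ weight β q := by
  unfold weight
  refine le_mul_of_one_le_right (Real.exp_pos _).le (one_le_pow₀ ?_)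
  have := norm_nonneg q.2
  linarith

lemma one_add_pow_factorial_le (m : ℕ) {t : ℝ} (ht : 0 ≤ t) :
    (1 + t) ^ m ≤ m.factorial * Real.exp 1 * Real.exp t := by
  have h := Real.pow_div_factorial_le_exp (1 + t) (by linarith) m
  rw [div_le_iff₀ (by positivity), Real.exp_add] at h
  linarith

lemma lintegral_exp_neg (a : ℝ) (ha : 0 < a) :
    ∫⁻ t in Ioi (0:ℝ), ENNReal.ofReal (Real.exp (-(a * t))) = ENNReal.ofReal (1 / a) := by
  have h1 : IntegrableOn (fun t : ℝ => Real.exp (-(a * t))) (Ioi 0) := by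
    simpa using exp_neg_integrableOn_Ioi 0 ha
  rw [← ofReal_integral_eq_lintegral_ofReal h1 (Eventually.of_forall fun _ => (Real.exp_pos _).le)]
  congr 1
  have := integral_exp_mul_Ioi (a := -a) (by linarith) 0
  simp only [neg_mul, mul_zero, Real.exp_zero] at this
  rw [this]
  field_simp

lemma exists_weight_absKernel_small {μ : Space d → ℝ} (hreg : RegularEquilibrium μ) :
    ∃ β : ℝ, 0 < β ∧ ∫⁻ q, ENNReal.ofReal (weight β q) * absKernel μ q ≤ 1 / 2 := by
  obtain ⟨C, hC, hb⟩ := lintegral_weight_absKernel_le hreg (m := d + 1) le_rfl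
  set c := C * ((d + 1).factorial * Real.exp 1) with hc
  have hc0 : 0 ≤ c := by positivity
  -- One unit of `β` pays for the `e^t` that dominates `(1 + t)^{d+1}`; the remaining integral is `c
  -- / (2 c + 1) ≤ 1/2`.
  refine ⟨2 * c + 2, by positivity, ?_⟩
  have hmk := measurable_absKernel hreg
  have hmw := measurable_weight (d := d) (2 * c + 2)
  rw [show (volume : Measure (ℝ × Space d)) = volume.prod volume from rfl,
    lintegral_prod _ (by fun_prop)]
  calc _ ≤ ∫⁻ t : ℝ, (Ioi (0:ℝ)).indicator (fun t => ENNReal.ofReal c *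
        ENNReal.ofReal (Real.exp (-((2 * c + 1) * t)))) t := by
        refine lintegral_mono fun t => ?_
        rcases le_or_gt t 0 with ht | ht
        · simp [absKernel_of_nonpos ht]
        · rw [indicator_of_mem (by exact ht), ← ENNReal.ofReal_mul hc0]
          have e1 : ∀ x : Space d, ENNReal.ofReal (weight (2 * c + 2) (t, x)) * absKernel μ (t, x) =
              ENNReal.ofReal (Real.exp (-((2 * c + 2) * t))) *
                (ENNReal.ofReal ((1 + ‖x‖) ^ (d + 1)) * absKernel μ (t, x)) := by
            intro x
            rw [weight, ENNReal.ofReal_mul (Real.exp_pos _).le, mul_assoc]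
          simp_rw [e1]
          rw [lintegral_const_mul _ (by fun_prop)]
          refine (mul_le_mul_right (hb t ht) _).trans ?_
          rw [← ENNReal.ofReal_mul (Real.exp_pos _).le]
          apply ENNReal.ofReal_le_ofReal
          have h1 := one_add_pow_factorial_le (d + 1) ht.le
          calc _ ≤ Real.exp (-((2 * c + 2) * t)) * (C * ((d + 1).factorial * Real.exp 1 * Real.exp t)) := by
                gcongr
            _ = c * (Real.exp (-((2 * c + 2) * t)) * Real.exp t) := by rw [hc]; ring
            _ = _ := by rw [← Real.exp_add]; congr 2; ring
    _ = ENNReal.ofReal (c * (1 / (2 * c + 1))) := by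
        rw [lintegral_indicator measurableSet_Ioi, lintegral_const_mul _ (by fun_prop),
          lintegral_exp_neg _ (by positivity), ENNReal.ofReal_mul hc0]
    _ ≤ _ := by
        rw [show (1 / 2 : ℝ≥0∞) = ENNReal.ofReal (1 / 2) by
          rw [ENNReal.ofReal_div_of_pos two_pos]; simp]
        apply ENNReal.ofReal_le_ofReal
        rw [mul_one_div, div_le_div_iff₀ (by positivity) (by positivity)]
        linarith

lemma weight_kernel_small {μ : Space d → ℝ} {β : ℝ}
    (h : ∫⁻ q, ENNReal.ofReal (weight β q) * absKernel μ q ≤ 1 / 2) :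
    ∫⁻ q, ENNReal.ofReal (weight β q) * ‖kernel μ q‖ₑ ≤ 1 / 2 := by
  refine (lintegral_mono fun q => ?_).trans h
  gcongr
  exact enorm_kernel_le q

/-- The weight truncated in space. -/
def truncatedWeight (β : ℝ) (n : ℕ) (q : ℝ × Space d) : ℝ :=
  Real.exp (-(β * q.1)) * min ((1 + ‖q.2‖) ^ (d + 1)) (n + 1)

lemma measurable_truncatedWeight (β : ℝ) (n : ℕ) : Measurable (truncatedWeight (d := d) β n) := by
  unfold truncatedWeight; fun_prop

lemma one_add_norm_add_le (x y : Space d) (m : ℕ) :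
    (1 + ‖x + y‖) ^ m ≤ (1 + ‖x‖) ^ m * (1 + ‖y‖) ^ m := by
  rw [← mul_pow]
  gcongr
  have := norm_add_le x y
  nlinarith [norm_nonneg x, norm_nonneg y, mul_nonneg (norm_nonneg x) (norm_nonneg y)]

/-- Truncation keeps the weight moderate because the spatial factor of `weight` is at least `1`. The
truncated weight is dominated by a multiple of `e^{-βt}`, so the integrals to be absorbed are finite
beforehand. -/
lemma truncatedWeight_add_le (β : ℝ) (n : ℕ) (p q : ℝ × Space d) :
    truncatedWeight β n (p + q) ≤ weight β p * truncatedWeight β n q := by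
  unfold truncatedWeight weight
  have h0 : (1:ℝ) ≤ (1 + ‖p.2‖) ^ (d + 1) := one_le_pow₀ (by have := norm_nonneg p.2; linarith)
  have h1 := one_add_norm_add_le p.2 q.2 (d + 1)
  have h2 : min ((1 + ‖p.2 + q.2‖) ^ (d + 1)) ((n : ℝ) + 1) ≤
      (1 + ‖p.2‖) ^ (d + 1) * min ((1 + ‖q.2‖) ^ (d + 1)) (n + 1) := by
    rcases le_total ((1 + ‖q.2‖) ^ (d + 1)) ((n : ℝ) + 1) with h | h
    · rw [min_eq_left h]; exact (min_le_left _ _).trans h1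
    · rw [min_eq_right h]
      exact (min_le_right _ _).trans (le_mul_of_one_le_left (by positivity) h0)
  have e : Real.exp (-(β * (p + q).1)) = Real.exp (-(β * p.1)) * Real.exp (-(β * q.1)) := by
    rw [← Real.exp_add]; congr 1; simp; ring
  rw [e]
  calc _ ≤ Real.exp (-(β * p.1)) * Real.exp (-(β * q.1)) *
        ((1 + ‖p.2‖) ^ (d + 1) * min ((1 + ‖q.2‖) ^ (d + 1)) (n + 1)) :=
        mul_le_mul_of_nonneg_left h2 (by positivity)
    _ = _ := by ring

/-- `G` is the space-time resolvent of the kernel. -/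
structure IsSpaceTimeResolvent (μ : Space d → ℝ) (β : ℝ) (G : ℝ × Space d → ℝ) : Prop where
  measurable : StronglyMeasurable G
  causal : ∀ t ≤ 0, ∀ x, G (t, x) = 0
  eq : G =ᵐ[volume] kernel μ + kernel μ ⋆[mul ℝ ℝ, volume] G
  weighted : ∫⁻ q, ENNReal.ofReal (weight β q) * ‖G q‖ₑ < ⊤

lemma exp_mul_char (β : ℝ) (p q : ℝ × Space d) :
    Real.exp (-(β * (p + q).1)) = Real.exp (-(β * p.1)) * Real.exp (-(β * q.1)) := by
  rw [← Real.exp_add]; congr 1; simp; ring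

lemma lintegral_exp_kernel_le {μ : Space d → ℝ} {β : ℝ}
    (hsmall : ∫⁻ q, ENNReal.ofReal (weight β q) * ‖kernel μ q‖ₑ ≤ 1 / 2) :
    ∫⁻ q : ℝ × Space d, ENNReal.ofReal (Real.exp (-(β * q.1))) * ‖kernel μ q‖ₑ ≤ 1 / 2 := by
  refine (lintegral_mono fun q => ?_).trans hsmall
  gcongr
  exact exp_le_weight β q

/-- A causal version of an absorption argument: a function with `|a| ≤ |k| * |a|` vanishes. -/
lemma ae_eq_zero_of_absorption {μ : Space d → ℝ} (hreg : RegularEquilibrium μ) {w W : ℝ × Space d → ℝ≥0∞}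
    (hw : Measurable w) (hW : Measurable W) (h : ∀ x y, W (x + y) ≤ w x * W y) (h0 : ∀ x, W x ≠ 0)
    (hsmall : ∫⁻ q, w q * ‖kernel μ q‖ₑ ≤ 1 / 2) {a : ℝ × Space d → ℝ≥0∞} (ha : AEMeasurable a)
    (hle : ∀ᵐ q, a q ≤ lconv (fun q => ‖kernel μ q‖ₑ) a q) (hfin : ∫⁻ q, W q * a q < ⊤) :
    a =ᵐ[volume] 0 := by
  have h1 := lintegral_le_of_absorption (b := 0) (measurable_kernel hreg).enorm.aemeasurable ha
    aemeasurable_zero hw hW h (by simpa using hle) hsmall hfin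
  simp only [Pi.zero_apply, mul_zero, lintegral_zero, nonpos_iff_eq_zero] at h1
  replace h1 := (lintegral_eq_zero_iff' (hW.aemeasurable.mul ha)).1 h1
  filter_upwards [h1] with q hq
  rcases mul_eq_zero.1 hq with h2 | h2
  · exact absurd h2 (h0 q)
  · exact h2

/-- Causality: the kernel vanishes for nonpositive times, so the convolution at a time `≤ T` only
sees times `≤ T`. Absorption can thus be localized to half-lines in time. -/
lemma indicator_le_lconv_kernel {μ : Space d → ℝ} {T : ℝ} {u b : ℝ × Space d → ℝ≥0∞} {q : ℝ × Space d}
    (h : q.1 ≤ T → u q ≤ b q + lconv (fun q => ‖kernel μ q‖ₑ) u q) :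
    {q : ℝ × Space d | q.1 ≤ T}.indicator u q ≤ {q : ℝ × Space d | q.1 ≤ T}.indicator b q +
      lconv (fun q => ‖kernel μ q‖ₑ) ({q : ℝ × Space d | q.1 ≤ T}.indicator u) q := by
  by_cases hq : q.1 ≤ T
  · rw [indicator_of_mem (by exact hq), indicator_of_mem (by exact hq)]
    refine (h hq).trans ?_
    gcongr
    refine lintegral_mono fun y => ?_
    rcases le_or_gt y.1 0 with hy | hy
    · have : kernel μ y = 0 := kernel_of_nonpos hy y.2
      simp [this]
    · rw [indicator_of_mem (by simp only [mem_ofPred_eq, Prod.fst_sub]; linarith)]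
  · rw [indicator_of_notMem (by exact hq)]
    exact (zero_le)

lemma enorm_le_add_lconv {k u q : ℝ × Space d → ℝ} {x : ℝ × Space d}
    (h : u x = q x + (k ⋆[mul ℝ ℝ, volume] u) x) :
    ‖u x‖ₑ ≤ ‖q x‖ₑ + lconv (fun q => ‖k q‖ₑ) (fun q => ‖u q‖ₑ) x := by
  rw [h]
  exact (enorm_add_le _ _).trans (add_le_add le_rfl (enorm_convolution_le k u x))

/-- After conjugation with the character `e^{-βt}` the kernel has norm at most `1/2`, and the
contraction principle gives a solution integrable under the exponential weight. Causality and the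
spatial weight are then both obtained by absorption. -/
lemma exists_spaceTimeResolvent {μ : Space d → ℝ} (hreg : RegularEquilibrium μ) {β : ℝ}
    (hsmall : ∫⁻ q, ENNReal.ofReal (weight β q) * ‖kernel μ q‖ₑ ≤ 1 / 2) :
    ∃ G, IsSpaceTimeResolvent μ β G := by
  have hmk := measurable_kernel hreg
  have hmw := measurable_weight (d := d) β
  set χ : ℝ × Space d → ℝ := fun q => Real.exp (-(β * q.1)) with hχ
  have hχm : Measurable χ := by simp only [hχ]; fun_prop
  have hχa : ∀ p q, χ (p + q) = χ p * χ q := exp_mul_char β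
  have hχ0 : ∀ q, 0 < χ q := fun q => Real.exp_pos _
  have hen : ∀ (f : ℝ × Space d → ℝ) q, ‖χ q * f q‖ₑ = ENNReal.ofReal (χ q) * ‖f q‖ₑ := by
    intro f q
    rw [enorm_mul, Real.enorm_of_nonneg (hχ0 q).le]
  have hexp := lintegral_exp_kernel_le hsmall
  have hki : Integrable fun q => χ q * kernel μ q := by
    refine ⟨(hχm.mul hmk).aestronglyMeasurable, ?_⟩
    rw [hasFiniteIntegral_iff_enorm]
    simp_rw [hen]
    exact hexp.trans_lt (by simp)
  have hks : ∫ q, ‖χ q * kernel μ q‖ ≤ 1 / 2 := by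
    rw [integral_norm_eq_lintegral_enorm hki.1]
    simp_rw [hen]
    exact (ENNReal.toReal_mono (by simp) hexp).trans (by simp)
  obtain ⟨g, hg, hgeq⟩ := exists_integrable_resolvent hki hks
  set h : ℝ × Space d → ℝ := fun q => (χ q)⁻¹ * hg.1.mk g q with hh
  have hhm : StronglyMeasurable h := (hχm.inv.stronglyMeasurable).mul hg.1.stronglyMeasurable_mk
  have hχh : (fun q => χ q * h q) =ᵐ[volume] g := by
    filter_upwards [hg.1.ae_eq_mk] with q hq
    rw [hh, hq, mul_inv_cancel_left₀ (hχ0 q).ne']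
  have heq : h =ᵐ[volume] kernel μ + kernel μ ⋆[mul ℝ ℝ, volume] h := by
    refine ae_eq_of_char_mul hχa (fun q => (hχ0 q).ne') ?_
    rw [convolution_congr_right _ hχh]
    exact hχh.trans hgeq
  have hfin : ∫⁻ q, ENNReal.ofReal (χ q) * ‖h q‖ₑ < ⊤ := by
    have := (hg.congr hχh.symm).2
    rw [hasFiniteIntegral_iff_enorm] at this
    simpa only [hen] using this
  have hle : ∀ᵐ q, ‖h q‖ₑ ≤ ‖kernel μ q‖ₑ + lconv (fun q => ‖kernel μ q‖ₑ) (fun q => ‖h q‖ₑ) q := by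
    filter_upwards [heq] with q hq
    exact enorm_le_add_lconv hq
  -- On `t ≤ 0` the source term `kernel μ` vanishes, so the restriction of `|h|` is bounded by its
  -- convolution with a kernel of norm at most `1/2`, and is zero.
  have hcausal : ∀ᵐ q : ℝ × Space d, q.1 ≤ 0 → h q = 0 := by
    have hms : MeasurableSet {q : ℝ × Space d | q.1 ≤ 0} := measurableSet_le measurable_fst measurable_const
    have := ae_eq_zero_of_absorption hreg (w := fun q => ENNReal.ofReal (χ q))
      (W := fun q => ENNReal.ofReal (χ q)) hχm.ennreal_ofReal hχm.ennreal_ofReal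
      (fun p q => by rw [hχa, ENNReal.ofReal_mul (hχ0 p).le])
      (fun q => by simpa using hχ0 q) hexp
      (a := {q : ℝ × Space d | q.1 ≤ 0}.indicator fun q => ‖h q‖ₑ)
      (hhm.measurable.enorm.aemeasurable.indicator hms) ?_ ?_
    · filter_upwards [this] with q hq h0
      rw [indicator_of_mem (by exact h0)] at hq
      simpa using hq
    · filter_upwards [hle] with q hq
      have h1 := indicator_le_lconv_kernel (T := 0) (b := fun q => ‖kernel μ q‖ₑ) (fun _ => hq)
      refine h1.trans (le_of_eq ?_)
      have : {q : ℝ × Space d | q.1 ≤ 0}.indicator (fun q => ‖kernel μ q‖ₑ) q = 0 := by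
        rw [indicator_apply_eq_zero]
        intro h0
        rw [kernel_of_nonpos (t := q.1) h0 q.2, enorm_zero]
      rw [this, zero_add]
    · refine lt_of_le_of_lt (lintegral_mono fun q => ?_) hfin
      gcongr
      exact indicator_le_self _ _ q
  have hweight : ∫⁻ q, ENNReal.ofReal (weight β q) * ‖h q‖ₑ < ⊤ := by
    refine lt_of_le_of_lt (lintegral_le_of_tendsto_of_le (C := 1)
      (f := fun n q => ENNReal.ofReal (truncatedWeight β n q) * ‖h q‖ₑ) (fun n => ?_)
      (Eventually.of_forall fun q => ?_) fun n => ?_) ENNReal.one_lt_top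
    · exact ((measurable_truncatedWeight β n).ennreal_ofReal.mul hhm.measurable.enorm).aemeasurable
    · refine tendsto_const_nhds.congr' ?_
      obtain ⟨N, hN⟩ := exists_nat_ge ((1 + ‖q.2‖) ^ (d + 1))
      filter_upwards [eventually_ge_atTop N] with n hn
      have : (N : ℝ) ≤ n := by exact_mod_cast hn
      rw [truncatedWeight, min_eq_left (by linarith), weight]
    · have := lintegral_le_of_absorption (a := fun q => ‖h q‖ₑ) (b := fun q => ‖kernel μ q‖ₑ)
        hmk.enorm.aemeasurable hhm.measurable.enorm.aemeasurable hmk.enorm.aemeasurable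
        hmw.ennreal_ofReal (measurable_truncatedWeight β n).ennreal_ofReal
        (fun p q => by
          rw [← ENNReal.ofReal_mul (weight_pos β p).le]
          exact ENNReal.ofReal_le_ofReal (truncatedWeight_add_le β n p q)) hle hsmall ?_
      · refine this.trans ?_
        calc _ ≤ 2 * ∫⁻ q, ENNReal.ofReal (weight β q) * ‖kernel μ q‖ₑ := by
              gcongr with q
              unfold truncatedWeight weight
              gcongr
              exact min_le_left _ _
          _ ≤ 2 * (1 / 2) := by gcongr
          _ = 1 := by simp [ENNReal.mul_inv_cancel]
      · refine lt_of_le_of_lt (b := ∫⁻ q, ENNReal.ofReal (n + 1) * (ENNReal.ofReal (χ q) * ‖h q‖ₑ))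
          (lintegral_mono fun q => ?_) ?_
        · rw [← mul_assoc, ← ENNReal.ofReal_mul (by positivity), mul_comm ((n : ℝ) + 1)]
          gcongr
          unfold truncatedWeight
          gcongr
          exact min_le_right _ _
        · rw [lintegral_const_mul' _ _ ENNReal.ofReal_ne_top]
          exact ENNReal.mul_lt_top ENNReal.ofReal_lt_top hfin
  -- Cutting off nonpositive times changes `h` on a null set only and makes it vanish there
  -- everywhere rather than almost everywhere.
  have hms : MeasurableSet {q : ℝ × Space d | 0 < q.1} := measurableSet_lt measurable_const measurable_fst
  have hind : {q : ℝ × Space d | 0 < q.1}.indicator h =ᵐ[volume] h := by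
    filter_upwards [hcausal] with q hq
    by_cases h0 : 0 < q.1
    · rw [indicator_of_mem (by exact h0)]
    · rw [indicator_of_notMem (by exact h0), hq (not_lt.1 h0)]
  refine ⟨{q : ℝ × Space d | 0 < q.1}.indicator h, hhm.indicator hms, fun t ht x => ?_, ?_, ?_⟩
  · exact indicator_of_notMem (by simpa using ht) _
  · rw [convolution_congr_right _ hind]
    exact hind.trans heq
  · refine lt_of_le_of_lt (le_of_eq (lintegral_congr_ae ?_)) hweight
    filter_upwards [hind] with q hq
    rw [hq]

end ScreenedVlasov
end

/-! ### The resolvent at fixed frequency -/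

noncomputable section
namespace ScreenedVlasov
open scoped ENNReal NNReal FourierTransform
open ContinuousLinearMap (mul)
set_option linter.unusedSectionVars false

variable {d : ℕ}

lemma ofReal_convolution {V : Type*} [AddCommGroup V] [MeasureSpace V] (f g : V → ℝ) (x : V) :
    (((f ⋆[mul ℝ ℝ, volume] g) x : ℝ) : ℂ) =
      ((fun y => (f y : ℂ)) ⋆[mul ℂ ℂ, volume] (fun y => (g y : ℂ))) x := by
  simp only [convolution_def, ContinuousLinearMap.mul_apply']
  rw [← integral_complex_ofReal]
  congr 1; ext y; push_cast; rfl

/-- The damped plane wave. -/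
def planeChar (β : ℝ) (w : Space d) (q : ℝ × Space d) : ℂ :=
  ((Real.exp (-(β * q.1)) : ℝ) : ℂ) * (Real.fourierChar (-(inner ℝ q.2 w)) : ℂ)

lemma planeChar_add (β : ℝ) (w : Space d) (p q : ℝ × Space d) :
    planeChar β w (p + q) = planeChar β w p * planeChar β w q := by
  simp only [planeChar]
  rw [exp_mul_char, Prod.snd_add, inner_add_left, neg_add, AddChar.map_add_eq_mul]
  push_cast
  ring

lemma norm_planeChar (β : ℝ) (w : Space d) (q : ℝ × Space d) :
    ‖planeChar β w q‖ = Real.exp (-(β * q.1)) := by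
  rw [planeChar, norm_mul, Complex.norm_real, Circle.norm_coe, mul_one,
    Real.norm_of_nonneg (Real.exp_pos _).le]

lemma continuous_planeChar (β : ℝ) (w : Space d) : Continuous (planeChar β w) := by
  unfold planeChar
  refine Continuous.mul (by fun_prop) ?_
  exact continuous_subtype_val.comp (by fun_prop)

/-- The moments of a space-time function against the damped plane wave. -/
def modulated (β : ℝ) (w : Space d) (j : Fin d) (i : ℕ) (f : ℝ × Space d → ℝ) (q : ℝ × Space d) : ℂ :=
  planeChar β w q * ((q.2 j ^ i * f q : ℝ) : ℂ)

lemma integral_modulated (β : ℝ) (w : Space d) (j : Fin d) (i : ℕ) (f : ℝ × Space d → ℝ) (t : ℝ) :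
    ∫ x, modulated β w j i f (t, x) = damp β (momentHat f j i w) t := by
  rw [damp, momentHat, Real.fourier_eq, ← integral_const_mul]
  congr 1; ext x
  rw [modulated, planeChar, Circle.smul_def, smul_eq_mul, mul_assoc]

lemma norm_coord_pow_le (x : Space d) (j : Fin d) {i : ℕ} (hi : i ≤ d + 1) :
    ‖x j‖ ^ i ≤ (1 + ‖x‖) ^ (d + 1) := by
  have := PiLp.norm_apply_le x j
  calc ‖x j‖ ^ i ≤ (1 + ‖x‖) ^ i := by gcongr; linarith
    _ ≤ _ := pow_le_pow_right₀ (by linarith [norm_nonneg x]) hi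

lemma integrable_modulated {β : ℝ} {f : ℝ × Space d → ℝ} (hf : AEStronglyMeasurable f)
    (h : ∫⁻ q, ENNReal.ofReal (weight β q) * ‖f q‖ₑ < ⊤) (w : Space d) (j : Fin d) {i : ℕ}
    (hi : i ≤ d + 1) : Integrable (modulated β w j i f) := by
  refine ⟨(continuous_planeChar β w).aestronglyMeasurable.mul ?_, ?_⟩
  · exact Complex.continuous_ofReal.comp_aestronglyMeasurable
      ((Continuous.aestronglyMeasurable (by fun_prop)).mul hf)
  · rw [hasFiniteIntegral_iff_enorm]
    refine lt_of_le_of_lt (lintegral_mono fun q => ?_) h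
    rw [modulated, enorm_mul, ← ofReal_norm, norm_planeChar, ← ofReal_norm, ← ofReal_norm,
      ← ENNReal.ofReal_mul (Real.exp_pos _).le, ← ENNReal.ofReal_mul (weight_pos β q).le]
    apply ENNReal.ofReal_le_ofReal
    rw [Complex.norm_real, norm_mul, norm_pow, weight, ← mul_assoc]
    gcongr
    exact norm_coord_pow_le q.2 j hi

lemma ae_exists_convolution_moments {β : ℝ} {f g : ℝ × Space d → ℝ} (hf : AEStronglyMeasurable f)
    (hg : AEStronglyMeasurable g)
    (h1 : ∫⁻ q, ENNReal.ofReal (weight β q) * ‖f q‖ₑ < ⊤)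
    (h2 : ∫⁻ q, ENNReal.ofReal (weight β q) * ‖g q‖ₑ < ⊤) (j : Fin d) {i i' : ℕ}
    (hi : i ≤ d + 1) (hi' : i' ≤ d + 1) :
    ∀ᵐ q, ConvolutionExistsAt (fun q => q.2 j ^ i * f q) (fun q => q.2 j ^ i' * g q) q
      (mul ℝ ℝ) volume := by
  have key : ∀ (i : ℕ), i ≤ d + 1 → ∀ f : ℝ × Space d → ℝ,
      ∫⁻ q, ENNReal.ofReal (weight β q) * ‖f q‖ₑ < ⊤ →
      ∫⁻ q, ENNReal.ofReal (Real.exp (-(β * q.1))) * ‖q.2 j ^ i * f q‖ₑ < ⊤ := by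
    intro i hi f h
    refine lt_of_le_of_lt (lintegral_mono fun q => ?_) h
    rw [← ofReal_norm, ← ofReal_norm,
      ← ENNReal.ofReal_mul (Real.exp_pos _).le, ← ENNReal.ofReal_mul (weight_pos β q).le]
    apply ENNReal.ofReal_le_ofReal
    rw [norm_mul, norm_pow, weight, ← mul_assoc]
    gcongr
    exact norm_coord_pow_le q.2 j hi
  have hm : Measurable fun q : ℝ × Space d => ENNReal.ofReal (Real.exp (-(β * q.1))) := by fun_prop
  refine ae_convolutionExistsAt_of_weight ((Continuous.aestronglyMeasurable (by fun_prop)).mul hf)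
    ((Continuous.aestronglyMeasurable (by fun_prop)).mul hg) hm hm (fun p q => ?_) (fun q => ?_)
    (key i hi f h1) (key i' hi' g h2)
  · rw [exp_mul_char, ENNReal.ofReal_mul (Real.exp_pos _).le]
  · simpa using Real.exp_pos _

/-- Multiplication by `x_j` is a derivation and the damped plane wave is a character, so both pass
through `G = K + K * G`. The spatial weight of order `d + 1` guarantees that all convolutions in the
Leibniz formula exist. -/
lemma IsSpaceTimeResolvent.modulated_eq {μ : Space d → ℝ} (hreg : RegularEquilibrium μ) {β : ℝ}
    (hsmall : ∫⁻ q, ENNReal.ofReal (weight β q) * ‖kernel μ q‖ₑ ≤ 1 / 2)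
    {G : ℝ × Space d → ℝ} (hG : IsSpaceTimeResolvent μ β G) (w : Space d) (j : Fin d) {m : ℕ}
    (hm : m ≤ d + 1) :
    ∀ᵐ q, modulated β w j m G q = modulated β w j m (kernel μ) q +
      ∑ i ∈ Finset.range (m + 1), (m.choose i : ℂ) *
        (modulated β w j i (kernel μ) ⋆[mul ℂ ℂ, volume] modulated β w j (m - i) G) q := by
  have hk := (measurable_kernel hreg).aestronglyMeasurable (μ := volume)
  have h1 : ∀ᵐ q, ∀ i ∈ Finset.range (m + 1), ConvolutionExistsAt (fun q => q.2 j ^ i * kernel μ q)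
      (fun q => q.2 j ^ (m - i) * G q) q (mul ℝ ℝ) volume := by
    rw [Finset.eventually_all]
    intro i hi
    have := Finset.mem_range.1 hi
    exact ae_exists_convolution_moments hk hG.measurable.aestronglyMeasurable
      (hsmall.trans_lt (by simp)) hG.weighted j (by omega) (by omega)
  filter_upwards [hG.eq, h1] with q hq hex
  have h2 := pow_mul_convolution (l := fun q : ℝ × Space d => q.2 j) (fun x y => by simp)
    (kernel μ) G m q fun i hi => hex i (Finset.mem_range.2 (by omega))
  rw [modulated, hq, Pi.add_apply, mul_add, h2, Complex.ofReal_add, mul_add, ← modulated]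
  congr 1
  rw [Complex.ofReal_sum, Finset.mul_sum]
  refine Finset.sum_congr rfl fun i _ => ?_
  rw [Complex.ofReal_mul, ofReal_convolution, mul_left_comm, char_mul_convolution (planeChar_add β w)]
  rfl

/-- Integrating the modulated equation over `x` turns space-time convolution into convolution in
time; dividing by `e^{-βt}` gives the Leibniz identities at fixed frequency. -/
lemma IsSpaceTimeResolvent.isDerivedResolvent {μ : Space d → ℝ} (hreg : RegularEquilibrium μ) {β : ℝ}
    (hsmall : ∫⁻ q, ENNReal.ofReal (weight β q) * ‖kernel μ q‖ₑ ≤ 1 / 2)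
    {G : ℝ × Space d → ℝ} (hG : IsSpaceTimeResolvent μ β G) (w : Space d) (j : Fin d) :
    IsDerivedResolvent (d + 1) (fun i => momentHat (kernel μ) j i w) (fun i => momentHat G j i w) := by
  have hk := (measurable_kernel hreg).aestronglyMeasurable (μ := volume)
  have hki : ∀ i ≤ d + 1, Integrable (modulated β w j i (kernel μ)) := fun i hi =>
    integrable_modulated hk (hsmall.trans_lt (by simp)) w j hi
  have hGi : ∀ i ≤ d + 1, Integrable (modulated β w j i G) := fun i hi =>
    integrable_modulated hG.measurable.aestronglyMeasurable hG.weighted w j hi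
  have hint : ∀ (f : ℝ × Space d → ℝ) i, Integrable (modulated β w j i f) →
      Integrable (damp β (momentHat f j i w)) := by
    intro f i hf
    have h1 : Integrable (modulated β w j i f) (volume.prod volume) := hf
    refine h1.integral_prod_left.congr (Eventually.of_forall fun t => ?_)
    exact integral_modulated β w j i f t
  refine ⟨fun i _ t ht => momentHat_of_nonpos (fun t ht x => kernel_of_nonpos ht x) j i w ht,
    fun i _ t ht => momentHat_of_nonpos hG.causal j i w ht,
    ⟨β, fun i hi => hint _ i (hki i hi), fun i hi => hint _ i (hGi i hi)⟩, fun m hm => ?_⟩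
  have hae := hG.modulated_eq hreg hsmall w j hm
  have hae' : ∀ᵐ t : ℝ, ∀ᵐ x : Space d, modulated β w j m G (t, x) =
      modulated β w j m (kernel μ) (t, x) + ∑ i ∈ Finset.range (m + 1), (m.choose i : ℂ) *
        (modulated β w j i (kernel μ) ⋆[mul ℂ ℂ, volume] modulated β w j (m - i) G) (t, x) :=
    Measure.ae_ae_of_ae_prod hae
  have hci : ∀ i ∈ Finset.range (m + 1), Integrable
      (modulated β w j i (kernel μ) ⋆[mul ℂ ℂ, volume] modulated β w j (m - i) G)
      ((volume : Measure ℝ).prod (volume : Measure (Space d))) := by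
    intro i hi
    have := Finset.mem_range.1 hi
    exact (hki i (by omega)).integrable_convolution (mul ℂ ℂ) (hGi (m - i) (by omega))
  have h1 : ∀ᵐ t : ℝ, ∀ i ∈ Finset.range (m + 1), Integrable (fun x : Space d =>
      (modulated β w j i (kernel μ) ⋆[mul ℂ ℂ, volume] modulated β w j (m - i) G) (t, x)) := by
    rw [Finset.eventually_all]
    exact fun i hi => (hci i hi).prod_right_ae
  have h2 : ∀ᵐ t : ℝ, ∀ i ∈ Finset.range (m + 1), (∫ x : Space d,
      (modulated β w j i (kernel μ) ⋆[mul ℂ ℂ, volume] modulated β w j (m - i) G) (t, x)) =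
      damp β (momentHat (kernel μ) j i w ⋆[mul ℂ ℂ, volume] momentHat G j (m - i) w) t := by
    rw [Finset.eventually_all]
    intro i hi
    have := Finset.mem_range.1 hi
    filter_upwards [ae_integral_convolution_eq (hki i (by omega)) (hGi (m - i) (by omega))] with t ht
    rw [ht, damp_convolution]
    simp only [integral_modulated]
  have h3 : ∀ᵐ t : ℝ, Integrable (fun x : Space d => modulated β w j m (kernel μ) (t, x)) := by
    have : Integrable (modulated β w j m (kernel μ)) (volume.prod volume) := hki m hm
    exact this.prod_right_ae
  filter_upwards [hae', h1, h2, h3] with t ht h1 h2 h3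
  have h4 := integral_congr_ae ht
  rw [integral_add h3 (integrable_finsetSum _ fun i hi => (h1 i hi).const_mul _),
    integral_finsetSum _ fun i hi => (h1 i hi).const_mul _, integral_modulated, integral_modulated] at h4
  refine mul_left_cancel₀ (exp_char_ne_zero β t) ?_
  have h5 : damp β (momentHat G j m w) t = ((Real.exp (-(β * t)) : ℝ) : ℂ) * momentHat G j m w t := rfl
  rw [← h5, h4, mul_add, Finset.mul_sum, damp]
  congr 1
  refine Finset.sum_congr rfl fun i hi => ?_
  rw [integral_const_mul, h2 i hi, damp]
  ring

lemma measurable_of_damp {β : ℝ} {h : ℝ → ℂ} (hh : AEStronglyMeasurable (damp β h)) :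
    AEStronglyMeasurable h := by
  have h1 : AEStronglyMeasurable (fun t => ((Real.exp (-(β * t)) : ℝ) : ℂ)⁻¹ * damp β h t) := by
    refine AEStronglyMeasurable.mul ?_ hh
    apply Measurable.aestronglyMeasurable
    fun_prop
  refine h1.congr (Eventually.of_forall fun t => ?_)
  simp only [damp]
  rw [inv_mul_cancel_left₀ (exp_char_ne_zero β t)]

/-- The Fourier transform of the resolvent and its frequency derivatives decay like powers of
`1 + |ξ| t`. -/
lemma momentHat_resolvent_bound {μ : Space d → ℝ} (hreg : RegularEquilibrium μ)
    (hpen : PenroseStable μ) {β : ℝ}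
    (hsmall : ∫⁻ q, ENNReal.ofReal (weight β q) * ‖kernel μ q‖ₑ ≤ 1 / 2)
    {G : ℝ × Space d → ℝ} (hG : IsSpaceTimeResolvent μ β G) :
    ∃ B : ℝ, 0 ≤ B ∧ ∀ (j : Fin d) (w : Space d), w ≠ 0 → ∀ᵐ t : ℝ, 0 < t →
      ‖momentHat G j 0 w t‖ ≤
        B * (1 / (1 + freq w ^ 2)) * (freq w / (1 + freq w * t) ^ (d + 3)) ∧
      ∀ i, i + 1 ≤ d + 1 → ‖momentHat G j (i + 1) w t‖ ≤
        B * ((1 + t) ^ i / (1 + freq w * t) ^ (d + 3)) := by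
  obtain ⟨A, hA, hk⟩ := momentHat_kernel_bound hreg
  obtain ⟨κ, hκ, hpen⟩ := hpen
  obtain ⟨D, hD, h0⟩ := resolvent_decay hA hκ (N := d + 3) (by omega)
  obtain ⟨B, hB, h1⟩ := derived_resolvent_decay hA hD (N := d + 3) (by omega) (d + 1)
  refine ⟨max D B, le_max_of_le_left hD, fun j w hw => ?_⟩
  have hr := freq_pos hw
  have H := hG.isDerivedResolvent hreg hsmall w j
  obtain ⟨β', hβk, hβh⟩ := H.integrable
  have hb0 : 0 ≤ 1 / (1 + freq w ^ 2) := by positivity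
  have hb1 : 1 / (1 + freq w ^ 2) ≤ 1 := by
    rw [div_le_one (by positivity)]; nlinarith
  have hdk : IsDecayKernel (freq w) (A * (1 / (1 + freq w ^ 2))) (d + 3 + 2)
      (momentHat (kernel μ) j 0 w) :=
    ⟨measurable_of_damp (hβk 0 (Nat.zero_le _)).1, H.causal_kernel 0 (Nat.zero_le _),
      fun t ht => (hk j w t ht).1⟩
  have hres : IsResolvent (momentHat (kernel μ) j 0 w) (momentHat G j 0 w) := by
    refine ⟨measurable_of_damp (hβh 0 (Nat.zero_le _)).1, H.causal 0 (Nat.zero_le _),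
      ⟨β', hβh 0 (Nat.zero_le _)⟩, ?_⟩
    filter_upwards [H.leibniz 0 (Nat.zero_le _)] with t ht
    rw [ht]
    simp
  have e0 := h0 (freq w) (1 / (1 + freq w ^ 2)) _ _ hr hb0 hb1 hdk hres fun γ hγ τ => by
    rw [← penroseIntegral_eq hreg]
    exact hpen γ hγ _ _
  -- For the derivatives the factor `1 / (1 + freq²)` is not needed and is bounded by `1`.
  have e1 := h1 (freq w) _ _ hr H (by
    filter_upwards [e0] with t ht h
    refine (ht h).trans ?_
    gcongr
    exact mul_le_of_le_one_right hD hb1) fun i hi t ht => (hk j w t ht).2 i hi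
  have e2 : ∀ᵐ t : ℝ, ∀ i ∈ Finset.range (d + 1), 0 < t → ‖momentHat G j (i + 1) w t‖ ≤
      B * ((1 + t) ^ i / (1 + freq w * t) ^ (d + 3)) := by
    rw [Finset.eventually_all]
    intro i hi
    exact e1 i (by have := Finset.mem_range.1 hi; omega)
  filter_upwards [e0, e2] with t h0 h2 ht
  refine ⟨(h0 ht).trans ?_, fun i hi => (h2 i (Finset.mem_range.2 (by omega)) ht).trans ?_⟩
  · gcongr
    exact le_max_left _ _
  · gcongr
    exact le_max_right _ _

lemma stronglyMeasurable_momentHat {G : ℝ × Space d → ℝ} (hG : StronglyMeasurable G) (j : Fin d)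
    (i : ℕ) : StronglyMeasurable fun q : Space d × ℝ => momentHat G j i q.1 q.2 := by
  have : (fun q : Space d × ℝ => momentHat G j i q.1 q.2) = fun q => ∫ x : Space d,
      (Real.fourierChar (-(inner ℝ x q.1)) : ℂ) * ((x j ^ i * G (q.2, x) : ℝ) : ℂ) := by
    ext q
    rw [momentHat, Real.fourier_eq]
    rfl
  rw [this]
  refine StronglyMeasurable.integral_prod_right (f := fun (q : Space d × ℝ) (x : Space d) =>
    (Real.fourierChar (-(inner ℝ x q.1)) : ℂ) * ((x j ^ i * G (q.2, x) : ℝ) : ℂ)) ?_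
  simp only [Function.uncurry_def]
  refine StronglyMeasurable.mul ?_ ?_
  · apply Continuous.stronglyMeasurable
    exact continuous_subtype_val.comp (by fun_prop)
  · refine Complex.continuous_ofReal.comp_stronglyMeasurable (StronglyMeasurable.mul ?_ ?_)
    · apply Continuous.stronglyMeasurable; fun_prop
    · exact hG.comp_measurable (by fun_prop)

/-- For almost every time the bounds on the Fourier transform hold at almost every frequency. -/
lemma ae_momentHat_resolvent_bound (hd : 0 < d) {μ : Space d → ℝ} (hreg : RegularEquilibrium μ)
    (hpen : PenroseStable μ) {β : ℝ}
    (hsmall : ∫⁻ q, ENNReal.ofReal (weight β q) * ‖kernel μ q‖ₑ ≤ 1 / 2)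
    {G : ℝ × Space d → ℝ} (hG : IsSpaceTimeResolvent μ β G) :
    ∃ B : ℝ, 0 ≤ B ∧ ∀ᵐ t : ℝ, 0 < t → ∀ (j : Fin d), ∀ᵐ w : Space d,
      ‖momentHat G j 0 w t‖ ≤
        B * (1 / (1 + freq w ^ 2)) * (freq w / (1 + freq w * t) ^ (d + 3)) ∧
      ∀ i, i + 1 ≤ d + 1 → ‖momentHat G j (i + 1) w t‖ ≤
        B * ((1 + t) ^ i / (1 + freq w * t) ^ (d + 3)) := by
  have : Nonempty (Fin d) := ⟨⟨0, hd⟩⟩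
  have : Nontrivial (Space d) := inferInstance
  obtain ⟨B, hB, h⟩ := momentHat_resolvent_bound hreg hpen hsmall hG
  refine ⟨B, hB, ?_⟩
  -- The bounds hold at each frequency for almost every time, with an exceptional set depending on
  -- the frequency. Joint measurability lets Fubini exchange the two quantifiers.
  have hms : ∀ j, MeasurableSet {q : Space d × ℝ | 0 < q.2 →
      ‖momentHat G j 0 q.1 q.2‖ ≤
        B * (1 / (1 + freq q.1 ^ 2)) * (freq q.1 / (1 + freq q.1 * q.2) ^ (d + 3)) ∧
      ∀ i, i + 1 ≤ d + 1 → ‖momentHat G j (i + 1) q.1 q.2‖ ≤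
        B * ((1 + q.2) ^ i / (1 + freq q.1 * q.2) ^ (d + 3))} := by
    intro j
    have hf : Measurable (freq (d := d)) := by unfold freq; fun_prop
    have hm := fun i => (stronglyMeasurable_momentHat hG.measurable j i).measurable
    have key : ∀ (i : ℕ) (g : Space d × ℝ → ℝ), Measurable g →
        Measurable fun q : Space d × ℝ => ‖momentHat G j i q.1 q.2‖ ≤ g q := fun i g hg =>
      measurableSet_setOfPred.1 (measurableSet_le (hm i).norm hg)
    refine measurableSet_setOfPred.2 (Measurable.imp (measurableSet_setOfPred.1
      (measurableSet_lt measurable_const measurable_snd)) ((key 0 _ (by fun_prop)).and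
      (Measurable.forall fun i => Measurable.imp measurable_const (key (i + 1) _ (by fun_prop)))))
  have hw : ∀ᵐ w : Space d, w ≠ 0 := by rw [ae_iff]; simp
  have h2 : ∀ j, ∀ᵐ t : ℝ, ∀ᵐ w : Space d, 0 < t →
      ‖momentHat G j 0 w t‖ ≤
        B * (1 / (1 + freq w ^ 2)) * (freq w / (1 + freq w * t) ^ (d + 3)) ∧
      ∀ i, i + 1 ≤ d + 1 → ‖momentHat G j (i + 1) w t‖ ≤
        B * ((1 + t) ^ i / (1 + freq w * t) ^ (d + 3)) := by
    intro j
    refine (Measure.ae_ae_comm (hms j)).1 ?_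
    filter_upwards [hw] with w hw using h j w hw
  filter_upwards [eventually_all.2 h2] with t ht hpos j
  filter_upwards [ht j] with w hw using hw hpos

end ScreenedVlasov
end

/-! ### Frequency integrals and Fourier inversion -/

noncomputable section
namespace ScreenedVlasov
open scoped ENNReal NNReal FourierTransform
open ContinuousLinearMap (mul)
set_option linter.unusedSectionVars false

variable {d : ℕ}

/-- In polar coordinates the integrand is `y^{d-1+k} / (1 + y)^{d+3}`. The exponent is nonnegative
since `0 < d + k`, and at most `d + 1` since `k ≤ 2`, which leaves `(1 + y)^{-2}`. -/
lemma integrable_zpow_div (hd : 0 < d) {k : ℤ} (hk : -1 ≤ k) (hk2 : k ≤ 2) (hdk : 0 < d + k) :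
    Integrable fun w : Space d => ‖w‖ ^ k / (1 + ‖w‖) ^ (d + 3) := by
  have : Nonempty (Fin d) := ⟨⟨0, hd⟩⟩
  have : Nontrivial (Space d) := inferInstance
  refine (integrable_fun_norm_addHaar (volume : Measure (Space d))
    (f := fun y : ℝ => y ^ k / (1 + y) ^ (d + 3))).2 ?_
  refine Integrable.mono' (integrableOn_decay (r := 1) one_pos).1 ?_ ?_
  · apply Measurable.aestronglyMeasurable
    have : Measurable fun y : ℝ => y ^ k := by fun_prop
    fun_prop
  · rw [ae_restrict_iff' measurableSet_Ioi]
    refine Eventually.of_forall fun y hy => ?_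
    have hy : 0 < y := hy
    obtain ⟨n, hn⟩ := Int.eq_ofNat_of_zero_le (a := d - 1 + k) (by omega)
    rw [finrank_euclideanSpace, Fintype.card_fin, smul_eq_mul, Real.norm_of_nonneg (by positivity),
      ← mul_div_assoc, ← zpow_natCast, ← zpow_add₀ hy.ne', show ((d - 1 : ℕ) : ℤ) + k = n by omega,
      zpow_natCast, div_le_div_iff₀ (by positivity) (by positivity), one_mul, one_mul]
    have h1 : y ^ n ≤ (1 + y) ^ (d + 1) := calc
      y ^ n ≤ (1 + y) ^ n := by gcongr; linarith
      _ ≤ _ := pow_le_pow_right₀ (by linarith) (by omega)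
    calc y ^ n * (1 + y) ^ 2 ≤ (1 + y) ^ (d + 1) * (1 + y) ^ 2 := by gcongr
      _ = _ := by ring

/-- Frequency integrals scale like powers of the time. -/
lemma exists_integral_freq_eq (hd : 0 < d) {k : ℤ} (hk : -1 ≤ k) (hk2 : k ≤ 2) {n : ℕ} (hn : 0 < n)
    (hnk : (n : ℤ) = d + k) :
    ∃ J : ℝ, 0 ≤ J ∧ ∀ t, 0 < t →
      Integrable (fun w : Space d => freq w ^ k / (1 + freq w * t) ^ (d + 3)) ∧
      ∫ w : Space d, freq w ^ k / (1 + freq w * t) ^ (d + 3) = J / t ^ n := by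
  have hi := integrable_zpow_div hd hk hk2 (by omega)
  refine ⟨((2 * Real.pi) ^ d)⁻¹ * ∫ w : Space d, ‖w‖ ^ k / (1 + ‖w‖) ^ (d + 3),
    mul_nonneg (by positivity) (integral_nonneg fun w => by positivity), fun t ht => ?_⟩
  have hR : 2 * Real.pi * t ≠ 0 := by positivity
  have e : (fun w : Space d => freq w ^ k / (1 + freq w * t) ^ (d + 3)) = fun w =>
      (t ^ k)⁻¹ * (‖(2 * Real.pi * t) • w‖ ^ k / (1 + ‖(2 * Real.pi * t) • w‖) ^ (d + 3)) := by
    ext w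
    have h1 : ‖(2 * Real.pi * t) • w‖ = freq w * t := by
      rw [freq_eq, norm_smul, Real.norm_of_nonneg (by positivity)]; ring
    have h2 : t ^ k ≠ 0 := zpow_ne_zero _ ht.ne'
    rw [h1, mul_zpow]
    field_simp
  rw [e]
  refine ⟨(hi.comp_smul hR).const_mul _, ?_⟩
  rw [integral_const_mul, Measure.integral_comp_smul volume
    (fun w : Space d => ‖w‖ ^ k / (1 + ‖w‖) ^ (d + 3)), finrank_euclideanSpace, Fintype.card_fin,
    smul_eq_mul, abs_of_pos (by positivity), mul_pow, ← zpow_natCast t n, hnk, zpow_add₀ ht.ne',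
    zpow_natCast, mul_inv]
  have h2 : t ^ k ≠ 0 := zpow_ne_zero _ ht.ne'
  field_simp

lemma fourier_inversion_bound {f : Space d → ℂ} (hf : Integrable f) {h : Space d → ℝ} (hh : Integrable h)
    (hb : ∀ᵐ w, ‖𝓕 f w‖ ≤ h w) :
    Integrable (𝓕 f) ∧ f =ᵐ[volume] 𝓕⁻ (𝓕 f) ∧ ∀ x, ‖𝓕⁻ (𝓕 f) x‖ ≤ ∫ w, h w := by
  have hi : Integrable (𝓕 f) := hh.mono' (continuous_fourier hf).aestronglyMeasurable hb
  refine ⟨hi, ae_eq_fourierInv_fourier hf hi, fun x => ?_⟩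
  rw [Real.fourierInv_eq_fourier_comp_neg]
  refine (norm_fourier_le x).trans ?_
  rw [integral_neg_eq_self (fun w => ‖𝓕 f w‖)]
  exact integral_mono_ae hi.norm hh hb

/-- One derivative in space costs one factor `|ξ| = 2π‖w‖` under the inversion integral. -/
lemma fourier_inversion_deriv {f : Space d → ℂ} (hf : Integrable f) {h : Space d → ℝ} (hh : Integrable h)
    (hb : ∀ᵐ w, ‖𝓕 f w‖ ≤ h w) (hh' : Integrable fun w => freq w * h w) :
    ContDiff ℝ 1 (𝓕⁻ (𝓕 f)) ∧ ∀ x, ‖fderiv ℝ (𝓕⁻ (𝓕 f)) x‖ ≤ ∫ w, freq w * h w := by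
  have hi := (fourier_inversion_bound hf hh hb).1
  set g : Space d → ℂ := fun w => 𝓕 f (-w) with hg
  have hgi : Integrable g := hi.comp_neg
  have hb' : ∀ᵐ w, freq w * ‖g w‖ ≤ freq w * h (-w) := by
    have : ∀ᵐ w, ‖𝓕 f (-w)‖ ≤ h (-w) :=
      (Measure.measurePreserving_neg volume).quasiMeasurePreserving.ae hb
    filter_upwards [this] with w hw
    exact mul_le_mul_of_nonneg_left hw (freq_nonneg w)
  have hneg : ∀ w : Space d, freq (-w) = freq w := fun w => by simp [freq_eq]
  have hhn : Integrable fun w => freq w * h (-w) := by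
    refine hh'.comp_neg.congr (Eventually.of_forall fun w => ?_)
    simp only [hneg]
  have hfg : Integrable fun w => freq w * ‖g w‖ := by
    refine hhn.mono' ?_ ?_
    · exact (Continuous.aestronglyMeasurable (by unfold freq; fun_prop)).mul hgi.1.norm
    · filter_upwards [hb'] with w hw
      rwa [Real.norm_of_nonneg (mul_nonneg (freq_nonneg w) (norm_nonneg _))]
  have hng : Integrable fun w => ‖w‖ * ‖g w‖ := by
    refine (hfg.const_mul (2 * Real.pi)⁻¹).congr (Eventually.of_forall fun w => ?_)
    simp only [freq_eq]
    field_simp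
  have e : 𝓕⁻ (𝓕 f) = 𝓕 g := Real.fourierInv_eq_fourier_comp_neg _
  rw [e]
  constructor
  · refine Real.contDiff_fourier (N := ((1 : ℕ) : ℕ∞)) fun n hn => ?_
    have hn : n ≤ 1 := by exact_mod_cast hn
    interval_cases n
    · simpa using hgi.norm
    · simpa using hng
  · intro x
    rw [Real.fderiv_fourier hgi hng]
    have h1 : ∀ w, ‖VectorFourier.fourierSMulRight (innerSL ℝ) g w‖ ≤ freq w * ‖g w‖ := by
      intro w
      refine (VectorFourier.norm_fourierSMulRight_le _ _ _).trans ?_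
      rw [freq_eq]
      have := norm_innerSL_le ℝ (E := Space d)
      calc _ ≤ 2 * Real.pi * 1 * ‖w‖ * ‖g w‖ := by gcongr
        _ = _ := by ring
    calc ‖𝓕 (VectorFourier.fourierSMulRight (innerSL ℝ) g) x‖
        ≤ ∫ w, ‖VectorFourier.fourierSMulRight (innerSL ℝ) g w‖ := by
          rw [Real.fourier_eq]
          refine (norm_integral_le_integral_norm _).trans (le_of_eq ?_)
          simp only [Circle.norm_smul]
      _ ≤ ∫ w, freq w * h (-w) := by
          refine integral_mono_of_nonneg (Eventually.of_forall fun _ => norm_nonneg _) hhn ?_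
          filter_upwards [hb'] with w hw using (h1 w).trans hw
      _ = _ := by
          rw [← integral_neg_eq_self (fun w => freq w * h w)]
          simp only [hneg]

lemma exists_norm_le_card_mul (hd : 0 < d) (x : Space d) : ∃ j : Fin d, ‖x‖ ≤ d * |x j| := by
  have : Nonempty (Fin d) := ⟨⟨0, hd⟩⟩
  obtain ⟨j, -, hj⟩ := Finset.exists_max_image Finset.univ (fun j => |x j|) Finset.univ_nonempty
  refine ⟨j, ?_⟩
  have h1 : ‖x‖ ≤ ∑ i : Fin d, |x i| := by
    have h2 : x = ∑ i : Fin d, x i • EuclideanSpace.single i (1:ℝ) := by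
      ext k
      simp [Pi.single_apply]
    calc ‖x‖ = ‖∑ i : Fin d, x i • EuclideanSpace.single i (1:ℝ)‖ := by rw [← h2]
      _ ≤ ∑ i : Fin d, ‖x i • EuclideanSpace.single i (1:ℝ)‖ := norm_sum_le _ _
      _ = _ := by simp [norm_smul]
  refine h1.trans ((Finset.sum_le_card_nsmul _ _ _ fun i _ => hj i (Finset.mem_univ _)).trans ?_)
  simp

end ScreenedVlasov
end

/-! ### Pointwise bounds at a fixed time -/

noncomputable section
namespace ScreenedVlasov
open scoped ENNReal NNReal FourierTransform
open ContinuousLinearMap (mul)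
set_option linter.unusedSectionVars false

variable {d : ℕ}

/-- The moments of `u` are integrable and their Fourier transforms obey the bounds of a resolvent at
time `t`. -/
structure FreqBound (B t : ℝ) (u : Space d → ℝ) : Prop where
  integrable : ∀ (j : Fin d), ∀ i ≤ d + 1, Integrable fun x : Space d => x j ^ i * u x
  zero : ∀ j : Fin d, ∀ᵐ w : Space d, ‖𝓕 (fun x : Space d => ((x j ^ 0 * u x : ℝ) : ℂ)) w‖ ≤
    B * (1 / (1 + freq w ^ 2)) * (freq w / (1 + freq w * t) ^ (d + 3))
  succ : ∀ j : Fin d, ∀ i, i + 1 ≤ d + 1 → ∀ᵐ w : Space d,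
    ‖𝓕 (fun x : Space d => ((x j ^ (i + 1) * u x : ℝ) : ℂ)) w‖ ≤
      B * ((1 + t) ^ i / (1 + freq w * t) ^ (d + 3))

/-- The continuous version of a function whose Fourier transform is integrable. -/
def smoothVersion (u : Space d → ℝ) : Space d → ℂ := 𝓕⁻ (𝓕 fun x => (u x : ℂ))

variable {B t : ℝ} {u : Space d → ℝ}

lemma FreqBound.ofReal_integrable (H : FreqBound B t u) (j : Fin d) {i : ℕ} (hi : i ≤ d + 1) :
    Integrable fun x : Space d => ((x j ^ i * u x : ℝ) : ℂ) :=
  (H.integrable j i hi).ofReal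

lemma FreqBound.zero' (H : FreqBound B t u) (j : Fin d) :
    ∀ᵐ w : Space d, ‖𝓕 (fun x : Space d => (u x : ℂ)) w‖ ≤
      B * (1 / (1 + freq w ^ 2)) * (freq w / (1 + freq w * t) ^ (d + 3)) := by
  simpa using H.zero j

lemma FreqBound.integrable' (H : FreqBound B t u) (j : Fin d) : Integrable fun x => (u x : ℂ) := by
  simpa using H.ofReal_integrable j (Nat.zero_le _)

/-- Here the smoothing of `(1 - Δ)⁻¹` is used: `r / (1 + r²) ≤ 1 / r` lowers the frequency power
from `1` to `-1` and the singularity at `t = 0` from `t^{-(d+1)}` to `t^{-(d-1)}`. -/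
lemma FreqBound.decay_short (hB : 0 ≤ B) (ht : 0 < t) (H : FreqBound B t u) (j : Fin d) :
    ∀ᵐ w : Space d, ‖𝓕 (fun x : Space d => (u x : ℂ)) w‖ ≤
      B * (freq w ^ (-1 : ℤ) / (1 + freq w * t) ^ (d + 3)) := by
  filter_upwards [H.zero' j] with w hw
  refine hw.trans ?_
  have hr := freq_nonneg w
  have h1 : (1 / (1 + freq w ^ 2)) * freq w ≤ freq w ^ (-1 : ℤ) := by
    -- At zero frequency both sides are zero, the right one by the convention `0⁻¹ = 0`.
    rcases hr.eq_or_lt with h0 | h0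
    · rw [← h0]; simp
    · rw [zpow_neg_one, ← one_div, div_mul_eq_mul_div, one_mul, div_le_div_iff₀ (by positivity) h0]
      nlinarith
  have h2 : 0 < 1 + freq w * t := by positivity
  calc _ = B * (((1 / (1 + freq w ^ 2)) * freq w) / (1 + freq w * t) ^ (d + 3)) := by ring
    _ ≤ _ := by gcongr

lemma FreqBound.decay_long (hB : 0 ≤ B) (ht : 0 < t) (H : FreqBound B t u) (j : Fin d) :
    ∀ᵐ w : Space d, ‖𝓕 (fun x : Space d => (u x : ℂ)) w‖ ≤
      B * (freq w ^ (1 : ℤ) / (1 + freq w * t) ^ (d + 3)) := by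
  filter_upwards [H.zero' j] with w hw
  refine hw.trans ?_
  have hr := freq_nonneg w
  rw [zpow_one]
  refine mul_le_mul_of_nonneg_right (mul_le_of_le_one_right hB ?_) (by positivity)
  rw [div_le_one (by positivity)]
  nlinarith

lemma FreqBound.sup_short (hd : 3 ≤ d) :
    ∃ C : ℝ, 0 ≤ C ∧ ∀ B t : ℝ, 0 ≤ B → 0 < t → ∀ u : Space d → ℝ, FreqBound B t u →
      (fun x => (u x : ℂ)) =ᵐ[volume] smoothVersion u ∧
      ∀ x, ‖smoothVersion u x‖ ≤ C * B / t ^ (d - 1) := by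
  obtain ⟨J, hJ, h⟩ := exists_integral_freq_eq (d := d) (by omega) (k := -1) (by norm_num) (by norm_num)
    (n := d - 1) (by omega) (by omega)
  refine ⟨J, hJ, fun B t hB ht u H => ?_⟩
  obtain ⟨hi, he⟩ := h t ht
  have h1 := fourier_inversion_bound (H.integrable' ⟨0, by omega⟩) (hi.const_mul B)
    (H.decay_short hB ht ⟨0, by omega⟩)
  refine ⟨h1.2.1, fun x => (h1.2.2 x).trans (le_of_eq ?_)⟩
  rw [integral_const_mul, he]
  ring

lemma freq_mul_zpow (w : Space d) {n : ℕ} (a : ℝ) :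
    freq w * (freq w ^ (n : ℤ) / a) = freq w ^ ((n + 1 : ℕ) : ℤ) / a := by
  rw [zpow_natCast, zpow_natCast, pow_succ]; ring

/-- The factor `1 / (1 + r²)` is useless at the low frequencies that govern long times. The power
`r` vanishing at the origin gives `t^{-(d+1)}`, and the gradient contributes another `r`. -/
lemma FreqBound.sup_long (hd : 3 ≤ d) :
    ∃ C : ℝ, 0 ≤ C ∧ ∀ B t : ℝ, 0 ≤ B → 0 < t → ∀ u : Space d → ℝ, FreqBound B t u →
      ContDiff ℝ 1 (smoothVersion u) ∧
      ∀ x, ‖smoothVersion u x‖ ≤ C * B / t ^ (d + 1) ∧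
        ‖fderiv ℝ (smoothVersion u) x‖ ≤ C * B / t ^ (d + 2) := by
  obtain ⟨J, hJ, h⟩ := exists_integral_freq_eq (d := d) (by omega) (k := (1 : ℕ)) (by norm_num) (by norm_num)
    (n := d + 1) (by omega) (by push_cast; ring)
  obtain ⟨J', hJ', h'⟩ := exists_integral_freq_eq (d := d) (by omega) (k := (2 : ℕ)) (by norm_num) (by norm_num)
    (n := d + 2) (by omega) (by push_cast; ring)
  refine ⟨max J J', le_max_of_le_left hJ, fun B t hB ht u H => ?_⟩
  obtain ⟨hi, he⟩ := h t ht
  obtain ⟨hi', he'⟩ := h' t ht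
  have hb := H.decay_long hB ht ⟨0, by omega⟩
  have h1 := fourier_inversion_bound (H.integrable' ⟨0, by omega⟩) (hi.const_mul B) hb
  have e : (fun w : Space d => freq w * (B * (freq w ^ ((1 : ℕ) : ℤ) / (1 + freq w * t) ^ (d + 3)))) =
      fun w => B * (freq w ^ ((2 : ℕ) : ℤ) / (1 + freq w * t) ^ (d + 3)) := by
    ext w
    rw [mul_left_comm, freq_mul_zpow]
  have h2 := fourier_inversion_deriv (H.integrable' ⟨0, by omega⟩) (hi.const_mul B) hb
    (by rw [e]; exact hi'.const_mul B)
  refine ⟨h2.1, fun x => ⟨(h1.2.2 x).trans ?_, (h2.2 x).trans ?_⟩⟩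
  · rw [integral_const_mul, he, mul_div_assoc', mul_comm B]
    gcongr
    exact le_max_left _ _
  · rw [e, integral_const_mul, he', mul_div_assoc', mul_comm B]
    gcongr
    exact le_max_right _ _

/-- The moments of the continuous version are bounded. -/
lemma FreqBound.moment_sup (hd : 3 ≤ d) :
    ∃ C : ℝ, 0 ≤ C ∧ ∀ B t : ℝ, 0 ≤ B → 1 ≤ t → ∀ u : Space d → ℝ, FreqBound B t u →
      ∀ (j : Fin d) (i : ℕ), i ≤ d →
        ContDiff ℝ 1 (smoothVersion fun x => x j ^ (i + 1) * u x) ∧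
        (fun x : Space d => ((x j ^ (i + 1) * u x : ℝ) : ℂ)) =ᵐ[volume]
          smoothVersion (fun x => x j ^ (i + 1) * u x) ∧
        ∀ x, ‖smoothVersion (fun x => x j ^ (i + 1) * u x) x‖ ≤ C * B * t ^ i / t ^ d ∧
          ‖fderiv ℝ (smoothVersion fun x => x j ^ (i + 1) * u x) x‖ ≤ C * B * t ^ i / t ^ (d + 1) := by
  obtain ⟨J, hJ, h⟩ := exists_integral_freq_eq (d := d) (by omega) (k := (0 : ℕ)) (by norm_num) (by norm_num)
    (n := d) (by omega) (by push_cast; ring)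
  obtain ⟨J', hJ', h'⟩ := exists_integral_freq_eq (d := d) (by omega) (k := (1 : ℕ)) (by norm_num) (by norm_num)
    (n := d + 1) (by omega) (by push_cast; ring)
  refine ⟨2 ^ d * max J J', mul_nonneg (by positivity) (le_max_of_le_left hJ),
    fun B t hB ht u H j i hi => ?_⟩
  have ht0 : 0 < t := by linarith
  obtain ⟨hi0, he⟩ := h t ht0
  obtain ⟨hi1, he'⟩ := h' t ht0
  have hf := H.ofReal_integrable j (i := i + 1) (by omega)
  have hb : ∀ᵐ w : Space d, ‖𝓕 (fun x : Space d => ((x j ^ (i + 1) * u x : ℝ) : ℂ)) w‖ ≤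
      (B * (1 + t) ^ i) * (freq w ^ ((0 : ℕ) : ℤ) / (1 + freq w * t) ^ (d + 3)) := by
    filter_upwards [H.succ j i (by omega)] with w hw
    refine hw.trans (le_of_eq ?_)
    simp; ring
  have e : (fun w : Space d => freq w * ((B * (1 + t) ^ i) * (freq w ^ ((0 : ℕ) : ℤ) / (1 + freq w * t) ^ (d + 3)))) =
      fun w => (B * (1 + t) ^ i) * (freq w ^ ((1 : ℕ) : ℤ) / (1 + freq w * t) ^ (d + 3)) := by
    ext w
    rw [mul_left_comm, freq_mul_zpow]
  have h1 := fourier_inversion_bound hf (hi0.const_mul (B * (1 + t) ^ i)) hb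
  have h2 := fourier_inversion_deriv hf (hi0.const_mul (B * (1 + t) ^ i)) hb
    (by rw [e]; exact hi1.const_mul _)
  -- The assumption `1 ≤ t` enters here, to replace the inhomogeneous growth by a pure power.
  have h3 : (1 + t) ^ i ≤ 2 ^ d * t ^ i := calc
    (1 + t) ^ i ≤ (2 * t) ^ i := by gcongr; linarith
    _ = 2 ^ i * t ^ i := mul_pow _ _ _
    _ ≤ _ := by gcongr; norm_num
  have h4 : ∀ I, 0 ≤ I → I ≤ max J J' → B * (1 + t) ^ i * I ≤ 2 ^ d * max J J' * B * t ^ i := by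
    intro I hI hIJ
    calc _ ≤ B * (2 ^ d * t ^ i) * max J J' := by gcongr
      _ = _ := by ring
  refine ⟨h2.1, h1.2.1, fun x => ⟨(h1.2.2 x).trans ?_, (h2.2 x).trans ?_⟩⟩
  · rw [integral_const_mul, he, mul_div_assoc']
    gcongr ?_ / _
    exact h4 J hJ (le_max_left _ _)
  · rw [e, integral_const_mul, he', mul_div_assoc']
    gcongr ?_ / _
    exact h4 J' hJ' (le_max_right _ _)

/-- Both sides are continuous versions of the same function, hence equal everywhere. This allows the
moment bounds to be read as pointwise weighted bounds on one function. -/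
lemma smoothVersion_moment (hd : 3 ≤ d) (hB : 0 ≤ B) (ht : 1 ≤ t) (H : FreqBound B t u) (j : Fin d) {i : ℕ}
    (hi : i ≤ d) (x : Space d) :
    smoothVersion (fun x => x j ^ (i + 1) * u x) x = ((x j ^ (i + 1) : ℝ) : ℂ) * smoothVersion u x := by
  obtain ⟨_, -, h⟩ := FreqBound.moment_sup hd
  obtain ⟨_, -, h'⟩ := FreqBound.sup_short hd
  obtain ⟨_, -, h''⟩ := FreqBound.sup_long hd
  obtain ⟨h1, h2, -⟩ := h B t hB ht u H j i hi
  have h3 := (h' B t hB (by linarith) u H).1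
  have h4 := (h'' B t hB (by linarith) u H).1
  have h5 : smoothVersion (fun x => x j ^ (i + 1) * u x) =ᵐ[volume]
      fun x => ((x j ^ (i + 1) : ℝ) : ℂ) * smoothVersion u x := by
    filter_upwards [h2, h3] with x h2 h3
    rw [← h2, ← h3, Complex.ofReal_mul]
  have h6 : Continuous fun x : Space d => ((x j ^ (i + 1) : ℝ) : ℂ) * smoothVersion u x :=
    (by fun_prop : Continuous fun x : Space d => ((x j ^ (i + 1) : ℝ) : ℂ)).mul h4.continuous
  exact congrFun (Continuous.ae_eq_iff_eq volume h1.continuous h6 |>.1 h5) x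

lemma hasFDerivAt_coord_pow (j : Fin d) (n : ℕ) (x : Space d) :
    HasFDerivAt (fun x : Space d => ((x j ^ (n + 1) : ℝ) : ℂ))
      (Complex.ofRealCLM.comp (((n + 1 : ℕ) * x j ^ n : ℝ) • EuclideanSpace.proj (𝕜 := ℝ) j)) x := by
  have h1 : HasFDerivAt (fun x : Space d => x j) (EuclideanSpace.proj (𝕜 := ℝ) j) x :=
    (EuclideanSpace.proj (𝕜 := ℝ) j).hasFDerivAt
  have h2 := (hasDerivAt_pow (n + 1) (x j)).comp_hasFDerivAt x h1
  exact Complex.ofRealCLM.hasFDerivAt.comp x h2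

/-- The weighted decay of the continuous version and of its derivative. -/
lemma FreqBound.coord_pow_bound (hd : 3 ≤ d) :
    ∃ C : ℝ, 0 ≤ C ∧ ∀ B t : ℝ, 0 ≤ B → 1 ≤ t → ∀ u : Space d → ℝ, FreqBound B t u →
      ∀ (j : Fin d) (x : Space d), |x j| ^ (d + 1) * ‖smoothVersion u x‖ ≤ C * B ∧
        |x j| ^ (d + 1) * ‖fderiv ℝ (smoothVersion u) x‖ ≤ C * B / t := by
  obtain ⟨C, hC, h⟩ := FreqBound.moment_sup hd
  obtain ⟨_, -, h''⟩ := FreqBound.sup_long hd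
  refine ⟨(d + 2) * C, by positivity, fun B t hB ht u H j x => ?_⟩
  have ht0 : 0 < t := by linarith
  have hv := (h'' B t hB ht0 u H).1
  obtain ⟨h1, -, h2⟩ := h B t hB ht u H j d le_rfl
  obtain ⟨-, -, h3⟩ := h B t hB ht u H j (d - 1) (by omega)
  have e1 := smoothVersion_moment hd hB ht H j le_rfl
  have e2 := smoothVersion_moment hd hB ht H j (i := d - 1) (by omega)
  rw [show d - 1 + 1 = d by omega] at e2 h3
  have htd : t ^ d = t ^ (d - 1) * t := by rw [← pow_succ, show d - 1 + 1 = d by omega]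
  have hn : ∀ n, |x j| ^ n * ‖smoothVersion u x‖ = ‖((x j ^ n : ℝ) : ℂ) * smoothVersion u x‖ := fun n => by
    rw [norm_mul, Complex.norm_real, norm_pow, Real.norm_eq_abs]
  have hCB : 0 ≤ C * B := mul_nonneg hC hB
  constructor
  · rw [hn, ← e1]
    refine (h2 x).1.trans ?_
    rw [mul_div_assoc, div_self (by positivity), mul_one]
    nlinarith [mul_nonneg (Nat.cast_nonneg (α := ℝ) d) hCB]
  -- With `v` the continuous version, `x_j^{d+1} ∇v = ∇(x_j^{d+1} v) - (d+1) x_j^d v e_j`. The first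
  -- term is bounded by the moment of order `d + 1`, the second by the one of order `d`; both are of
  -- size `1/t`.
  · have hD : HasFDerivAt (smoothVersion fun x => x j ^ (d + 1) * u x)
        (((x j ^ (d + 1) : ℝ) : ℂ) • fderiv ℝ (smoothVersion u) x + smoothVersion u x •
          (Complex.ofRealCLM.comp (((d + 1 : ℕ) * x j ^ d : ℝ) • EuclideanSpace.proj (𝕜 := ℝ) j))) x := by
      rw [show (smoothVersion fun x => x j ^ (d + 1) * u x) =
        fun x => ((x j ^ (d + 1) : ℝ) : ℂ) * smoothVersion u x from funext e1]
      exact (hasFDerivAt_coord_pow j d x).mul ((hv.differentiable (by norm_num)) x).hasFDerivAt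
    have h4 := (h2 x).2
    rw [hD.fderiv] at h4
    have h5 : ‖smoothVersion u x • (Complex.ofRealCLM.comp (((d + 1 : ℕ) * x j ^ d : ℝ) •
        EuclideanSpace.proj (𝕜 := ℝ) j) : Space d →L[ℝ] ℂ)‖ ≤ (d + 1) * (C * B / t) := by
      have h6 := (h3 x).1
      rw [e2, ← hn, htd, mul_comm (C * B), mul_div_mul_left _ _ (by positivity)] at h6
      have h7 : ‖(EuclideanSpace.proj (𝕜 := ℝ) j : Space d →L[ℝ] ℝ)‖ ≤ 1 :=
        ContinuousLinearMap.opNorm_le_bound _ zero_le_one fun x => by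
          simpa using PiLp.norm_apply_le x j
      rw [norm_smul]
      calc _ ≤ ‖smoothVersion u x‖ * (‖Complex.ofRealCLM‖ * ‖((d + 1 : ℕ) * x j ^ d : ℝ) •
            (EuclideanSpace.proj (𝕜 := ℝ) j : Space d →L[ℝ] ℝ)‖) := by
            gcongr
            exact ContinuousLinearMap.opNorm_comp_le _ _
        _ ≤ ‖smoothVersion u x‖ * (1 * (((d : ℝ) + 1) * |x j| ^ d * 1)) := by
            rw [Complex.ofRealCLM_norm, norm_smul, norm_mul, norm_pow, Real.norm_eq_abs (x j),
              Real.norm_of_nonneg (by positivity)]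
            push_cast
            gcongr
        _ = (d + 1) * (|x j| ^ d * ‖smoothVersion u x‖) := by ring
        _ ≤ _ := by gcongr
    have h8 : |x j| ^ (d + 1) * ‖fderiv ℝ (smoothVersion u) x‖ =
        ‖((x j ^ (d + 1) : ℝ) : ℂ) • fderiv ℝ (smoothVersion u) x‖ := by
      rw [norm_smul, Complex.norm_real, norm_pow, Real.norm_eq_abs]
    have h9 : C * B * t ^ d / t ^ (d + 1) = C * B / t := by
      rw [pow_succ, mul_comm (C * B), mul_div_mul_left _ _ (by positivity)]
    rw [h8]
    calc _ ≤ C * B / t + (d + 1) * (C * B / t) := by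
          rw [← h9] at h5 ⊢
          exact (norm_le_add_norm_add _ _).trans (add_le_add h4 h5)
      _ = _ := by ring

/-- The profile of the pointwise decay at time `t`. -/
def profile (t : ℝ) (x : Space d) : ℝ := 1 / (1 + ‖x‖ / t) ^ (d + 1)

lemma profile_pos (ht : 0 < t) (x : Space d) : 0 < profile t x := by
  unfold profile; positivity

/-- `(t + ‖x‖)^{d+1} ≤ 2^{d+1}(t^{d+1} + ‖x‖^{d+1})`, and `‖x‖` is at most `d` times the largest
coordinate, so bounds with pure coordinate weights suffice. -/
lemma le_profile_of_bounds (hd : 0 < d) (ht : 0 < t) {a X : ℝ} (hX : 0 ≤ X) (x : Space d) (h1 : t ^ (d + 1) * X ≤ a)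
    (h2 : ∀ j, |x j| ^ (d + 1) * X ≤ a) :
    X ≤ (2 ^ (d + 1) * (1 + (d : ℝ) ^ (d + 1))) * (a / t ^ (d + 1)) * profile t x := by
  obtain ⟨j, hj⟩ := exists_norm_le_card_mul hd x
  have h3 : (t + ‖x‖) ^ (d + 1) ≤ 2 ^ (d + 1) * (t ^ (d + 1) + ‖x‖ ^ (d + 1)) := by
    refine (add_pow_le ht.le (norm_nonneg x) _).trans ?_
    gcongr
    · norm_num
    · omega
  have h4 : ‖x‖ ^ (d + 1) * X ≤ (d : ℝ) ^ (d + 1) * a := calc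
    _ ≤ (d * |x j|) ^ (d + 1) * X := by gcongr
    _ = (d : ℝ) ^ (d + 1) * (|x j| ^ (d + 1) * X) := by rw [mul_pow]; ring
    _ ≤ _ := by gcongr; exact h2 j
  have h5 : 1 + ‖x‖ / t = (t + ‖x‖) / t := by field_simp
  rw [profile, h5, div_pow, one_div_div, mul_assoc, div_mul_div_cancel₀ (by positivity),
    mul_div_assoc', le_div_iff₀ (by positivity)]
  calc X * (t + ‖x‖) ^ (d + 1) ≤ X * (2 ^ (d + 1) * (t ^ (d + 1) + ‖x‖ ^ (d + 1))) := by gcongr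
    _ = 2 ^ (d + 1) * (t ^ (d + 1) * X + ‖x‖ ^ (d + 1) * X) := by ring
    _ ≤ 2 ^ (d + 1) * (a + (d : ℝ) ^ (d + 1) * a) := by gcongr
    _ = _ := by ring

lemma FreqBound.profile_bound (hd : 3 ≤ d) :
    ∃ C : ℝ, 0 ≤ C ∧ ∀ B t : ℝ, 0 ≤ B → 1 ≤ t → ∀ u : Space d → ℝ, FreqBound B t u →
      ∀ x : Space d, ‖smoothVersion u x‖ ≤ C * B / t ^ (d + 1) * profile t x ∧
        ‖fderiv ℝ (smoothVersion u) x‖ ≤ C * B / t ^ (d + 2) * profile t x := by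
  obtain ⟨C₁, hC₁, h₁⟩ := FreqBound.sup_long hd
  obtain ⟨C₂, hC₂, h₂⟩ := FreqBound.coord_pow_bound hd
  refine ⟨(2 ^ (d + 1) * (1 + (d : ℝ) ^ (d + 1))) * (C₁ + C₂), by positivity, fun B t hB ht u H x => ?_⟩
  have ht0 : 0 < t := by linarith
  obtain ⟨-, h3⟩ := h₁ B t hB ht0 u H
  have h4 := fun j => h₂ B t hB ht u H j x
  have e1 : C₁ * B ≤ (C₁ + C₂) * B := by gcongr; linarith
  have e2 : C₂ * B ≤ (C₁ + C₂) * B := by gcongr; linarith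
  constructor
  · refine (le_profile_of_bounds (by omega) ht0 (a := (C₁ + C₂) * B) (norm_nonneg _) x ?_
      fun j => (h4 j).1.trans e2).trans (le_of_eq (by ring))
    rw [mul_comm, ← le_div_iff₀ (by positivity)]
    exact (h3 x).1.trans (by gcongr)
  · refine (le_profile_of_bounds (by omega) ht0 (a := (C₁ + C₂) * B / t) (norm_nonneg _) x ?_
      fun j => (h4 j).2.trans (by gcongr)).trans (le_of_eq ?_)
    · rw [mul_comm, ← le_div_iff₀ (by positivity), div_div, ← pow_succ']
      exact (h3 x).2.trans (by gcongr)
    · rw [div_div, ← pow_succ', show d + 1 + 1 = d + 2 by omega]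
      ring

/-- Scaling by `t`; the exponent `d + 1` exceeds the dimension by one, which is why moments up to
order `d + 1` are followed throughout. -/
lemma lintegral_profile (d : ℕ) : ∃ J : ℝ, 0 ≤ J ∧ ∀ t, 0 < t →
    ∫⁻ x : Space d, ENNReal.ofReal (profile t x) = ENNReal.ofReal (J * t ^ d) := by
  have hi : Integrable fun x : Space d => profile 1 x := by
    refine (integrable_one_add_norm (E := Space d) (μ := volume) (r := d + 1) (by simp)).congr
      (Eventually.of_forall fun x => ?_)
    simp only [profile]
    rw [Real.rpow_neg (by positivity), one_div, div_one]
    norm_cast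
  refine ⟨∫ x : Space d, profile 1 x, integral_nonneg fun x => (profile_pos one_pos x).le, fun t ht => ?_⟩
  have e : (fun x : Space d => profile t x) = fun x => profile 1 (t⁻¹ • x) := by
    ext x
    simp only [profile]
    rw [div_one, norm_smul, Real.norm_of_nonneg (by positivity), ← div_eq_inv_mul]
  have hi' : Integrable fun x : Space d => profile t x := by
    rw [e]; exact hi.comp_smul (by positivity)
  rw [← ofReal_integral_eq_lintegral_ofReal hi' (Eventually.of_forall fun x => (profile_pos ht x).le)]
  congr 1
  simp only [e]
  rw [Measure.integral_comp_smul volume (fun x : Space d => profile 1 x), finrank_euclideanSpace,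
    Fintype.card_fin, smul_eq_mul, abs_of_pos (by positivity), inv_pow, inv_inv, mul_comm]

end ScreenedVlasov
end

/-! ### Kernel estimates and choice of a representative -/

noncomputable section
namespace ScreenedVlasov
open scoped ENNReal NNReal FourierTransform
open ContinuousLinearMap (mul)
set_option linter.unusedSectionVars false

variable {d : ℕ}

/-- A classical `C¹` gradient is a weak gradient. -/
lemma hasWeakGradient_of_contDiff {u v : Space d → ℝ} (hv : ContDiff ℝ 1 v) (huv : u =ᵐ[volume] v) :
    HasWeakGradient u (fun x => ∇ v x) := by
  have hgc : Continuous fun x => ∇ v x := by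
    have := hv.continuous_fderiv (by norm_num)
    unfold gradient
    exact (LinearIsometryEquiv.continuous _).comp this
  refine ⟨hv.continuous.locallyIntegrable.congr huv.symm, hgc.locallyIntegrable, fun φ hφ hs => ?_⟩
  have hgφ : Continuous fun x => ∇ φ x := by
    have := hφ.continuous_fderiv (by norm_num)
    unfold gradient
    exact (LinearIsometryEquiv.continuous _).comp this
  have hsφ : HasCompactSupport fun x => ∇ φ x := by
    have h1 : HasCompactSupport (fderiv ℝ φ) := hs.fderiv (𝕜 := ℝ)
    unfold gradient
    exact h1.comp_left (g := (InnerProductSpace.toDual ℝ (Space d)).symm) (map_zero _)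
  have e1 : ∫ x, u x • ∇ φ x = ∫ x, v x • ∇ φ x := by
    refine integral_congr_ae ?_
    filter_upwards [huv] with x hx
    rw [hx]
  have i1 : Integrable fun x => v x • ∇ φ x :=
    (hv.continuous.smul hgφ).integrable_of_hasCompactSupport hsφ.smul_left
  have i2 : Integrable fun x => φ x • ∇ v x :=
    (hφ.continuous.smul hgc).integrable_of_hasCompactSupport hs.smul_right
  rw [e1]
  refine ext_inner_left ℝ fun e => ?_
  rw [inner_neg_right, ← integral_inner i1, ← integral_inner i2]
  have c1 : ∀ x, inner ℝ e (v x • ∇ φ x) = v x * fderiv ℝ φ x e := fun x => by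
    rw [inner_smul_right, real_inner_comm, inner_gradient_left]
  have c2 : ∀ x, inner ℝ e (φ x • ∇ v x) = fderiv ℝ v x e * φ x := fun x => by
    rw [inner_smul_right, real_inner_comm, inner_gradient_left, mul_comm]
  have j1 := i1.const_inner (𝕜 := ℝ) e
  have j2 := i2.const_inner (𝕜 := ℝ) e
  simp only [c1, c2] at j1 j2 ⊢
  refine integral_mul_fderiv_eq_neg_fderiv_mul_of_integrable j2 j1 ?_
    (fun x _ => hv.differentiable (by norm_num) x) (fun x _ => hφ.differentiable (by norm_num) x)
  exact (hv.continuous.mul hφ.continuous).integrable_of_hasCompactSupport hs.mul_left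

lemma norm_gradient_eq (v : Space d → ℝ) (x : Space d) : ‖∇ v x‖ = ‖fderiv ℝ v x‖ := by
  rw [gradient, LinearIsometryEquiv.norm_map]

lemma eLpNorm_one_le_of_profile {F : Type*} [NormedAddCommGroup F] :
    ∃ J : ℝ, 0 ≤ J ∧ ∀ (t a : ℝ), 0 < t → 0 ≤ a → ∀ f : Space d → F,
      (∀ᵐ x, ‖f x‖ ≤ a * profile t x) → eLpNorm f 1 volume ≤ ENNReal.ofReal (J * (a * t ^ d)) := by
  obtain ⟨J, hJ, h⟩ := lintegral_profile d
  refine ⟨J, hJ, fun t a ht ha f hf => ?_⟩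
  rw [eLpNorm_one_eq_lintegral_enorm]
  calc ∫⁻ x, ‖f x‖ₑ ≤ ∫⁻ x : Space d, ENNReal.ofReal a * ENNReal.ofReal (profile t x) := by
        refine lintegral_mono_ae ?_
        filter_upwards [hf] with x hx
        rw [← ofReal_norm, ← ENNReal.ofReal_mul ha]
        exact ENNReal.ofReal_le_ofReal hx
    _ = _ := by
        rw [lintegral_const_mul' _ _ ENNReal.ofReal_ne_top, h t ht, ← ENNReal.ofReal_mul ha]
        congr 1; ring

/-- The estimates at a fixed time, deduced from the frequency bounds. -/
lemma FreqBound.estimates (hd : 3 ≤ d) :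
    ∃ C : ℝ, 0 ≤ C ∧ ∀ B t : ℝ, 0 ≤ B → 0 < t → ∀ u : Space d → ℝ, FreqBound B t u →
      eLpNorm u ⊤ volume ≤ ENNReal.ofReal (C * B / t ^ (d - 1)) ∧
      eLpNorm u ⊤ volume ≤ ENNReal.ofReal (C * B / t ^ (d + 1)) ∧
      (1 ≤ t → eLpNorm u 1 volume ≤ ENNReal.ofReal (C * B / t) ∧
        ∃ g : Space d → Space d, HasWeakGradient u g ∧
          eLpNorm g 1 volume ≤ ENNReal.ofReal (C * B / t ^ 2) ∧
          eLpNorm g ⊤ volume ≤ ENNReal.ofReal (C * B / t ^ (d + 2))) := by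
  obtain ⟨C₁, hC₁, h₁⟩ := FreqBound.sup_short hd
  obtain ⟨C₂, hC₂, h₂⟩ := FreqBound.sup_long hd
  obtain ⟨C₃, hC₃, h₃⟩ := FreqBound.profile_bound hd
  obtain ⟨J, hJ, hJ'⟩ := eLpNorm_one_le_of_profile (d := d) (F := ℝ)
  obtain ⟨I, hI, hI'⟩ := eLpNorm_one_le_of_profile (d := d) (F := Space d)
  obtain ⟨C, hC, k1, k2, k3, k4⟩ : ∃ C : ℝ, 0 ≤ C ∧ C₁ ≤ C ∧ C₂ ≤ C ∧ J * C₃ ≤ C ∧ I * C₃ ≤ C :=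
    ⟨C₁ + C₂ + J * C₃ + I * C₃, by positivity, by
      have := mul_nonneg hJ hC₃; have := mul_nonneg hI hC₃; refine ⟨?_, ?_, ?_, ?_⟩ <;> linarith⟩
  refine ⟨C, hC, fun B t hB ht u H => ?_⟩
  obtain ⟨hae, b1⟩ := h₁ B t hB ht u H
  obtain ⟨hcd, b2⟩ := h₂ B t hB ht u H
  set v : Space d → ℝ := fun x => (smoothVersion u x).re with hv
  have huv : u =ᵐ[volume] v := by
    filter_upwards [hae] with x hx
    rw [hv]
    simp only
    rw [← hx, Complex.ofReal_re]
  have hvc : ContDiff ℝ 1 v := Complex.reCLM.contDiff.comp hcd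
  have hun : ∀ᵐ x, ‖u x‖ = ‖smoothVersion u x‖ := by
    filter_upwards [hae] with x hx
    rw [← hx, Complex.norm_real]
  have hgn : ∀ x, ‖∇ v x‖ ≤ ‖fderiv ℝ (smoothVersion u) x‖ := by
    intro x
    have h1 : HasFDerivAt v (Complex.reCLM.comp (fderiv ℝ (smoothVersion u) x)) x :=
      Complex.reCLM.hasFDerivAt.comp x (hcd.differentiable (by norm_num) x).hasFDerivAt
    rw [norm_gradient_eq, h1.fderiv]
    refine (ContinuousLinearMap.opNorm_comp_le _ _).trans ?_
    rw [Complex.reCLM_norm, one_mul]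
  refine ⟨?_, ?_, fun ht1 => ⟨?_, fun x => ∇ v x, hasWeakGradient_of_contDiff hvc huv, ?_, ?_⟩⟩
  · rw [eLpNorm_exponent_top]
    refine eLpNormEssSup_le_of_ae_bound ?_
    filter_upwards [hun] with x hx
    rw [hx]
    exact (b1 x).trans (by gcongr)
  · rw [eLpNorm_exponent_top]
    refine eLpNormEssSup_le_of_ae_bound ?_
    filter_upwards [hun] with x hx
    rw [hx]
    exact (b2 x).1.trans (by gcongr)
  · refine (hJ' t (C₃ * B / t ^ (d + 1)) ht (by positivity) u ?_).trans (ENNReal.ofReal_le_ofReal ?_)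
    · filter_upwards [hun] with x hx
      rw [hx]
      exact (h₃ B t hB ht1 u H x).1
    -- Height `t^{-(d+1)}` times mass `t^d` of the profile. The gradient has height `t^{-(d+2)}` and
    -- gains one more power.
    · have : C₃ * B / t ^ (d + 1) * t ^ d = C₃ * B / t := by
        rw [pow_succ]; field_simp
      rw [this, mul_div_assoc', ← mul_assoc]
      gcongr
  · refine (hI' t (C₃ * B / t ^ (d + 2)) ht (by positivity) _ (Eventually.of_forall fun x =>
      (hgn x).trans (h₃ B t hB ht1 u H x).2)).trans (ENNReal.ofReal_le_ofReal ?_)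
    have : C₃ * B / t ^ (d + 2) * t ^ d = C₃ * B / t ^ 2 := by
      rw [pow_add]; field_simp
    rw [this, mul_div_assoc', ← mul_assoc]
    gcongr
  · rw [eLpNorm_exponent_top]
    refine eLpNormEssSup_le_of_ae_bound (Eventually.of_forall fun x => (hgn x).trans
      ((b2 x).2.trans (by gcongr)))

lemma ae_lintegral_weight_lt_top {β : ℝ} {G : ℝ × Space d → ℝ} (hG : Measurable G)
    (h : ∫⁻ q, ENNReal.ofReal (weight β q) * ‖G q‖ₑ < ⊤) :
    ∀ᵐ t : ℝ, ∫⁻ x : Space d, ENNReal.ofReal ((1 + ‖x‖) ^ (d + 1)) * ‖G (t, x)‖ₑ < ⊤ := by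
  have hm := measurable_weight (d := d) β
  rw [show (volume : Measure (ℝ × Space d)) = volume.prod volume from rfl,
    lintegral_prod _ (by fun_prop)] at h
  filter_upwards [ae_lt_top' (Measurable.lintegral_prod_right'
    (f := fun q : ℝ × Space d => ENNReal.ofReal (weight β q) * ‖G q‖ₑ) (by fun_prop)).aemeasurable h.ne] with t ht
  have e : ∀ x : Space d, ENNReal.ofReal (weight β (t, x)) * ‖G (t, x)‖ₑ =
      ENNReal.ofReal (Real.exp (-(β * t))) * (ENNReal.ofReal ((1 + ‖x‖) ^ (d + 1)) * ‖G (t, x)‖ₑ) := by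
    intro x
    rw [weight, ENNReal.ofReal_mul (Real.exp_pos _).le, mul_assoc]
  simp_rw [e] at ht
  rw [lintegral_const_mul' _ _ ENNReal.ofReal_ne_top] at ht
  by_contra hc
  rw [not_lt, top_le_iff] at hc
  rw [hc, ENNReal.mul_top (by simpa using Real.exp_pos _)] at ht
  exact lt_irrefl _ ht

lemma ae_freqBound (hd : 3 ≤ d) {μ : Space d → ℝ} (hreg : RegularEquilibrium μ)
    (hpen : PenroseStable μ) {β : ℝ}
    (hsmall : ∫⁻ q, ENNReal.ofReal (weight β q) * ‖kernel μ q‖ₑ ≤ 1 / 2)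
    {G : ℝ × Space d → ℝ} (hG : IsSpaceTimeResolvent μ β G) :
    ∃ B : ℝ, 0 ≤ B ∧ ∀ᵐ t : ℝ, 0 < t → FreqBound B t fun x => G (t, x) := by
  obtain ⟨B, hB, h⟩ := ae_momentHat_resolvent_bound (by omega) hreg hpen hsmall hG
  refine ⟨B, hB, ?_⟩
  filter_upwards [h, ae_lintegral_weight_lt_top hG.measurable.measurable hG.weighted] with t ht hw hpos
  refine ⟨fun j i hi => ?_, fun j => ?_, fun j i hi => ?_⟩
  · have hm : Measurable fun x : Space d => G (t, x) := by
      have := hG.measurable.measurable; fun_prop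
    refine ⟨((by fun_prop : Measurable fun x : Space d => x j ^ i).mul hm).aestronglyMeasurable, ?_⟩
    rw [hasFiniteIntegral_iff_enorm]
    refine lt_of_le_of_lt (lintegral_mono fun x => ?_) hw
    rw [← ofReal_norm, ← ofReal_norm, ← ENNReal.ofReal_mul (by positivity)]
    apply ENNReal.ofReal_le_ofReal
    rw [norm_mul, norm_pow]
    gcongr
    exact norm_coord_pow_le x j hi
  · filter_upwards [ht hpos j] with w hw using hw.1
  · filter_upwards [ht hpos j] with w hw using hw.2 i hi

/-- The resolvent is bounded in `L¹` for short times. -/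
lemma ae_lintegral_resolvent_le {μ : Space d → ℝ} (hreg : RegularEquilibrium μ) {β : ℝ} (hβ : 0 < β)
    {G : ℝ × Space d → ℝ} (hG : IsSpaceTimeResolvent μ β G) :
    ∃ C : ℝ, 0 ≤ C ∧ ∀ᵐ t : ℝ, t ≤ 1 → ∫⁻ x : Space d, ‖G (t, x)‖ₑ ≤ ENNReal.ofReal C := by
  obtain ⟨C, hC, hK⟩ := lintegral_weight_kernel_le hreg (m := 0) (Nat.zero_le _)
  have hk := measurable_kernel hreg
  have hGm := hG.measurable.measurable
  have hK' : ∀ t, ∫⁻ x : Space d, ‖kernel μ (t, x)‖ₑ ≤ ENNReal.ofReal C := by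
    intro t
    rcases le_or_gt t 0 with ht | ht
    · simp [kernel_of_nonpos ht]
    · simpa using hK t ht
  set E : ℝ≥0∞ := ∫⁻ q : ℝ × Space d, ENNReal.ofReal (Real.exp (-(β * q.1))) * ‖G q‖ₑ with hE
  have hEf : E < ⊤ := by
    refine lt_of_le_of_lt (lintegral_mono fun q => ?_) hG.weighted
    gcongr
    exact exp_le_weight β q
  have hle : ∀ᵐ q, ‖G q‖ₑ ≤ ‖kernel μ q‖ₑ + lconv (fun q => ‖G q‖ₑ) (fun q => ‖kernel μ q‖ₑ) q := by
    filter_upwards [hG.eq] with q hq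
    rw [hq, Pi.add_apply, convolution_mul_comm]
    exact (enorm_add_le _ _).trans (add_le_add le_rfl (enorm_convolution_le G (kernel μ) q))
  have hae : ∀ᵐ t : ℝ, ∀ᵐ x : Space d, ‖G (t, x)‖ₑ ≤ ‖kernel μ (t, x)‖ₑ +
      lconv (fun q => ‖G q‖ₑ) (fun q => ‖kernel μ q‖ₑ) (t, x) := Measure.ae_ae_of_ae_prod hle
  refine ⟨C + (ENNReal.ofReal C * (ENNReal.ofReal (Real.exp β) * E)).toReal, by positivity, ?_⟩
  filter_upwards [hae] with t ht ht1
  have hconv : ∫⁻ x : Space d, lconv (fun q => ‖G q‖ₑ) (fun q => ‖kernel μ q‖ₑ) (t, x) ≤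
      ENNReal.ofReal C * (ENNReal.ofReal (Real.exp β) * E) := by
    calc _ = ∫⁻ y : ℝ × Space d, ∫⁻ x : Space d, ‖G y‖ₑ * ‖kernel μ ((t, x) - y)‖ₑ := by
          unfold lconv
          rw [lintegral_lintegral_swap]
          apply Measurable.aemeasurable
          simp only [Function.uncurry_def]
          fun_prop
      _ ≤ ∫⁻ y : ℝ × Space d, ENNReal.ofReal C * (ENNReal.ofReal (Real.exp β) *
            (ENNReal.ofReal (Real.exp (-(β * y.1))) * ‖G y‖ₑ)) := by
          refine lintegral_mono fun y => ?_
          rw [lintegral_const_mul _ (by fun_prop)]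
          rcases le_or_gt t y.1 with hy | hy
          · have : ∀ x : Space d, kernel μ ((t, x) - y) = 0 := fun x =>
              kernel_of_nonpos (t := t - y.1) (by linarith) (x - y.2)
            simp [this]
          · have e1 : ∫⁻ x : Space d, ‖kernel μ ((t, x) - y)‖ₑ ≤ ENNReal.ofReal C := by
              have : ∀ x : Space d, kernel μ ((t, x) - y) = kernel μ (t - y.1, x - y.2) := fun x => rfl
              simp_rw [this]
              rw [lintegral_sub_right_eq_self (fun x : Space d => ‖kernel μ (t - y.1, x)‖ₑ)]
              exact hK' _
            -- Only times `y.1 < t ≤ 1` contribute, and there inserting the exponential weight costs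
            -- at most `e^β`; `G` is integrable against that weight.
            have e2 : 1 ≤ ENNReal.ofReal (Real.exp β) * ENNReal.ofReal (Real.exp (-(β * y.1))) := by
              rw [← ENNReal.ofReal_mul (Real.exp_pos _).le, ← Real.exp_add]
              rw [ENNReal.one_le_ofReal, Real.one_le_exp_iff]
              nlinarith
            calc _ ≤ ‖G y‖ₑ * ENNReal.ofReal C := by gcongr
              _ = ENNReal.ofReal C * (1 * ‖G y‖ₑ) := by rw [one_mul, mul_comm]
              _ ≤ ENNReal.ofReal C * ((ENNReal.ofReal (Real.exp β) * ENNReal.ofReal (Real.exp (-(β * y.1)))) * ‖G y‖ₑ) := by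
                  gcongr
              _ = _ := by rw [mul_assoc (ENNReal.ofReal (Real.exp β))]
      _ = _ := by
          rw [lintegral_const_mul' _ _ ENNReal.ofReal_ne_top,
            lintegral_const_mul' _ _ ENNReal.ofReal_ne_top]
  have hfin : ENNReal.ofReal C * (ENNReal.ofReal (Real.exp β) * E) ≠ ⊤ :=
    ENNReal.mul_ne_top ENNReal.ofReal_ne_top (ENNReal.mul_ne_top ENNReal.ofReal_ne_top hEf.ne)
  rw [ENNReal.ofReal_add hC ENNReal.toReal_nonneg, ENNReal.ofReal_toReal hfin]
  refine (lintegral_mono_ae ht).trans ?_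
  rw [lintegral_add_left (by fun_prop)]
  exact add_le_add (hK' t) hconv

/-- The frequency integrals give `t^{-(d-1)}`, without the loss `δ`; for `t ≤ 1` the stated
denominator is even smaller than `2 t^{d-1}`. -/
lemma rpow_add_rpow_le_short {d : ℕ} (hd : 3 ≤ d) {t δ : ℝ} (ht : 0 < t) (ht1 : t ≤ 1) (hδ : 0 < δ) :
    t ^ ((d : ℝ) - 1 + δ) + t ^ ((d : ℝ) + 1) ≤ 2 * t ^ (d - 1) := by
  have e : (t ^ (d - 1) : ℝ) = t ^ ((d : ℝ) - 1) := by
    rw [← Real.rpow_natCast, Nat.cast_sub (by omega), Nat.cast_one]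
  rw [e, two_mul]
  gcongr 1
  · exact Real.rpow_le_rpow_of_exponent_ge ht ht1 (by linarith)
  · exact Real.rpow_le_rpow_of_exponent_ge ht ht1 (by linarith)

lemma rpow_add_rpow_le_long {d : ℕ} {t δ : ℝ} (ht1 : 1 ≤ t) (hδ : δ < 1) :
    t ^ ((d : ℝ) - 1 + δ) + t ^ ((d : ℝ) + 1) ≤ 2 * t ^ (d + 1) := by
  have e : (t ^ (d + 1) : ℝ) = t ^ ((d : ℝ) + 1) := by
    rw [← Real.rpow_natCast, Nat.cast_add, Nat.cast_one]
  rw [e, two_mul]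
  gcongr 1
  exact Real.rpow_le_rpow_of_exponent_le ht1 (by linarith)

/-- In the constant, `2 C B` covers the two summands of the denominator and `1 + t ≤ 2 t`, the term
`2 L` covers `1 + t ≤ 2` at short times, and `1` ensures positivity. It does not depend on `δ`. The
alternative `G t = 0` accounts for the exceptional times. -/
lemma kernelBounds_of_bounds (hd : 3 ≤ d) {G : ℝ → Space d → ℝ} {B C L : ℝ} (hB : 0 ≤ B) (hC : 0 ≤ C)
    (hL : 0 ≤ L)
    (hest : ∀ B t : ℝ, 0 ≤ B → 0 < t → ∀ u : Space d → ℝ, FreqBound B t u →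
      eLpNorm u ⊤ volume ≤ ENNReal.ofReal (C * B / t ^ (d - 1)) ∧
      eLpNorm u ⊤ volume ≤ ENNReal.ofReal (C * B / t ^ (d + 1)) ∧
      (1 ≤ t → eLpNorm u 1 volume ≤ ENNReal.ofReal (C * B / t) ∧
        ∃ g : Space d → Space d, HasWeakGradient u g ∧
          eLpNorm g 1 volume ≤ ENNReal.ofReal (C * B / t ^ 2) ∧
          eLpNorm g ⊤ volume ≤ ENNReal.ofReal (C * B / t ^ (d + 2))))
    (hfreq : ∀ t, 0 < t → G t = 0 ∨ FreqBound B t (G t))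
    (hone : ∀ t, t ≤ 1 → eLpNorm (G t) 1 volume ≤ ENNReal.ofReal L) {δ : ℝ} (hδ : 0 < δ) (hδ1 : δ < 1) :
    KernelBounds G δ (2 * (C * B) + 2 * L + 1) := by
  have hCB : 0 ≤ C * B := mul_nonneg hC hB
  refine ⟨fun t ht => ?_, fun t ht => ?_, fun t ht => ?_⟩
  · rcases le_total t 1 with h1 | h1
    · refine (hone t h1).trans (ENNReal.ofReal_le_ofReal ?_)
      rw [le_div_iff₀ (by linarith)]
      nlinarith
    · rcases hfreq t ht with h0 | h0
      · rw [h0, eLpNorm_zero]; exact zero_le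
      · refine ((hest B t hB ht _ h0).2.2 h1).1.trans (ENNReal.ofReal_le_ofReal ?_)
        rw [div_le_div_iff₀ ht (by linarith)]
        nlinarith
  · rcases hfreq t ht with h0 | h0
    · rw [h0, eLpNorm_zero]; exact zero_le
    obtain ⟨h2, h3, -⟩ := hest B t hB ht _ h0
    have hp : 0 < t ^ ((d : ℝ) - 1 + δ) + t ^ ((d : ℝ) + 1) := by positivity
    rcases le_total t 1 with h1 | h1
    · refine h2.trans (ENNReal.ofReal_le_ofReal ?_)
      rw [div_le_div_iff₀ (by positivity) hp]
      have := rpow_add_rpow_le_short hd ht h1 hδ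
      have hp' : 0 < t ^ (d - 1) := by positivity
      calc _ ≤ C * B * (2 * t ^ (d - 1)) := by gcongr
        _ = 2 * (C * B) * t ^ (d - 1) := by ring
        _ ≤ _ := by gcongr; linarith
    · refine h3.trans (ENNReal.ofReal_le_ofReal ?_)
      rw [div_le_div_iff₀ (by positivity) hp]
      have := rpow_add_rpow_le_long (d := d) h1 hδ1
      calc _ ≤ C * B * (2 * t ^ (d + 1)) := by gcongr
        _ = 2 * (C * B) * t ^ (d + 1) := by ring
        _ ≤ _ := by gcongr; linarith
  · have ht0 : 0 < t := by linarith
    rcases hfreq t ht0 with h0 | h0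
    · refine ⟨0, ?_, ?_, ?_⟩
      · rw [h0]
        exact ⟨locallyIntegrable_zero, locallyIntegrable_zero, fun φ _ _ => by simp⟩
      · simp
      · simp
    · obtain ⟨g, hg, h1, h2⟩ := ((hest B t hB ht0 _ h0).2.2 ht).2
      have hle : C * B ≤ 2 * (C * B) + 2 * L + 1 := by linarith
      exact ⟨g, hg, h1.trans (ENNReal.ofReal_le_ofReal (by gcongr)),
        h2.trans (ENNReal.ofReal_le_ofReal (by gcongr))⟩

/-- A version of the resolvent that satisfies the kernel bounds at every time. -/
lemma exists_regular_resolvent (hd : 3 ≤ d) {μ : Space d → ℝ} (hreg : RegularEquilibrium μ)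
    (hpen : PenroseStable μ) {β : ℝ} (hβ : 0 < β)
    (hsmall : ∫⁻ q, ENNReal.ofReal (weight β q) * ‖kernel μ q‖ₑ ≤ 1 / 2) :
    ∃ G : ℝ → Space d → ℝ, IsSpaceTimeResolvent μ β (Function.uncurry G) ∧
      ∀ δ : ℝ, 0 < δ → δ < 1 → ∃ C : ℝ, 0 < C ∧ KernelBounds G δ C := by
  obtain ⟨G, hG⟩ := exists_spaceTimeResolvent hreg hsmall
  obtain ⟨B, hB, hfreq⟩ := ae_freqBound hd hreg hpen hsmall hG
  obtain ⟨L, hL, hone⟩ := ae_lintegral_resolvent_le hreg hβ hG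
  obtain ⟨C, hC, hest⟩ := FreqBound.estimates hd
  have hbad : ∀ᵐ t : ℝ, (0 < t → FreqBound B t fun x => G (t, x)) ∧
      (t ≤ 1 → ∫⁻ x : Space d, ‖G (t, x)‖ₑ ≤ ENNReal.ofReal L) := hfreq.and hone
  -- The estimates are required at every time but proved at almost every time. Setting `G` to zero
  -- on a measurable null set of times that contains the bad ones makes them trivial there and
  -- affects no almost-everywhere identity.
  set N : Set ℝ := toMeasurable volume {t : ℝ | ¬((0 < t → FreqBound B t fun x => G (t, x)) ∧
      (t ≤ 1 → ∫⁻ x : Space d, ‖G (t, x)‖ₑ ≤ ENNReal.ofReal L))} with hN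
  have hN0 : volume N = 0 := by rw [hN, measure_toMeasurable]; exact hbad
  have hNm : MeasurableSet N := measurableSet_toMeasurable _ _
  have hgood : ∀ t ∉ N, (0 < t → FreqBound B t fun x => G (t, x)) ∧
      (t ≤ 1 → ∫⁻ x : Space d, ‖G (t, x)‖ₑ ≤ ENNReal.ofReal L) := by
    intro t ht
    by_contra hc
    exact ht (subset_toMeasurable _ _ hc)
  set S : Set (ℝ × Space d) := {q | q.1 ∉ N} with hS
  have hSm : MeasurableSet S := measurable_fst hNm.compl
  set G' : ℝ → Space d → ℝ := fun t x => S.indicator G (t, x) with hG'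
  have hu : Function.uncurry G' = S.indicator G := rfl
  have h0 : ∀ t ∈ N, G' t = 0 := by
    intro t ht
    ext x
    simp only [hG']
    exact indicator_of_notMem (by simpa [hS] using ht) _
  have h1 : ∀ t ∉ N, G' t = fun x => G (t, x) := by
    intro t ht
    ext x
    simp only [hG']
    exact indicator_of_mem (by exact ht) _
  have hae : S.indicator G =ᵐ[volume] G := by
    have : ∀ᵐ q : ℝ × Space d, q.1 ∉ N := by
      have h2 : ∀ᵐ t : ℝ, t ∉ N := by rw [ae_iff]; simpa using hN0
      exact Measure.quasiMeasurePreserving_fst.ae h2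
    filter_upwards [this] with q hq
    exact indicator_of_mem (by exact hq) _
  refine ⟨G', ⟨?_, ?_, ?_, ?_⟩, fun δ hδ hδ1 => ⟨2 * (C * B) + 2 * L + 1, by positivity,
    kernelBounds_of_bounds hd hB hC hL hest (fun t ht => ?_) (fun t ht => ?_) hδ hδ1⟩⟩
  · rw [hu]; exact hG.measurable.indicator hSm
  · intro t ht x
    rw [hu]
    by_cases hq : (t, x) ∈ S
    · rw [indicator_of_mem hq, hG.causal t ht x]
    · rw [indicator_of_notMem hq]
  · rw [hu, convolution_congr_right _ hae]
    exact hae.trans hG.eq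
  · rw [hu]
    refine lt_of_le_of_lt (le_of_eq (lintegral_congr_ae ?_)) hG.weighted
    filter_upwards [hae] with q hq
    rw [hq]
  · by_cases h : t ∈ N
    · exact Or.inl (h0 t h)
    · right
      rw [h1 t h]
      exact (hgood t h).1 ht
  · by_cases h : t ∈ N
    · rw [h0 t h, eLpNorm_zero]; exact zero_le
    · rw [h1 t h, eLpNorm_one_eq_lintegral_enorm]
      exact (hgood t h).2 ht

end ScreenedVlasov
end

/-! ### The density equation as a convolution equation -/

noncomputable section
namespace ScreenedVlasov
open scoped ENNReal NNReal FourierTransform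
open ContinuousLinearMap (mul)
set_option linter.unusedSectionVars false

variable {d : ℕ}

lemma gradPotential_eq (hd : 0 < d) (r : Space d → ℝ) (z : Space d) :
    gradPotential r z = ∫ y, r y • greenGrad (z - y) := by
  rw [gradPotential, convolution_congr _ (EventuallyEq.refl _ r) (ae_gradient_greenKernel hd)]
  rfl

lemma gradPotential_congr {r r' : Space d → ℝ} (h : r =ᵐ[volume] r') :
    gradPotential r = gradPotential r' :=
  convolution_congr _ h (EventuallyEq.refl _ _)

lemma lintegral_lintegral_le_absKernel {μ : Space d → ℝ} (hreg : RegularEquilibrium μ)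
    {ρ : ℝ × Space d → ℝ} (hρ : Measurable ρ) (t : ℝ) (x : Space d) :
    ∫⁻ s in Ioc 0 t, ∫⁻ v, ∫⁻ y, ‖ρ (s, y)‖ₑ * (‖greenGrad (x - (t - s) • v - y)‖ₑ * ‖∇ μ v‖ₑ) ≤
      lconv (fun q => ‖ρ q‖ₑ) (absKernel μ) (t, x) := by
  have hg := measurable_greenGrad (d := d)
  have hm := (continuous_gradient hreg).measurable
  have hk := measurable_absKernel hreg
  have h1 : ∀ᵐ s : ℝ, s ≠ t := by rw [ae_iff]; simp
  calc _ ≤ ∫⁻ s in Ioc 0 t, ∫⁻ y, ‖ρ (s, y)‖ₑ * absKernel μ (t - s, x - y) := by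
        refine lintegral_mono_ae ?_
        filter_upwards [ae_restrict_mem measurableSet_Ioc, ae_restrict_of_ae h1] with s hs hst
        have hst' : 0 < t - s := by
          have := lt_of_le_of_ne hs.2 hst; linarith
        rw [lintegral_lintegral_swap (Measurable.aemeasurable (by
          simp only [Function.uncurry_def]; fun_prop))]
        refine lintegral_mono fun y => ?_
        rw [lintegral_const_mul _ (by fun_prop), absKernel_of_pos hst']
        gcongr with v
        rw [sub_right_comm]
    _ ≤ ∫⁻ s : ℝ, ∫⁻ y, ‖ρ (s, y)‖ₑ * absKernel μ (t - s, x - y) := setLIntegral_le_lintegral _ _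
    _ = _ := by
        rw [lconv, show (volume : Measure (ℝ × Space d)) = volume.prod volume from rfl,
          lintegral_prod _ (by fun_prop)]
        rfl

/-- The reaction term is the convolution with the space-time kernel. -/
lemma reaction_integral_of_measurable (hd : 0 < d) {μ : Space d → ℝ} (hreg : RegularEquilibrium μ)
    {ρ : ℝ → Space d → ℝ} (hρ : Measurable (Function.uncurry ρ))
    (hcausal : ∀ᵐ p : ℝ × Space d, p.1 < 0 → ρ p.1 p.2 = 0) {t : ℝ} (ht : 0 ≤ t) {x : Space d}
    (hfin : lconv (fun q => ‖Function.uncurry ρ q‖ₑ) (absKernel μ) (t, x) < ⊤) :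
    IntegrableOn (fun q : ℝ × Space d => reaction μ ρ t x q.1 q.2) (Ioc 0 t ×ˢ univ) volume ∧
    ∫ s in (0 : ℝ)..t, ∫ v, reaction μ ρ t x s v =
      (kernel μ ⋆[mul ℝ ℝ, volume] Function.uncurry ρ) (t, x) := by
  have hg := measurable_greenGrad (d := d)
  have hm := (continuous_gradient hreg).measurable
  have hk := measurable_kernel hreg
  set ν : Measure ℝ := volume.restrict (Ioc 0 t) with hν
  set Ψ : ℝ × (Space d × Space d) → ℝ := fun q => Function.uncurry ρ (q.1, q.2.2) *
    inner ℝ (greenGrad (x - (t - q.1) • q.2.1 - q.2.2)) (∇ μ q.2.1) with hΨ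
  have hΨm : Measurable Ψ := by
    refine Measurable.mul (by fun_prop) (Measurable.inner ?_ ?_)
    · fun_prop
    · fun_prop
  have hle := lintegral_lintegral_le_absKernel hreg hρ t x
  have hfin' := hle.trans_lt hfin
  have hΨe : ∀ s v y, ‖Ψ (s, v, y)‖ₑ ≤ ‖Function.uncurry ρ (s, y)‖ₑ *
      (‖greenGrad (x - (t - s) • v - y)‖ₑ * ‖∇ μ v‖ₑ) := by
    intro s v y
    simp only [hΨ]
    rw [enorm_mul]
    gcongr
    rw [← ofReal_norm, ← ofReal_norm, ← ofReal_norm, ← ENNReal.ofReal_mul (norm_nonneg _)]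
    exact ENNReal.ofReal_le_ofReal (norm_inner_le_norm _ _)
  have hΨi : Integrable Ψ (ν.prod (volume.prod volume)) := by
    refine ⟨hΨm.aestronglyMeasurable, ?_⟩
    rw [hasFiniteIntegral_iff_enorm, lintegral_prod _ hΨm.enorm.aemeasurable]
    refine lt_of_le_of_lt (lintegral_mono fun s => ?_) hfin'
    rw [lintegral_prod _ (by fun_prop)]
    exact lintegral_mono fun v => lintegral_mono fun y => hΨe s v y
  have hΨ2 : Integrable (fun q : (ℝ × Space d) × Space d => Ψ (q.1.1, (q.1.2, q.2)))
      ((ν.prod volume).prod volume) :=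
    (measurePreserving_prodAssoc ν (volume : Measure (Space d)) (volume : Measure (Space d))).integrable_comp_of_integrable hΨi
  -- The inner product with `∇μ` must be moved inside the Bochner integral defining `gradPotential`,
  -- which requires that integral to converge.
  have hinner : ∀ᵐ q : ℝ × Space d ∂(ν.prod volume), reaction μ ρ t x q.1 q.2 = ∫ y, Ψ (q.1, (q.2, y)) := by
    have h1 : ∀ᵐ q : ℝ × Space d ∂(ν.prod volume), ∫⁻ y, ‖Function.uncurry ρ (q.1, y)‖ₑ *
        (‖greenGrad (x - (t - q.1) • q.2 - y)‖ₑ * ‖∇ μ q.2‖ₑ) < ⊤ := by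
      refine ae_lt_top (Measurable.lintegral_prod_right' (f := fun p : (ℝ × Space d) × Space d =>
        ‖Function.uncurry ρ (p.1.1, p.2)‖ₑ *
        (‖greenGrad (x - (t - p.1.1) • p.1.2 - p.2)‖ₑ * ‖∇ μ p.1.2‖ₑ)) (by fun_prop)) ?_
      rw [lintegral_prod _ (Measurable.aemeasurable (Measurable.lintegral_prod_right' (f := fun p : (ℝ × Space d) × Space d =>
        ‖Function.uncurry ρ (p.1.1, p.2)‖ₑ *
        (‖greenGrad (x - (t - p.1.1) • p.1.2 - p.2)‖ₑ * ‖∇ μ p.1.2‖ₑ)) (by fun_prop)))]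
      exact hfin'.ne
    filter_upwards [h1] with q hq
    rw [reaction, gradPotential_eq hd]
    -- Where `∇μ` vanishes the potential integral may diverge, but both sides are zero; elsewhere
    -- its convergence follows from that of the product with `‖∇μ‖`.
    by_cases h0 : ∇ μ q.2 = 0
    · simp only [hΨ]
      rw [h0]
      simp only [inner_zero_right, mul_zero, integral_zero]
    · have hi : Integrable fun y => ρ q.1 y • greenGrad (x - (t - q.1) • q.2 - y) := by
        refine ⟨Measurable.aestronglyMeasurable ?_, ?_⟩
        · have : Measurable (ρ q.1) := hρ.comp measurable_prodMk_left
          exact this.smul (by fun_prop)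
        · rw [hasFiniteIntegral_iff_enorm]
          by_contra hc
          rw [not_lt, top_le_iff] at hc
          have e : ∀ y, ‖Function.uncurry ρ (q.1, y)‖ₑ *
              (‖greenGrad (x - (t - q.1) • q.2 - y)‖ₑ * ‖∇ μ q.2‖ₑ) =
              ‖ρ q.1 y • greenGrad (x - (t - q.1) • q.2 - y)‖ₑ * ‖∇ μ q.2‖ₑ := fun y => by
            rw [enorm_smul, mul_assoc]; rfl
          simp_rw [e] at hq
          rw [lintegral_mul_const' _ _ enorm_ne_top, hc, ENNReal.top_mul (by simpa using h0)] at hq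
          exact lt_irrefl _ hq
      rw [real_inner_comm, ← integral_inner hi]
      congr 1; ext y
      simp only [hΨ]
      rw [inner_smul_right, real_inner_comm]
      rfl
  have hreact : Integrable (fun q : ℝ × Space d => reaction μ ρ t x q.1 q.2) (ν.prod volume) :=
    hΨ2.integral_prod_left.congr (hinner.mono fun q hq => hq.symm)
  have hmeas : ν.prod (volume : Measure (Space d)) = (volume : Measure (ℝ × Space d)).restrict (Ioc 0 t ×ˢ univ) := by
    rw [show (volume : Measure (ℝ × Space d)) = volume.prod volume from rfl, ← Measure.prod_restrict,
      Measure.restrict_univ]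
  refine ⟨by rw [IntegrableOn, ← hmeas]; exact hreact, ?_⟩
  have hconv : Integrable (fun q : ℝ × Space d => Function.uncurry ρ q * kernel μ ((t, x) - q)) := by
    refine convolutionExistsAt_of_lconv (f := Function.uncurry ρ) (g := kernel μ)
      hρ.aestronglyMeasurable hk.aestronglyMeasurable (lt_of_le_of_lt (lintegral_mono fun q => ?_) hfin)
    gcongr
    exact enorm_kernel_le _
  have h1 : ∀ᵐ s : ℝ ∂ν, ∀ᵐ v : Space d, reaction μ ρ t x s v = ∫ y, Ψ (s, (v, y)) :=
    Measure.ae_ae_of_ae_prod hinner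
  have h2 : ∀ᵐ s : ℝ ∂ν, Integrable (fun p : Space d × Space d => Ψ (s, p)) (volume.prod volume) :=
    hΨi.prod_right_ae
  have hst : ∀ᵐ s : ℝ ∂ν, s ≠ t := by
    refine ae_restrict_of_ae ?_
    rw [ae_iff]; simp
  calc _ = ∫ s, (∫ v, reaction μ ρ t x s v) ∂ν := intervalIntegral.integral_of_le ht
    _ = ∫ s, (∫ y, Function.uncurry ρ (s, y) * kernel μ ((t, x) - (s, y))) ∂ν := by
        refine integral_congr_ae ?_
        filter_upwards [h1, h2, hst, ae_restrict_mem measurableSet_Ioc] with s h1 h2 hst hs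
        have hst' : 0 < t - s := by
          have := lt_of_le_of_ne hs.2 hst; linarith
        rw [integral_congr_ae h1, integral_integral_swap h2]
        congr 1; ext y
        rw [show ((t, x) - (s, y) : ℝ × Space d) = (t - s, x - y) from rfl, kernel_of_pos hst',
          ← integral_const_mul]
        simp only [hΨ]
        congr 1; ext v
        rw [sub_right_comm]
    _ = ∫ q, Function.uncurry ρ q * kernel μ ((t, x) - q) ∂(ν.prod volume) := by
        rw [integral_prod]
        rw [hmeas]
        exact hconv.integrableOn
    _ = ∫ q, Function.uncurry ρ q * kernel μ ((t, x) - q) := by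
        rw [hmeas]
        -- Outside `0 < s ≤ t` the integrand vanishes almost everywhere: for `s < 0` by causality of
        -- `ρ`, for `s > t` by causality of the kernel, and `s = 0` is null.
        refine setIntegral_eq_integral_of_ae_compl_eq_zero ?_
        have h0 : ∀ᵐ q : ℝ × Space d, q.1 ≠ 0 := by
          refine Measure.quasiMeasurePreserving_fst.ae (p := fun s : ℝ => s ≠ 0) ?_
          rw [ae_iff]; simp
        filter_upwards [hcausal, h0] with q hq h0 hn
        rcases lt_or_ge q.1 0 with h | h
        · simp [Function.uncurry, hq h]
        · have h3 : t < q.1 := by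
            by_contra hc
            exact hn ⟨⟨lt_of_le_of_ne h h0.symm, not_lt.1 hc⟩, mem_univ _⟩
          rw [show kernel μ ((t, x) - q) = 0 from kernel_of_nonpos (t := t - q.1) (by linarith) (x - q.2),
            mul_zero]
    _ = _ := by
        rw [convolution_mul_comm, convolution_def]
        rfl

lemma lconv_congr_left {V : Type*} [NormedAddCommGroup V] [MeasureSpace V] {a a' : V → ℝ≥0∞} (h : a =ᵐ[volume] a') (b : V → ℝ≥0∞) (x : V) :
    lconv a b x = lconv a' b x := by
  refine lintegral_congr_ae ?_
  filter_upwards [h] with y hy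
  rw [hy]

/-- At almost every time the slices of `ρ` and of its measurable version agree almost everywhere,
and `gradPotential` sees only such classes. So the measurable case suffices. -/
lemma reaction_integral (hd : 0 < d) {μ : Space d → ℝ} (hreg : RegularEquilibrium μ)
    {ρ : ℝ → Space d → ℝ} (hρ : AEStronglyMeasurable (Function.uncurry ρ))
    (hcausal : ∀ᵐ p : ℝ × Space d, p.1 < 0 → ρ p.1 p.2 = 0) {t : ℝ} (ht : 0 ≤ t) {x : Space d}
    (hfin : lconv (fun q => ‖Function.uncurry ρ q‖ₑ) (absKernel μ) (t, x) < ⊤) :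
    IntegrableOn (fun q : ℝ × Space d => reaction μ ρ t x q.1 q.2) (Ioc 0 t ×ˢ univ) volume ∧
    ∫ s in (0 : ℝ)..t, ∫ v, reaction μ ρ t x s v =
      (kernel μ ⋆[mul ℝ ℝ, volume] Function.uncurry ρ) (t, x) := by
  set ρ' : ℝ → Space d → ℝ := fun s y => hρ.mk _ (s, y) with hρ'
  have hu : Function.uncurry ρ' = hρ.mk _ := rfl
  have hae : Function.uncurry ρ =ᵐ[volume] Function.uncurry ρ' := hρ.ae_eq_mk
  have hs : ∀ᵐ s : ℝ, ρ s =ᵐ[volume] ρ' s := Measure.ae_ae_of_ae_prod hae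
  have hr : ∀ᵐ s : ℝ, ∀ v, reaction μ ρ t x s v = reaction μ ρ' t x s v := by
    filter_upwards [hs] with s hs v
    rw [reaction, reaction, gradPotential_congr hs]
  have hcausal' : ∀ᵐ p : ℝ × Space d, p.1 < 0 → ρ' p.1 p.2 = 0 := by
    filter_upwards [hcausal, hae] with p h1 h2 h3
    have : ρ p.1 p.2 = ρ' p.1 p.2 := h2
    rw [← this, h1 h3]
  have hfin' : lconv (fun q => ‖Function.uncurry ρ' q‖ₑ) (absKernel μ) (t, x) < ⊤ := by
    exact lt_of_eq_of_lt (lconv_congr_left (hae.fun_comp fun r => ‖r‖ₑ) _ _).symm hfin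
  obtain ⟨h1, h2⟩ := reaction_integral_of_measurable hd hreg (by rw [hu]; exact hρ.stronglyMeasurable_mk.measurable)
    hcausal' ht hfin'
  constructor
  · refine h1.congr ?_
    refine ae_restrict_of_ae ?_
    have := Measure.quasiMeasurePreserving_fst (μ := (volume : Measure ℝ))
      (ν := (volume : Measure (Space d))).ae hr
    filter_upwards [this] with q hq using (hq q.2).symm
  · rw [convolution_congr_right _ hae, ← h2]
    refine intervalIntegral.integral_congr_ae ?_
    filter_upwards [hr] with s hs _
    simp only [hs]

end ScreenedVlasov
end

/-! ### Uniqueness in the class of locally integrable `L²`-valued functions -/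

noncomputable section
namespace ScreenedVlasov
open scoped ENNReal NNReal FourierTransform
open ContinuousLinearMap (mul)
set_option linter.unusedSectionVars false

variable {d : ℕ}

lemma lconv_comm (a b : ℝ × Space d → ℝ≥0∞) : lconv a b = lconv b a := by
  ext x
  rw [lconv, ← lintegral_sub_left_eq_self _ x, lconv]
  refine lintegral_congr fun y => ?_
  rw [sub_sub_cancel, mul_comm]

/-- A weight that is moderate with respect to `weight` and decays in space. -/
def dualWeight (β : ℝ) (q : ℝ × Space d) : ℝ := Real.exp (-(β * q.1)) * ((1 + ‖q.2‖) ^ (d + 1))⁻¹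

lemma dualWeight_pos (β : ℝ) (q : ℝ × Space d) : 0 < dualWeight β q := by
  unfold dualWeight; positivity

lemma measurable_dualWeight (β : ℝ) : Measurable (dualWeight (d := d) β) := by
  unfold dualWeight; fun_prop

/-- A Peetre inequality: `1 + |q| ≤ (1 + |p|)(1 + |p + q|)`. Hence the smallness of the kernel under
the growing weight also controls functions measured with the decaying one. -/
lemma dualWeight_add_le (β : ℝ) (p q : ℝ × Space d) :
    dualWeight β (p + q) ≤ weight β p * dualWeight β q := by
  unfold dualWeight weight
  rw [exp_mul_char]
  have h := one_add_norm_add_le (-p.2) (p.2 + q.2) (d + 1)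
  rw [norm_neg, neg_add_cancel_left] at h
  have h2 : ((1 + ‖p.2 + q.2‖) ^ (d + 1))⁻¹ ≤ (1 + ‖p.2‖) ^ (d + 1) * ((1 + ‖q.2‖) ^ (d + 1))⁻¹ := by
    rw [← div_eq_mul_inv, le_div_iff₀ (by positivity), inv_mul_le_iff₀ (by positivity)]
    linarith
  calc _ ≤ Real.exp (-(β * p.1)) * Real.exp (-(β * q.1)) *
        ((1 + ‖p.2‖) ^ (d + 1) * ((1 + ‖q.2‖) ^ (d + 1))⁻¹) :=
        mul_le_mul_of_nonneg_left h2 (by positivity)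
    _ = _ := by ring

lemma ofReal_dualWeight_add_le (β : ℝ) (p q : ℝ × Space d) :
    ENNReal.ofReal (dualWeight β (p + q)) ≤
      ENNReal.ofReal (weight β p) * ENNReal.ofReal (dualWeight β q) := by
  rw [← ENNReal.ofReal_mul (weight_pos β p).le]
  exact ENNReal.ofReal_le_ofReal (dualWeight_add_le β p q)

lemma measurableSet_time_le (T : ℝ) : MeasurableSet {q : ℝ × Space d | q.1 ≤ T} :=
  measurableSet_le measurable_fst measurable_const

lemma aemeasurable_dualWeight_mul_indicator (β : ℝ) {f : ℝ × Space d → ℝ}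
    (hf : AEStronglyMeasurable f) (T : ℝ) :
    AEMeasurable fun q => ENNReal.ofReal (dualWeight β q) *
      {q : ℝ × Space d | q.1 ≤ T}.indicator (fun q => ‖f q‖ₑ) q :=
  (measurable_dualWeight β).ennreal_ofReal.aemeasurable.mul
    (hf.enorm.indicator (measurableSet_time_le T))

/-- Weighted integrability of functions with controlled `L²` norms. -/
lemma exists_lintegral_decay_mul_le :
    ∃ A : ℝ≥0∞, A ≠ ⊤ ∧ ∀ f : Space d → ℝ, AEStronglyMeasurable f →
      ∫⁻ x, ENNReal.ofReal (((1 + ‖x‖) ^ (d + 1))⁻¹) * ‖f x‖ₑ ≤ A * eLpNorm f 2 volume := by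
  refine ⟨(∫⁻ x : Space d, ENNReal.ofReal (((1 + ‖x‖) ^ (d + 1))⁻¹) ^ (2:ℝ)) ^ (1 / (2:ℝ)), ?_, ?_⟩
  · refine ENNReal.rpow_ne_top_of_nonneg (by norm_num) ?_
    have h := finite_integral_one_add_norm (E := Space d) (μ := volume) (r := (d + 1 : ℕ)) (by simp)
    refine (lt_of_le_of_lt (lintegral_mono fun x => ?_) h).ne
    rw [Real.rpow_neg (by positivity), Real.rpow_natCast, ENNReal.ofReal_rpow_of_nonneg (by positivity) (by norm_num)]
    refine ENNReal.ofReal_le_ofReal ?_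
    rw [Real.rpow_two, sq]
    refine mul_le_of_le_one_left (by positivity) (inv_le_one_of_one_le₀ (one_le_pow₀ ?_))
    have := norm_nonneg x
    linarith
  · intro f hf
    have h := ENNReal.lintegral_mul_le_Lp_mul_Lq (volume : Measure (Space d)) Real.HolderConjugate.two_two
      (f := fun x => ENNReal.ofReal (((1 + ‖x‖) ^ (d + 1))⁻¹)) (g := fun x => ‖f x‖ₑ)
      (by fun_prop) hf.enorm
    rw [eLpNorm_eq_lintegral_rpow_enorm_toReal (by norm_num) (by norm_num)]
    simpa using h

/-- An `L²` slice need not be integrable, but the spatial factor of the dual weight is square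
integrable and Cauchy-Schwarz applies. Times are restricted to `[0, T]` by causality and the
indicator, and there `e^{-βt} ≤ 1`. -/
lemma lintegral_dualWeight_indicator_lt_top {β : ℝ} (hβ : 0 < β) {ρ : ℝ → Space d → ℝ}
    (hρ : AEStronglyMeasurable (Function.uncurry ρ))
    (hloc : ∀ T : ℝ, ∫⁻ t in Icc (-T) T, eLpNorm (ρ t) 2 volume < ⊤)
    (hcausal : ∀ᵐ p : ℝ × Space d, p.1 < 0 → ρ p.1 p.2 = 0) (T : ℝ) :
    ∫⁻ q, ENNReal.ofReal (dualWeight β q) *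
      {q : ℝ × Space d | q.1 ≤ T}.indicator (fun q => ‖Function.uncurry ρ q‖ₑ) q < ⊤ := by
  obtain ⟨A, hA, hAf⟩ := exists_lintegral_decay_mul_le (d := d)
  rw [show (volume : Measure (ℝ × Space d)) = volume.prod volume from rfl,
    lintegral_prod _ (aemeasurable_dualWeight_mul_indicator β hρ T)]
  have h1 : ∀ᵐ t : ℝ, AEStronglyMeasurable (ρ t) volume := hρ.prodMk_left
  have h2 : ∀ᵐ t : ℝ, ∀ᵐ x : Space d, t < 0 → ρ t x = 0 := Measure.ae_ae_of_ae_prod hcausal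
  calc _ ≤ ∫⁻ t : ℝ, (Icc (-T) T).indicator (fun t => A * eLpNorm (ρ t) 2 volume) t := by
        refine lintegral_mono_ae ?_
        filter_upwards [h1, h2] with t h1 h2
        rcases lt_or_ge t 0 with ht | ht
        · refine le_trans (le_of_eq ?_) zero_le
          rw [lintegral_eq_zero_of_ae_eq_zero]
          filter_upwards [h2] with x hx
          simp [indicator_apply, Function.uncurry, hx ht]
        · by_cases hT : t ≤ T
          · rw [indicator_of_mem (by constructor <;> linarith)]
            refine le_trans (lintegral_mono fun x => ?_) (hAf _ h1)
            rw [indicator_of_mem (by exact hT)]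
            refine mul_le_mul_left (ENNReal.ofReal_le_ofReal ?_) _
            unfold dualWeight
            refine mul_le_of_le_one_left (by positivity) (Real.exp_le_one_iff.2 ?_)
            have := mul_nonneg hβ.le ht
            simp only
            linarith
          · refine le_trans (le_of_eq ?_) zero_le
            have : ∀ x : Space d, {q : ℝ × Space d | q.1 ≤ T}.indicator
                (fun q => ‖Function.uncurry ρ q‖ₑ) (t, x) = 0 := fun x =>
              indicator_of_notMem (by exact hT) _
            simp [this]
    _ = A * ∫⁻ t in Icc (-T) T, eLpNorm (ρ t) 2 volume := by
        rw [lintegral_indicator measurableSet_Icc, lintegral_const_mul' _ _ hA]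
    _ < ⊤ := ENNReal.mul_lt_top hA.lt_top (hloc T)

/-- Up to time `n` the convolution only involves the restriction of `a` to times `≤ n`, for which
the weighted Young inequality gives finiteness; a countable union over `n` covers all times. -/
lemma ae_lconv_absKernel_lt_top {μ : Space d → ℝ} (hreg : RegularEquilibrium μ) {β : ℝ}
    (hsmall : ∫⁻ q, ENNReal.ofReal (weight β q) * absKernel μ q ≤ 1 / 2)
    {a : ℝ × Space d → ℝ≥0∞} (ha : AEMeasurable a)
    (hfin : ∀ T : ℝ, ∫⁻ q, ENNReal.ofReal (dualWeight β q) *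
      {q : ℝ × Space d | q.1 ≤ T}.indicator a q < ⊤) :
    ∀ᵐ q, lconv a (absKernel μ) q < ⊤ := by
  have hmW := (measurable_dualWeight (d := d) β).ennreal_ofReal
  have hmk := (measurable_absKernel hreg).aemeasurable (μ := (volume : Measure (ℝ × Space d)))
  have h1 : ∀ n : ℕ, ∀ᵐ q, ENNReal.ofReal (dualWeight β q) *
      lconv (absKernel μ) ({q : ℝ × Space d | q.1 ≤ (n : ℝ)}.indicator a) q < ⊤ := by
    intro n
    have hi := ha.indicator (measurableSet_time_le (n : ℝ))
    refine ae_lt_top' (hmW.aemeasurable.mul (aemeasurable_lconv hmk hi)) (ne_of_lt ?_)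
    exact (lintegral_mul_lconv_le hmk hi (measurable_weight β).ennreal_ofReal hmW
      (ofReal_dualWeight_add_le β)).trans_lt
        (ENNReal.mul_lt_top (hsmall.trans_lt (by simp)) (hfin n))
  filter_upwards [ae_all_iff.2 h1] with q hq
  obtain ⟨n, hn⟩ := exists_nat_ge q.1
  have h2 : lconv a (absKernel μ) q =
      lconv (absKernel μ) ({q : ℝ × Space d | q.1 ≤ (n : ℝ)}.indicator a) q := by
    rw [lconv_comm]
    refine lintegral_congr fun y => ?_
    rcases le_or_gt y.1 0 with hy | hy
    · rw [show absKernel μ y = 0 from absKernel_of_nonpos hy y.2, zero_mul, zero_mul]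
    · rw [indicator_of_mem (by simp only [mem_ofPred_eq, Prod.fst_sub]; linarith)]
  rw [h2]
  by_contra hc
  rw [not_lt, top_le_iff] at hc
  have := hq n
  rw [hc, ENNReal.mul_top (by simpa using dualWeight_pos β q)] at this
  exact lt_irrefl _ this

/-- In the solution class the density equation is a convolution equation. -/
lemma ae_reaction_integral (hd : 0 < d) {μ : Space d → ℝ} (hreg : RegularEquilibrium μ) {β : ℝ}
    (hβ : 0 < β) (hsmall : ∫⁻ q, ENNReal.ofReal (weight β q) * absKernel μ q ≤ 1 / 2)
    {ρ : ℝ → Space d → ℝ} (hρ : AEStronglyMeasurable (Function.uncurry ρ))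
    (hloc : ∀ T : ℝ, ∫⁻ t in Icc (-T) T, eLpNorm (ρ t) 2 volume < ⊤)
    (hcausal : ∀ᵐ p : ℝ × Space d, p.1 < 0 → ρ p.1 p.2 = 0) :
    ∀ᵐ p : ℝ × Space d, ConvolutionExistsAt (kernel μ) (Function.uncurry ρ) p (mul ℝ ℝ) volume ∧
      (0 ≤ p.1 →
        IntegrableOn (fun q : ℝ × Space d => reaction μ ρ p.1 p.2 q.1 q.2) (Ioc 0 p.1 ×ˢ univ) volume ∧
        ∫ s in (0 : ℝ)..p.1, ∫ v, reaction μ ρ p.1 p.2 s v =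
          (kernel μ ⋆[mul ℝ ℝ, volume] Function.uncurry ρ) p) := by
  have hfin := ae_lconv_absKernel_lt_top hreg hsmall hρ.enorm
    (lintegral_dualWeight_indicator_lt_top hβ hρ hloc hcausal)
  filter_upwards [hfin] with p hp
  refine ⟨convolutionExistsAt_of_lconv (measurable_kernel hreg).aestronglyMeasurable hρ ?_,
    fun h0 => reaction_integral hd hreg hρ hcausal h0 hp⟩
  rw [lconv_comm] at hp
  refine lt_of_le_of_lt (lintegral_mono fun q => ?_) hp
  exact mul_le_mul_left (enorm_kernel_le q) _

/-- The difference satisfies `|D| ≤ |K| * |D|`. Restricted to times `≤ n` it has finite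
dual-weighted norm, and a kernel of norm at most `1/2` forces it to vanish. -/
lemma IsDensitySolution.ae_eq (hd : 0 < d) {μ : Space d → ℝ} (hreg : RegularEquilibrium μ) {β : ℝ}
    (hβ : 0 < β) (hsmall : ∫⁻ q, ENNReal.ofReal (weight β q) * absKernel μ q ≤ 1 / 2)
    {S ρ ρ' : ℝ → Space d → ℝ} (h : IsDensitySolution μ S ρ) (h' : IsDensitySolution μ S ρ') :
    Function.uncurry ρ =ᵐ[volume] Function.uncurry ρ' := by
  set D : ℝ × Space d → ℝ := fun q => Function.uncurry ρ q - Function.uncurry ρ' q with hD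
  have hDm : AEStronglyMeasurable D := h.measurable.sub h'.measurable
  have hle : ∀ᵐ q, ‖D q‖ₑ ≤ 0 + lconv (fun q => ‖kernel μ q‖ₑ) (fun q => ‖D q‖ₑ) q := by
    filter_upwards [h.causal, h'.causal, h.equation, h'.equation,
      ae_reaction_integral hd hreg hβ hsmall h.measurable h.locallyIntegrable h.causal,
      ae_reaction_integral hd hreg hβ hsmall h'.measurable h'.locallyIntegrable h'.causal]
      with q c c' e e' r r'
    rcases lt_or_ge q.1 0 with hq | hq
    · simp [hD, Function.uncurry, c hq, c' hq]
    · have : D q = (0 : ℝ × Space d → ℝ) q + (kernel μ ⋆[mul ℝ ℝ, volume] D) q := by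
        have h1 : (kernel μ ⋆[mul ℝ ℝ, volume] D) q =
            (kernel μ ⋆[mul ℝ ℝ, volume] Function.uncurry ρ) q -
            (kernel μ ⋆[mul ℝ ℝ, volume] Function.uncurry ρ') q := by
          simp only [convolution_def, hD, ContinuousLinearMap.mul_apply', mul_sub]
          exact integral_sub r.1 r'.1
        rw [h1, ← (r.2 hq).2, ← (r'.2 hq).2]
        simp only [hD, Function.uncurry, Pi.zero_apply]
        rw [(e hq).2, (e' hq).2]
        ring
      simpa using enorm_le_add_lconv this
  have hz : ∀ n : ℕ, {q : ℝ × Space d | q.1 ≤ (n : ℝ)}.indicator (fun q => ‖D q‖ₑ) =ᵐ[volume] 0 := by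
    intro n
    refine ae_eq_zero_of_absorption hreg (measurable_weight β).ennreal_ofReal
      (measurable_dualWeight β).ennreal_ofReal (ofReal_dualWeight_add_le β)
      (fun q => by simpa using dualWeight_pos β q) (weight_kernel_small hsmall)
      (hDm.enorm.indicator (measurableSet_time_le _)) ?_ ?_
    · filter_upwards [hle] with q hq
      have := indicator_le_lconv_kernel (T := (n : ℝ)) (b := 0) (fun _ => hq)
      simpa using this
    · have f := lintegral_dualWeight_indicator_lt_top hβ h.measurable h.locallyIntegrable h.causal n
      have f' := lintegral_dualWeight_indicator_lt_top hβ h'.measurable h'.locallyIntegrable h'.causal n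
      refine lt_of_le_of_lt ?_ (ENNReal.add_lt_top.2 ⟨f, f'⟩)
      rw [← lintegral_add_left' (aemeasurable_dualWeight_mul_indicator β h.measurable n)]
      refine lintegral_mono fun q => ?_
      rw [← mul_add]
      refine mul_le_mul_right ?_ _
      by_cases hq : q.1 ≤ (n : ℝ)
      · rw [indicator_of_mem (by exact hq), indicator_of_mem (by exact hq), indicator_of_mem (by exact hq)]
        exact enorm_sub_le
      · rw [indicator_of_notMem (by exact hq)]
        exact zero_le
  filter_upwards [ae_all_iff.2 hz] with q hq
  obtain ⟨n, hn⟩ := exists_nat_ge q.1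
  have := hq n
  rw [indicator_of_mem (by exact hn)] at this
  have h0 : D q = 0 := by simpa using this
  exact sub_eq_zero.1 h0

end ScreenedVlasov
end

/-! ### Existence and the resolvent formula -/

noncomputable section
namespace ScreenedVlasov
open scoped ENNReal NNReal FourierTransform
open ContinuousLinearMap (mul)
set_option linter.unusedSectionVars false

variable {d : ℕ}

/-- `‖f‖₂² ≤ ‖f‖_∞ ‖f‖₁ ≤ (‖f‖₁ + ‖f‖_∞)²`. It reduces membership in the solution class to separate
bounds in `L¹` and `L^∞`. -/
lemma eLpNorm_two_le_one_add_top {α : Type*} [MeasurableSpace α] {ν : Measure α} (f : α → ℝ) :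
    eLpNorm f 2 ν ≤ eLpNorm f 1 ν + eLpNorm f ⊤ ν := by
  by_cases hM : eLpNorm f ⊤ ν = ⊤
  · rw [hM]; simp
  rw [eLpNorm_eq_lintegral_rpow_enorm_toReal (by norm_num) (by norm_num), eLpNorm_one_eq_lintegral_enorm]
  rw [eLpNorm_exponent_top] at *
  have h1 : ∫⁻ x, ‖f x‖ₑ ^ (2:ℝ) ∂ν ≤ eLpNormEssSup f ν * ∫⁻ x, ‖f x‖ₑ ∂ν := by
    rw [← lintegral_const_mul' _ _ hM]
    refine lintegral_mono_ae ?_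
    filter_upwards [enorm_ae_le_eLpNormEssSup f ν] with x hx
    rw [ENNReal.rpow_two, sq]
    gcongr
  have h2 : ∫⁻ x, ‖f x‖ₑ ^ (2:ℝ) ∂ν ≤ (∫⁻ x, ‖f x‖ₑ ∂ν + eLpNormEssSup f ν) ^ (2:ℝ) := by
    refine h1.trans ?_
    rw [ENNReal.rpow_two, sq]
    exact mul_le_mul' le_add_self le_self_add
  simp only [ENNReal.toReal_ofNat]
  rw [one_div, ENNReal.rpow_inv_le_iff (by norm_num)]
  exact h2

/-- The sublevel set at height `c` consists of the times at which the slice of `{‖f‖ₑ > c}` is null,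
and slice measures are measurable functions of time. -/
lemma measurable_eLpNorm_top {f : ℝ → Space d → ℝ} (hf : StronglyMeasurable (Function.uncurry f)) :
    Measurable fun t => eLpNorm (f t) ⊤ volume := by
  refine measurable_of_Iic fun c => ?_
  have hm : MeasurableSet {p : ℝ × Space d | c < ‖f p.1 p.2‖ₑ} :=
    measurableSet_lt measurable_const hf.measurable.enorm
  have h1 := measurable_measure_prodMk_left (ν := (volume : Measure (Space d))) hm
  convert h1 (measurableSet_singleton 0) using 1
  ext t
  simp only [eLpNorm_exponent_top, mem_preimage, mem_Iic, mem_singleton_iff]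
  have h2 : (volume (Prod.mk t ⁻¹' {p : ℝ × Space d | c < ‖f p.1 p.2‖ₑ}) = 0) ↔
      ∀ᵐ x, ‖f t x‖ₑ ≤ c := by
    rw [ae_iff]
    simp only [not_le]
    rfl
  rw [h2]
  constructor
  · intro h
    filter_upwards [enorm_ae_le_eLpNormEssSup (f t) volume] with x hx using hx.trans h
  · exact fun h => essSup_le_of_ae_le _ h

lemma measurable_eLpNorm_one {f : ℝ → Space d → ℝ} (hf : StronglyMeasurable (Function.uncurry f)) :
    Measurable fun t => eLpNorm (f t) 1 volume := by
  simp_rw [eLpNorm_one_eq_lintegral_enorm]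
  exact hf.measurable.enorm.lintegral_prod_right'

lemma IsSource.exists_measurable {S : ℝ → Space d → ℝ} (h : IsSource S) :
    ∃ S' : ℝ → Space d → ℝ, StronglyMeasurable (Function.uncurry S') ∧
      (∀ t < 0, ∀ x, S' t x = 0) ∧ Function.uncurry S =ᵐ[volume] Function.uncurry S' ∧
      ∫⁻ t, (eLpNorm (S' t) 1 volume + eLpNorm (S' t) ⊤ volume) < ⊤ := by
  have hms : MeasurableSet {q : ℝ × Space d | 0 ≤ q.1} := measurableSet_le measurable_const measurable_fst
  set F : ℝ × Space d → ℝ := {q : ℝ × Space d | 0 ≤ q.1}.indicator (h.measurable.mk _) with hF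
  have hae : Function.uncurry S =ᵐ[volume] F := by
    filter_upwards [h.measurable.ae_eq_mk, h.causal] with q h1 h2
    rcases lt_or_ge q.1 0 with hq | hq
    · rw [hF, indicator_of_notMem (by simpa using hq)]
      exact h2 hq
    · rw [hF, indicator_of_mem (by exact hq), h1]
  refine ⟨fun t x => F (t, x), h.measurable.stronglyMeasurable_mk.indicator hms, fun t ht x =>
    indicator_of_notMem (by simpa using ht) _, hae, ?_⟩
  have hs : ∀ᵐ t : ℝ, S t =ᵐ[volume] fun x => F (t, x) := Measure.ae_ae_of_ae_prod hae
  refine lt_of_le_of_lt (lintegral_mono_ae ?_) h.integrable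
  filter_upwards [hs] with t ht
  rw [eLpNorm_congr_ae ht, eLpNorm_congr_ae ht]

lemma setLIntegral_Icc_le_exp {β : ℝ} (hβ : 0 < β) (T : ℝ) (f : ℝ → ℝ≥0∞) :
    ∫⁻ t in Icc (-T) T, f t ≤
      ENNReal.ofReal (Real.exp (β * T)) * ∫⁻ t, ENNReal.ofReal (Real.exp (-(β * t))) * f t := by
  rw [← lintegral_const_mul' _ _ ENNReal.ofReal_ne_top]
  refine le_trans (setLIntegral_mono' measurableSet_Icc fun t ht => ?_) (setLIntegral_le_lintegral _ _)
  rw [← mul_assoc, ← ENNReal.ofReal_mul (Real.exp_pos _).le, ← Real.exp_add]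
  refine le_mul_of_one_le_left' ?_
  rw [ENNReal.one_le_ofReal, Real.one_le_exp_iff]
  have := mul_le_mul_of_nonneg_left ht.2 hβ.le
  linarith

section Source

variable {β : ℝ} {G S : ℝ → Space d → ℝ}

lemma lintegral_exp_source_lt_top (hβ : 0 < β) (hS : StronglyMeasurable (Function.uncurry S))
    (hc : ∀ t < 0, ∀ x, S t x = 0)
    (hfin : ∫⁻ t, (eLpNorm (S t) 1 volume + eLpNorm (S t) ⊤ volume) < ⊤) :
    ∫⁻ q, ENNReal.ofReal (Real.exp (-(β * q.1))) * ‖Function.uncurry S q‖ₑ < ⊤ := by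
  have hSm := hS.measurable
  rw [show (volume : Measure (ℝ × Space d)) = volume.prod volume from rfl, lintegral_prod _ (by fun_prop)]
  refine lt_of_le_of_lt (lintegral_mono fun t => ?_) hfin
  refine le_trans ?_ le_self_add
  rw [eLpNorm_one_eq_lintegral_enorm]
  refine lintegral_mono fun x => ?_
  rcases lt_or_ge t 0 with ht | ht
  · simp [Function.uncurry, hc t ht x]
  · refine mul_le_of_le_one_left' ?_
    rw [ENNReal.ofReal_le_one, Real.exp_le_one_iff]
    have := mul_nonneg hβ.le ht
    simp only; linarith

lemma lintegral_exp_mul_top_lt_top (hβ : 0 < β) (hc : ∀ t < 0, ∀ x, S t x = 0)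
    (hfin : ∫⁻ t, (eLpNorm (S t) 1 volume + eLpNorm (S t) ⊤ volume) < ⊤) :
    ∫⁻ t, ENNReal.ofReal (Real.exp (-(β * t))) * eLpNorm (S t) ⊤ volume < ⊤ := by
  refine lt_of_le_of_lt (lintegral_mono fun t => ?_) hfin
  refine le_trans ?_ le_add_self
  rcases lt_or_ge t 0 with ht | ht
  · have : S t = 0 := funext (hc t ht)
    simp [this]
  · refine mul_le_of_le_one_left' ?_
    rw [ENNReal.ofReal_le_one, Real.exp_le_one_iff]
    have := mul_nonneg hβ.le ht
    linarith

lemma eLpNorm_top_spaceTimeConv_le (hG : StronglyMeasurable (Function.uncurry G))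
    (hS : StronglyMeasurable (Function.uncurry S)) (t : ℝ) :
    eLpNorm (spaceTimeConv G S t) ⊤ volume ≤
      lconv (fun s => eLpNorm (G s) 1 volume) (fun s => eLpNorm (S s) ⊤ volume) t := by
  have hGm := hG.measurable
  have hSm := hS.measurable
  rw [eLpNorm_exponent_top]
  refine essSup_le_of_ae_le _ (Eventually.of_forall fun x => ?_)
  refine (enorm_convolution_le _ _ _).trans ?_
  rw [lconv, show (volume : Measure (ℝ × Space d)) = volume.prod volume from rfl,
    lintegral_prod _ (by fun_prop)]
  refine lintegral_mono fun s => ?_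
  have h1 : ∀ᵐ y : Space d, ‖S (t - s) (x - y)‖ₑ ≤ eLpNorm (S (t - s)) ⊤ volume := by
    have := (quasiMeasurePreserving_sub_left_of_right_invariant (volume : Measure (Space d)) x).ae
      (enorm_ae_le_eLpNormEssSup (S (t - s)) volume)
    simpa using this
  have hGs : Measurable fun y => ‖Function.uncurry G (s, y)‖ₑ := by fun_prop
  calc _ ≤ ∫⁻ y, ‖Function.uncurry G (s, y)‖ₑ * eLpNorm (S (t - s)) ⊤ volume := by
        refine lintegral_mono_ae ?_
        filter_upwards [h1] with y hy
        exact mul_le_mul_right hy _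
    _ = _ := by
        rw [lintegral_mul_const _ hGs]
        simp only [eLpNorm_one_eq_lintegral_enorm]
        rfl

lemma stronglyMeasurable_spaceTimeConv (hG : StronglyMeasurable (Function.uncurry G))
    (hS : StronglyMeasurable (Function.uncurry S)) :
    StronglyMeasurable (Function.uncurry (spaceTimeConv G S)) := by
  have hGm := hG.measurable
  have hSm := hS.measurable
  have : Measurable fun p : (ℝ × Space d) × (ℝ × Space d) =>
      Function.uncurry G p.2 * Function.uncurry S (p.1 - p.2) := by fun_prop
  exact this.stronglyMeasurable.integral_prod_right'

/-- `G` maps `L¹` to `L¹` and `L^∞` to `L^∞` in space, with exponentially weighted integrability in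
time; so Young's inequality applies to each of the two norms of the source. On a bounded time
interval the exponential weight costs only a constant. -/
lemma lintegral_eLpNorm_two_spaceTimeConv_lt_top (hβ : 0 < β)
    (hG : StronglyMeasurable (Function.uncurry G))
    (hGw : ∫⁻ q : ℝ × Space d, ENNReal.ofReal (Real.exp (-(β * q.1))) * ‖Function.uncurry G q‖ₑ < ⊤)
    (hS : StronglyMeasurable (Function.uncurry S)) (hc : ∀ t < 0, ∀ x, S t x = 0)
    (hfin : ∫⁻ t, (eLpNorm (S t) 1 volume + eLpNorm (S t) ⊤ volume) < ⊤) (T : ℝ) :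
    ∫⁻ t in Icc (-T) T, eLpNorm (spaceTimeConv G S t) 2 volume < ⊤ := by
  have hGm := hG.measurable
  have hu := stronglyMeasurable_spaceTimeConv hG hS
  have hum := hu.measurable
  refine (setLIntegral_Icc_le_exp hβ T _).trans_lt (ENNReal.mul_lt_top ENNReal.ofReal_lt_top ?_)
  have hexp : Measurable fun t : ℝ => ENNReal.ofReal (Real.exp (-(β * t))) := by fun_prop
  have hadd : ∀ s t : ℝ, ENNReal.ofReal (Real.exp (-(β * (s + t)))) ≤
      ENNReal.ofReal (Real.exp (-(β * s))) * ENNReal.ofReal (Real.exp (-(β * t))) := fun s t => by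
    rw [← ENNReal.ofReal_mul (Real.exp_pos _).le, ← Real.exp_add, mul_add, neg_add]
  have hG1 : ∫⁻ s : ℝ, ENNReal.ofReal (Real.exp (-(β * s))) * eLpNorm (G s) 1 volume < ⊤ := by
    rw [show (volume : Measure (ℝ × Space d)) = volume.prod volume from rfl,
      lintegral_prod _ (by fun_prop)] at hGw
    refine lt_of_le_of_lt (lintegral_mono fun s => ?_) hGw
    rw [eLpNorm_one_eq_lintegral_enorm, ← lintegral_const_mul' _ _ ENNReal.ofReal_ne_top]
    rfl
  have h1 : ∫⁻ t, ENNReal.ofReal (Real.exp (-(β * t))) * eLpNorm (spaceTimeConv G S t) 1 volume < ⊤ := by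
    calc _ = ∫⁻ q : ℝ × Space d, ENNReal.ofReal (Real.exp (-(β * q.1))) *
          ‖Function.uncurry (spaceTimeConv G S) q‖ₑ := by
          rw [show (volume : Measure (ℝ × Space d)) = volume.prod volume from rfl,
            lintegral_prod _ (by fun_prop)]
          refine lintegral_congr fun t => ?_
          rw [eLpNorm_one_eq_lintegral_enorm, ← lintegral_const_mul' _ _ ENNReal.ofReal_ne_top]
          rfl
      _ ≤ ∫⁻ q : ℝ × Space d, ENNReal.ofReal (Real.exp (-(β * q.1))) *
          lconv (fun q => ‖Function.uncurry G q‖ₑ) (fun q => ‖Function.uncurry S q‖ₑ) q :=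
          lintegral_mono fun q => mul_le_mul_right (enorm_convolution_le _ _ _) _
      _ ≤ _ := lintegral_mul_lconv_le hGm.enorm.aemeasurable hS.measurable.enorm.aemeasurable
          (hexp.comp measurable_fst) (hexp.comp measurable_fst) (fun p q => hadd p.1 q.1)
      _ < ⊤ := ENNReal.mul_lt_top hGw (lintegral_exp_source_lt_top hβ hS hc hfin)
  have h2 : ∫⁻ t, ENNReal.ofReal (Real.exp (-(β * t))) * eLpNorm (spaceTimeConv G S t) ⊤ volume < ⊤ := by
    refine lt_of_le_of_lt (lintegral_mono fun t =>
      mul_le_mul_right (eLpNorm_top_spaceTimeConv_le hG hS t) _) ?_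
    exact (lintegral_mul_lconv_le (measurable_eLpNorm_one hG).aemeasurable
      (measurable_eLpNorm_top hS).aemeasurable hexp hexp hadd).trans_lt
        (ENNReal.mul_lt_top hG1 (lintegral_exp_mul_top_lt_top hβ hc hfin))
  refine lt_of_le_of_lt (lintegral_mono fun t => mul_le_mul_right (eLpNorm_two_le_one_add_top _) _) ?_
  simp_rw [mul_add]
  exact (lintegral_add_left (hexp.mul (measurable_eLpNorm_one hu)) _).trans_lt
    (ENNReal.add_lt_top.2 ⟨h1, h2⟩)

end Source

lemma IsSpaceTimeResolvent.exp_lt_top {μ : Space d → ℝ} {β : ℝ} {G : ℝ × Space d → ℝ}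
    (hG : IsSpaceTimeResolvent μ β G) :
    ∫⁻ q : ℝ × Space d, ENNReal.ofReal (Real.exp (-(β * q.1))) * ‖G q‖ₑ < ⊤ := by
  refine lt_of_le_of_lt (lintegral_mono fun q => ?_) hG.weighted
  gcongr
  exact exp_le_weight β q

/-- The resolvent formula solves the density equation. -/
lemma IsSpaceTimeResolvent.isDensitySolution (hd : 0 < d) {μ : Space d → ℝ}
    (hreg : RegularEquilibrium μ) {β : ℝ} (hβ : 0 < β)
    (hsmall : ∫⁻ q, ENNReal.ofReal (weight β q) * absKernel μ q ≤ 1 / 2) {G : ℝ → Space d → ℝ}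
    (hG : IsSpaceTimeResolvent μ β (Function.uncurry G)) {S : ℝ → Space d → ℝ} (h : IsSource S) :
    ∃ ρ : ℝ → Space d → ℝ, IsDensitySolution μ S ρ ∧ ∀ᵐ p : ℝ × Space d,
      ConvolutionExistsAt (Function.uncurry G) (Function.uncurry S) p (mul ℝ ℝ) volume ∧
      ρ p.1 p.2 = S p.1 p.2 + spaceTimeConv G S p.1 p.2 := by
  obtain ⟨S', hS, hc, hae, hfin⟩ := h.exists_measurable
  have hconv : spaceTimeConv G S = spaceTimeConv G S' := by
    ext t x
    rw [spaceTimeConv, spaceTimeConv, convolution_congr_right _ hae]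
  have hu := stronglyMeasurable_spaceTimeConv hG.measurable hS
  have hexpS := lintegral_exp_source_lt_top hβ hS hc hfin
  set χ : ℝ × Space d → ℝ := fun q => Real.exp (-(β * q.1)) with hχ
  have hχm : Measurable χ := by simp only [hχ]; fun_prop
  have hχa : ∀ p q, χ (p + q) = χ p * χ q := exp_mul_char β
  have hχ0 : ∀ q, 0 < χ q := fun q => Real.exp_pos _
  have hint : ∀ f : ℝ × Space d → ℝ, Measurable f → ∫⁻ q, ENNReal.ofReal (χ q) * ‖f q‖ₑ < ⊤ →
      Integrable fun q => χ q * f q := by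
    intro f hf hfi
    refine ⟨(hχm.mul hf).aestronglyMeasurable, ?_⟩
    rw [hasFiniteIntegral_iff_enorm]
    refine lt_of_eq_of_lt (lintegral_congr fun q => ?_) hfi
    rw [enorm_mul, Real.enorm_of_nonneg (hχ0 q).le]
  set ρ : ℝ → Space d → ℝ := fun t x => S' t x + spaceTimeConv G S' t x with hρ
  have hρm : StronglyMeasurable (Function.uncurry ρ) := hS.add hu
  -- The resolvent identity is used in the direction from `S + G * S` to the equation with kernel
  -- `K`, under the character `e^{-βt}` that makes all factors integrable.
  have heq : Function.uncurry ρ =ᵐ[volume]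
      Function.uncurry S' + kernel μ ⋆[mul ℝ ℝ, volume] Function.uncurry ρ :=
    eq_add_kernel_convolution_char hχa (fun q => (hχ0 q).ne')
      (hint _ (measurable_kernel hreg) ((lintegral_exp_kernel_le (weight_kernel_small hsmall)).trans_lt (by simp)))
      (hint _ hG.measurable.measurable hG.exp_lt_top) (hint _ hS.measurable hexpS) hG.eq
      (Eventually.of_forall fun q => rfl)
  have hexists : ∀ᵐ p, ConvolutionExistsAt (Function.uncurry G) (Function.uncurry S) p (mul ℝ ℝ) volume := by
    refine ae_convolutionExistsAt_of_weight hG.measurable.aestronglyMeasurable h.measurable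
      hχm.ennreal_ofReal hχm.ennreal_ofReal
      (fun p q => by rw [hχa, ENNReal.ofReal_mul (hχ0 p).le]) (fun q => by simpa using hχ0 q)
      hG.exp_lt_top ?_
    refine lt_of_eq_of_lt (lintegral_congr_ae ?_) hexpS
    filter_upwards [hae] with q hq
    rw [hq]
  have hcausal : ∀ t < 0, ∀ x, ρ t x = 0 := by
    intro t ht x
    simp only [hρ]
    rw [hc t ht x, zero_add, spaceTimeConv, convolution_def]
    refine integral_eq_zero_of_ae (Eventually.of_forall fun q => ?_)
    simp only [ContinuousLinearMap.mul_apply', Pi.zero_apply]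
    rcases le_or_gt q.1 0 with hq | hq
    · rw [hG.causal q.1 hq q.2, zero_mul]
    · rw [show Function.uncurry S' ((t, x) - q) = 0 from hc (t - q.1) (by linarith) (x - q.2), mul_zero]
  have hcausal' : ∀ᵐ p : ℝ × Space d, p.1 < 0 → ρ p.1 p.2 = 0 :=
    Eventually.of_forall fun p hp => hcausal p.1 hp p.2
  have hloc : ∀ T : ℝ, ∫⁻ t in Icc (-T) T, eLpNorm (ρ t) 2 volume < ⊤ := by
    intro T
    have h1 : ∫⁻ t in Icc (-T) T, (eLpNorm (S' t) 1 volume + eLpNorm (S' t) ⊤ volume) < ⊤ :=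
      (setLIntegral_le_lintegral _ _).trans_lt hfin
    have h2 := lintegral_eLpNorm_two_spaceTimeConv_lt_top hβ hG.measurable hG.exp_lt_top hS hc hfin T
    refine lt_of_le_of_lt (lintegral_mono fun t => ?_)
      (lt_of_eq_of_lt (lintegral_add_left ((measurable_eLpNorm_one hS).add (measurable_eLpNorm_top hS)) _)
        (ENNReal.add_lt_top.2 ⟨h1, h2⟩))
    have m1 : Measurable (S' t) := hS.measurable.comp measurable_prodMk_left
    have m2 : Measurable (spaceTimeConv G S' t) := hu.measurable.comp measurable_prodMk_left
    refine (eLpNorm_add_le m1.aestronglyMeasurable m2.aestronglyMeasurable (by norm_num)).trans ?_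
    exact add_le_add_left (eLpNorm_two_le_one_add_top _) _
  refine ⟨ρ, ⟨hρm.aestronglyMeasurable, hloc, hcausal', ?_⟩, ?_⟩
  · filter_upwards [ae_reaction_integral hd hreg hβ hsmall hρm.aestronglyMeasurable hloc hcausal', heq, hae]
      with p hp h1 h2 h0
    refine ⟨(hp.2 h0).1, ?_⟩
    rw [(hp.2 h0).2]
    have h3 : S p.1 p.2 = S' p.1 p.2 := h2
    rw [h3, add_comm]
    exact h1
  · filter_upwards [hexists, hae] with p hp h2
    refine ⟨hp, ?_⟩
    have h3 : S p.1 p.2 = S' p.1 p.2 := h2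
    rw [h3, hconv]

end ScreenedVlasov
end

theorem theorem2p1 (d : ℕ) (hd : 3 ≤ d) (μ : EuclideanSpace ℝ (Fin d) → ℝ)
    (hreg : ScreenedVlasov.RegularEquilibrium μ) (hpen : ScreenedVlasov.PenroseStable μ) :
    ∃ G : ℝ → EuclideanSpace ℝ (Fin d) → ℝ,
      AEStronglyMeasurable (Function.uncurry G) volume ∧
      (∀ t : ℝ, AEStronglyMeasurable (G t) volume) ∧
      (∀ t : ℝ, t < 0 → ∀ x, G t x = 0) ∧
      (∀ δ : ℝ, 0 < δ → δ < 1 → ∃ C : ℝ, 0 < C ∧ ScreenedVlasov.KernelBounds G δ C) ∧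
      ∀ S : ℝ → EuclideanSpace ℝ (Fin d) → ℝ, ScreenedVlasov.IsSource S →
        ∃ ρ : ℝ → EuclideanSpace ℝ (Fin d) → ℝ,
          ScreenedVlasov.IsDensitySolution μ S ρ ∧
          (∀ ρ' : ℝ → EuclideanSpace ℝ (Fin d) → ℝ, ScreenedVlasov.IsDensitySolution μ S ρ' →
            Function.uncurry ρ' =ᵐ[volume] Function.uncurry ρ) ∧
          ∀ᵐ p : ℝ × EuclideanSpace ℝ (Fin d),
            ConvolutionExistsAt (Function.uncurry G) (Function.uncurry S) p
              (ContinuousLinearMap.mul ℝ ℝ) volume ∧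
            ρ p.1 p.2 = S p.1 p.2 + ScreenedVlasov.spaceTimeConv G S p.1 p.2 := by
  obtain ⟨β, hβ, hsmall⟩ := ScreenedVlasov.exists_weight_absKernel_small hreg
  obtain ⟨G, hG, hbounds⟩ := ScreenedVlasov.exists_regular_resolvent hd hreg hpen hβ
    (ScreenedVlasov.weight_kernel_small hsmall)
  refine ⟨G, hG.measurable.aestronglyMeasurable, fun t => ?_, fun t ht x => hG.causal t ht.le x,
    hbounds, fun S hS => ?_⟩
  · exact (hG.measurable.measurable.comp measurable_prodMk_left).aestronglyMeasurable
  · obtain ⟨ρ, hρ, hformula⟩ := hG.isDensitySolution (by omega) hreg hβ hsmall hS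
    exact ⟨ρ, hρ, fun ρ' hρ' => hρ'.ae_eq (by omega) hreg hβ hsmall hρ, hformula⟩
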